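/- Let $X_t=\sum_{i=1}^{N_t}Y_i+ct$, $t\ge 0$, be a compound Poisson process with linear component: $c\in\mathbb R$, $N$ is a homogeneous Poisson process with intensity $\lambda>0$, and the jump sizes $Y_1,Y_2,\dots$ are i.i.d. random variables with finite mean, independent of $N$, with $\mathbb P\{Y_1=0\}=0$. Assume that $\mathbb E(c/\lambda+Y_1)=:-a<0$ and that the distribution $F$ of $Y_1^+=\max(Y_1,0)$ is strong subexponential, that is, with $\overline F(x)=F(x,\infty)$, $$\int_0^x\overline F(x-y)\overline F(y)\,dy\sim 2\,\overline F(x)\int_0^\infty\overline F(y)\,dy\qquad\text{as }x\to\infty .$$ For $t\in[0,\infty]$ let $M_t=\sup\{X_u: 0\le u\le t,\ u<\infty\}$, and let $N_\infty=\infty$. A random time $\tau$ (with values in $[0,\infty]$) is said not to depend on the future increments of $X$ if, for every $t>0$, the $\sigma$-algebras $\sigma\{X_s,\ s\le t,\ \mathbb I\{\tau\le t\}\}$ and $\sigma\{X_s-X_t,\ s>t\}$ are independent. Then \begin{align*} \mathbb P\{M_\tau>x\}&=\frac{1+o(1)}{a}\,\mathbb E\int_x^{x+aN_\tau}\overline F(v)\,dv+o(\overline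 F(x)),\\ \mathbb P\{M_\tau>x\}&=\frac{1+o(1)}{a}\,\mathbb E\int_x^{x+a\lambda\tau}\overline F(v)\,dv+o(\overline F(x)),\\ \mathbb P\{M_\tau>x\}&=\frac{1+o(1)}{|\mathbb E X_1|}\,\mathbb E\int_x^{x+|\mathbb E X_1|\tau}\mathbb P\{X_1>v\}\,dv+o(\overline F(x)) \end{align*} as $x\to\infty$, each of the three uniformly for all random times $\tau$ that do not depend on the future increments of $X$. -/

import Mathlib

open MeasureTheory ProbabilityTheory Filter Topology
open scoped ENNReal NNReal

noncomputable section

namespace RandomTimeMaxima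

/-- The tail `x ↦ G (x, ∞)` of a distribution `G` on the real line. -/
def tail (G : Measure ℝ) (x : ℝ) : ℝ := G.real (Set.Ioi x)

/-- The class of strong subexponential distributions: `G` is a probability distribution on `ℝ` with
finite mean and `∫_0^x tail(x-y) tail(y) dy ∼ 2 a⁺ tail(x)` with `a⁺ = ∫_0^∞ tail(y) dy`.
Here `f ∼ g` means that the quotient tends to `1`; since `0 / 0 = 0`, this forces the
tail of `G` to be positive everywhere. -/
def StrongSubexponential (G : Measure ℝ) : Prop :=
  IsProbabilityMeasure G ∧ Integrable (fun y : ℝ => y) G ∧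
    Tendsto
      (fun x : ℝ => (∫ y in (0 : ℝ)..x, tail G (x - y) * tail G y) /
        (2 * (∫ y in Set.Ioi (0 : ℝ), tail G y) * tail G x))
      atTop (𝓝 1)

variable {Ω : Type*}

/-- The epoch `T_n`, the sum of the first `n` inter-arrival times. -/
def epoch (gap : ℕ → Ω → ℝ) (n : ℕ) (ω : Ω) : ℝ := ∑ i ∈ Finset.range n, gap i ω

/-- The counting process `N_s = #{n ≥ 1 : T_n ≤ s}`, for `s ∈ [0, ∞]`. -/
def count (gap : ℕ → Ω → ℝ) (s : ℝ≥0∞) (ω : Ω) : ℕ∞ :=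
  {n : ℕ | ENNReal.ofReal (epoch gap (n + 1) ω) ≤ s}.encard

/-- The process `X_t = Y_1 + ⋯ + Y_{N_t} + c t`, `t ∈ [0, ∞)`; the variable `Y_{i+1}` is `Y i`. -/
def compound (gap Y : ℕ → Ω → ℝ) (c : ℝ) (t : ℝ≥0) (ω : Ω) : ℝ :=
  (∑ i ∈ Finset.range (count gap t ω).toNat, Y i ω) + c * t

/-- `gap` and `Y` are the inter-arrival times and the jump sizes of a compound Poisson process
of intensity `rate`: the inter-arrival times are i.i.d. exponential, the jump sizes
are i.i.d. and nonzero, and the two sequences are independent. -/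
structure IsCompoundPoissonData [MeasurableSpace Ω] (μ : Measure Ω) (rate : ℝ)
    (gap Y : ℕ → Ω → ℝ) : Prop where
  rate_pos : 0 < rate
  measurable_gap : ∀ i, Measurable (gap i)
  measurable_jump : ∀ i, Measurable (Y i)
  law_gap : ∀ i, μ.map (gap i) = expMeasure rate
  indep_gap : iIndepFun gap μ
  identDistrib_jump : ∀ i, IdentDistrib (Y i) (Y 0) μ μ
  indep_jump : iIndepFun Y μ
  indep_gap_jump : IndepFun (fun ω i => gap i ω) (fun ω i => Y i ω) μ
  jump_ne_zero : ∀ᵐ ω ∂μ, Y 0 ω ≠ 0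

/-- `M_s = sup_{u ∈ [0, s], u < ∞} X_u`, for `s ∈ [0, ∞]`. -/
def runningMax (X : ℝ≥0 → Ω → ℝ) (s : ℝ≥0∞) (ω : Ω) : EReal :=
  ⨆ (u : ℝ≥0) (_ : (u : ℝ≥0∞) ≤ s), (X u ω : EReal)

/-- The random time `τ` does not depend on the future increments of `X`: for every `t > 0` the
σ-algebras `σ(X_s, s ≤ t, 𝕀{τ ≤ t})` and `σ(X_s - X_t, s > t)` are independent. -/
def NotDependOnFuture [MeasurableSpace Ω] (μ : Measure Ω) (X : ℝ≥0 → Ω → ℝ)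
    (τ : Ω → ℝ≥0∞) : Prop :=
  ∀ t : ℝ≥0, 0 < t →
    Indep
      ((⨆ (s : ℝ≥0) (_ : s ≤ t), MeasurableSpace.comap (X s) inferInstance) ⊔
        MeasurableSpace.generateFrom {{ω | τ ω ≤ (t : ℝ≥0∞)}})
      (⨆ (s : ℝ≥0) (_ : t < s), MeasurableSpace.comap (fun ω => X s ω - X t ω) inferInstance)
      μ

/-- The random times with values in `[0, ∞]` that do not depend on the future increments of `X`. -/
def randomTimes [MeasurableSpace Ω] (μ : Measure Ω) (X : ℝ≥0 → Ω → ℝ) : Set (Ω → ℝ≥0∞) :=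
  {τ | Measurable τ ∧ NotDependOnFuture μ X τ}

/-- `∫_x^{x+ℓ} G(v, ∞) dv`, for a length `ℓ ∈ [0, ∞]`. -/
def tailIntegral (G : Measure ℝ) (x : ℝ) (ℓ : ℝ≥0∞) : ℝ≥0∞ :=
  ∫⁻ v in {v : ℝ | x < v ∧ ENNReal.ofReal (v - x) ≤ ℓ}, G (Set.Ioi v)

/-- `E ∫_x^{x+L} G(v, ∞) dv`, for a random length `L` with values in `[0, ∞]`. -/
def meanTailIntegral [MeasurableSpace Ω] (μ : Measure Ω) (G : Measure ℝ) (x : ℝ)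
    (L : Ω → ℝ≥0∞) : ℝ :=
  (∫⁻ ω, tailIntegral G x (L ω) ∂μ).toReal

/-- `f_i(x) = (1 + o(1)) g_i(x) + o(h(x))` as `x → ∞`, uniformly for all `i ∈ S`. -/
def UniformAsymp {ι : Type*} (S : Set ι) (f g : ι → ℝ → ℝ) (h : ℝ → ℝ) : Prop :=
  ∃ δ η : ι → ℝ → ℝ,
    TendstoUniformlyOn (fun x i => δ i x) (fun _ => 0) atTop S ∧
    TendstoUniformlyOn (fun x i => η i x) (fun _ => 0) atTop S ∧
    ∀ᶠ x in atTop, ∀ i ∈ S, f i x = (1 + δ i x) * g i x + η i x * h x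

end RandomTimeMaxima

end

/-! ### Strong subexponential tail functions: long-tailedness and the self-convolution -/

namespace RandomTimeMaxima

section

/-! The process drifts downwards at speed `|E X_1| = a λ`, and it passes a high level `x`
essentially by one big jump. A jump at time `u` has to exceed about `x + a λ u`, and jumps arrive at
rate `λ`; integrating over `u ≤ τ` gives `(1/a) E ∫_x^{x + a λ τ} F̄`. What needs proof is
uniformity over all `τ`, which may depend on the past and may be so short that the main term is
itself no larger than the error `o(F̄(x))`.

The core is potential theory for a random walk with mean step `-α` whose steps have tail `p f`. The
multiple `p / α` of the integrated tail `∫_y^∞ f` is nearly harmonic for the walk killed with value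
1 when it crosses the level: a step changes it on average by about `-p f y`, and crossing
contributes about `p f y`. Strong subexponentiality makes jumps to intermediate levels negligible
(`HasTail.mid_jump`). A slightly larger multiple, corrected near the level, is superharmonic
(`exists_superharmonic`); a slightly smaller one is subharmonic away from the level for steps
truncated from above (`exists_subharmonic`). Optional stopping at `σ` then compares the crossing
probability with `p / α` times the mean of the window `∫_x^{x - S} f`, where `S` is the stopped
walk, truncated so as to be light-tailed.

`window_replacement` exchanges the random length `-S` for `α σ`. For large `σ` exponential deviation
bounds and concavity of the window in its length suffice. For boundedly many steps the difference is
`f x` times a centred stopped walk up to `o(f x)`, and Wald's identity removes it except for a part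
charged to the window. This yields `exceed_upper` and `exceed_lower`, uniformly over stopping times
of filtrations with independent steps.

The process is sampled on a grid of mesh `η`. Increments over a cell and maxima over a cell both
have tail `λ η F̄` (`hasTail_compound`, `hasTail_pathMax`), which gives the upper bound `max_upper`.
In the lower bound, rounding the time up to the grid may count a crossing that happens too late.
`overshoot` bounds this by a small multiple of the probability that the maximum up to two time units
later exceeds `x`, since a big increment in a very short time is much rarer than one in unit time;
`max_upper` controls that probability, and `max_lower` follows.

The hypothesis on `τ` concerns one time at a time. `NotDependOnFuture.futureIndep` upgrades it to a
filtration containing all events `τ ≤ s` with `0 < s ≤ t`. For the form with `N_τ`, the number of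
jumps is a functional of the path (`jumpCount_eq`), so the counts over cells are independent
light-tailed steps and `window_replacement` applies again (`jumps_window`). The third form follows
from `P(X_1 > v) ∼ λ F̄(v)`. Unbounded and infinite times are limits of their truncations, the
bounds being uniform in the truncation. -/

/-- Tail functions of strong subexponential type. -/
structure StrongTail (f : ℝ → ℝ) : Prop where
  anti : Antitone f
  pos : ∀ x, 0 < f x
  le_one : ∀ x, f x ≤ 1
  int : IntegrableOn f (Set.Ioi 0)
  strong : Tendsto (fun x : ℝ => (∫ y in (0 : ℝ)..x, f (x - y) * f y) /
        (2 * (∫ y in Set.Ioi (0 : ℝ), f y) * f x)) atTop (𝓝 1)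

namespace StrongTail

variable {f : ℝ → ℝ} (hf : StrongTail f)
include hf

lemma nonneg (x : ℝ) : 0 ≤ f x := (hf.pos x).le

lemma measurable : Measurable f := hf.anti.measurable

lemma intervalIntegrable (a b : ℝ) : IntervalIntegrable f volume a b :=
  (hf.anti.antitoneOn _).intervalIntegrable

lemma integrableOn_Ioi (a : ℝ) : IntegrableOn f (Set.Ioi a) := by
  have h : Set.Ioi a ⊆ Set.Ioc a (max a 0) ∪ Set.Ioi 0 := by
    intro x hx
    rcases le_or_gt x (max a 0) with h | h
    · exact Or.inl ⟨hx, h⟩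
    · exact Or.inr ((le_max_right a 0).trans_lt h)
  refine IntegrableOn.mono_set (IntegrableOn.union ?_ hf.int) h
  exact (intervalIntegrable_iff_integrableOn_Ioc_of_le (le_max_left _ _)).1
    (hf.intervalIntegrable _ _)

lemma intervalIntegrable_conv (x a b : ℝ) :
    IntervalIntegrable (fun y => f (x - y) * f y) volume a b := by
  have h1 : IntervalIntegrable (fun y => f (x - y)) volume a b := by
    have : Monotone fun y => f (x - y) := fun u v huv => hf.anti (by linarith)
    exact (this.monotoneOn _).intervalIntegrable
  refine IntervalIntegrable.mono_fun' (hf.intervalIntegrable a b) ?_ ?_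
  · exact ((hf.measurable.comp (measurable_const.sub measurable_id)).mul
      hf.measurable).aestronglyMeasurable
  · refine Eventually.of_forall fun y => ?_
    simp only [Real.norm_of_nonneg (mul_nonneg (hf.nonneg _) (hf.nonneg _))]
    exact mul_le_of_le_one_left (hf.nonneg _) (hf.le_one _)

/-- Strict because `f` charges the interval from `s` to `s + 1`. The gap keeps the denominator in
`long_tailed_nonneg` away from zero. -/
lemma integral_lt (s : ℝ) : (∫ y in (0:ℝ)..s, f y) < ∫ y in Set.Ioi (0:ℝ), f y := by
  have key : ∀ s : ℝ, (∫ y in (0:ℝ)..s, f y) ≤ ∫ y in Set.Ioi (0:ℝ), f y := by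
    intro s
    have h0 : 0 ≤ ∫ y in Set.Ioi (0:ℝ), f y := integral_nonneg fun y => hf.nonneg y
    rcases le_total s 0 with hs | hs
    · refine le_trans ?_ h0
      rw [intervalIntegral.integral_symm, neg_nonpos]
      exact intervalIntegral.integral_nonneg hs fun y _ => hf.nonneg y
    · rw [intervalIntegral.integral_of_le hs]
      exact setIntegral_mono_set hf.int (Eventually.of_forall fun y => hf.nonneg y)
        Set.Ioc_subset_Ioi_self.eventuallyLE
  have h1 : (∫ y in (0:ℝ)..s, f y) + ∫ y in s..(s+1), f y = ∫ y in (0:ℝ)..(s+1), f y :=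
    intervalIntegral.integral_add_adjacent_intervals (hf.intervalIntegrable _ _)
      (hf.intervalIntegrable _ _)
  have h2 : 0 < ∫ y in s..(s+1), f y :=
    intervalIntegral.intervalIntegral_pos_of_pos (hf.intervalIntegrable _ _) hf.pos (by linarith)
  linarith [key (s+1)]

lemma mean_pos : 0 < ∫ y in Set.Ioi (0:ℝ), f y := by simpa using hf.integral_lt 0

lemma tendsto_integral : Tendsto (fun s => ∫ y in (0:ℝ)..s, f y) atTop
    (𝓝 (∫ y in Set.Ioi (0:ℝ), f y)) :=
  intervalIntegral_tendsto_integral_Ioi 0 hf.int tendsto_id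

lemma tendsto_conv : Tendsto (fun x => (∫ y in (0 : ℝ)..x, f (x - y) * f y) / f x) atTop
    (𝓝 (2 * ∫ y in Set.Ioi (0:ℝ), f y)) := by
  have h := hf.strong.mul_const (2 * ∫ y in Set.Ioi (0:ℝ), f y)
  rw [one_mul] at h
  refine h.congr fun x => ?_
  have := hf.mean_pos.ne'
  have := (hf.pos x).ne'
  field_simp

omit hf in
lemma conv_refl (x a b : ℝ) :
    (∫ y in a..b, f (x - y) * f y) = ∫ y in (x-b)..(x-a), f (x - y) * f y := by
  rw [← intervalIntegral.integral_comp_sub_left (fun y => f (x - y) * f y) x]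
  refine intervalIntegral.integral_congr fun y _ => ?_
  simp [mul_comm]

/-- Splitting the convolution at `s` and `x - s`. -/
lemma conv_split (x s : ℝ) : (∫ y in (0:ℝ)..x, f (x - y) * f y) =
    2 * (∫ y in (0:ℝ)..s, f (x - y) * f y) + ∫ y in s..(x - s), f (x - y) * f y := by
  have i := hf.intervalIntegrable_conv x
  rw [← intervalIntegral.integral_add_adjacent_intervals (i 0 s) (i s x),
    ← intervalIntegral.integral_add_adjacent_intervals (i s (x-s)) (i (x-s) x),
    conv_refl x 0 s, sub_zero]
  ring

lemma conv_ge_of_le (x a b : ℝ) (hab : a ≤ b) :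
    f (x - a) * (∫ y in a..b, f y) ≤ ∫ y in a..b, f (x - y) * f y := by
  rw [← intervalIntegral.integral_const_mul]
  refine intervalIntegral.integral_mono_on hab ((hf.intervalIntegrable _ _).const_mul _)
    (hf.intervalIntegrable_conv _ _ _) fun y hy => ?_
  exact mul_le_mul_of_nonneg_right (hf.anti (by linarith [hy.1])) (hf.nonneg _)

lemma one_le_ratio {s : ℝ} (hs : 0 ≤ s) (x : ℝ) : 1 ≤ f (x - s) / f x := by
  rw [one_le_div (hf.pos x)]; exact hf.anti (by linarith)

/-- By symmetry the convolution is twice its part over `[0, x/2]`. There `[0, s]` contributes at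
least `f x` times its mass `ms`, and the rest at least `f (x - s)` times the mass of `[s, x/2]`. As
the total is asymptotic to `2 m f x`, solving for `f (x - s) / f x` gives an upper bound with limit
`(m - ms) / (m - ms) = 1`. -/
lemma long_tailed_nonneg {s : ℝ} (hs : 0 ≤ s) : Tendsto (fun x => f (x - s) / f x) atTop (𝓝 1) := by
  set m := ∫ y in Set.Ioi (0:ℝ), f y with hm
  set ms := ∫ y in (0:ℝ)..s, f y with hms
  have hlt : ms < m := hf.integral_lt s
  have h2 : Tendsto (fun x : ℝ => (∫ y in (0:ℝ)..(x/2), f y) - ms) atTop (𝓝 (m - ms)) :=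
    (hf.tendsto_integral.comp (tendsto_id.atTop_div_const two_pos)).sub_const _
  have h1 : Tendsto (fun x => ((∫ y in (0 : ℝ)..x, f (x - y) * f y) / f x / 2 - ms) /
      ((∫ y in (0:ℝ)..(x/2), f y) - ms)) atTop (𝓝 1) := by
    have := ((hf.tendsto_conv.div_const 2).sub_const ms).div h2 (sub_pos.2 hlt).ne'
    rwa [mul_div_cancel_left₀ _ (two_ne_zero), div_self (sub_pos.2 hlt).ne'] at this
  refine tendsto_of_tendsto_of_tendsto_of_le_of_le' tendsto_const_nhds h1
    (Eventually.of_forall fun x => hf.one_le_ratio hs x) ?_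
  filter_upwards [h2.eventually (lt_mem_nhds (sub_pos.2 hlt)), eventually_ge_atTop (2 * s)]
    with x hx hxs
  rw [le_div_iff₀ hx]
  have e1 := hf.conv_split x s
  have e2 : (∫ y in s..(x - s), f (x - y) * f y) = 2 * ∫ y in s..(x/2), f (x - y) * f y := by
    rw [← intervalIntegral.integral_add_adjacent_intervals (hf.intervalIntegrable_conv x s (x/2))
      (hf.intervalIntegrable_conv x (x/2) (x-s)), conv_refl x s (x/2)]
    rw [show x - x / 2 = x / 2 by ring]
    ring
  have e3 := hf.conv_ge_of_le x 0 s hs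
  have e4 := hf.conv_ge_of_le x s (x/2) (by linarith)
  have e5 : (∫ y in (0:ℝ)..(x/2), f y) - ms = ∫ y in s..(x/2), f y := by
    rw [hms, intervalIntegral.integral_interval_sub_left (hf.intervalIntegrable _ _)
      (hf.intervalIntegrable _ _)]
  rw [e5, div_mul_eq_mul_div, div_le_iff₀ (hf.pos x)]
  have e6 : (∫ y in (0 : ℝ)..x, f (x - y) * f y) / f x * f x = ∫ y in (0 : ℝ)..x, f (x - y) * f y :=
    div_mul_cancel₀ _ (hf.pos x).ne'
  rw [sub_zero] at e3
  nlinarith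

lemma long_tailed (s : ℝ) : Tendsto (fun x => f (x + s) / f x) atTop (𝓝 1) := by
  rcases le_total s 0 with hs | hs
  · simpa using hf.long_tailed_nonneg (s := -s) (by linarith)
  · have h := (hf.long_tailed_nonneg hs).comp (tendsto_atTop_add_const_right atTop s tendsto_id)
    have h' := h.inv₀ one_ne_zero
    rw [inv_one] at h'
    refine h'.congr fun x => ?_
    simp

lemma eventually_shift (s : ℝ) {ε : ℝ} (hε : 0 < ε) : ∀ᶠ x in atTop, f (x - s) ≤ (1 + ε) * f x := by
  have h := hf.long_tailed (-s)
  filter_upwards [h.eventually (gt_mem_nhds (show (1:ℝ) < 1 + ε by linarith))] with x hx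
  rw [div_lt_iff₀ (hf.pos x)] at hx
  simpa [sub_eq_add_neg] using hx.le

lemma eventually_shift' (s : ℝ) {ε : ℝ} (hε : 0 < ε) :
    ∀ᶠ x in atTop, (1 - ε) * f x ≤ f (x + s) := by
  have h := hf.long_tailed s
  filter_upwards [h.eventually (lt_mem_nhds (show 1 - ε < (1:ℝ) by linarith))] with x hx
  rw [lt_div_iff₀ (hf.pos x)] at hx
  exact hx.le

/-- The end pieces `[0, B]` and `[x - B, x]` each contribute at least `f x` times the mass of `[0,
B]`, together nearly all of the asymptotic value `2 m f x` when `B` is large; only the difference is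
left for the middle. -/
lemma eventually_conv_mid {ε : ℝ} (hε : 0 < ε) : ∃ B₀ > 0, ∀ B ≥ B₀, ∀ᶠ x in atTop,
    (∫ y in B..(x - B), f (x - y) * f y) ≤ ε * f x := by
  have h := hf.tendsto_integral.eventually
    (lt_mem_nhds (show (∫ y in Set.Ioi (0:ℝ), f y) - ε / 4 < _ by linarith))
  obtain ⟨B₀, hB₀⟩ := eventually_atTop.1 h
  refine ⟨max B₀ 1, by positivity, fun B hB => ?_⟩
  have hB1 := hB₀ B ((le_max_left _ _).trans hB)
  have hBpos : 0 < B := lt_of_lt_of_le (by norm_num) ((le_max_right _ _).trans hB)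
  filter_upwards [hf.tendsto_conv.eventually
    (gt_mem_nhds (show (2 * ∫ y in Set.Ioi (0:ℝ), f y) <
      2 * (∫ y in Set.Ioi (0:ℝ), f y) + ε / 4 by linarith))] with x hx
  rw [div_lt_iff₀ (hf.pos x)] at hx
  have e1 := hf.conv_split x B
  have e3 := hf.conv_ge_of_le x 0 B hBpos.le
  rw [sub_zero] at e3
  nlinarith [hf.pos x]

/-- A long-tailed function decreases more slowly than every exponential function. -/
lemma exp_bound {δ : ℝ} (hδ : 0 < δ) : ∃ C ≥ 1, ∀ x t : ℝ, 0 ≤ t →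
    f (x - t) ≤ C * Real.exp (δ * t) * f x := by
  have h := hf.long_tailed_nonneg (s := 1) (by norm_num)
  obtain ⟨x₀, hx₀⟩ := eventually_atTop.1
    (h.eventually (gt_mem_nhds (show (1:ℝ) < Real.exp δ by simpa using hδ)))
  -- along integer steps above `x₀`
  have step : ∀ n : ℕ, ∀ x : ℝ, x₀ ≤ x → f x ≤ Real.exp (δ * n) * f (x + n) := by
    intro n
    induction n with
    | zero => intro x _; simp
    | succ k ih =>
      intro x hx
      refine (ih x hx).trans ?_
      have h1 := hx₀ (x + k + 1) (by linarith [k.cast_nonneg (α := ℝ)])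
      rw [div_lt_iff₀ (hf.pos _)] at h1
      rw [show x + k + 1 - 1 = x + k by ring] at h1
      calc Real.exp (δ * k) * f (x + k) ≤ Real.exp (δ * k) * (Real.exp δ * f (x + k + 1)) := by
            gcongr
        _ = Real.exp (δ * (k + 1 : ℕ)) * f (x + (k + 1 : ℕ)) := by
            rw [← mul_assoc, ← Real.exp_add]; push_cast; ring_nf
  have real : ∀ x t : ℝ, x₀ ≤ x → 0 ≤ t → f x ≤ Real.exp (δ * (t + 1)) * f (x + t) := by
    intro x t hx ht
    refine (step ⌈t⌉₊ x hx).trans ?_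
    have h1 : (⌈t⌉₊ : ℝ) ≤ t + 1 := (Nat.ceil_lt_add_one ht).le
    have h2 : f (x + ⌈t⌉₊) ≤ f (x + t) := hf.anti (by linarith [Nat.le_ceil t])
    have h3 : 0 ≤ f (x + ⌈t⌉₊) := hf.nonneg _
    gcongr
  have hfx := hf.pos x₀
  refine ⟨max 1 (Real.exp δ / f x₀), le_max_left _ _, fun x t ht => ?_⟩
  have hC : Real.exp δ / f x₀ ≤ max 1 (Real.exp δ / f x₀) := le_max_right _ _
  -- Above `x₀` the steps apply directly. Otherwise `f (x - t)` is bounded only by 1, and `f x` is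
  -- bounded from below by `f x₀` or by the decay started at `x₀`; the factor `1 / f x₀` in the
  -- constant pays for this.
  rcases le_total x₀ (x - t) with h1 | h1
  · have h2 := real (x - t) t h1 ht
    rw [sub_add_cancel, mul_add, mul_one, Real.exp_add] at h2
    have h3 : Real.exp δ ≤ Real.exp δ / f x₀ := by
      rw [le_div_iff₀ hfx]; exact mul_le_of_le_one_right (Real.exp_pos _).le (hf.le_one _)
    calc f (x - t) ≤ Real.exp δ * Real.exp (δ * t) * f x := by linarith
      _ ≤ _ := by
        have := hf.nonneg x
        gcongr; exact h3.trans hC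
  · rcases le_total x x₀ with h2 | h2
    · calc f (x - t) ≤ 1 := hf.le_one _
        _ ≤ Real.exp δ / f x₀ * Real.exp (δ * t) * f x := by
          rw [div_mul_eq_mul_div, div_mul_eq_mul_div, le_div_iff₀ hfx, one_mul]
          have h3 : f x₀ ≤ f x := hf.anti h2
          have h4 : 1 ≤ Real.exp δ * Real.exp (δ * t) := by
            rw [← Real.exp_add]; exact Real.one_le_exp (by positivity)
          nlinarith [hf.nonneg x]
        _ ≤ _ := by have := hf.nonneg x; gcongr
    · have h3 := real x₀ (x - x₀) le_rfl (by linarith)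
      rw [add_sub_cancel] at h3
      have h4 : Real.exp (δ * (x - x₀ + 1)) ≤ Real.exp δ * Real.exp (δ * t) := by
        rw [← Real.exp_add]; refine Real.exp_le_exp.2 ?_; nlinarith
      calc f (x - t) ≤ 1 := hf.le_one _
        _ ≤ Real.exp δ / f x₀ * Real.exp (δ * t) * f x := by
          rw [div_mul_eq_mul_div, div_mul_eq_mul_div, le_div_iff₀ hfx, one_mul]
          nlinarith [hf.nonneg x]
        _ ≤ _ := by have := hf.nonneg x; gcongr

/-- Exponentially small quantities are negligible with respect to a long-tailed function. -/
lemma eventually_exp_le {s ε : ℝ} (hs : 0 < s) (hε : 0 < ε) :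
    ∀ᶠ x in atTop, Real.exp (-s * x) ≤ ε * f x := by
  -- Half of the rate gives `exp (-(s/2) x) ≤ (C / f 0) f x`; the other half tends to zero and
  -- absorbs the constant.
  obtain ⟨C, hC, h⟩ := hf.exp_bound (δ := s / 2) (by linarith)
  have h0 := hf.pos 0
  have hlim : Tendsto (fun x : ℝ => C / f 0 * Real.exp (-(s / 2) * x)) atTop (𝓝 0) := by
    have : Tendsto (fun x : ℝ => Real.exp (-(s / 2) * x)) atTop (𝓝 0) :=
      Real.tendsto_exp_atBot.comp (tendsto_id.const_mul_atTop_of_neg (by linarith))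
    simpa using this.const_mul (C / f 0)
  filter_upwards [hlim.eventually (gt_mem_nhds hε), eventually_ge_atTop 0] with x hx hx0
  have h1 := h x x hx0
  rw [sub_self] at h1
  have h2 : f 0 * Real.exp (-(s/2) * x) ≤ C * f x := by
    calc _ ≤ C * Real.exp (s / 2 * x) * f x * Real.exp (-(s/2) * x) := by gcongr
      _ = C * f x * (Real.exp (s / 2 * x) * Real.exp (-(s/2) * x)) := by ring
      _ = _ := by rw [← Real.exp_add]; simp
  have h3 : Real.exp (-s * x) = Real.exp (-(s/2) * x) * Real.exp (-(s/2) * x) := by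
    rw [← Real.exp_add]; ring_nf
  have h4 : 0 < Real.exp (-(s/2) * x) := Real.exp_pos _
  have h5 : Real.exp (-(s/2) * x) ≤ C / f 0 * f x := by
    rw [div_mul_eq_mul_div, le_div_iff₀ h0]; linarith
  rw [h3]
  calc _ ≤ Real.exp (-(s/2) * x) * (C / f 0 * f x) := by gcongr
    _ = C / f 0 * Real.exp (-(s/2) * x) * f x := by ring
    _ ≤ ε * f x := by have := hf.nonneg x; gcongr

end StrongTail

end

end RandomTimeMaxima

/-! ### Integrated tails, window integrals, and variables whose tail is comparable to `f` -/

namespace RandomTimeMaxima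

section

/-- The integrated tail `∫_y^∞ f`. -/
noncomputable def tailInt (f : ℝ → ℝ) (y : ℝ) : ℝ := ∫ v in Set.Ioi y, f v

/-- The integral `∫_x^{x+t} f`, for real `t`. -/
noncomputable def windowInt (f : ℝ → ℝ) (x t : ℝ) : ℝ := ∫ v in x..(x + t), f v

namespace StrongTail

variable {f : ℝ → ℝ} (hf : StrongTail f)
include hf

lemma tailInt_sub (x y : ℝ) : tailInt f x - tailInt f y = ∫ v in x..y, f v := by
  unfold tailInt
  rw [intervalIntegral.integral_Ioi_sub_Ioi' (hf.integrableOn_Ioi x) (hf.integrableOn_Ioi y)]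

lemma tailInt_nonneg (x : ℝ) : 0 ≤ tailInt f x := integral_nonneg fun y => hf.nonneg y

lemma windowInt_eq (x t : ℝ) : windowInt f x t = tailInt f x - tailInt f (x + t) := by
  rw [hf.tailInt_sub]; rfl

lemma windowInt_sub (x s t : ℝ) :
    windowInt f x t - windowInt f x s = windowInt f (x + s) (t - s) := by
  simp only [hf.windowInt_eq]
  rw [show x + s + (t - s) = x + t by ring]; ring

lemma windowInt_le (x t : ℝ) : windowInt f x t ≤ t * f x := by
  rcases le_total 0 t with ht | ht
  · have := intervalIntegral.integral_mono_on (show x ≤ x + t by linarith)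
      (hf.intervalIntegrable x (x+t)) (intervalIntegrable_const (c := f x))
      (fun y hy => hf.anti hy.1)
    simpa [windowInt] using this
  · have := intervalIntegral.integral_mono_on (show x + t ≤ x by linarith)
      (intervalIntegrable_const (c := f x)) (hf.intervalIntegrable (x+t) x)
      (fun y hy => hf.anti hy.2)
    rw [windowInt, intervalIntegral.integral_symm]
    simp at this
    linarith

/-- The tangent inequality of the concave function `t ↦ ∫_x^{x+t} f`. -/
lemma windowInt_tangent (x s t : ℝ) :
    windowInt f x t ≤ windowInt f x s + (t - s) * f (x + s) := by
  linarith [hf.windowInt_sub x s t, hf.windowInt_le (x + s) (t - s)]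

omit hf in
lemma windowInt_zero (x : ℝ) : windowInt f x 0 = 0 := by simp [windowInt]

lemma windowInt_mono (x : ℝ) : Monotone (windowInt f x) := by
  intro s t hst
  have h := hf.windowInt_tangent x t s
  nlinarith [hf.nonneg (x + t)]

lemma windowInt_nonneg (x : ℝ) {t : ℝ} (ht : 0 ≤ t) : 0 ≤ windowInt f x t := by
  simpa [windowInt_zero] using hf.windowInt_mono x ht

lemma windowInt_ge (x t : ℝ) : t * f (x + t) ≤ windowInt f x t := by
  have := hf.windowInt_tangent x t 0
  rw [windowInt_zero] at this
  linarith

lemma abs_windowInt_le (x t : ℝ) : |windowInt f x t| ≤ |t| := by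
  have h1 := hf.windowInt_le x t
  have h2 := hf.windowInt_ge x t
  rw [abs_le]
  rcases le_total 0 t with ht | ht
  · rw [abs_of_nonneg ht]
    constructor
    · nlinarith [hf.nonneg (x+t)]
    · nlinarith [hf.le_one x]
  · rw [abs_of_nonpos ht]
    constructor
    · nlinarith [hf.le_one (x+t)]
    · nlinarith [hf.nonneg x]

lemma continuous_windowInt (x : ℝ) : Continuous (windowInt f x) :=
  (intervalIntegral.continuous_primitive (fun a b => hf.intervalIntegrable a b) x).comp
    (continuous_const.add continuous_id)

/-- Superlinearity from concavity. -/
lemma windowInt_mul_ge (x : ℝ) {c t : ℝ} (hc : 0 ≤ c) (hc1 : c ≤ 1) :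
    c * windowInt f x t ≤ windowInt f x (c * t) := by
  have h1 := hf.windowInt_tangent x (c * t) t
  have h2 := hf.windowInt_ge x (c * t)
  have h3 := hf.nonneg (x + c * t)
  have h4 : (1 - c) * (c * t * f (x + c * t)) ≤ (1 - c) * windowInt f x (c * t) :=
    mul_le_mul_of_nonneg_left h2 (by linarith)
  nlinarith [mul_le_mul_of_nonneg_left h1 hc]

lemma windowInt_mul_le (x : ℝ) {c t : ℝ} (hc : 1 ≤ c) :
    windowInt f x (c * t) ≤ c * windowInt f x t := by
  have hc0 : 0 < c := by linarith
  have h := hf.windowInt_mul_ge x (c := c⁻¹) (t := c * t) (by positivity)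
    (inv_le_one_of_one_le₀ hc)
  rw [inv_mul_cancel_left₀ hc0.ne', inv_mul_le_iff₀ hc0] at h
  exact h

/-- Monotonicity gives `x f x ≤ 2 ∫_{x/2}^x f`, which vanishes because `f` is integrable. -/
lemma tendsto_mul_self : Tendsto (fun x => x * f x) atTop (𝓝 0) := by
  have h1 : Tendsto (fun x : ℝ => 2 * ((∫ y in (0:ℝ)..x, f y) - ∫ y in (0:ℝ)..(x/2), f y))
      atTop (𝓝 0) := by
    have := (hf.tendsto_integral.sub (hf.tendsto_integral.comp
      (tendsto_id.atTop_div_const two_pos))).const_mul 2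
    simpa using this
  refine tendsto_of_tendsto_of_tendsto_of_le_of_le' tendsto_const_nhds h1 ?_ ?_
  · filter_upwards [eventually_ge_atTop 0] with x hx using mul_nonneg hx (hf.nonneg x)
  · filter_upwards [eventually_ge_atTop 0] with x hx
    rw [intervalIntegral.integral_interval_sub_left (hf.intervalIntegrable _ _)
      (hf.intervalIntegrable _ _)]
    have := hf.windowInt_ge (x/2) (x/2)
    rw [windowInt, add_halves] at this
    linarith

lemma tendsto_zero : Tendsto f atTop (𝓝 0) := by
  refine tendsto_of_tendsto_of_tendsto_of_le_of_le' tendsto_const_nhds hf.tendsto_mul_self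
    (Eventually.of_forall hf.nonneg) ?_
  filter_upwards [eventually_ge_atTop 1] with x hx
  exact le_mul_of_one_le_left (hf.nonneg x) hx

lemma tailInt_tendsto : Tendsto (tailInt f) atTop (𝓝 0) := by
  have h : ∀ x, tailInt f x = tailInt f 0 - ∫ y in (0:ℝ)..x, f y := fun x => by
    rw [← hf.tailInt_sub]; ring
  have := hf.tendsto_integral.const_sub (tailInt f 0)
  rw [show ∫ y in Set.Ioi (0:ℝ), f y = tailInt f 0 from rfl, sub_self] at this
  exact this.congr fun x => (h x).symm

lemma tailInt_anti : Antitone (tailInt f) := by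
  intro x y hxy
  have := hf.tailInt_sub x y
  have h2 : 0 ≤ ∫ v in x..y, f v := intervalIntegral.integral_nonneg hxy fun y _ => hf.nonneg y
  linarith

end StrongTail

variable {Ω : Type*} [MeasurableSpace Ω]

/-- The right tail of `ξ` is asymptotically equivalent to `p f`. -/
def HasTail (μ : Measure Ω) (ξ : Ω → ℝ) (f : ℝ → ℝ) (p : ℝ) : Prop :=
  Tendsto (fun v => μ.real {ω | v < ξ ω} / f v) atTop (𝓝 p)

namespace HasTail

variable {μ : Measure Ω} [IsProbabilityMeasure μ] {f : ℝ → ℝ} {ξ : Ω → ℝ} {p : ℝ}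

omit [IsProbabilityMeasure μ] in
lemma shift (hf : StrongTail f) (h : HasTail μ ξ f p) (s : ℝ) :
    Tendsto (fun v => μ.real {ω | v + s < ξ ω} / f v) atTop (𝓝 p) := by
  have h1 := (h.comp (tendsto_atTop_add_const_right atTop s tendsto_id)).mul (hf.long_tailed s)
  rw [mul_one] at h1
  refine h1.congr fun x => ?_
  simp only [Function.comp_apply, id]
  rw [div_mul_div_cancel₀ (hf.pos _).ne']

lemma bound (hf : StrongTail f) (h : HasTail μ ξ f p) :
    ∃ C ≥ 0, ∀ v, μ.real {ω | v < ξ ω} ≤ C * f v := by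
  obtain ⟨R, hR⟩ := eventually_atTop.1 (h.eventually (gt_mem_nhds (lt_add_one p)))
  refine ⟨max (p + 1) (1 / f R), le_max_of_le_right (by have := hf.pos R; positivity), fun v => ?_⟩
  have hv := hf.pos v
  rcases le_total R v with h1 | h1
  · have h2 := hR v h1
    rw [div_lt_iff₀ hv] at h2
    exact h2.le.trans (mul_le_mul_of_nonneg_right (le_max_left _ _) hv.le)
  · calc μ.real {ω | v < ξ ω} ≤ 1 := measureReal_le_one
      _ ≤ 1 / f R * f v := by
        rw [div_mul_eq_mul_div, one_mul, one_le_div (hf.pos R)]; exact hf.anti h1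
      _ ≤ _ := mul_le_mul_of_nonneg_right (le_max_right _ _) hv.le

/-- Long-tailedness: a shift by `s` does not change the leading constant `p`, so the difference of
the two tails is `o(f)`. -/
lemma window (hf : StrongTail f) (hξ : Measurable ξ) (h : HasTail μ ξ f p) {s : ℝ} (hs : 0 ≤ s) :
    Tendsto (fun v => μ.real {ω | v - s < ξ ω ∧ ξ ω ≤ v} / f v) atTop (𝓝 0) := by
  have h1 := (h.shift hf (-s)).sub h
  rw [sub_self] at h1
  refine h1.congr fun v => ?_
  rw [← sub_div]
  congr 1
  have hsub : {ω | v < ξ ω} ⊆ {ω | v + -s < ξ ω} := fun ω (hω : v < ξ ω) =>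
    show v + -s < ξ ω by linarith
  rw [← measureReal_sdiff hsub (measurableSet_lt measurable_const hξ)]
  congr 1
  ext ω
  simp [sub_eq_add_neg]

/-- Fubini: the increment of the integrated tail is the integral of `f (y - t)` over `t` between 0
and `ξ`, and integrating over `ω` first leaves a tail probability of `ξ`. The outcome is a
convolution, the object that strong subexponentiality controls. -/
lemma lintegral_window (hf : StrongTail f) (hξ : Measurable ξ) {B y : ℝ} (hB : 0 ≤ B) :
    ∫⁻ ω in {ω | B < ξ ω ∧ ξ ω ≤ y}, ENNReal.ofReal (tailInt f (y - ξ ω) - tailInt f y) ∂μ =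
      ∫⁻ t in Set.Ioc 0 y, ENNReal.ofReal (f (y - t)) *
        μ {ω | (B < ξ ω ∧ ξ ω ≤ y) ∧ t < ξ ω} := by
  have hS : MeasurableSet {ω | B < ξ ω ∧ ξ ω ≤ y} :=
    (measurableSet_lt measurable_const hξ).inter (measurableSet_le hξ measurable_const)
  have hmf := hf.measurable
  have h1 : ∀ ω ∈ {ω | B < ξ ω ∧ ξ ω ≤ y}, ENNReal.ofReal (tailInt f (y - ξ ω) - tailInt f y) =
      ∫⁻ t in Set.Ioc 0 y, ENNReal.ofReal (f (y - t)) *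
        Set.indicator {q : Ω × ℝ | q.2 < ξ q.1} 1 (ω, t) := by
    intro ω hω
    have h2 : tailInt f (y - ξ ω) - tailInt f y = ∫ t in (0:ℝ)..(ξ ω), f (y - t) := by
      rw [hf.tailInt_sub, intervalIntegral.integral_comp_sub_left, sub_zero]
    have h3 : IntervalIntegrable (fun t => f (y - t)) volume 0 (ξ ω) := by
      have : Monotone fun t => f (y - t) := fun u v huv => hf.anti (by linarith)
      exact (this.monotoneOn _).intervalIntegrable
    have hω0 : 0 ≤ ξ ω := hB.trans hω.1.le
    -- Passing to the open interval turns the constraint into the strict `t < ξ ω`, the form in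
    -- which tails appear.
    rw [h2, intervalIntegral.integral_of_le hω0,
      ofReal_integral_eq_lintegral_ofReal ((intervalIntegrable_iff_integrableOn_Ioc_of_le hω0).1 h3)
        (Eventually.of_forall fun t => hf.nonneg _), setLIntegral_congr Ioo_ae_eq_Ioc.symm]
    rw [← lintegral_indicator measurableSet_Ioo, ← lintegral_indicator measurableSet_Ioc]
    congr 1
    ext t
    by_cases ht : t ∈ Set.Ioo 0 (ξ ω)
    · have : t ∈ Set.Ioc 0 y := ⟨ht.1, ht.2.le.trans hω.2⟩
      simp [Set.indicator, ht.1, ht.2, this.2]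
    · by_cases h0 : 0 < t
      · have : ¬ t < ξ ω := fun h => ht ⟨h0, h⟩
        simp [Set.indicator, this]
      · simp [Set.indicator, h0]
  rw [setLIntegral_congr_fun hS h1, lintegral_lintegral_swap]
  · refine lintegral_congr fun t => ?_
    have hmt : MeasurableSet {ω | t < ξ ω} := measurableSet_lt measurable_const hξ
    rw [lintegral_const_mul]
    · congr 1
      have : (fun ω => Set.indicator {q : Ω × ℝ | q.2 < ξ q.1} (1 : Ω × ℝ → ℝ≥0∞) (ω, t)) =
          Set.indicator {ω | t < ξ ω} 1 := by
        ext ω; simp [Set.indicator]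
      rw [this, lintegral_indicator_one hmt, Measure.restrict_apply hmt, Set.inter_comm]
      rfl
    · exact (measurable_one.indicator (measurableSet_lt measurable_snd
        (hξ.comp measurable_fst))).comp measurable_prodMk_right
  · refine Measurable.aemeasurable ?_
    refine Measurable.mul ?_ ?_
    · exact (hmf.comp (measurable_const.sub measurable_snd)).ennreal_ofReal
    · exact measurable_one.indicator (measurableSet_lt measurable_snd
        (hξ.comp measurable_fst))

/-- A single big jump does not land at an intermediate level. -/
lemma mid_jump (hf : StrongTail f) (hξ : Measurable ξ) (h : HasTail μ ξ f p) {ε : ℝ} (hε : 0 < ε) :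
    ∃ B₀ > 0, ∀ B ≥ B₀, ∀ᶠ y in atTop,
      ∫⁻ ω in {ω | B < ξ ω ∧ ξ ω ≤ y}, ENNReal.ofReal (tailInt f (y - ξ ω) - tailInt f y) ∂μ ≤
        ENNReal.ofReal (ε * f y) := by
  obtain ⟨C, hC0, hC⟩ := h.bound hf
  obtain ⟨B₁, hB₁, hmid⟩ := hf.eventually_conv_mid (ε := ε / (3 * (C + 1))) (by positivity)
  obtain ⟨B₂, hB₂⟩ := eventually_atTop.1 (hf.tendsto_mul_self.eventually
    (gt_mem_nhds (show (0:ℝ) < ε / (6 * (C + 1)) by positivity)))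
  -- `B₁` controls the middle of the convolution; `B₂` makes `B f B` small, as the first of the
  -- three ranges of `t` below requires.
  refine ⟨max B₁ B₂, lt_max_of_lt_left hB₁, fun B hB => ?_⟩
  have hB0 : 0 < B := hB₁.trans_le ((le_max_left _ _).trans hB)
  filter_upwards [hmid B ((le_max_left _ _).trans hB), hf.eventually_shift B one_pos,
    (h.window hf hξ hB0.le).eventually (gt_mem_nhds (show (0:ℝ) < ε / (3 * B) by positivity)),
    eventually_ge_atTop (2 * B)] with y h1 h2 h3 hy
  rw [lintegral_window hf hξ hB0.le]
  rw [div_lt_iff₀ (hf.pos y)] at h3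
  have hconv : Monotone fun t => f (y - t) := fun u v huv => hf.anti (by linarith)
  rw [← Set.Ioc_union_Ioc_eq_Ioc hB0.le (show B ≤ y by linarith),
    lintegral_union measurableSet_Ioc (Set.Ioc_disjoint_Ioc_of_le le_rfl),
    ← Set.Ioc_union_Ioc_eq_Ioc (show B ≤ y - B by linarith) (show y - B ≤ y by linarith),
    lintegral_union measurableSet_Ioc (Set.Ioc_disjoint_Ioc_of_le le_rfl)]
  -- For `t ≤ B` the factor `f (y - t)` is at most `2 f y`, while the event forces `ξ > B`, of
  -- probability at most `C f B`.
  have p1 : ∫⁻ t in Set.Ioc 0 B, ENNReal.ofReal (f (y - t)) *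
        μ {ω | (B < ξ ω ∧ ξ ω ≤ y) ∧ t < ξ ω} ≤ ENNReal.ofReal (ε / 3 * f y) := by
    calc _ ≤ ∫⁻ t in Set.Ioc 0 B, ENNReal.ofReal (2 * f y * (C * f B)) := by
          refine setLIntegral_mono measurable_const fun t ht => ?_
          rw [ENNReal.ofReal_mul (by have := hf.nonneg y; positivity)]
          refine mul_le_mul' (ENNReal.ofReal_le_ofReal ?_) ?_
          · exact (hconv ht.2).trans (by linarith)
          · refine le_trans (measure_mono fun ω hω => ?_)
              ((ENNReal.le_ofReal_iff_toReal_le (measure_ne_top _ _)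
                (mul_nonneg hC0 (hf.nonneg _))).2 (hC B))
            exact hω.1.1
      _ = ENNReal.ofReal (2 * f y * (C * f B) * B) := by
          rw [setLIntegral_const, Real.volume_Ioc, sub_zero, ← ENNReal.ofReal_mul]
          have := hf.nonneg y; have := hf.nonneg B; positivity
      _ ≤ _ := by
          refine ENNReal.ofReal_le_ofReal ?_
          have h4 := hB₂ B ((le_max_right _ _).trans hB)
          rw [lt_div_iff₀ (by positivity)] at h4
          have h5 : C * (B * f B) ≤ (C + 1) * (B * f B) := by
            have := hf.nonneg B
            gcongr; linarith
          have h6 := hf.nonneg y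
          have h7 : 2 * (C * (B * f B)) ≤ ε / 3 := by linarith
          calc _ = 2 * (C * (B * f B)) * f y := by ring
            _ ≤ _ := by gcongr
  have p2 : ∫⁻ t in Set.Ioc B (y - B), ENNReal.ofReal (f (y - t)) *
        μ {ω | (B < ξ ω ∧ ξ ω ≤ y) ∧ t < ξ ω} ≤ ENNReal.ofReal (ε / 3 * f y) := by
    have hint := hf.intervalIntegrable_conv y B (y - B)
    rw [intervalIntegrable_iff_integrableOn_Ioc_of_le (by linarith)] at hint
    calc _ ≤ ∫⁻ t in Set.Ioc B (y - B), ENNReal.ofReal C * ENNReal.ofReal (f (y - t) * f t) := by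
          refine setLIntegral_mono (((hf.measurable.comp (measurable_const.sub measurable_id)).mul
            hf.measurable).ennreal_ofReal.const_mul _) fun t ht => ?_
          rw [ENNReal.ofReal_mul (hf.nonneg _), mul_left_comm, ← ENNReal.ofReal_mul hC0]
          refine mul_le_mul' le_rfl ?_
          refine le_trans (measure_mono fun ω hω => ?_)
              ((ENNReal.le_ofReal_iff_toReal_le (measure_ne_top _ _)
                (mul_nonneg hC0 (hf.nonneg _))).2 (hC t))
          exact hω.2
      _ = ENNReal.ofReal (C * ∫ t in B..(y - B), f (y - t) * f t) := by
          rw [lintegral_const_mul' _ _ ENNReal.ofReal_ne_top, ENNReal.ofReal_mul hC0,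
            intervalIntegral.integral_of_le (by linarith),
            ofReal_integral_eq_lintegral_ofReal hint
              (Eventually.of_forall fun t => mul_nonneg (hf.nonneg _) (hf.nonneg _))]
      _ ≤ _ := by
          refine ENNReal.ofReal_le_ofReal ?_
          have h6 := hf.nonneg y
          calc _ ≤ C * (ε / (3 * (C + 1)) * f y) := by gcongr
            _ ≤ (C + 1) * (ε / (3 * (C + 1)) * f y) := by gcongr; linarith
            _ = _ := by field_simp
  -- Near the upper end only `f ≤ 1` is used, but the event confines `ξ` to a window of length `B`
  -- below `y`, whose probability is `o(f y)` by `window`.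
  have p3 : ∫⁻ t in Set.Ioc (y - B) y, ENNReal.ofReal (f (y - t)) *
        μ {ω | (B < ξ ω ∧ ξ ω ≤ y) ∧ t < ξ ω} ≤ ENNReal.ofReal (ε / 3 * f y) := by
    calc _ ≤ ∫⁻ t in Set.Ioc (y - B) y, ENNReal.ofReal (ε / (3 * B) * f y) := by
          refine setLIntegral_mono measurable_const fun t ht => ?_
          rw [← one_mul (ENNReal.ofReal (_ * _))]
          refine mul_le_mul' (ENNReal.ofReal_le_one.2 (hf.le_one _)) ?_
          refine le_trans (measure_mono (t := {ω | y - B < ξ ω ∧ ξ ω ≤ y}) fun ω hω => ?_)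
              ((ENNReal.le_ofReal_iff_toReal_le (measure_ne_top _ _)
                (mul_nonneg (by positivity) (hf.nonneg _))).2 h3.le)
          exact ⟨ht.1.trans hω.2, hω.1.2⟩
      _ = ENNReal.ofReal (ε / (3 * B) * f y * B) := by
          rw [setLIntegral_const, Real.volume_Ioc, sub_sub_cancel, ← ENNReal.ofReal_mul]
          have := hf.nonneg y; positivity
      _ ≤ _ := by
          refine ENNReal.ofReal_le_ofReal (le_of_eq ?_)
          field_simp
  refine (add_le_add p1 (add_le_add p2 p3)).trans ?_
  have h6 := hf.nonneg y
  rw [← ENNReal.ofReal_add (by positivity) (by positivity),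
    ← ENNReal.ofReal_add (by positivity) (by positivity)]
  exact ENNReal.ofReal_le_ofReal (by linarith)

/-- The values of `f` after an intermediate jump. -/
lemma mid_jump' (hf : StrongTail f) (hξ : Measurable ξ) (h : HasTail μ ξ f p) {ε : ℝ}
    (hε : 0 < ε) : ∃ B₀ > 0, ∀ B ≥ B₀, ∀ᶠ y in atTop,
      ∫⁻ ω in {ω | B < ξ ω ∧ ξ ω ≤ y}, ENNReal.ofReal (f (y - ξ ω)) ∂μ ≤
        ENNReal.ofReal (ε * f y) := by
  obtain ⟨C, hC, hexp⟩ := hf.exp_bound one_pos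
  set K := C * Real.exp (1 * 1) with hK
  have hK0 : 0 < K := by positivity
  obtain ⟨B₀, hB₀, hB⟩ := h.mid_jump hf hξ (ε := ε / K) (by positivity)
  refine ⟨max B₀ 1, lt_max_of_lt_left hB₀, fun B hBB => ?_⟩
  filter_upwards [hB B ((le_max_left _ _).trans hBB)] with y hy
  have hS : MeasurableSet {ω | B < ξ ω ∧ ξ ω ≤ y} :=
    (measurableSet_lt measurable_const hξ).inter (measurableSet_le hξ measurable_const)
  have hm : Measurable (tailInt f) := hf.tailInt_anti.measurable
  calc _ ≤ ∫⁻ ω in {ω | B < ξ ω ∧ ξ ω ≤ y},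
        ENNReal.ofReal K * ENNReal.ofReal (tailInt f (y - ξ ω) - tailInt f y) ∂μ := by
        refine setLIntegral_mono (((hm.comp (measurable_const.sub hξ)).sub_const
          _).ennreal_ofReal.const_mul _) fun ω hω => ?_
        rw [← ENNReal.ofReal_mul hK0.le]
        refine ENNReal.ofReal_le_ofReal ?_
        -- A unit step to the right costs the factor `K`, and since `ξ > 1` the unit interval
        -- starting at `y - ξ` lies below `y`. Hence `f (y - ξ)` is at most `K` times the increment
        -- handled by `mid_jump`.
        have h1 := hexp (y - ξ ω + 1) 1 zero_le_one
        have h2 := hf.windowInt_ge (y - ξ ω) 1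
        rw [hf.windowInt_eq] at h2
        have h3 : 1 < ξ ω := ((le_max_right _ _).trans hBB).trans_lt hω.1
        have h4 := hf.tailInt_anti (show y - ξ ω + 1 ≤ y by linarith)
        rw [add_sub_cancel_right] at h1
        exact h1.trans (mul_le_mul_of_nonneg_left (by linarith) hK0.le)
    _ = ENNReal.ofReal K * _ := lintegral_const_mul' _ _ ENNReal.ofReal_ne_top
    _ ≤ ENNReal.ofReal K * ENNReal.ofReal (ε / K * f y) := by gcongr
    _ = _ := by rw [← ENNReal.ofReal_mul hK0.le]; congr 1; field_simp

end HasTail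

end

end RandomTimeMaxima

/-! ### Drift estimates and a superharmonic function for a walk with negative drift -/

namespace RandomTimeMaxima

section

variable {Ω : Type*} [MeasurableSpace Ω] {μ : Measure Ω} [IsProbabilityMeasure μ]
  {f : ℝ → ℝ} {ξ m : Ω → ℝ} {p A α : ℝ}

namespace StrongTail

lemma mul_antitone (hf : StrongTail f) {k : ℝ → ℝ} (hk : Antitone k) (hk0 : ∀ v, 0 ≤ k v) :
    Antitone (fun v => k v * f v) := fun _ _ h =>
  mul_le_mul (hk h) (hf.anti h) (hf.nonneg _) (hk0 _)

lemma mul_integrableOn_Ioi (hf : StrongTail f) {k : ℝ → ℝ} {K : ℝ} (hk : Antitone k)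
    (hk0 : ∀ v, 0 ≤ k v) (hkK : ∀ v, k v ≤ K) (a : ℝ) :
    IntegrableOn (fun v => k v * f v) (Set.Ioi a) := by
  refine Integrable.mono' ((hf.integrableOn_Ioi a).const_mul K)
    (hk.measurable.mul hf.measurable).aestronglyMeasurable (Eventually.of_forall fun v => ?_)
  rw [Real.norm_of_nonneg (mul_nonneg (hk0 v) (hf.nonneg v))]
  exact mul_le_mul_of_nonneg_right (hkK v) (hf.nonneg v)

end StrongTail

lemma tailInt_mul_sub (hf : StrongTail f) {k : ℝ → ℝ} {K : ℝ} (hk : Antitone k)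
    (hk0 : ∀ v, 0 ≤ k v) (hkK : ∀ v, k v ≤ K) (x y : ℝ) :
    tailInt (fun v => k v * f v) x - tailInt (fun v => k v * f v) y = ∫ v in x..y, k v * f v :=
  intervalIntegral.integral_Ioi_sub_Ioi' (hf.mul_integrableOn_Ioi hk hk0 hkK x)
    (hf.mul_integrableOn_Ioi hk hk0 hkK y)

/-- Pointwise bound for the increment of the integral of `k f` after a step `s ≤ y`. -/
lemma tailInt_step_le (hf : StrongTail f) {k : ℝ → ℝ} {K : ℝ} (hk : Antitone k)
    (hk0 : ∀ v, 0 ≤ k v) (hkK : ∀ v, k v ≤ K) {y s A B : ℝ} (hB : 0 ≤ B) (hs : -A ≤ s) :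
    tailInt (fun v => k v * f v) (y - s) ≤ tailInt (fun v => k v * f v) y
      + (max s 0 * (k (y - B) * f (y - B)) - max (-s) 0 * (k (y + A) * f (y + A)))
      + if B < s then K * (tailInt f (y - s) - tailInt f y) else 0 := by
  have hw := hf.mul_antitone hk hk0
  have hwi : ∀ a b, IntervalIntegrable (fun v => k v * f v) volume a b := fun a b =>
    (hw.antitoneOn _).intervalIntegrable
  have hsub := tailInt_mul_sub hf hk hk0 hkK (y - s) y
  have hpos : 0 ≤ k (y - B) * f (y - B) := mul_nonneg (hk0 _) (hf.nonneg _)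
  split_ifs with h
  · have hs0 : 0 < s := hB.trans_lt h
    rw [max_eq_left hs0.le, max_eq_right (by linarith), zero_mul, sub_zero]
    have h1 : ∫ v in (y - s)..y, k v * f v ≤ K * (tailInt f (y - s) - tailInt f y) := by
      rw [hf.tailInt_sub, ← intervalIntegral.integral_const_mul]
      exact intervalIntegral.integral_mono_on (by linarith) (hwi _ _)
        ((hf.intervalIntegrable _ _).const_mul K)
        fun v _ => mul_le_mul_of_nonneg_right (hkK v) (hf.nonneg v)
    nlinarith
  · push Not at h
    rw [add_zero]
    rcases le_total 0 s with hs0 | hs0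
    · rw [max_eq_left hs0, max_eq_right (by linarith), zero_mul, sub_zero]
      have h1 := intervalIntegral.integral_mono_on (show y - s ≤ y by linarith) (hwi (y - s) y)
        (intervalIntegrable_const (c := k (y - B) * f (y - B)))
        (fun v hv => hw (show y - B ≤ v by linarith [hv.1]))
      simp only [intervalIntegral.integral_const, sub_sub_cancel, smul_eq_mul] at h1
      linarith
    · rw [max_eq_right hs0, max_eq_left (by linarith), zero_mul, zero_sub]
      have h1 := intervalIntegral.integral_mono_on (show y ≤ y - s by linarith)
        (intervalIntegrable_const (c := k (y + A) * f (y + A))) (hwi y (y - s))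
        (fun v hv => hw (show v ≤ y + A by linarith [hv.2]))
      simp only [intervalIntegral.integral_const, smul_eq_mul] at h1
      rw [intervalIntegral.integral_symm] at hsub
      linarith

/-- Integrates `tailInt_step_le` over one step, with value 1 when `m` passes the level. Because `ξ ≤
max m 0`, a step without crossing has `ξ ≤ y`, so every such step above `B` is an intermediate jump
covered by `hjump`. -/
lemma lintegral_step_le (hf : StrongTail f) (hξ : Measurable ξ) (hm : Measurable m) (hA0 : 0 ≤ A)
    (hA : ∀ ω, -A ≤ ξ ω) (hξm : ∀ᵐ ω ∂μ, ξ ω ≤ max (m ω) 0) (hint : Integrable ξ μ)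
    {k : ℝ → ℝ} {K : ℝ} (hk : Antitone k) (hk0 : ∀ v, 0 ≤ k v) (hkK : ∀ v, k v ≤ K) {y B η : ℝ}
    (hy : 0 ≤ y) (hB : 0 ≤ B) (hK : 0 ≤ K)
    (hjump : ∫⁻ ω in {ω | B < ξ ω ∧ ξ ω ≤ y},
      ENNReal.ofReal (tailInt f (y - ξ ω) - tailInt f y) ∂μ ≤ ENNReal.ofReal η) :
    ∫⁻ ω, (if y < m ω then 1 else ENNReal.ofReal (tailInt (fun v => k v * f v) (y - ξ ω))) ∂μ ≤
      ENNReal.ofReal (μ.real {ω | y < m ω} * (1 + A * (k (y + A) * f (y + A)))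
        + tailInt (fun v => k v * f v) y
        + ((∫ ω, max (ξ ω) 0 ∂μ) * (k (y - B) * f (y - B))
        - (∫ ω, max (-ξ ω) 0 ∂μ) * (k (y + A) * f (y + A)))) + ENNReal.ofReal (K * η) := by
  set W := tailInt (fun v => k v * f v) with hW
  set w₁ := k (y - B) * f (y - B) with hw₁
  set w₂ := k (y + A) * f (y + A) with hw₂
  have hw₁0 : 0 ≤ w₁ := mul_nonneg (hk0 _) (hf.nonneg _)
  have hw₂0 : 0 ≤ w₂ := mul_nonneg (hk0 _) (hf.nonneg _)
  have hWnn : ∀ y, 0 ≤ W y := fun y =>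
    integral_nonneg fun v => mul_nonneg (hk0 v) (hf.nonneg v)
  have hS : MeasurableSet {ω | B < ξ ω ∧ ξ ω ≤ y} :=
    (measurableSet_lt measurable_const hξ).inter (measurableSet_le hξ measurable_const)
  have hmS : MeasurableSet {ω | y < m ω} := measurableSet_lt measurable_const hm
  set g : Ω → ℝ := fun ω => Set.indicator {ω | y < m ω} (fun _ => 1 + A * w₂) ω + W y
    + (max (ξ ω) 0 * w₁ - max (-ξ ω) 0 * w₂) with hg
  -- the lower bound `-A` of the steps keeps the linear part nonnegative
  have hlin : ∀ s, -A ≤ s → 0 ≤ W y + (max s 0 * w₁ - max (-s) 0 * w₂) := by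
    intro s hs
    rcases le_total 0 s with h0 | h0
    · rw [max_eq_left h0, max_eq_right (by linarith), zero_mul, sub_zero]
      have := hWnn y; positivity
    · have h1 := tailInt_step_le hf hk hk0 hkK (y := y) hB hs
      rw [if_neg (by linarith), add_zero] at h1
      exact (hWnn _).trans h1
  have hg0 : ∀ ω, 0 ≤ g ω := fun ω => by
    have h1 := hlin (ξ ω) (hA ω)
    have h2 : 0 ≤ Set.indicator {ω | y < m ω} (fun _ => 1 + A * w₂) ω :=
      Set.indicator_nonneg (fun _ _ => by positivity) ω
    simp only [hg]; linarith
  have i1 : Integrable (Set.indicator {ω | y < m ω} (fun _ => 1 + A * w₂)) μ :=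
    (integrable_const _).indicator hmS
  have i2 : Integrable (fun ω => max (ξ ω) 0 * w₁) μ := hint.pos_part.mul_const _
  have i3 : Integrable (fun ω => max (-ξ ω) 0 * w₂) μ := hint.neg_part.mul_const _
  have hgi : Integrable g μ := (i1.add (integrable_const _)).add (i2.sub i3)
  have hgint : ∫ ω, g ω ∂μ = μ.real {ω | y < m ω} * (1 + A * w₂) + W y
      + ((∫ ω, max (ξ ω) 0 ∂μ) * w₁ - (∫ ω, max (-ξ ω) 0 ∂μ) * w₂) := by
    have e1 : ∫ ω, g ω ∂μ = ∫ ω, (Set.indicator {ω | y < m ω} (fun _ => 1 + A * w₂) ω + W y) ∂μ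
      + ∫ ω, (max (ξ ω) 0 * w₁ - max (-ξ ω) 0 * w₂) ∂μ :=
        integral_add (i1.add (integrable_const _)) (i2.sub i3)
    rw [e1, integral_add i1 (integrable_const _), integral_sub i2 i3, integral_mul_const,
      integral_mul_const, integral_indicator_const _ hmS]
    simp
  have hpt : ∀ᵐ ω ∂μ, (if y < m ω then 1 else ENNReal.ofReal (W (y - ξ ω))) ≤
      ENNReal.ofReal (g ω) + Set.indicator {ω | B < ξ ω ∧ ξ ω ≤ y}
        (fun ω => ENNReal.ofReal K * ENNReal.ofReal (tailInt f (y - ξ ω) - tailInt f y)) ω := by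
    filter_upwards [hξm] with ω hω
    split_ifs with h
    · refine le_add_right ?_
      rw [ENNReal.one_le_ofReal]
      have h1 := hlin (ξ ω) (hA ω)
      have h2 : Set.indicator {ω | y < m ω} (fun _ => 1 + A * w₂) ω = 1 + A * w₂ :=
        Set.indicator_of_mem (show ω ∈ {ω | y < m ω} from h) _
      simp only [hg, h2]
      have : 0 ≤ A * w₂ := by positivity
      linarith
    · have hξy : ξ ω ≤ y := hω.trans (max_le (not_lt.1 h) hy)
      have h1 := tailInt_step_le hf hk hk0 hkK (y := y) hB (hA ω)
      have h2 : Set.indicator {ω | y < m ω} (fun _ => 1 + A * w₂) ω = 0 :=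
        Set.indicator_of_notMem (show ω ∉ {ω | y < m ω} from h) _
      have h3 : g ω = W y + (max (ξ ω) 0 * w₁ - max (-ξ ω) 0 * w₂) := by
        simp only [hg, h2]; ring
      by_cases hBξ : B < ξ ω
      · rw [if_pos hBξ] at h1
        rw [Set.indicator_of_mem (show ω ∈ {ω | B < ξ ω ∧ ξ ω ≤ y} from ⟨hBξ, hξy⟩),
          ← ENNReal.ofReal_mul hK, h3]
        have h4 := hf.tailInt_anti (show y - ξ ω ≤ y by linarith)
        rw [← ENNReal.ofReal_add (hlin _ (hA ω)) (mul_nonneg hK (by linarith))]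
        exact ENNReal.ofReal_le_ofReal h1
      · rw [if_neg hBξ, add_zero] at h1
        refine le_add_right ?_
        rw [h3]
        exact ENNReal.ofReal_le_ofReal h1
  refine (lintegral_mono_ae hpt).trans ?_
  rw [lintegral_add_left' hgi.aemeasurable.ennreal_ofReal,
    ← ofReal_integral_eq_lintegral_ofReal hgi (Eventually.of_forall hg0), hgint]
  refine add_le_add le_rfl ?_
  rw [lintegral_indicator hS, lintegral_const_mul' _ _ ENNReal.ofReal_ne_top, ENNReal.ofReal_mul hK]
  gcongr

/-- The drift inequality for the functions `∫_y^∞ k f` with slowly varying decreasing `k`. -/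
lemma drift_le (hf : StrongTail f) (hξ : Measurable ξ) (hm : Measurable m) (hA0 : 0 ≤ A)
    (hA : ∀ ω, -A ≤ ξ ω) (hξm : ∀ᵐ ω ∂μ, ξ ω ≤ max (m ω) 0) (hint : Integrable ξ μ)
    (hmean : ∫ ω, ξ ω ∂μ = -α) (hξt : HasTail μ ξ f p) (hmt : HasTail μ m f p) {ε : ℝ}
    (hε : 0 < ε) : ∃ C ≥ 0, ∃ R, ∀ (K δ : ℝ) (k : ℝ → ℝ), 1 ≤ K → 0 ≤ δ → Antitone k →
      (∀ v, 0 ≤ k v) → (∀ v, k v ≤ K) → (∀ v s, 0 ≤ s → k (v - s) ≤ k v + δ * s) →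
      ∀ y ≥ R, p + ε * K + δ * C ≤ α * k y →
      ∫⁻ ω, (if y < m ω then 1 else ENNReal.ofReal (tailInt (fun v => k v * f v) (y - ξ ω))) ∂μ ≤
        ENNReal.ofReal (tailInt (fun v => k v * f v) y) := by
  -- Steps up to `B` are treated linearly; intermediate steps beyond `B` cost only a small multiple
  -- of `f y`.
  obtain ⟨B, hB0, hB⟩ := hξt.mid_jump hf hξ (ε := ε / 4) (by linarith)
  have hjump := hB B le_rfl
  set mp := ∫ ω, max (ξ ω) 0 ∂μ with hmp
  set mn := ∫ ω, max (-ξ ω) 0 ∂μ with hmn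
  have hmp0 : 0 ≤ mp := integral_nonneg fun ω => le_max_right _ _
  have hmn0 : 0 ≤ mn := integral_nonneg fun ω => le_max_right _ _
  have hα : mp - mn = -α := by
    rw [← hmean, hmp, hmn, ← integral_sub hint.pos_part hint.neg_part]
    refine integral_congr_ae (Eventually.of_forall fun ω => ?_)
    simp only
    rcases le_total 0 (ξ ω) with h | h
    · rw [max_eq_left h, max_eq_right (by linarith), sub_zero]
    · rw [max_eq_right h, max_eq_left (by linarith)]; ring
  -- Relative error allowed when `f (y - B)` and `f (y + A)` are replaced by `f y`; it must remain
  -- small after multiplication by both mean parts.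
  set ε₁ := min 1 (ε / (4 * (mp + mn + 1))) with hε₁
  have hε₁0 : 0 < ε₁ := by positivity
  have hε₁1 : ε₁ ≤ 1 := min_le_left _ _
  have hε₁ε : ε₁ * (mp + mn + 1) ≤ ε / 4 := by
    calc _ ≤ ε / (4 * (mp + mn + 1)) * (mp + mn + 1) := by gcongr; exact min_le_right _ _
      _ = ε / 4 := by field_simp
  have hsmall : ∀ᶠ y in atTop, (|p| + 1) * A * f y < ε / 4 := by
    have := hf.tendsto_zero.const_mul ((|p| + 1) * A)
    rw [mul_zero] at this
    exact this.eventually (gt_mem_nhds (by linarith))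
  have hall := hjump.and ((hf.eventually_shift B hε₁0).and ((hf.eventually_shift' A hε₁0).and
    ((hmt.eventually (gt_mem_nhds (show p < p + ε₁ by linarith))).and
    (hsmall.and (eventually_ge_atTop 0)))))
  obtain ⟨R, hR⟩ := eventually_atTop.1 hall
  refine ⟨2 * B * mp + A * mn, by positivity, R, fun K δ k hK hδ hk hk0 hkK hkl y hy hcond => ?_⟩
  obtain ⟨h1, h2, h3, h4, h5, h6⟩ := hR y hy
  have hfy := hf.pos y
  rw [div_lt_iff₀ hfy] at h4
  refine (lintegral_step_le hf hξ hm hA0 hA hξm hint hk hk0 hkK h6 hB0.le (by linarith) h1).trans ?_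
  have hP0 : 0 ≤ μ.real {ω | y < m ω} := measureReal_nonneg
  have hw₁ : k (y - B) * f (y - B) ≤ (k y + δ * B) * ((1 + ε₁) * f y) :=
    mul_le_mul (hkl y B hB0.le) h2 (hf.nonneg _) (by have := hk0 y; positivity)
  have hw₂ : (k y - δ * A) * ((1 - ε₁) * f y) ≤ k (y + A) * f (y + A) := by
    have h7 := hkl (y + A) A hA0
    rw [add_sub_cancel_right] at h7
    have h8 : 0 ≤ (1 - ε₁) * f y := mul_nonneg (by linarith) hfy.le
    calc _ ≤ k (y + A) * ((1 - ε₁) * f y) := mul_le_mul_of_nonneg_right (by linarith) h8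
      _ ≤ _ := mul_le_mul_of_nonneg_left h3 (hk0 _)
  have hw₃ : k (y + A) * f (y + A) ≤ K * f y :=
    mul_le_mul (hkK _) (hf.anti (by linarith)) (hf.nonneg _) (by linarith)
  have hky := hk0 y
  have hkKy := hkK y
  have hPle : μ.real {ω | y < m ω} * (1 + A * (k (y + A) * f (y + A))) ≤
      (p + ε₁) * f y + K * (ε / 4) * f y := by
    have h8 : μ.real {ω | y < m ω} ≤ (|p| + 1) * f y :=
      h4.le.trans (mul_le_mul_of_nonneg_right (by linarith [le_abs_self p]) hfy.le)
    have h9 : μ.real {ω | y < m ω} * (A * (k (y + A) * f (y + A))) ≤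
        (|p| + 1) * f y * (A * (K * f y)) := by
      have := hk0 (y + A); have := hf.nonneg (y + A)
      gcongr
    have h10 : (|p| + 1) * f y * (A * (K * f y)) ≤ K * (ε / 4) * f y := by
      calc _ = K * ((|p| + 1) * A * f y) * f y := by ring
        _ ≤ _ := by gcongr
    linarith [h4.le]
  have key : μ.real {ω | y < m ω} * (1 + A * (k (y + A) * f (y + A)))
      + (mp * (k (y - B) * f (y - B)) - mn * (k (y + A) * f (y + A))) + K * (ε / 4 * f y) ≤ 0 := by
    have a1 : mp * (k (y - B) * f (y - B)) ≤ mp * ((k y + δ * B) * ((1 + ε₁) * f y)) := by gcongr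
    have a2 : mn * ((k y - δ * A) * ((1 - ε₁) * f y)) ≤ mn * (k (y + A) * f (y + A)) := by gcongr
    -- The balance divided by `f y`: crossing contributes `p`, the positive and negative mean parts
    -- combine to `-α k y`, the variation of `k` costs `δ (2 B mp + A mn)`, and the remaining errors
    -- fit into `ε K`.
    have a3 : (p + ε₁) + K * (ε / 4) + mp * ((k y + δ * B) * (1 + ε₁))
        - mn * ((k y - δ * A) * (1 - ε₁)) + K * (ε / 4) ≤ 0 := by
      have b1 : mp * ((k y + δ * B) * (1 + ε₁)) ≤ mp * k y + mp * (k y * ε₁) + δ * (2 * B * mp) := by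
        have : δ * B * mp * (1 + ε₁) ≤ δ * B * mp * 2 := by gcongr; linarith
        linarith
      have b2 : mn * k y - mn * (k y * ε₁) - δ * (A * mn) ≤ mn * ((k y - δ * A) * (1 - ε₁)) := by
        have : 0 ≤ mn * (δ * A * ε₁) := by positivity
        linarith
      have b3 : k y * (ε₁ * (mp + mn)) ≤ K * (ε₁ * (mp + mn)) := by gcongr
      have b4 : ε₁ ≤ K * ε₁ := le_mul_of_one_le_left hε₁0.le hK
      have b5 : K * (ε₁ * (mp + mn + 1)) ≤ K * (ε / 4) := by gcongr
      have b6 : mp * k y - mn * k y = -(α * k y) := by rw [← sub_mul, hα]; ring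
      have b7 : 0 < ε * K := by positivity
      linarith
    have a4 := mul_nonneg_of_nonpos_of_nonpos a3 (neg_nonpos.2 hfy.le)
    linarith
  set Z := μ.real {ω | y < m ω} * (1 + A * (k (y + A) * f (y + A)))
        + tailInt (fun v => k v * f v) y + (mp * (k (y - B) * f (y - B))
        - mn * (k (y + A) * f (y + A))) with hZ
  have hWnn : 0 ≤ tailInt (fun v => k v * f v) y :=
    integral_nonneg fun v => mul_nonneg (hk0 v) (hf.nonneg v)
  have hKε : 0 ≤ K * (ε / 4 * f y) := by positivity
  -- Needed to merge the two `ENNReal.ofReal` terms. The only negative contribution is at most `A`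
  -- times `k f` at `y + A`, hence at most what the integrated tail loses over a step of length `A`.
  have hZ0 : 0 ≤ Z := by
    have h7 : 0 ≤ k (y + A) * f (y + A) := mul_nonneg (hk0 _) (hf.nonneg _)
    have h8 : mn * (k (y + A) * f (y + A)) ≤ tailInt (fun v => k v * f v) y := by
      have h9 : tailInt (fun v => k v * f v) (y + A) ≤ tailInt (fun v => k v * f v) y
          - A * (k (y + A) * f (y + A)) := by
        rcases hA0.eq_or_lt with h0 | h0
        · simp [← h0]
        have := tailInt_step_le hf hk hk0 hkK (y := y) (s := -A) hB0.le le_rfl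
        rw [if_neg (by linarith), max_eq_right (by linarith), neg_neg, max_eq_left hA0] at this
        rw [sub_neg_eq_add] at this
        linarith
      have h10 : 0 ≤ tailInt (fun v => k v * f v) (y + A) :=
        integral_nonneg fun v => mul_nonneg (hk0 v) (hf.nonneg v)
      have h11 : mn ≤ A := by
        calc mn ≤ ∫ _, A ∂μ := integral_mono hint.neg_part (integrable_const _)
              fun ω => max_le (by linarith [hA ω]) hA0
          _ = A := by simp
      have := mul_le_mul_of_nonneg_right h11 h7
      linarith
    have h9 : 0 ≤ mp * (k (y - B) * f (y - B)) :=
      mul_nonneg hmp0 (mul_nonneg (hk0 _) (hf.nonneg _))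
    have h10 : 0 ≤ μ.real {ω | y < m ω} * (1 + A * (k (y + A) * f (y + A))) := by positivity
    linarith
  rw [← ENNReal.ofReal_add hZ0 hKε]
  exact ENNReal.ofReal_le_ofReal (by linarith)

/-- A bounded decreasing function which is superharmonic for a walk with negative drift, killed when
its step variable `m` exceeds the current level, and which is asymptotically `κ ∫_y^∞ f`. -/
lemma exists_superharmonic (hf : StrongTail f) (hξ : Measurable ξ) (hm : Measurable m)
    (hA0 : 0 ≤ A) (hA : ∀ ω, -A ≤ ξ ω) (hξm : ∀ᵐ ω ∂μ, ξ ω ≤ max (m ω) 0) (hint : Integrable ξ μ)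
    (hmean : ∫ ω, ξ ω ∂μ = -α) (hα : 0 < α) (hp : 0 ≤ p) (hξt : HasTail μ ξ f p)
    (hmt : HasTail μ m f p) {κ : ℝ} (hκ : p < α * κ) :
    ∃ V : ℝ → ℝ, Antitone V ∧ (∀ y, 0 ≤ V y) ∧ (∀ y, V y ≤ 1) ∧
      (∀ᶠ y in atTop, V y = κ * tailInt f y) ∧
      ∀ y, ∫⁻ ω, (if y < m ω then 1 else ENNReal.ofReal (V (y - ξ ω))) ∂μ ≤
        ENNReal.ofReal (V y) := by
  have hκ0 : 0 < κ := by
    by_contra h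
    push Not at h
    nlinarith
  obtain ⟨C₁, hC₁, R₁, hdrift₁⟩ := drift_le hf hξ hm hA0 hA hξm hint hmean hξt hmt
    (ε := α / 4) (by linarith)
  have hpos : 0 < ∫ v in R₁..(R₁ + 1), f v :=
    intervalIntegral.intervalIntegral_pos_of_pos (hf.intervalIntegrable _ _) hf.pos (by linarith)
  -- The large value of `k` near the level. It dominates `κ`, makes the integrated function at least
  -- 1 at `R₁`, so that the cap 1 covers everything below `R₁`, and makes the drift beat the crude
  -- error allowed between `R₁` and `R`.
  set K := max (max 1 κ) (max (1 / ∫ v in R₁..(R₁ + 1), f v) (2 * (p + 1) / α)) with hK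
  have hK1 : 1 ≤ K := (le_max_left _ _).trans (le_max_left _ _)
  have hKκ : κ ≤ K := (le_max_right _ _).trans (le_max_left _ _)
  have hKp : p + 1 ≤ α * K / 2 := by
    have : 2 * (p + 1) / α ≤ K := (le_max_right _ _).trans (le_max_right _ _)
    rw [div_le_iff₀ hα] at this
    linarith
  have hKI : 1 ≤ K * ∫ v in R₁..(R₁ + 1), f v := by
    have : (1 / ∫ v in R₁..(R₁ + 1), f v) ≤ K := (le_max_left _ _).trans (le_max_right _ _)
    rwa [div_le_iff₀ hpos] at this
  set γ := α * κ - p with hγ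
  have hγ0 : 0 < γ := by linarith
  obtain ⟨C₂, hC₂, R₂, hdrift₂⟩ := drift_le hf hξ hm hA0 hA hξm hint hmean hξt hmt
    (ε := γ / (2 * K)) (by positivity)
  set R := max R₂ (R₁ + 1) with hR
  -- The slope with which `k` descends from `K` to `κ`, so small that the loss stays within the
  -- slack of both drift inequalities.
  set δ := min (1 / (C₁ + 1)) (γ / (2 * (C₂ + 1))) with hδ
  have hδ0 : 0 < δ := by positivity
  have hδ1 : δ * C₁ ≤ 1 := by
    have : δ * (C₁ + 1) ≤ 1 := by
      calc _ ≤ 1 / (C₁ + 1) * (C₁ + 1) := by gcongr; exact min_le_left _ _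
        _ = 1 := by field_simp
    linarith
  have hδ2 : δ * C₂ ≤ γ / 2 := by
    have : δ * (C₂ + 1) ≤ γ / 2 := by
      calc _ ≤ γ / (2 * (C₂ + 1)) * (C₂ + 1) := by gcongr; exact min_le_right _ _
        _ = γ / 2 := by field_simp
    linarith
  set k : ℝ → ℝ := fun v => max κ (K - δ * max 0 (v - R)) with hk
  have hka : Antitone k := by
    intro u v huv
    simp only [hk]
    gcongr
  have hk0 : ∀ v, 0 ≤ k v := fun v => hκ0.le.trans (le_max_left _ _)
  have hkκ : ∀ v, κ ≤ k v := fun v => le_max_left _ _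
  have hkK : ∀ v, k v ≤ K := fun v => max_le hKκ (by
    have : 0 ≤ δ * max 0 (v - R) := mul_nonneg hδ0.le (le_max_left _ _)
    linarith)
  have hkl : ∀ v s, 0 ≤ s → k (v - s) ≤ k v + δ * s := by
    intro v s hs
    have hδs : 0 ≤ δ * s := by positivity
    refine max_le (by linarith [hkκ v]) ?_
    have h1 : K - δ * max 0 (v - R) ≤ k v := le_max_right _ _
    have h2 : max 0 (v - R) ≤ max 0 (v - s - R) + s := by
      refine max_le (by positivity) ?_
      linarith [le_max_right 0 (v - s - R)]
    have h3 := mul_le_mul_of_nonneg_left h2 hδ0.le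
    linarith
  set W := tailInt (fun v => k v * f v) with hW
  have hWanti : Antitone W := by
    intro x y hxy
    have h1 := tailInt_mul_sub hf hka hk0 hkK x y
    have h2 : 0 ≤ ∫ v in x..y, k v * f v :=
      intervalIntegral.integral_nonneg hxy fun v _ => mul_nonneg (hk0 v) (hf.nonneg v)
    simp only [hW]; linarith
  have hWnn : ∀ y, 0 ≤ W y := fun y =>
    integral_nonneg fun v => mul_nonneg (hk0 v) (hf.nonneg v)
  have hWR : 1 ≤ W R₁ := by
    have h1 := tailInt_mul_sub hf hka hk0 hkK R₁ (R₁ + 1)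
    have h2 : ∫ v in R₁..(R₁ + 1), k v * f v = K * ∫ v in R₁..(R₁ + 1), f v := by
      rw [← intervalIntegral.integral_const_mul]
      refine intervalIntegral.integral_congr fun v hv => ?_
      rw [Set.uIcc_of_le (by linarith)] at hv
      have h3 : v - R ≤ 0 := by linarith [hv.2, le_max_right R₂ (R₁ + 1)]
      simp only [hk, max_eq_left h3, mul_zero, sub_zero, max_eq_right hKκ]
    have h3 := hWnn (R₁ + 1)
    simp only [hW] at h3 ⊢
    linarith
  have hWev : ∀ᶠ y in atTop, W y = κ * tailInt f y := by
    filter_upwards [eventually_ge_atTop (R + (K - κ) / δ)] with y hy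
    simp only [hW, tailInt]
    rw [← integral_const_mul]
    refine setIntegral_congr_fun measurableSet_Ioi fun v hv => ?_
    have h1 : (K - κ) / δ ≤ v - R := by linarith [Set.mem_Ioi.1 hv]
    rw [div_le_iff₀ hδ0] at h1
    have h2 : v - R ≤ max 0 (v - R) := le_max_right _ _
    have h3 := mul_le_mul_of_nonneg_left h2 hδ0.le
    simp only [hk]
    rw [max_eq_left (by linarith)]
  refine ⟨fun y => min 1 (W y), fun x y h => min_le_min le_rfl (hWanti h),
    fun y => le_min zero_le_one (hWnn y), fun y => min_le_left _ _, ?_, fun y => ?_⟩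
  · have hlim : Tendsto (fun y => κ * tailInt f y) atTop (𝓝 0) := by
      simpa using hf.tailInt_tendsto.const_mul κ
    filter_upwards [hWev, hlim.eventually (gt_mem_nhds one_pos)] with y h1 h2
    rw [h1, min_eq_right h2.le]
  -- Where the cap is active the integrand never exceeds 1; elsewhere `y ≥ R₁` and the drift
  -- inequality for the uncapped function applies.
  · by_cases hy1 : 1 ≤ W y
    · simp only [min_eq_left hy1, ENNReal.ofReal_one]
      calc _ ≤ ∫⁻ _, 1 ∂μ := by
            refine lintegral_mono fun ω => ?_
            simp only
            split_ifs
            · exact le_rfl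
            · exact ENNReal.ofReal_le_one.2 (min_le_left _ _)
        _ = 1 := by simp
    · push Not at hy1
      have hyR : R₁ ≤ y := by
        by_contra h
        push Not at h
        linarith [hWanti h.le]
      beta_reduce
      rw [min_eq_right hy1.le]
      refine le_trans (lintegral_mono fun ω => ?_)
        (?_ : ∫⁻ ω, (if y < m ω then 1 else ENNReal.ofReal (W (y - ξ ω))) ∂μ ≤ _)
      · simp only
        split_ifs
        · exact le_rfl
        · exact ENNReal.ofReal_le_ofReal (min_le_right _ _)
      -- Up to `R` the coefficient is the constant `K` and the coarse inequality suffices. Beyond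
      -- `R` it may be as small as `κ`, and the fine inequality uses the slack `γ = α κ - p`.
      rcases le_total y R with h | h
      · refine hdrift₁ K δ k hK1 hδ0.le hka hk0 hkK hkl y hyR ?_
        have : k y = K := by
          simp only [hk]
          rw [max_eq_left (by linarith : y - R ≤ 0), mul_zero, sub_zero, max_eq_right hKκ]
        rw [this]
        nlinarith
      · refine hdrift₂ K δ k hK1 hδ0.le hka hk0 hkK hkl y ((le_max_left _ _).trans h) ?_
        have h1 : γ / (2 * K) * K = γ / 2 := by field_simp
        have h2 := mul_le_mul_of_nonneg_left (hkκ y) hα.le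
        rw [h1]
        linarith

end

end RandomTimeMaxima

/-! ### Partial sums, filtrations with independent steps, stopping times and Wald's identity -/

namespace RandomTimeMaxima

section

/-- The sum of the first `n` terms of a sequence. -/
def partialSum {Ω : Type*} (X : ℕ → Ω → ℝ) (n : ℕ) (ω : Ω) : ℝ := ∑ i ∈ Finset.range n, X i ω

lemma partialSum_succ {Ω : Type*} (X : ℕ → Ω → ℝ) (n : ℕ) (ω : Ω) :
    partialSum X (n + 1) ω = partialSum X n ω + X n ω := Finset.sum_range_succ _ _

@[simp] lemma partialSum_zero {Ω : Type*} (X : ℕ → Ω → ℝ) (ω : Ω) : partialSum X 0 ω = 0 := by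
  simp [partialSum]

/-- A filtration `P` with independent steps: `Q n` is the information of the `n`-th step. -/
structure IndepSteps {Ω : Type*} [mΩ : MeasurableSpace Ω] (μ : Measure Ω)
    (P Q : ℕ → MeasurableSpace Ω) : Prop where
  le : ∀ n, P n ≤ mΩ
  mono : Monotone P
  step_le : ∀ n, Q n ≤ P (n + 1)
  indep : ∀ n, Indep (P n) (Q n) μ

/-- A bounded stopping time of a filtration with independent steps. -/
structure GridStopping {Ω : Type*} [mΩ : MeasurableSpace Ω] (μ : Measure Ω)
    (P Q : ℕ → MeasurableSpace Ω) (σ : Ω → ℕ) : Prop extends IndepSteps μ P Q where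
  stopped : ∀ n, MeasurableSet[P n] {ω | σ ω ≤ n}
  bdd : ∃ L, ∀ ω, σ ω ≤ L

variable {Ω : Type*} [mΩ : MeasurableSpace Ω] {μ : Measure Ω} [IsProbabilityMeasure μ]

lemma measurable_eval_nat {α : Type*} [MeasurableSpace α] {g : ℕ → Ω → α} {σ : Ω → ℕ}
    (hg : ∀ n, Measurable (g n)) (hσ : Measurable σ) : Measurable fun ω => g (σ ω) ω :=
  (measurable_from_prod_countable_right (f := fun q : ℕ × Ω => g q.1 q.2) hg).comp
    (hσ.prodMk measurable_id)

omit [IsProbabilityMeasure μ] in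
lemma integrable_eval_nat {g : ℕ → Ω → ℝ} {σ : Ω → ℕ} {L : ℕ} (hg : ∀ n, Measurable (g n))
    (hσ : Measurable σ) (hL : ∀ ω, σ ω ≤ L) (hi : ∀ n ≤ L, Integrable (g n) μ) :
    Integrable (fun ω => g (σ ω) ω) μ := by
  refine Integrable.mono' (g := fun ω => ∑ n ∈ Finset.range (L + 1), |g n ω|)
    (integrable_finsetSum _ fun n hn => (hi n (by simpa [Nat.lt_succ_iff] using hn)).abs)
    (measurable_eval_nat hg hσ).aestronglyMeasurable (Eventually.of_forall fun ω => ?_)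
  exact Finset.single_le_sum (f := fun n => |g n ω|) (fun _ _ => abs_nonneg _)
    (Finset.mem_range.2 (Nat.lt_succ_of_le (hL ω)))

namespace IndepSteps

variable {P Q : ℕ → MeasurableSpace Ω} {X : ℕ → Ω → ℝ}

omit [IsProbabilityMeasure μ] in
lemma step_le' (h : IndepSteps μ P Q) (n : ℕ) : Q n ≤ mΩ := (h.step_le n).trans (h.le _)

omit [IsProbabilityMeasure μ] in
lemma measurable_partialSum (h : IndepSteps μ P Q) (hX : ∀ n, Measurable[Q n] (X n)) (n : ℕ) :
    Measurable[P n] (partialSum X n) := by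
  unfold partialSum
  refine Finset.measurable_fun_sum _ fun i hi => ?_
  exact (hX i).mono ((h.step_le i).trans (h.mono (Finset.mem_range.1 hi))) le_rfl

omit [IsProbabilityMeasure μ] in
lemma indepFun_partialSum (h : IndepSteps μ P Q) (hX : ∀ n, Measurable[Q n] (X n)) (n : ℕ) :
    IndepFun (partialSum X n) (X n) μ :=
  indep_of_indep_of_le_right (indep_of_indep_of_le_left (h.indep n)
    (h.measurable_partialSum hX n).comap_le) (hX n).comap_le

lemma exp_partialSum (h : IndepSteps μ P Q) (hX : ∀ n, Measurable[Q n] (X n))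
    (hid : ∀ n, IdentDistrib (X n) (X 0) μ μ) {θ : ℝ}
    (hθ : Integrable (fun ω => Real.exp (θ * X 0 ω)) μ) (n : ℕ) :
    Integrable (fun ω => Real.exp (θ * partialSum X n ω)) μ ∧
      ∫ ω, Real.exp (θ * partialSum X n ω) ∂μ = (∫ ω, Real.exp (θ * X 0 ω) ∂μ) ^ n := by
  induction n with
  | zero => simp
  | succ n ih =>
    have hid' : IdentDistrib (fun ω => Real.exp (θ * X n ω)) (fun ω => Real.exp (θ * X 0 ω)) μ μ :=
      (hid n).comp (u := fun x => Real.exp (θ * x)) (by fun_prop)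
    have hn := hid'.integrable_iff.2 hθ
    have hind : IndepFun (fun ω => Real.exp (θ * partialSum X n ω))
        (fun ω => Real.exp (θ * X n ω)) μ :=
      (h.indepFun_partialSum hX n).comp (φ := fun x => Real.exp (θ * x))
        (ψ := fun x => Real.exp (θ * x)) (by fun_prop) (by fun_prop)
    have heq : ∀ ω, Real.exp (θ * partialSum X (n + 1) ω) =
        Real.exp (θ * partialSum X n ω) * Real.exp (θ * X n ω) := fun ω => by
      rw [partialSum_succ, mul_add, Real.exp_add]
    simp_rw [heq]
    refine ⟨hind.integrable_mul ih.1 hn, ?_⟩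
    rw [hind.integral_fun_mul_eq_mul_integral ih.1.1 hn.1, ih.2, hid'.integral_eq, pow_succ]

end IndepSteps

/-- For a variable with exponential moments and negative mean, small exponential moments are less
than one. -/
lemma eventually_mgf_lt_one {X : Ω → ℝ} (hX : integrableExpSet X μ ∈ 𝓝 0) (hneg : ∫ ω, X ω ∂μ < 0) :
    ∀ᶠ θ in 𝓝[>] (0:ℝ), Integrable (fun ω => Real.exp (θ * X ω)) μ ∧
      ∫ ω, Real.exp (θ * X ω) ∂μ < 1 := by
  have h0 : (0:ℝ) ∈ interior (integrableExpSet X μ) := mem_interior_iff_mem_nhds.2 hX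
  -- The moment generating function equals 1 at zero, and its derivative there is the negative mean.
  have hd := hasDerivAt_mgf h0
  simp only [zero_mul, Real.exp_zero, mul_one] at hd
  have hlt := hd.tendsto_slope.eventually (gt_mem_nhds hneg)
  have hlt' : ∀ᶠ θ in 𝓝[>] (0:ℝ), slope (mgf X μ) 0 θ < 0 :=
    hlt.filter_mono (nhdsWithin_mono _ fun x (hx : 0 < x) => hx.ne')
  filter_upwards [hlt', nhdsWithin_le_nhds hX, self_mem_nhdsWithin] with θ h1 h2 h3
  refine ⟨h2, ?_⟩
  have h3' : (0:ℝ) < θ := h3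
  rw [slope_def_field, mgf_zero, sub_zero, div_neg_iff] at h1
  rcases h1 with h1 | h1
  · linarith [h1.2]
  · have := h1.1
    simp only [mgf] at this
    linarith

omit [IsProbabilityMeasure μ] in
lemma integrableExpSet_add_const {X : Ω → ℝ} (hX : integrableExpSet X μ ∈ 𝓝 0) (c : ℝ) :
    integrableExpSet (fun ω => X ω + c) μ ∈ 𝓝 0 := by
  filter_upwards [hX] with θ hθ
  have : Integrable (fun ω => Real.exp (θ * X ω)) μ := hθ
  have h2 := this.const_mul (Real.exp (θ * c))
  refine h2.congr (Eventually.of_forall fun ω => ?_)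
  simp only
  rw [← Real.exp_add]; ring_nf

omit [IsProbabilityMeasure μ] in
lemma integrableExpSet_neg' {X : Ω → ℝ} (hX : integrableExpSet X μ ∈ 𝓝 0) :
    integrableExpSet (fun ω => -X ω) μ ∈ 𝓝 0 := by
  have h : Tendsto (fun θ : ℝ => -θ) (𝓝 0) (𝓝 0) := by simpa using (continuous_neg.tendsto (0:ℝ))
  filter_upwards [h hX] with θ hθ
  have : Integrable (fun ω => Real.exp (-θ * X ω)) μ := hθ
  refine this.congr (Eventually.of_forall fun ω => ?_)
  simp only; ring_nf

lemma integrableExpSet_of_bdd {X : Ω → ℝ} (hX : Measurable X) {C : ℝ} (hC : ∀ ω, |X ω| ≤ C) :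
    integrableExpSet X μ ∈ 𝓝 0 := by
  refine Filter.mem_of_superset univ_mem fun θ _ => ?_
  refine Integrable.of_bound (C := Real.exp (|θ| * C))
    (by fun_prop) (Eventually.of_forall fun ω => ?_)
  rw [Real.norm_of_nonneg (Real.exp_pos _).le]
  refine Real.exp_le_exp.2 ((le_abs_self _).trans ?_)
  rw [abs_mul]
  exact mul_le_mul_of_nonneg_left (hC ω) (abs_nonneg _)

namespace GridStopping

variable {P Q : ℕ → MeasurableSpace Ω} {X : ℕ → Ω → ℝ} {σ : Ω → ℕ}

omit [IsProbabilityMeasure μ] in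
lemma measurable_lt (h : GridStopping μ P Q σ) (n : ℕ) : MeasurableSet[P n] {ω | n < σ ω} := by
  have := (h.stopped n).compl
  convert this using 1
  ext ω; simp

omit [IsProbabilityMeasure μ] in
lemma measurable (h : GridStopping μ P Q σ) : Measurable σ := by
  refine measurable_of_Iic fun n => ?_
  exact h.le n _ (h.stopped n)

-- The event `n < σ` is decided before the step of index `n`, hence independent of it.
omit [IsProbabilityMeasure μ] in
lemma setIntegral_step (h : GridStopping μ P Q σ) (hX : ∀ n, Measurable[Q n] (X n)) (n : ℕ) :
    ∫ ω in {ω | n < σ ω}, X n ω ∂μ = μ.real {ω | n < σ ω} * ∫ ω, X n ω ∂μ :=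
  Indep.setIntegral_eq_mul (f := id) (h.le n) (indep_of_indep_of_le_right (h.indep n) (hX n).comap_le)
    ((hX n).mono (h.step_le' n) le_rfl).aemeasurable (h.measurable_lt n)
    aestronglyMeasurable_id

omit [IsProbabilityMeasure μ] in
/-- Wald's identity for the stopping time `min σ N`. -/
lemma integral_partialSum_min (h : GridStopping μ P Q σ) (hX : ∀ n, Measurable[Q n] (X n))
    (hi : ∀ n, Integrable (X n) μ) (N : ℕ) :
    ∫ ω, partialSum X (min (σ ω) N) ω ∂μ =
      ∑ n ∈ Finset.range N, μ.real {ω | n < σ ω} * ∫ ω, X n ω ∂μ := by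
  have hms : ∀ n, MeasurableSet {ω | n < σ ω} := fun n => h.le n _ (h.measurable_lt n)
  have h1 : ∀ ω, partialSum X (min (σ ω) N) ω =
      ∑ n ∈ Finset.range N, Set.indicator {ω | n < σ ω} (X n) ω := by
    intro ω
    unfold partialSum
    simp only [Set.indicator_apply, Set.mem_ofPred_eq]
    rw [← Finset.sum_filter]
    congr 1
    ext n
    simp only [Finset.mem_range, Finset.mem_filter, lt_min_iff]
    tauto
  simp_rw [h1]
  rw [integral_finsetSum _ fun n _ => (hi n).indicator (hms n)]
  refine Finset.sum_congr rfl fun n _ => ?_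
  rw [integral_indicator (hms n), h.setIntegral_step hX]

end GridStopping

end

end RandomTimeMaxima

/-! ### Exponential deviation bounds and expansions of window integrals -/

namespace RandomTimeMaxima

section

variable {Ω : Type*} [mΩ : MeasurableSpace Ω] {μ : Measure Ω} [IsProbabilityMeasure μ]
  {f : ℝ → ℝ}

omit mΩ in
lemma partialSum_add_const (X : ℕ → Ω → ℝ) (c : ℝ) (n : ℕ) (ω : Ω) :
    partialSum (fun i ω => X i ω + c) n ω = partialSum X n ω + c * n := by
  simp [partialSum, Finset.sum_add_distrib, mul_comm]

omit mΩ in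
lemma partialSum_neg (X : ℕ → Ω → ℝ) (n : ℕ) (ω : Ω) :
    partialSum (fun i ω => -X i ω) n ω = -partialSum X n ω := by
  simp [partialSum]

omit [IsProbabilityMeasure μ] in
lemma integrable_of_integrableExpSet {X : Ω → ℝ} (hX : integrableExpSet X μ ∈ 𝓝 0) :
    Integrable X μ := by
  simpa using integrable_pow_of_mem_interior_integrableExpSet
    (mem_interior_iff_mem_nhds.2 hX) 1

/-- Exponential bounds for the deviations of a random walk with light-tailed steps. -/
lemma exists_deviation_bound {ζ : ℕ → Ω → ℝ} (hid : ∀ n, IdentDistrib (ζ n) (ζ 0) μ μ)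
    (hexp : integrableExpSet (ζ 0) μ ∈ 𝓝 0) {β : ℝ} (hmean : ∫ ω, ζ 0 ω ∂μ = β) {ε : ℝ}
    (hε : 0 < ε) : ∃ θ > 0, ∃ r, 0 ≤ r ∧ r < 1 ∧ ∀ P Q, IndepSteps μ P Q →
      (∀ n, Measurable[Q n] (ζ n)) → ∀ n : ℕ,
      (Integrable (fun ω => Real.exp (θ * (partialSum ζ n ω - β * n - ε * n))) μ ∧
        ∫ ω, Real.exp (θ * (partialSum ζ n ω - β * n - ε * n)) ∂μ ≤ r ^ n) ∧
      (Integrable (fun ω => Real.exp (θ * (-(partialSum ζ n ω - β * n) - ε * n))) μ ∧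
        ∫ ω, Real.exp (θ * (-(partialSum ζ n ω - β * n) - ε * n)) ∂μ ≤ r ^ n) := by
  have hi := integrable_of_integrableExpSet hexp
  -- Upper and lower deviations beyond slope `ε` are governed by two walks with mean step `-ε`. One
  -- small `θ` serves both, and `r` depends only on the law of a step, not on the filtration.
  set X : ℕ → Ω → ℝ := fun i ω => ζ i ω + (-β - ε) with hX
  set X' : ℕ → Ω → ℝ := fun i ω => -ζ i ω + (β - ε) with hX'
  have e1 := eventually_mgf_lt_one (X := X 0) (integrableExpSet_add_const hexp _) (by
    simp only [hX]
    rw [integral_add hi (integrable_const _), hmean]; simp; linarith)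
  have e2 := eventually_mgf_lt_one (X := X' 0)
    (integrableExpSet_add_const (integrableExpSet_neg' hexp) _) (by
    simp only [hX']
    rw [integral_add (f := fun ω => -ζ 0 ω) hi.neg (integrable_const _), integral_neg, hmean]; simp; linarith)
  obtain ⟨θ, ⟨⟨i1, l1⟩, i2, l2⟩, hθ⟩ := ((e1.and e2).and self_mem_nhdsWithin).exists
  have hn1 : 0 ≤ ∫ ω, Real.exp (θ * X 0 ω) ∂μ := integral_nonneg fun ω => (Real.exp_pos _).le
  have hn2 : 0 ≤ ∫ ω, Real.exp (θ * X' 0 ω) ∂μ := integral_nonneg fun ω => (Real.exp_pos _).le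
  refine ⟨θ, hθ, max (∫ ω, Real.exp (θ * X 0 ω) ∂μ) (∫ ω, Real.exp (θ * X' 0 ω) ∂μ),
    le_max_of_le_left hn1, max_lt l1 l2, fun P Q h hζ n => ⟨?_, ?_⟩⟩
  · obtain ⟨a1, a2⟩ := h.exp_partialSum (X := X) (fun n => (hζ n).add_const _)
      (fun n => (hid n).comp (u := fun x => x + (-β - ε)) (by fun_prop)) i1 n
    have e : ∀ ω, partialSum X n ω = partialSum ζ n ω - β * n - ε * n := fun ω => by
      rw [hX, partialSum_add_const]; ring
    simp only [e] at a1 a2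
    exact ⟨a1, a2.le.trans (pow_le_pow_left₀ hn1 (le_max_left _ _) _)⟩
  · obtain ⟨a1, a2⟩ := h.exp_partialSum (X := X') (fun n => (hζ n).neg.add_const _)
      (fun n => (hid n).comp (u := fun x => -x + (β - ε)) (by fun_prop)) i2 n
    have e : ∀ ω, partialSum X' n ω = -(partialSum ζ n ω - β * n) - ε * n := fun ω => by
      rw [hX', partialSum_add_const, partialSum_neg]; ring
    simp only [e] at a1 a2
    exact ⟨a1, a2.le.trans (pow_le_pow_left₀ hn2 (le_max_right _ _) _)⟩

namespace StrongTail

lemma windowInt_div_tendsto (hf : StrongTail f) (t : ℝ) :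
    Tendsto (fun x => windowInt f x t / f x) atTop (𝓝 t) := by
  have h1 : Tendsto (fun x => t * (f (x + t) / f x)) atTop (𝓝 t) := by
    simpa using (hf.long_tailed t).const_mul t
  refine tendsto_of_tendsto_of_tendsto_of_le_of_le h1 tendsto_const_nhds (fun x => ?_) fun x => ?_
  · simp only
    rw [← mul_div_assoc]
    exact div_le_div_of_nonneg_right (hf.windowInt_ge x t) (hf.nonneg x)
  · simp only
    rw [div_le_iff₀ (hf.pos x)]
    exact hf.windowInt_le x t

lemma le_exp_div {δ u : ℝ} (hδ : 0 < δ) : u ≤ Real.exp (δ * u) / δ := by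
  rw [le_div_iff₀ hδ]
  linarith [Real.add_one_le_exp (δ * u)]

/-- For negative `t` the window extends to the left of `x`, where `f` may exceed `f x` by an
exponential factor; doubling the rate absorbs the factor `|t|`. This supplies the dominating
function for the linearization. -/
lemma abs_windowInt_le_exp (hf : StrongTail f) {C δ : ℝ} (hδ : 0 < δ)
    (hC : ∀ x t : ℝ, 0 ≤ t → f (x - t) ≤ C * Real.exp (δ * t) * f x) (hC1 : 1 ≤ C) (x t : ℝ) :
    |windowInt f x t| ≤ C / δ * Real.exp (2 * δ * |t|) * f x := by
  have hfx := hf.pos x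
  have hexp : |t| * Real.exp (δ * |t|) ≤ Real.exp (2 * δ * |t|) / δ := by
    calc _ ≤ Real.exp (δ * |t|) / δ * Real.exp (δ * |t|) := by gcongr; exact le_exp_div hδ
      _ = _ := by rw [div_mul_eq_mul_div, ← Real.exp_add]; ring_nf
  have key : |windowInt f x t| ≤ |t| * (C * Real.exp (δ * |t|) * f x) := by
    rcases le_total 0 t with ht | ht
    · rw [abs_of_nonneg (hf.windowInt_nonneg x ht), abs_of_nonneg ht]
      refine (hf.windowInt_le x t).trans (mul_le_mul_of_nonneg_left ?_ ht)
      have : 1 ≤ Real.exp (δ * t) := Real.one_le_exp (by positivity)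
      have : 1 ≤ C * Real.exp (δ * t) := by nlinarith
      exact le_mul_of_one_le_left hfx.le this
    · have h1 := hC x (-t) (by linarith)
      have h2 := hf.windowInt_ge x t
      have h3 : windowInt f x t ≤ 0 := by
        simpa [windowInt_zero] using hf.windowInt_mono x ht
      rw [sub_neg_eq_add] at h1
      rw [abs_of_nonpos h3, abs_of_nonpos ht]
      nlinarith
  calc _ ≤ _ := key
    _ = C * f x * (|t| * Real.exp (δ * |t|)) := by ring
    _ ≤ C * f x * (Real.exp (2 * δ * |t|) / δ) := by gcongr
    _ = _ := by ring

/-- First-order expansion of the mean of a window integral of random length. -/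
lemma tendsto_linearization (hf : StrongTail f) {V : Ω → ℝ} (hV : Measurable V) {δ : ℝ}
    (hδ : 0 < δ) (h1 : Integrable (fun ω => Real.exp (2 * δ * V ω)) μ)
    (h2 : Integrable (fun ω => Real.exp (2 * δ * -V ω)) μ) (hVi : Integrable V μ) (s : ℝ) :
    Tendsto (fun x => ∫ ω, |windowInt f x (s + V ω) - windowInt f x s - f x * V ω| / f x ∂μ)
      atTop (𝓝 0) := by
  obtain ⟨C, hC1, hC⟩ := hf.exp_bound hδ
  have hlim : Tendsto (fun x => ∫ ω, |windowInt f x (s + V ω) - windowInt f x s - f x * V ω| / f x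
      ∂μ) atTop (𝓝 (∫ _, (0:ℝ) ∂μ)) := by
    -- Divided by `f x`, windows of fixed length converge to their length, so the integrand tends to
    -- zero pointwise; the exponential moments of `V` dominate it.
    refine tendsto_integral_filter_of_dominated_convergence
      (fun ω => C / δ * (Real.exp (2 * δ * |s|) * (Real.exp (2 * δ * V ω) +
        Real.exp (2 * δ * -V ω))) + C / δ * Real.exp (2 * δ * |s|) + |V ω|) ?_ ?_ ?_ ?_
    · refine Eventually.of_forall fun x => Measurable.aestronglyMeasurable ?_
      have := (hf.continuous_windowInt x).measurable
      exact ((((this.comp (measurable_const.add hV)).sub_const _).sub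
        (hV.const_mul _)).abs).div_const _
    · refine Eventually.of_forall fun x => Eventually.of_forall fun ω => ?_
      have hfx := hf.pos x
      rw [Real.norm_of_nonneg (div_nonneg (abs_nonneg _) hfx.le), div_le_iff₀ hfx]
      have b1 := hf.abs_windowInt_le_exp hδ hC hC1 x (s + V ω)
      have b2 := hf.abs_windowInt_le_exp hδ hC hC1 x s
      have b3 : Real.exp (2 * δ * |s + V ω|) ≤ Real.exp (2 * δ * |s|) * (Real.exp (2 * δ * V ω) +
          Real.exp (2 * δ * -V ω)) := by
        calc Real.exp (2 * δ * |s + V ω|) ≤ Real.exp (2 * δ * |s| + 2 * δ * |V ω|) := by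
              refine Real.exp_le_exp.2 ?_
              rw [← mul_add]
              exact mul_le_mul_of_nonneg_left (abs_add_le _ _) (by positivity)
          _ = Real.exp (2 * δ * |s|) * Real.exp (2 * δ * |V ω|) := Real.exp_add _ _
          _ ≤ _ := by
            gcongr
            rcases abs_choice (V ω) with h | h <;> rw [h]
            · linarith [Real.exp_pos (2 * δ * -V ω)]
            · linarith [Real.exp_pos (2 * δ * V ω)]
      have b4 : C / δ * Real.exp (2 * δ * |s + V ω|) * f x ≤ C / δ * (Real.exp (2 * δ * |s|) *
          (Real.exp (2 * δ * V ω) + Real.exp (2 * δ * -V ω))) * f x := by gcongr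
      have b5 : |f x * V ω| = |V ω| * f x := by rw [abs_mul, abs_of_pos hfx, mul_comm]
      have b6 := abs_sub (windowInt f x (s + V ω) - windowInt f x s) (f x * V ω)
      have b7 := abs_sub (windowInt f x (s + V ω)) (windowInt f x s)
      rw [add_mul, add_mul]
      linarith
    · exact ((((h1.add h2).const_mul _).const_mul _).add (integrable_const _)).add hVi.abs
    · refine Eventually.of_forall fun ω => ?_
      have l1 := ((hf.windowInt_div_tendsto (s + V ω)).sub (hf.windowInt_div_tendsto s)).sub
        (tendsto_const_nhds (x := V ω))
      rw [show s + V ω - s - V ω = 0 by ring] at l1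
      have l2 := l1.abs
      rw [abs_zero] at l2
      refine l2.congr fun x => ?_
      have hfx := hf.pos x
      rw [← abs_of_pos hfx, ← abs_div, abs_of_pos hfx]
      congr 1
      field_simp
  simpa using hlim

/-- Replacing a length near `β n` by `β n`, with the excess `J` of the deviation over `ε n`. -/
lemma windowInt_deviation_le (hf : StrongTail f) {C δ : ℝ} (hδ : 0 < δ)
    (hC : ∀ x t : ℝ, 0 ≤ t → f (x - t) ≤ C * Real.exp (δ * t) * f x) (hC1 : 1 ≤ C) {β ε : ℝ}
    (hβ : 0 < β) (hε : 0 ≤ ε) (hεβ : ε ≤ β) (x D : ℝ) {u : ℝ} (hu : 0 ≤ u) :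
    |windowInt f x (β * u + D) - windowInt f x (β * u)| ≤ ε / β * windowInt f x (β * u)
      + C * (max (|D| - ε * u) 0 * Real.exp (δ * max (|D| - ε * u) 0)) * f x := by
  set J := max (|D| - ε * u) 0 with hJ
  have hJ0 : 0 ≤ J := le_max_right _ _
  have hDJ : |D| ≤ ε * u + J := by linarith [le_max_left (|D| - ε * u) 0]
  have hD := abs_le.1 hDJ
  have hfx := hf.pos x
  have hexp : 1 ≤ Real.exp (δ * J) := Real.one_le_exp (by positivity)
  have hβu : 0 ≤ β * u := by positivity
  have hJf : J * f x ≤ C * (J * Real.exp (δ * J)) * f x := by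
    have : J ≤ C * (J * Real.exp (δ * J)) := by
      have : 1 ≤ C * Real.exp (δ * J) := by nlinarith
      calc J ≤ J * (C * Real.exp (δ * J)) := le_mul_of_one_le_right hJ0 this
        _ = _ := by ring
    gcongr
  rw [abs_sub_le_iff]
  constructor
  -- The part `ε u` of the deviation rescales the length by `(β + ε) / β`, which concavity turns
  -- into the factor `1 + ε / β`; only the excess `J` is paid at the price `f x` per unit.
  · have h1 := hf.windowInt_mono x (show β * u + D ≤ (β + ε) * u + J by linarith [hD.2])
    have h2 := hf.windowInt_tangent x ((β + ε) * u) ((β + ε) * u + J)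
    have h3 := hf.windowInt_mul_le x (c := (β + ε) / β) (t := β * u)
      (by rw [one_le_div hβ]; linarith)
    have h4 : (β + ε) / β * (β * u) = (β + ε) * u := by field_simp
    rw [h4] at h3
    have h5 : (β + ε) / β = 1 + ε / β := by field_simp
    rw [h5] at h3
    have h6 : f (x + (β + ε) * u) ≤ f x := hf.anti (by
      have : 0 ≤ (β + ε) * u := by positivity
      linarith)
    have h7 : J * f (x + (β + ε) * u) ≤ J * f x := by gcongr
    rw [add_sub_cancel_left] at h2
    linarith
  -- Here the excess may push the end of the window to the left of `x`, which is where the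
  -- exponential weight on `J` comes from.
  · have h1 := hf.windowInt_mono x (show (β - ε) * u - J ≤ β * u + D by linarith [hD.1])
    have h2 := hf.windowInt_tangent x ((β - ε) * u - J) ((β - ε) * u)
    have h3 := hf.windowInt_mul_ge x (c := (β - ε) / β) (t := β * u)
      (by have : 0 ≤ β - ε := by linarith
          positivity) (by rw [div_le_one hβ]; linarith)
    have h4 : (β - ε) / β * (β * u) = (β - ε) * u := by field_simp
    rw [h4] at h3
    have h5 : (β - ε) / β = 1 - ε / β := by field_simp
    rw [h5] at h3
    have h6 : f (x + ((β - ε) * u - J)) ≤ C * Real.exp (δ * J) * f x := by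
      refine (hf.anti ?_).trans (hC x J hJ0)
      have : 0 ≤ (β - ε) * u := mul_nonneg (by linarith) hu
      linarith
    have h7 : J * f (x + ((β - ε) * u - J)) ≤ J * (C * Real.exp (δ * J) * f x) := by gcongr
    rw [sub_sub_cancel] at h2
    have h8 : J * (C * Real.exp (δ * J) * f x) = C * (J * Real.exp (δ * J)) * f x := by ring
    linarith

end StrongTail

lemma excess_mul_exp_le {δ : ℝ} (hδ : 0 < δ) (D e : ℝ) :
    max (|D| - e) 0 * Real.exp (δ * max (|D| - e) 0) ≤
      (Real.exp (2 * δ * (D - e)) + Real.exp (2 * δ * (-D - e))) / δ := by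
  rcases le_total (|D| - e) 0 with h | h
  · rw [max_eq_right h, zero_mul]; positivity
  · rw [max_eq_left h]
    calc _ ≤ Real.exp (δ * (|D| - e)) / δ * Real.exp (δ * (|D| - e)) := by
          gcongr; exact StrongTail.le_exp_div hδ
      _ = Real.exp (2 * δ * (|D| - e)) / δ := by
          rw [div_mul_eq_mul_div, ← Real.exp_add]; ring_nf
      _ ≤ _ := by
        gcongr
        rcases abs_choice D with h | h <;> rw [h]
        · linarith [Real.exp_pos (2 * δ * (-D - e))]
        · linarith [Real.exp_pos (2 * δ * (D - e))]

end

end RandomTimeMaxima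

/-! ### Replacing a stopped light-tailed walk by its mean inside a window integral -/

namespace RandomTimeMaxima

section

variable {Ω : Type*} [mΩ : MeasurableSpace Ω] {μ : Measure Ω} [IsProbabilityMeasure μ]
  {f : ℝ → ℝ}

/-- In the mean of a window integral of random length, a light-tailed random walk stopped at `σ` may
be replaced by its mean `β σ`, uniformly in the stopping times `σ`. -/
theorem window_replacement (hf : StrongTail f) {ζ : ℕ → Ω → ℝ}
    (hid : ∀ n, IdentDistrib (ζ n) (ζ 0) μ μ) (hexp : integrableExpSet (ζ 0) μ ∈ 𝓝 0) {β : ℝ}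
    (hβ : 0 < β) (hmean : ∫ ω, ζ 0 ω ∂μ = β) {ε : ℝ} (hε : 0 < ε) :
    ∀ᶠ x in atTop, ∀ P Q σ, GridStopping μ P Q σ → (∀ n, Measurable[Q n] (ζ n)) →
      |∫ ω, windowInt f x (partialSum ζ (σ ω) ω) ∂μ - ∫ ω, windowInt f x (β * σ ω) ∂μ| ≤
        ε * (∫ ω, windowInt f x (β * σ ω) ∂μ + f x) := by
  -- The quantifier over filtrations stands inside the eventuality. One filtration is fixed to
  -- obtain measurability of the steps; if there is none, nothing has to be proved.
  by_cases hex : ∃ P Q, IndepSteps μ P Q ∧ ∀ n, Measurable[Q n] (ζ n)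
  swap
  · exact Eventually.of_forall fun x P Q σ h hζ => absurd ⟨P, Q, h.toIndepSteps, hζ⟩ hex
  obtain ⟨P₀, Q₀, h₀, hζ₀⟩ := hex
  have hζm : ∀ n, Measurable (ζ n) := fun n => (hζ₀ n).mono (h₀.step_le' n) le_rfl
  have hζi0 := integrable_of_integrableExpSet hexp
  have hζi : ∀ n, Integrable (ζ n) μ := fun n => (hid n).integrable_iff.2 hζi0
  -- Deviations of slope `ε₂` cost a fraction `ε₂ / β` of the window directly and twice that through
  -- the Wald correction: three in all.
  set ε₂ := min β (ε * β / 3) with hε₂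
  have hε₂0 : 0 < ε₂ := by positivity
  have hε₂β : ε₂ ≤ β := min_le_left _ _
  have hε₂ε : 3 * (ε₂ / β) ≤ ε := by
    have : ε₂ ≤ ε * β / 3 := min_le_right _ _
    rw [← mul_div_assoc, div_le_iff₀ hβ]
    linarith
  obtain ⟨θ, hθ, r, hr0, hr1, hdev⟩ := exists_deviation_bound hid hexp hmean hε₂0
  set δ := θ / 2 with hδ
  have hδ0 : 0 < δ := by positivity
  have h2δ : 2 * δ = θ := by rw [hδ]; ring
  obtain ⟨C, hC1, hC⟩ := hf.exp_bound hδ0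
  set D : ℕ → Ω → ℝ := fun n ω => partialSum ζ n ω - β * n with hD
  have hsm : ∀ n, Measurable (partialSum ζ n) := fun n =>
    (h₀.measurable_partialSum hζ₀ n).mono (h₀.le n) le_rfl
  have hDm : ∀ n, Measurable (D n) := fun n => (hsm n).sub_const _
  have hsi : ∀ n, Integrable (partialSum ζ n) μ := fun n =>
    integrable_finsetSum _ fun i _ => hζi i
  have hDi : ∀ n, Integrable (D n) μ := fun n => (hsi n).sub (integrable_const _)
  set J : ℕ → Ω → ℝ := fun n ω => max (|D n ω| - ε₂ * n) 0 with hJ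
  set G : ℕ → Ω → ℝ := fun n ω => J n ω * Real.exp (δ * J n ω) with hG
  have hJ0 : ∀ n ω, 0 ≤ J n ω := fun n ω => le_max_right _ _
  have hG0 : ∀ n ω, 0 ≤ G n ω := fun n ω => mul_nonneg (hJ0 n ω) (Real.exp_pos _).le
  have hJG : ∀ n ω, J n ω ≤ G n ω := fun n ω =>
    le_mul_of_one_le_right (hJ0 n ω) (Real.one_le_exp (mul_nonneg hδ0.le (hJ0 n ω)))
  have hJm : ∀ n, Measurable (J n) := fun n => ((hDm n).abs.sub_const _).max measurable_const
  have hGm : ∀ n, Measurable (G n) := fun n =>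
    (hJm n).mul (Real.measurable_exp.comp ((hJm n).const_mul _))
  have hGle : ∀ n ω, G n ω ≤ (Real.exp (θ * (D n ω - ε₂ * n)) +
      Real.exp (θ * (-D n ω - ε₂ * n))) / δ := fun n ω => by
    have := excess_mul_exp_le hδ0 (D n ω) (ε₂ * n)
    rwa [h2δ] at this
  have hdev0 := hdev P₀ Q₀ h₀ hζ₀
  have hGbd : ∀ n, Integrable (fun ω => (Real.exp (θ * (D n ω - ε₂ * n)) +
      Real.exp (θ * (-D n ω - ε₂ * n))) / δ) μ := fun n =>
    ((hdev0 n).1.1.add (hdev0 n).2.1).div_const _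
  have hGi : ∀ n, Integrable (G n) μ := fun n => by
    refine (hGbd n).mono' (hGm n).aestronglyMeasurable (Eventually.of_forall fun ω => ?_)
    rw [Real.norm_of_nonneg (hG0 n ω)]
    exact hGle n ω
  have hGint : ∀ n, ∫ ω, G n ω ∂μ ≤ 2 / δ * r ^ n := fun n => by
    refine (integral_mono (hGi n) (hGbd n) (hGle n)).trans ?_
    rw [integral_div, integral_add (hdev0 n).1.1 (hdev0 n).2.1, div_mul_eq_mul_div]
    have a1 : ∫ ω, Real.exp (θ * (D n ω - ε₂ * n)) ∂μ ≤ r ^ n := (hdev0 n).1.2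
    have a2 : ∫ ω, Real.exp (θ * (-D n ω - ε₂ * n)) ∂μ ≤ r ^ n := (hdev0 n).2.2
    gcongr
    linarith
  -- the number of steps treated by linearization
  obtain ⟨N, hN⟩ : ∃ N : ℕ, 2 / δ * (C + 1) / (1 - r) * r ^ N ≤ ε / 2 := by
    have hlim : Tendsto (fun n : ℕ => 2 / δ * (C + 1) / (1 - r) * r ^ n) atTop (𝓝 0) := by
      simpa using (tendsto_pow_atTop_nhds_zero_of_lt_one hr0 hr1).const_mul
        (2 / δ * (C + 1) / (1 - r))
    exact (hlim.eventually (ge_mem_nhds (show (0:ℝ) < ε / 2 by linarith))).exists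
  have hlinint : ∀ n, Integrable (fun ω => Real.exp (2 * δ * D n ω)) μ ∧
      Integrable (fun ω => Real.exp (2 * δ * -D n ω)) μ := fun n => by
    constructor
    · refine ((hdev0 n).1.1.const_mul (Real.exp (θ * (ε₂ * n)))).congr
        (Eventually.of_forall fun ω => ?_)
      simp only
      rw [← Real.exp_add, h2δ]; simp only [hD]; ring_nf
    · refine ((hdev0 n).2.1.const_mul (Real.exp (θ * (ε₂ * n)))).congr
        (Eventually.of_forall fun ω => ?_)
      simp only
      rw [← Real.exp_add, h2δ]; simp only [hD]; ring_nf
  have hlin : ∀ᶠ x in atTop, ∀ n ∈ Finset.range (N + 1),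
      ∫ ω, |windowInt f x (β * n + D n ω) - windowInt f x (β * n) - f x * D n ω| / f x ∂μ <
        ε / (2 * (N + 1)) := by
    rw [eventually_all_finset]
    intro n _
    exact (hf.tendsto_linearization (hDm n) hδ0 (hlinint n).1 (hlinint n).2 (hDi n)
      (β * n)).eventually (gt_mem_nhds (by positivity))
  filter_upwards [hlin, hf.eventually_shift' (β * N) (ε := 1 / 2) (by norm_num)]
    with x hlinx hshift P Q σ h hζ
  obtain ⟨L, hL⟩ := h.bdd
  have hfx := hf.pos x
  have hσm : Measurable σ := h.measurable
  have hΦm := (hf.continuous_windowInt x).measurable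
  have hΦi : ∀ V : Ω → ℝ, Integrable V μ → Integrable (fun ω => windowInt f x (V ω)) μ :=
    fun V hV => Integrable.mono hV
      (hΦm.comp_aemeasurable hV.1.aemeasurable).aestronglyMeasurable
      (Eventually.of_forall fun ω => hf.abs_windowInt_le x (V ω))
  have i1 : Integrable (fun ω => windowInt f x (partialSum ζ (σ ω) ω)) μ :=
    hΦi _ (integrable_eval_nat hsm hσm hL fun n _ => hsi n)
  have i2 : Integrable (fun ω => windowInt f x (β * σ ω)) μ :=
    hΦi _ (integrable_eval_nat (g := fun n _ => β * (n : ℝ)) (fun n => measurable_const) hσm hL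
      fun n _ => integrable_const _)
  -- The first-order term of the expansion, used only when `σ ≤ N`. It is not small pointwise; only
  -- its mean is, up to a contribution of the event `σ > N`.
  set T : Ω → ℝ := fun ω => if σ ω ≤ N then D (σ ω) ω else 0 with hT
  have hS : MeasurableSet {ω | N < σ ω} := h.le N _ (h.measurable_lt N)
  have hTeq : ∀ ω, T ω = D (min (σ ω) N) ω - Set.indicator {ω | N < σ ω} (D N) ω := by
    intro ω
    simp only [hT]
    by_cases hω : σ ω ≤ N
    · rw [if_pos hω, min_eq_left hω, Set.indicator_of_notMem (by simpa using hω), sub_zero]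
    · rw [if_neg hω, min_eq_right (by omega), Set.indicator_of_mem (by simpa using hω), sub_self]
  have iDmin : Integrable (fun ω => D (min (σ ω) N) ω) μ :=
    integrable_eval_nat (L := N) hDm (hσm.min measurable_const) (fun ω => min_le_right _ _)
      fun n _ => hDi n
  have iT : Integrable T μ := by
    have : Integrable (fun ω => D (min (σ ω) N) ω - Set.indicator {ω | N < σ ω} (D N) ω) μ :=
      iDmin.sub ((hDi N).indicator hS)
    exact this.congr (Eventually.of_forall fun ω => (hTeq ω).symm)
  have hp0 : 0 ≤ μ.real {ω | N < σ ω} := measureReal_nonneg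
  have hTint : |∫ ω, T ω ∂μ| ≤ ε₂ * N * μ.real {ω | N < σ ω} + 2 / δ * r ^ N := by
    have e1 : ∫ ω, D (min (σ ω) N) ω ∂μ = 0 := by
      have hw := h.integral_partialSum_min (X := fun n ω => ζ n ω + -β)
        (fun n => (hζ n).add_const _) (fun n => (hζi n).add (integrable_const _)) N
      have e2 : ∀ n ω, partialSum (fun n ω => ζ n ω + -β) n ω = D n ω := fun n ω => by
        rw [partialSum_add_const]; simp only [hD]; ring
      simp only [e2] at hw
      rw [hw]
      refine Finset.sum_eq_zero fun n _ => ?_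
      rw [integral_add (hζi n) (integrable_const _), (hid n).integral_eq, hmean]
      simp
    -- The centred walk stopped at `min σ N` has mean zero, so the mean of `T` is minus that of the
    -- deviation at `N` on the event `N < σ`.
    have e3 : ∫ ω, T ω ∂μ = -∫ ω in {ω | N < σ ω}, D N ω ∂μ := by
      rw [integral_congr_ae (Eventually.of_forall hTeq),
        integral_sub iDmin ((hDi N).indicator hS), e1, integral_indicator hS, zero_sub]
    rw [e3, abs_neg]
    calc |∫ ω in {ω | N < σ ω}, D N ω ∂μ| ≤ ∫ ω in {ω | N < σ ω}, |D N ω| ∂μ :=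
          abs_integral_le_integral_abs
      _ ≤ ∫ ω in {ω | N < σ ω}, (ε₂ * N + G N ω) ∂μ := by
          refine setIntegral_mono (hDi N).abs.integrableOn
            ((integrable_const _).add (hGi N)).integrableOn fun ω => ?_
          have : |D N ω| - ε₂ * N ≤ J N ω := le_max_left _ _
          linarith [hJG N ω]
      _ = ε₂ * N * μ.real {ω | N < σ ω} + ∫ ω in {ω | N < σ ω}, G N ω ∂μ := by
          rw [integral_add (integrable_const _) (hGi N).integrableOn]
          simp [mul_comm]
      _ ≤ _ := by
          gcongr
          exact (setIntegral_le_integral (hGi N) (Eventually.of_forall (hG0 N))).trans (hGint N)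
  -- The product of `N` and the probability of `N < σ` is charged to the window itself: on this
  -- event its length is at least `β N`, and over that length `f` stays above half of `f x`.
  have hNP : N * μ.real {ω | N < σ ω} * f x * β ≤ 2 * ∫ ω, windowInt f x (β * σ ω) ∂μ := by
    have e1 : ∫ ω in {ω | N < σ ω}, windowInt f x (β * N) ∂μ ≤
        ∫ ω, windowInt f x (β * σ ω) ∂μ := by
      refine le_trans (setIntegral_mono_on (integrable_const _).integrableOn i2.integrableOn hS
        fun ω hω => ?_) (setIntegral_le_integral i2 (Eventually.of_forall fun ω =>
          hf.windowInt_nonneg x (by positivity)))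
      refine hf.windowInt_mono x (mul_le_mul_of_nonneg_left ?_ hβ.le)
      exact_mod_cast (show N < σ ω from hω).le
    rw [setIntegral_const, smul_eq_mul] at e1
    have e2 := hf.windowInt_ge x (β * N)
    have e3 : β * N * (f x / 2) ≤ β * N * f (x + β * N) := by
      gcongr; linarith
    have e4 : μ.real {ω | N < σ ω} * (β * N * (f x / 2)) ≤
        μ.real {ω | N < σ ω} * windowInt f x (β * N) := by
      gcongr; linarith
    linarith
  set E : Ω → ℝ := fun ω => windowInt f x (partialSum ζ (σ ω) ω) - windowInt f x (β * σ ω)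
    - f x * T ω with hE
  have iLn : ∀ n, Integrable (fun ω => |windowInt f x (β * n + D n ω) - windowInt f x (β * n)
      - f x * D n ω|) μ := fun n => by
    have a1 : Integrable (fun ω => windowInt f x (β * n + D n ω)) μ :=
      hΦi _ ((integrable_const _).add (hDi n))
    exact ((a1.sub (integrable_const _)).sub ((hDi n).const_mul _)).abs
  have hDsum : ∀ n ω, β * n + D n ω = partialSum ζ n ω := fun n ω => by simp only [hD]; ring
  -- Summing over all possible values of `σ` frees the bound from the way `σ` depends on the walk;
  -- geometric decay later removes the dependence on `L`.
  have hEle : ∀ ω, |E ω| ≤ ∑ n ∈ Finset.range (N + 1),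
      |windowInt f x (β * n + D n ω) - windowInt f x (β * n) - f x * D n ω|
      + ε₂ / β * windowInt f x (β * σ ω)
      + C * f x * ∑ n ∈ Finset.Ico (N + 1) (L + 1), G n ω := by
    intro ω
    have hΦ0 : 0 ≤ windowInt f x (β * σ ω) := hf.windowInt_nonneg x (by positivity)
    have hsum0 : 0 ≤ ∑ n ∈ Finset.range (N + 1),
      |windowInt f x (β * n + D n ω) - windowInt f x (β * n) - f x * D n ω| :=
      Finset.sum_nonneg fun _ _ => abs_nonneg _
    have hGs0 : 0 ≤ ∑ n ∈ Finset.Ico (N + 1) (L + 1), G n ω :=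
      Finset.sum_nonneg fun n _ => hG0 n ω
    by_cases hω : σ ω ≤ N
    · have e1 : E ω = windowInt f x (β * σ ω + D (σ ω) ω) - windowInt f x (β * σ ω)
          - f x * D (σ ω) ω := by
        simp only [hE, hT, if_pos hω, hDsum]
      rw [e1]
      have e2 := Finset.single_le_sum (f := fun n : ℕ => |windowInt f x (β * n + D n ω)
        - windowInt f x (β * n) - f x * D n ω|) (fun _ _ => abs_nonneg _)
        (Finset.mem_range.2 (Nat.lt_succ_of_le hω))
      have : 0 ≤ ε₂ / β * windowInt f x (β * σ ω) := by positivity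
      have : 0 ≤ C * f x * ∑ n ∈ Finset.Ico (N + 1) (L + 1), G n ω := by positivity
      linarith
    · have e1 : E ω = windowInt f x (β * σ ω + D (σ ω) ω) - windowInt f x (β * σ ω) := by
        simp only [hE, hT, if_neg hω, hDsum, mul_zero, sub_zero]
      rw [e1]
      have e2 := hf.windowInt_deviation_le hδ0 hC hC1 hβ hε₂0.le hε₂β x (D (σ ω) ω)
        (u := σ ω) (by positivity)
      have e3 := Finset.single_le_sum (f := fun n => G n ω) (fun n _ => hG0 n ω)
        (Finset.mem_Ico.2 ⟨not_le.1 hω, Nat.lt_succ_of_le (hL ω)⟩)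
      have e4 : C * G (σ ω) ω * f x ≤ C * f x * ∑ n ∈ Finset.Ico (N + 1) (L + 1), G n ω := by
        calc _ = C * f x * G (σ ω) ω := by ring
          _ ≤ _ := by gcongr
      have e5 : C * (max (|D (σ ω) ω| - ε₂ * σ ω) 0 *
        Real.exp (δ * max (|D (σ ω) ω| - ε₂ * σ ω) 0)) * f x = C * G (σ ω) ω * f x := rfl
      linarith
  have iE : Integrable E μ := (i1.sub i2).sub (iT.const_mul _)
  have hEint : |∫ ω, E ω ∂μ| ≤ ε / 2 * f x + ε₂ / β * ∫ ω, windowInt f x (β * σ ω) ∂μ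
      + C * f x * (2 / δ * (r ^ (N + 1) / (1 - r))) := by
    have s1 : Integrable (fun ω => ∑ n ∈ Finset.range (N + 1),
        |windowInt f x (β * n + D n ω) - windowInt f x (β * n) - f x * D n ω|) μ :=
      integrable_finsetSum _ fun n _ => iLn n
    have s2 : Integrable (fun ω => ε₂ / β * windowInt f x (β * σ ω)) μ := i2.const_mul _
    have s3 : Integrable (fun ω => C * f x * ∑ n ∈ Finset.Ico (N + 1) (L + 1), G n ω) μ :=
      (integrable_finsetSum _ fun n _ => hGi n).const_mul _
    refine abs_integral_le_integral_abs.trans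
      ((integral_mono iE.abs ((s1.add s2).add s3) hEle).trans ?_)
    have t1 : ∫ ω, (∑ n ∈ Finset.range (N + 1),
      |windowInt f x (β * n + D n ω) - windowInt f x (β * n) - f x * D n ω|
      + ε₂ / β * windowInt f x (β * σ ω)
      + C * f x * ∑ n ∈ Finset.Ico (N + 1) (L + 1), G n ω) ∂μ =
      (∑ n ∈ Finset.range (N + 1), ∫ ω,
        |windowInt f x (β * n + D n ω) - windowInt f x (β * n) - f x * D n ω| ∂μ)
      + ε₂ / β * ∫ ω, windowInt f x (β * σ ω) ∂μ
      + C * f x * ∑ n ∈ Finset.Ico (N + 1) (L + 1), ∫ ω, G n ω ∂μ := by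
      have s12 : Integrable (fun ω => ∑ n ∈ Finset.range (N + 1),
        |windowInt f x (β * n + D n ω) - windowInt f x (β * n) - f x * D n ω|
        + ε₂ / β * windowInt f x (β * σ ω)) μ := s1.add s2
      rw [integral_add s12 s3, integral_add s1 s2, integral_finsetSum _ fun n _ => iLn n,
        integral_const_mul, integral_const_mul, integral_finsetSum _ fun n _ => hGi n]
    refine (le_of_eq t1).trans ?_
    gcongr ?_ + _ + C * f x * ?_
    · calc _ ≤ ∑ n ∈ Finset.range (N + 1), ε / (2 * (N + 1)) * f x := by
            refine Finset.sum_le_sum fun n hn => ?_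
            have := hlinx n hn
            rw [integral_div, div_lt_iff₀ hfx] at this
            exact this.le
        _ = ε / 2 * f x := by
            rw [Finset.sum_const, Finset.card_range, nsmul_eq_mul]
            push_cast
            field_simp
    · calc _ ≤ ∑ n ∈ Finset.Ico (N + 1) (L + 1), 2 / δ * r ^ n :=
            Finset.sum_le_sum fun n _ => hGint n
        _ = 2 / δ * ∑ n ∈ Finset.Ico (N + 1) (L + 1), r ^ n := by rw [Finset.mul_sum]
        _ ≤ _ := by
            gcongr
            exact geom_sum_Ico_le_of_lt_one hr0 hr1
  have hsplit : ∫ ω, windowInt f x (partialSum ζ (σ ω) ω) ∂μ - ∫ ω, windowInt f x (β * σ ω) ∂μ =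
      ∫ ω, E ω ∂μ + f x * ∫ ω, T ω ∂μ := by
    rw [← integral_const_mul, ← integral_sub i1 i2, ← integral_add iE (iT.const_mul _)]
    refine integral_congr_ae (Eventually.of_forall fun ω => ?_)
    simp only [hE]; ring
  rw [hsplit]
  set I := ∫ ω, windowInt f x (β * σ ω) ∂μ with hI
  have hI0 : 0 ≤ I := integral_nonneg fun ω => hf.windowInt_nonneg x (by positivity)
  refine (abs_add_le _ _).trans ?_
  rw [abs_mul, abs_of_pos hfx]
  have k1 : f x * |∫ ω, T ω ∂μ| ≤ f x * (ε₂ * N * μ.real {ω | N < σ ω} + 2 / δ * r ^ N) := by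
    gcongr
  have k2 : f x * (ε₂ * N * μ.real {ω | N < σ ω}) ≤ 2 * (ε₂ / β) * I := by
    have : ε₂ / β * (N * μ.real {ω | N < σ ω} * f x * β) ≤ ε₂ / β * (2 * I) := by gcongr
    have e : ε₂ / β * (N * μ.real {ω | N < σ ω} * f x * β) =
      f x * (ε₂ * N * μ.real {ω | N < σ ω}) := by field_simp
    linarith
  have k3 : C * (2 / δ * (r ^ (N + 1) / (1 - r))) + 2 / δ * r ^ N ≤ ε / 2 := by
    have h1r : 0 < 1 - r := by linarith
    have p1 : r ^ (N + 1) ≤ r ^ N := pow_le_pow_of_le_one hr0 hr1.le (Nat.le_succ N)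
    have p2 : r ^ N ≤ r ^ N / (1 - r) := by
      rw [le_div_iff₀ h1r]
      have := pow_nonneg hr0 N
      nlinarith
    calc _ ≤ C * (2 / δ * (r ^ N / (1 - r))) + 2 / δ * (r ^ N / (1 - r)) := by gcongr
      _ = 2 / δ * (C + 1) / (1 - r) * r ^ N := by ring
      _ ≤ _ := hN
  have k4 : f x * (C * (2 / δ * (r ^ (N + 1) / (1 - r))) + 2 / δ * r ^ N) ≤ f x * (ε / 2) := by
    gcongr
  have k5 : 3 * (ε₂ / β) * I ≤ ε * I := by gcongr
  linarith

end

end RandomTimeMaxima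

/-! ### Exceedance events and the killed process -/

namespace RandomTimeMaxima

section

variable {Ω : Type*} [mΩ : MeasurableSpace Ω] {μ : Measure Ω} [IsProbabilityMeasure μ]
  {f : ℝ → ℝ}

/-- Freezes the past in an integral over an event of the past. The indicator of `B` is carried along
as a further coordinate of the past variable, so independence of two random variables is enough. -/
lemma setLIntegral_indep {Ω : Type*} {m₁ m₂ : MeasurableSpace Ω} [mΩ : MeasurableSpace Ω]
    {μ : Measure Ω} [IsProbabilityMeasure μ] (hind : Indep m₁ m₂ μ) (h₁ : m₁ ≤ mΩ)
    (h₂ : m₂ ≤ mΩ) {α β : Type*} [MeasurableSpace α] [MeasurableSpace β] {U : Ω → α} {W : Ω → β}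
    (hU : Measurable[m₁] U) (hW : Measurable[m₂] W) {B : Set Ω} (hB : MeasurableSet[m₁] B)
    {g : α × β → ℝ≥0∞} (hg : Measurable g) :
    ∫⁻ ω in B, g (U ω, W ω) ∂μ = ∫⁻ ω in B, ∫⁻ ω', g (U ω, W ω') ∂μ ∂μ := by
  have hU' : Measurable U := hU.mono h₁ le_rfl
  have hW' : Measurable W := hW.mono h₂ le_rfl
  have hB' : MeasurableSet B := h₁ _ hB
  have hb : Measurable[m₁] (B.indicator (1 : Ω → ℝ≥0∞)) :=
    (@measurable_const ℝ≥0∞ Ω _ m₁ 1).indicator hB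
  have hUb : Measurable[m₁] fun ω => (U ω, B.indicator (1 : Ω → ℝ≥0∞) ω) := hU.prodMk hb
  have hUb' : Measurable fun ω => (U ω, B.indicator (1 : Ω → ℝ≥0∞) ω) := hUb.mono h₁ le_rfl
  have hI : IndepFun (fun ω => (U ω, B.indicator (1 : Ω → ℝ≥0∞) ω)) W μ :=
    indep_of_indep_of_le_right (indep_of_indep_of_le_left hind hUb.comap_le) hW.comap_le
  have hmap := (indepFun_iff_map_prod_eq_prod_map_map hUb'.aemeasurable hW'.aemeasurable).1 hI
  set G : (α × ℝ≥0∞) × β → ℝ≥0∞ := fun q => q.1.2 * g (q.1.1, q.2) with hG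
  have hGm : Measurable G := by
    refine (measurable_snd.comp measurable_fst).mul (hg.comp ?_)
    exact (measurable_fst.comp measurable_fst).prodMk measurable_snd
  have key : ∫⁻ ω, G ((U ω, B.indicator (1 : Ω → ℝ≥0∞) ω), W ω) ∂μ =
      ∫⁻ ω, ∫⁻ ω', G ((U ω, B.indicator (1 : Ω → ℝ≥0∞) ω), W ω') ∂μ ∂μ := by
    calc _ = ∫⁻ q, G q ∂(μ.map fun ω => ((U ω, B.indicator (1 : Ω → ℝ≥0∞) ω), W ω)) :=
          (lintegral_map hGm (hUb'.prodMk hW')).symm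
      _ = ∫⁻ u, ∫⁻ w, G (u, w) ∂(μ.map W) ∂(μ.map fun ω => (U ω, B.indicator 1 ω)) := by
          rw [hmap, lintegral_prod _ hGm.aemeasurable]
      _ = ∫⁻ ω, ∫⁻ w, G ((U ω, B.indicator (1 : Ω → ℝ≥0∞) ω), w) ∂(μ.map W) ∂μ :=
          lintegral_map hGm.lintegral_prod_right' hUb'
      _ = _ := by
          refine lintegral_congr fun ω => ?_
          exact lintegral_map (hGm.comp measurable_prodMk_left) hW'
  have hl : ∀ (φ : Ω → ℝ≥0∞), ∫⁻ ω in B, φ ω ∂μ = ∫⁻ ω, B.indicator (1 : Ω → ℝ≥0∞) ω * φ ω ∂μ := by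
    intro φ
    rw [← lintegral_indicator hB']
    refine lintegral_congr fun ω => ?_
    by_cases h : ω ∈ B <;> simp [h]
  rw [hl, hl]
  refine key.trans (lintegral_congr fun ω => ?_)
  simp only [hG]
  by_cases h : ω ∈ B <;> simp [h]

/-- The event that the walk with steps `ξ`, with overshoot variables `m`, exceeds `x` during one of
the first `σ` steps. -/
def exceed (ξ m : ℕ → Ω → ℝ) (x : ℝ) (σ : Ω → ℕ) : Set Ω :=
  {ω | ∃ k < σ ω, x < partialSum ξ k ω + m k ω}

open scoped Classical in
/-- A function of the distance to the level `x`, killed with value `1` when the level is exceeded,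
and stopped at `min σ n`. -/
noncomputable def killed (ξ m : ℕ → Ω → ℝ) (x : ℝ) (σ : Ω → ℕ) (V : ℝ → ℝ) (n : ℕ) (ω : Ω) : ℝ≥0∞ :=
  if ω ∈ exceed ξ m x (fun ω => min (σ ω) n) then 1 else
    ENNReal.ofReal (V (x - partialSum ξ (min (σ ω) n) ω))

namespace GridStopping

variable {P Q : ℕ → MeasurableSpace Ω} {σ : Ω → ℕ} {ξ m : ℕ → Ω → ℝ}

omit [IsProbabilityMeasure μ] in
lemma measurableSet_exceed_min (h : GridStopping μ P Q σ) (hξ : ∀ n, Measurable[Q n] (ξ n))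
    (hm : ∀ n, Measurable[Q n] (m n)) (x : ℝ) (n : ℕ) :
    MeasurableSet[P n] (exceed ξ m x (fun ω => min (σ ω) n)) := by
  have : exceed ξ m x (fun ω => min (σ ω) n) = ⋃ k ∈ Finset.range n,
      ({ω | k < σ ω} ∩ {ω | x < partialSum ξ k ω + m k ω}) := by
    ext ω
    simp only [exceed, Set.mem_ofPred_eq, lt_min_iff, Finset.mem_range, Set.mem_iUnion,
      Set.mem_inter_iff, exists_prop]
    constructor
    · rintro ⟨k, ⟨h1, h2⟩, h3⟩; exact ⟨k, h2, h1, h3⟩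
    · rintro ⟨k, h2, h1, h3⟩; exact ⟨k, ⟨h1, h2⟩, h3⟩
  rw [this]
  refine Finset.measurableSet_biUnion _ fun k hk => ?_
  have hk' : k + 1 ≤ n := Finset.mem_range.1 hk
  refine MeasurableSet.inter (h.mono (by omega) _ (h.measurable_lt k)) ?_
  have h1 : Measurable[P n] fun ω => partialSum ξ k ω + m k ω :=
    ((h.measurable_partialSum hξ k).mono (h.mono (by omega)) le_rfl).add
      ((hm k).mono ((h.step_le k).trans (h.mono hk')) le_rfl)
  exact h1 measurableSet_Ioi

omit [IsProbabilityMeasure μ] in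
lemma measurableSet_exceed (h : GridStopping μ P Q σ) (hξ : ∀ n, Measurable[Q n] (ξ n))
    (hm : ∀ n, Measurable[Q n] (m n)) (x : ℝ) : MeasurableSet (exceed ξ m x σ) := by
  obtain ⟨L, hL⟩ := h.bdd
  have := h.le _ _ (h.measurableSet_exceed_min hξ hm x L)
  convert this using 2
  ext ω
  rw [min_eq_left (hL ω)]

/-- One step of the killed process. -/
lemma lintegral_killed_succ (h : GridStopping μ P Q σ) (hξ : ∀ n, Measurable[Q n] (ξ n))
    (hm : ∀ n, Measurable[Q n] (m n)) (x : ℝ) {V : ℝ → ℝ} (hV : Measurable V) (n : ℕ) :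
    ∃ B, MeasurableSet[P n] B ∧
      ∫⁻ ω, killed ξ m x σ V n ω ∂μ = ∫⁻ ω in Bᶜ, killed ξ m x σ V n ω ∂μ +
        ∫⁻ ω in B, ENNReal.ofReal (V (x - partialSum ξ n ω)) ∂μ ∧
      ∫⁻ ω, killed ξ m x σ V (n + 1) ω ∂μ = ∫⁻ ω in Bᶜ, killed ξ m x σ V n ω ∂μ +
        ∫⁻ ω in B, ∫⁻ ω', (if x - partialSum ξ n ω < m n ω' then 1 else
          ENNReal.ofReal (V (x - partialSum ξ n ω - ξ n ω'))) ∂μ ∂μ := by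
  have hE := h.measurableSet_exceed_min hξ hm x n
  have hB := (h.measurable_lt n).inter hE.compl
  -- The paths that are still running and not yet killed; off `B` this step changes nothing.
  set B := {ω | n < σ ω} ∩ (exceed ξ m x (fun ω => min (σ ω) n))ᶜ with hBdef
  have hB' : MeasurableSet B := h.le n _ hB
  refine ⟨B, hB, ?_, ?_⟩
  · rw [← lintegral_add_compl _ hB', add_comm]
    congr 1
    refine setLIntegral_congr_fun hB' fun ω hω => ?_
    simp only [killed]
    rw [if_neg hω.2, min_eq_right (le_of_lt hω.1)]
  · have hg : Measurable fun q : ℝ × (ℝ × ℝ) => if x - q.1 < q.2.2 then (1 : ℝ≥0∞) else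
        ENNReal.ofReal (V (x - q.1 - q.2.1)) := by
      refine Measurable.ite (measurableSet_lt (by fun_prop) (by fun_prop)) measurable_const ?_
      exact (hV.comp (by fun_prop)).ennreal_ofReal
    have hW : Measurable[Q n] fun ω => (ξ n ω, m n ω) := (hξ n).prodMk (hm n)
    have hI := setLIntegral_indep (h.indep n) (h.le n) (h.step_le' n)
      (h.measurable_partialSum hξ n) hW hB hg
    rw [← hI, ← lintegral_add_compl _ hB', add_comm]
    congr 1
    · refine setLIntegral_congr_fun hB'.compl fun ω hω => ?_
      simp only [killed]
      by_cases h1 : n < σ ω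
      · have h2 : ω ∈ exceed ξ m x (fun ω => min (σ ω) n) := by
          by_contra h2; exact hω ⟨h1, h2⟩
        rw [if_pos h2, if_pos]
        obtain ⟨k, hk, hk'⟩ := h2
        exact ⟨k, hk.trans_le (min_le_min le_rfl (Nat.le_succ n)), hk'⟩
      · push Not at h1
        simp only [exceed, Set.mem_ofPred_eq, min_eq_left h1, min_eq_left (h1.trans (Nat.le_succ n))]
    · refine setLIntegral_congr_fun hB' fun ω hω => ?_
      have h1 : n < σ ω := hω.1
      have h2 := hω.2
      simp only [killed]
      have h3 : min (σ ω) (n + 1) = n + 1 := min_eq_right h1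
      have h4 : ω ∈ exceed ξ m x (fun ω => min (σ ω) (n + 1)) ↔ x - partialSum ξ n ω < m n ω := by
        constructor
        · rintro ⟨k, hk, hk'⟩
          change k < min (σ ω) (n + 1) at hk
          rw [h3] at hk
          rcases Nat.lt_succ_iff_lt_or_eq.1 hk with h5 | h5
          · exact absurd ⟨k, lt_min (h5.trans h1) h5, hk'⟩ h2
          · rw [h5] at hk'; linarith
        · intro h5
          refine ⟨n, ?_, by linarith⟩
          change n < min (σ ω) (n + 1)
          omega
      rw [h3, partialSum_succ]
      simp only [h4]
      congr 2
      ring_nf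

/-- The killed process of a superharmonic function is a supermartingale. -/
lemma lintegral_killed_le (h : GridStopping μ P Q σ) (hξ : ∀ n, Measurable[Q n] (ξ n))
    (hm : ∀ n, Measurable[Q n] (m n)) (x : ℝ) {V : ℝ → ℝ} (hV : Measurable V)
    (hstep : ∀ n y, ∫⁻ ω, (if y < m n ω then 1 else ENNReal.ofReal (V (y - ξ n ω))) ∂μ ≤
      ENNReal.ofReal (V y)) (n : ℕ) :
    ∫⁻ ω, killed ξ m x σ V n ω ∂μ ≤ ENNReal.ofReal (V x) := by
  induction n with
  | zero => simp [killed, exceed]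
  | succ n ih =>
    obtain ⟨B, hB, e1, e2⟩ := h.lintegral_killed_succ hξ hm x hV n
    refine le_trans ?_ ih
    rw [e1, e2]
    gcongr with ω
    exact hstep n _

/-- The submartingale counterpart. Subharmonicity is required without loss only when the remaining
distance is at least `R`; otherwise a step may lose `C`, which produces the sum. -/
lemma le_lintegral_killed (h : GridStopping μ P Q σ) (hξ : ∀ n, Measurable[Q n] (ξ n))
    (hm : ∀ n, Measurable[Q n] (m n)) (x : ℝ) {V : ℝ → ℝ} (hV : Measurable V) {R C : ℝ}
    (hstep : ∀ n y, ENNReal.ofReal (V y) ≤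
      ∫⁻ ω, (if y < m n ω then 1 else ENNReal.ofReal (V (y - ξ n ω))) ∂μ +
      Set.indicator (Set.Iio R) (fun _ => ENNReal.ofReal C) y) (n : ℕ) :
    ENNReal.ofReal (V x) ≤ ∫⁻ ω, killed ξ m x σ V n ω ∂μ +
      ∑ k ∈ Finset.range n, ENNReal.ofReal C * μ {ω | x - partialSum ξ k ω < R} := by
  induction n with
  | zero => simp [killed, exceed]
  | succ n ih =>
    obtain ⟨B, hB, e1, e2⟩ := h.lintegral_killed_succ hξ hm x hV n
    refine ih.trans ?_
    rw [Finset.sum_range_succ, ← add_assoc, add_right_comm]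
    gcongr
    rw [e1, e2, add_assoc]
    gcongr
    have hsm : Measurable (partialSum ξ n) := (h.measurable_partialSum hξ n).mono (h.le n) le_rfl
    have hset : MeasurableSet {ω | x - partialSum ξ n ω < R} :=
      measurableSet_lt (measurable_const.sub hsm) measurable_const
    have hind : Measurable fun ω => Set.indicator (Set.Iio R) (fun _ => ENNReal.ofReal C)
        (x - partialSum ξ n ω) :=
      (measurable_const.indicator measurableSet_Iio).comp (measurable_const.sub hsm)
    calc ∫⁻ ω in B, ENNReal.ofReal (V (x - partialSum ξ n ω)) ∂μ
        ≤ ∫⁻ ω in B, (∫⁻ ω', (if x - partialSum ξ n ω < m n ω' then 1 else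
          ENNReal.ofReal (V (x - partialSum ξ n ω - ξ n ω'))) ∂μ +
          Set.indicator (Set.Iio R) (fun _ => ENNReal.ofReal C) (x - partialSum ξ n ω)) ∂μ :=
          lintegral_mono fun ω => hstep n _
      _ = _ := lintegral_add_right _ hind
      _ ≤ _ := by
        gcongr
        refine (lintegral_mono' Measure.restrict_le_self le_rfl).trans (le_of_eq ?_)
        have : (fun ω => Set.indicator (Set.Iio R) (fun _ => ENNReal.ofReal C)
            (x - partialSum ξ n ω)) = Set.indicator {ω | x - partialSum ξ n ω < R}
            (fun _ => ENNReal.ofReal C) := by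
          ext ω; simp [Set.indicator]
        rw [this, lintegral_indicator_const hset]

end GridStopping

end

end RandomTimeMaxima

/-! ### Lower deviations, truncation, and comparison with a superharmonic function -/

namespace RandomTimeMaxima

section

variable {Ω : Type*} [mΩ : MeasurableSpace Ω] {μ : Measure Ω} [IsProbabilityMeasure μ]
  {f : ℝ → ℝ}

/-- A light-tailed walk with positive drift is rarely below `-x / 2`. -/
lemma exists_lower_bound (hf : StrongTail f) {ζ : ℕ → Ω → ℝ}
    (hid : ∀ n, IdentDistrib (ζ n) (ζ 0) μ μ) (hexp : integrableExpSet (ζ 0) μ ∈ 𝓝 0)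
    (hpos : 0 < ∫ ω, ζ 0 ω ∂μ) {K ε : ℝ} (hK : 0 ≤ K) (hε : 0 < ε) :
    ∃ θ > 0, ∀ᶠ x in atTop, ∃ c ≥ 0, (∀ u < -x / 2, K * |u| + 1 ≤ c * Real.exp (-θ * u)) ∧
      ∀ P Q, IndepSteps μ P Q → (∀ n, Measurable[Q n] (ζ n)) → ∀ N : ℕ,
        (∀ n, Integrable (fun ω => Real.exp (-θ * partialSum ζ n ω)) μ) ∧
        ∑ n ∈ Finset.range N, ∫ ω, c * Real.exp (-θ * partialSum ζ n ω) ∂μ ≤ ε * f x := by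
  have hneg := eventually_mgf_lt_one (X := fun ω => -ζ 0 ω) (integrableExpSet_neg' hexp) (by
    rw [integral_neg]; linarith)
  obtain ⟨θ, ⟨hi, hr⟩, hθ⟩ := (hneg.and self_mem_nhdsWithin).exists
  have hθ : 0 < θ := hθ
  have hi' : Integrable (fun ω => Real.exp (-θ * ζ 0 ω)) μ := by
    refine hi.congr (Eventually.of_forall fun ω => ?_); simp
  have hr' : ∫ ω, Real.exp (-θ * ζ 0 ω) ∂μ < 1 := by
    refine lt_of_eq_of_lt (integral_congr_ae (Eventually.of_forall fun ω => ?_)) hr; simp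
  set r := ∫ ω, Real.exp (-θ * ζ 0 ω) ∂μ
  have hr0 : 0 ≤ r := integral_nonneg fun ω => (Real.exp_pos _).le
  refine ⟨θ, hθ, ?_⟩
  -- Half of the exponent `-θ u` absorbs the linear growth. The other half is at least `θ x / 4` for
  -- `u < -x / 2` and permits the exponentially small constant `c`.
  set K' := 2 * K / θ + 1 with hK'
  have hK'0 : 0 < K' := by positivity
  filter_upwards [hf.eventually_exp_le (s := θ / 4) (by positivity)
    (show 0 < ε * (1 - r) / K' by have : 0 < 1 - r := by linarith
                                  positivity), eventually_ge_atTop 0] with x hx hx0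
  refine ⟨K' * Real.exp (-(θ / 4) * x), by positivity, fun u hu => ?_, fun P Q h hζ N => ?_⟩
  · have hu0 : u < 0 := by linarith
    rw [abs_of_neg hu0, mul_assoc, ← Real.exp_add]
    have h1 : Real.exp (θ / 2 * -u) ≤ Real.exp (-(θ / 4) * x + -θ * u) :=
      Real.exp_le_exp.2 (by nlinarith)
    have h2 := Real.add_one_le_exp (θ / 2 * -u)
    have h3 : 1 ≤ Real.exp (θ / 2 * -u) := Real.one_le_exp (by nlinarith)
    have h4 : K * -u ≤ 2 * K / θ * Real.exp (θ / 2 * -u) := by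
      calc K * -u = 2 * K / θ * (θ / 2 * -u) := by field_simp
        _ ≤ _ := by gcongr; linarith
    calc K * -u + 1 ≤ K' * Real.exp (θ / 2 * -u) := by rw [hK']; linarith
      _ ≤ _ := by gcongr
  · have he := fun n => h.exp_partialSum hζ hid hi' n
    refine ⟨fun n => (he n).1, ?_⟩
    simp_rw [integral_const_mul, (he _).2]
    rw [← Finset.mul_sum]
    -- The exponential moments of the partial sums decay geometrically, so the sum is bounded
    -- uniformly in `N`.
    have hg : ∑ n ∈ Finset.range N, r ^ n ≤ (1 - r)⁻¹ :=
      (Summable.sum_le_tsum _ (fun _ _ => pow_nonneg hr0 _)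
        (summable_geometric_of_lt_one hr0 hr')).trans_eq (tsum_geometric_of_lt_one hr0 hr')
    have h1r : 0 < 1 - r := by linarith
    have hz : 0 ≤ ε * (1 - r) / K' * f x :=
      mul_nonneg (div_nonneg (mul_nonneg hε.le h1r.le) hK'0.le) (hf.nonneg x)
    calc _ ≤ K' * (ε * (1 - r) / K' * f x) * (1 - r)⁻¹ := by gcongr
      _ = ε * f x := by field_simp

-- Dominated convergence by `|ξ|`. It lets steps be bounded from below at an arbitrarily small cost
-- in the drift.
omit [IsProbabilityMeasure μ] in
lemma tendsto_integral_max_neg {ξ : Ω → ℝ} (hξ : Integrable ξ μ) :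
    Tendsto (fun A : ℝ => ∫ ω, max (ξ ω) (-A) ∂μ) atTop (𝓝 (∫ ω, ξ ω ∂μ)) := by
  refine tendsto_integral_filter_of_dominated_convergence (fun ω => |ξ ω|) ?_ ?_ hξ.abs ?_
  · exact Eventually.of_forall fun A => (hξ.1.sup aestronglyMeasurable_const)
  · filter_upwards [eventually_ge_atTop 0] with A hA
    refine Eventually.of_forall fun ω => ?_
    rw [Real.norm_eq_abs]
    rcases le_total (ξ ω) (-A) with h | h
    · rw [max_eq_right h, abs_neg, abs_of_nonneg hA]
      linarith [neg_abs_le (ξ ω)]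
    · rw [max_eq_left h]
  · refine Eventually.of_forall fun ω => tendsto_const_nhds.congr' ?_
    filter_upwards [eventually_ge_atTop (-ξ ω)] with A hA
    rw [max_eq_left (by linarith)]

omit [IsProbabilityMeasure μ] in
lemma tendsto_integral_min {ξ : Ω → ℝ} (hξ : Integrable ξ μ) :
    Tendsto (fun b : ℝ => ∫ ω, min (ξ ω) b ∂μ) atTop (𝓝 (∫ ω, ξ ω ∂μ)) := by
  have := (tendsto_integral_max_neg hξ.neg).neg
  simp only [Pi.neg_apply, ← integral_neg, neg_neg, max_neg_neg] at this
  exact this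

lemma partialSum_mono {Ω : Type*} {X Y : ℕ → Ω → ℝ} (h : ∀ n ω, X n ω ≤ Y n ω) (n : ℕ) (ω : Ω) :
    partialSum X n ω ≤ partialSum Y n ω := Finset.sum_le_sum fun i _ => h i ω

lemma exceed_mono {Ω : Type*} {ξ ξ' m m' : ℕ → Ω → ℝ} (h : ∀ n ω, ξ n ω ≤ ξ' n ω)
    (hm : ∀ n ω, m n ω ≤ m' n ω) (x : ℝ) (σ : Ω → ℕ) : exceed ξ m x σ ⊆ exceed ξ' m' x σ := by
  rintro ω ⟨k, hk, hk'⟩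
  exact ⟨k, hk, hk'.trans_le (add_le_add (partialSum_mono h k ω) (hm k ω))⟩

omit [IsProbabilityMeasure μ] in
lemma HasTail.congr_right {ξ ξ' : Ω → ℝ} {p : ℝ} (h : HasTail μ ξ f p)
    (he : ∀ᶠ v in atTop, ∀ ω, v < ξ' ω ↔ v < ξ ω) : HasTail μ ξ' f p := by
  refine Tendsto.congr' ?_ h
  filter_upwards [he] with v hv
  simp only [hv]

/-- The comparison between the exceedance probability and the stopped truncated walk. -/
lemma exceed_le_of_superharmonic (hf : StrongTail f) {ξ m ζ : ℕ → Ω → ℝ} {V : ℝ → ℝ} {κ ε c θ x : ℝ}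
    {P Q : ℕ → MeasurableSpace Ω} {σ : Ω → ℕ} {L : ℕ}
    (h : GridStopping μ P Q σ) (hL : ∀ ω, σ ω ≤ L)
    (hξ : ∀ n, Measurable[Q n] (ξ n)) (hm : ∀ n, Measurable[Q n] (m n))
    (hζ : ∀ n, Measurable[Q n] (ζ n)) (hζξ : ∀ n ω, -ζ n ω ≤ ξ n ω)
    (hVa : Antitone V) (hV0 : ∀ y, 0 ≤ V y) (hV1 : ∀ y, V y ≤ 1) (hκ : 0 ≤ κ)
    (hε : 0 ≤ ε) (hc : 0 ≤ c)
    (hstep : ∀ n y, ∫⁻ ω, (if y < m n ω then 1 else ENNReal.ofReal (V (y - ξ n ω))) ∂μ ≤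
      ENNReal.ofReal (V y)) (hx0 : 0 ≤ x) (hVe : ∀ y ≥ x / 2, V y = κ * tailInt f y)
    (hVx : V (x / 2) ≤ ε) (hce : ∀ u < -x / 2, κ * |u| + 1 ≤ c * Real.exp (-θ * u))
    (hi : ∀ n, Integrable (fun ω => Real.exp (-θ * partialSum ζ n ω)) μ)
    (hw : Integrable (fun ω => windowInt f x (partialSum ζ (σ ω) ω)) μ) :
    (1 - ε) * μ.real (exceed ξ m x σ) ≤ κ * ∫ ω, windowInt f x (partialSum ζ (σ ω) ω) ∂μ +
      ∑ n ∈ Finset.range (L + 1), ∫ ω, c * Real.exp (-θ * partialSum ζ n ω) ∂μ := by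
  set E := exceed ξ m x σ with hE
  have hEm : MeasurableSet E := h.measurableSet_exceed hξ hm x
  have hVm : Measurable V := hVa.measurable
  have hQm : Measurable fun ω => partialSum ζ (σ ω) ω :=
    measurable_eval_nat (fun n => (h.measurable_partialSum hζ n).mono (h.le n) le_rfl) h.measurable
  have hk := h.lintegral_killed_le hξ hm x hVm hstep L
  have hQS : ∀ n ω, -partialSum ζ n ω ≤ partialSum ξ n ω := fun n ω => by
    rw [← partialSum_neg]; exact partialSum_mono hζξ n ω
  -- With `Q` the stopped sum of `ζ`: as `-ζ ≤ ξ` and `V` is decreasing, `V (x + Q)` is a lower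
  -- bound for the terminal value of the killed process.
  set φ : Ω → ℝ := E.indicator 1 + Eᶜ.indicator fun ω => V (x + partialSum ζ (σ ω) ω) with hφ
  have hφm : Measurable φ := (measurable_one.indicator hEm).add
    ((hVm.comp (measurable_const.add hQm)).indicator hEm.compl)
  have hφ1 : ∀ ω, 0 ≤ φ ω ∧ φ ω ≤ 1 := by
    intro ω
    simp only [hφ, Pi.add_apply]
    by_cases hω : ω ∈ E
    · simp [hω]
    · simp [hω, hV0, hV1]
  have hφi : Integrable φ μ := Integrable.of_bound hφm.aestronglyMeasurable (C := 1)
    (Eventually.of_forall fun ω => by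
      rw [Real.norm_of_nonneg (hφ1 ω).1]; exact (hφ1 ω).2)
  have h1 : ∫ ω, φ ω ∂μ ≤ V x := by
    rw [← ENNReal.ofReal_le_ofReal_iff (hV0 x),
      ofReal_integral_eq_lintegral_ofReal hφi (Eventually.of_forall fun ω => (hφ1 ω).1)]
    refine le_trans (lintegral_mono fun ω => ?_) hk
    simp only [killed]
    have hσ : (fun ω => min (σ ω) L) = σ := funext fun ω => min_eq_left (hL ω)
    rw [hσ, min_eq_left (hL ω)]
    simp only [hφ, Pi.add_apply]
    by_cases hω : ω ∈ E
    · simp only [hω, Set.mem_compl_iff, not_true_eq_false, not_false_eq_true,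
        Set.indicator_of_mem, Set.indicator_of_notMem, Pi.one_apply, add_zero, ENNReal.ofReal_one]
      rw [if_pos hω]
    · simp only [hω, Set.mem_compl_iff, not_false_eq_true,
        Set.indicator_of_mem, Set.indicator_of_notMem, zero_add]
      rw [if_neg hω]
      refine ENNReal.ofReal_le_ofReal (hVa ?_)
      linarith [hQS (σ ω) ω]
  set ψ : Ω → ℝ := fun ω => ∑ n ∈ Finset.range (L + 1), c * Real.exp (-θ * partialSum ζ n ω) with hψ
  have hψi : Integrable ψ μ := integrable_finsetSum _ fun n _ => (hi n).const_mul c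
  have hIi : Integrable (E.indicator (1 : Ω → ℝ)) μ := (integrable_const (1 : ℝ)).indicator hEm
  -- Off the rare event `Q < -x / 2` both values of `V` are `κ` times integrated tails, and their
  -- difference is `κ` times the window of length `Q`. On the rare event the exponential terms in
  -- `ψ` pay for everything.
  have hpt : ∀ ω, V x + (1 - ε) * E.indicator 1 ω ≤ φ ω +
      κ * windowInt f x (partialSum ζ (σ ω) ω) + ψ ω := by
    intro ω
    have hψ0 : c * Real.exp (-θ * partialSum ζ (σ ω) ω) ≤ ψ ω :=
      Finset.single_le_sum (f := fun n => c * Real.exp (-θ * partialSum ζ n ω))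
        (fun n _ => by positivity) (Finset.mem_range.2 (Nat.lt_succ_of_le (hL ω)))
    have hψ1 : 0 ≤ ψ ω := le_trans (by positivity) hψ0
    set q := partialSum ζ (σ ω) ω with hq
    rcases lt_or_ge q (-x / 2) with h2 | h2
    · have h3 := hce q h2
      have h4 := (abs_le.1 (hf.abs_windowInt_le x q)).1
      have h5 : κ * -|q| ≤ κ * windowInt f x q := mul_le_mul_of_nonneg_left h4 hκ
      have h6 := (hφ1 ω).1
      have h7 := hV1 x
      have h8 : (1 - ε) * E.indicator 1 ω ≤ φ ω := by
        simp only [hφ, Pi.add_apply]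
        by_cases hω : ω ∈ E
        · simp [hω, hε]
        · simp [hω, hV0]
      linarith
    · have h3 := hVe (x + q) (by linarith)
      have h4 := hVe x (by linarith)
      rw [hf.windowInt_eq]
      have h5 : V (x + q) ≤ ε := (hVa (by linarith)).trans hVx
      by_cases hω : ω ∈ E
      · have : φ ω = 1 := by simp [hφ, hω]
        rw [this, Set.indicator_of_mem hω, Pi.one_apply]
        linarith
      · have : φ ω = V (x + q) := by simp [hφ, hω, hq]
        rw [this, Set.indicator_of_notMem hω]
        linarith
  have hint := integral_mono ((integrable_const (V x)).add (hIi.const_mul (1 - ε)))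
    ((hφi.add (hw.const_mul κ)).add hψi) hpt
  simp only [Pi.add_apply] at hint
  rw [integral_add (integrable_const _) (hIi.const_mul _),
    integral_add (f := fun ω => φ ω + κ * windowInt f x (partialSum ζ (σ ω) ω))
      (hφi.add (hw.const_mul κ)) hψi,
    integral_add hφi (hw.const_mul κ), integral_const_mul, integral_const_mul,
    integral_indicator_one hEm, hψ, integral_finsetSum _ fun n _ => (hi n).const_mul c] at hint
  simp only [integral_const, probReal_univ, one_smul] at hint
  linarith

end

end RandomTimeMaxima

/-! ### Upper bound for a random walk on a random time interval -/

namespace RandomTimeMaxima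

section

variable {Ω : Type*} [mΩ : MeasurableSpace Ω] {μ : Measure Ω} [IsProbabilityMeasure μ]
  {f : ℝ → ℝ}

lemma integrable_windowInt (hf : StrongTail f) {W : Ω → ℝ} (hW : Measurable W) {L : ℝ}
    (hL : ∀ ω, |W ω| ≤ L) (x : ℝ) : Integrable (fun ω => windowInt f x (W ω)) μ :=
  Integrable.of_bound (C := L)
    ((hf.continuous_windowInt x).measurable.comp hW).aestronglyMeasurable
    (Eventually.of_forall fun ω => (hf.abs_windowInt_le x _).trans (hL ω))

omit [IsProbabilityMeasure μ] in
lemma integrable_windowInt_partialSum (hf : StrongTail f) {ζ : ℕ → Ω → ℝ} {σ : Ω → ℕ} {L : ℕ}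
    (hζ : ∀ n, Measurable (partialSum ζ n)) (hζi : ∀ n, Integrable (ζ n) μ) (hσ : Measurable σ)
    (hL : ∀ ω, σ ω ≤ L) (x : ℝ) :
    Integrable (fun ω => windowInt f x (partialSum ζ (σ ω) ω)) μ := by
  refine Integrable.mono (integrable_eval_nat (g := partialSum ζ) (L := L) hζ hσ hL
    fun n _ => integrable_finsetSum _ fun i _ => hζi i)
    ((hf.continuous_windowInt x).measurable.comp (measurable_eval_nat hζ hσ)).aestronglyMeasurable
    (Eventually.of_forall fun ω => ?_)
  simpa using hf.abs_windowInt_le x (partialSum ζ (σ ω) ω)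

/-- Upper bound for the maximum of a random walk on a random time interval. -/
theorem exceed_upper (hf : StrongTail f) {ξ m : ℕ → Ω → ℝ} {α p ε : ℝ}
    (hξm : ∀ n, Measurable (ξ n)) (hmm : ∀ n, Measurable (m n))
    (hid : ∀ n, IdentDistrib (fun ω => (ξ n ω, m n ω)) (fun ω => (ξ 0 ω, m 0 ω)) μ μ)
    (hξm0 : ∀ᵐ ω ∂μ, ξ 0 ω ≤ max (m 0 ω) 0) (hint : Integrable (ξ 0) μ)
    (hmean : ∫ ω, ξ 0 ω ∂μ = -α) (hα : 0 < α) (hp : 0 < p) (hξt : HasTail μ (ξ 0) f p)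
    (hmt : HasTail μ (m 0) f p) (hε : 0 < ε) :
    ∀ᶠ x in atTop, ∀ P Q σ, GridStopping μ P Q σ → (∀ n, Measurable[Q n] (ξ n)) →
      (∀ n, Measurable[Q n] (m n)) →
      μ.real (exceed ξ m x σ) ≤
        (1 + ε) * (p / α * ∫ ω, windowInt f x (α * σ ω) ∂μ) + ε * f x := by
  -- the small parameter
  have ht1 : Tendsto (fun e : ℝ => (1 + e) ^ 4 / (1 - e)) (𝓝 0) (𝓝 1) := by
    have : ContinuousAt (fun e : ℝ => (1 + e) ^ 4 / (1 - e)) 0 :=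
      ContinuousAt.div (by fun_prop) (by fun_prop) (by norm_num)
    simpa [ContinuousAt] using this
  have ht2 : Tendsto (fun e : ℝ => ((1 + e) ^ 2 * p / α + 1) * e / (1 - e)) (𝓝 0) (𝓝 0) := by
    have : ContinuousAt (fun e : ℝ => ((1 + e) ^ 2 * p / α + 1) * e / (1 - e)) 0 :=
      ContinuousAt.div (by fun_prop) (by fun_prop) (by norm_num)
    simpa [ContinuousAt] using this
  obtain ⟨e, ⟨⟨⟨he1, he2⟩, he4⟩, he3⟩⟩ := ((((ht1.eventually (gt_mem_nhds (show 1 < 1 + ε by linarith))).and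
    (ht2.eventually (gt_mem_nhds hε))).and (gt_mem_nhds one_pos)).filter_mono
      (nhdsWithin_le_nhds (s := Set.Ioi 0))).and self_mem_nhdsWithin |>.exists
  have he3 : 0 < e := he3
  -- truncation from below
  have hA := ((tendsto_integral_max_neg hint).eventually
    (gt_mem_nhds (show ∫ ω, ξ 0 ω ∂μ < -(α / (1 + e)) by
      rw [hmean, neg_lt_neg_iff, div_lt_iff₀ (by linarith)]; nlinarith))).and (eventually_ge_atTop 0)
  obtain ⟨A, hA1, hA0⟩ := hA.exists
  set ξA : ℕ → Ω → ℝ := fun n ω => max (ξ n ω) (-A) with hξA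
  set αA := -∫ ω, ξA 0 ω ∂μ with hαA
  have hαA1 : α / (1 + e) < αA := by rw [hαA]; linarith
  have hαA0 : 0 < αA := lt_trans (by positivity) hαA1
  have hξAi : Integrable (ξA 0) μ := hint.sup (integrable_const _)
  have hαA2 : αA ≤ α := by
    have : ∫ ω, ξ 0 ω ∂μ ≤ ∫ ω, ξA 0 ω ∂μ := integral_mono hint hξAi fun ω => le_max_left _ _
    linarith
  -- Slightly more than `p / αA`, because a superharmonic function is available only under a strict
  -- inequality.
  set κ := (1 + e) * p / αA with hκ
  have hκ0 : 0 < κ := by positivity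
  have hpκ : p < αA * κ := by rw [hκ, mul_div_cancel₀ _ hαA0.ne']; nlinarith
  have hκ2 : κ ≤ (1 + e) ^ 2 * p / α := by
    rw [hκ, div_le_div_iff₀ hαA0 hα]
    rw [div_lt_iff₀ (by linarith)] at hαA1
    have := mul_le_mul_of_nonneg_left hαA1.le (show 0 ≤ (1 + e) * p by positivity)
    nlinarith
  have hξAt : HasTail μ (ξA 0) f p := hξt.congr_right (by
    filter_upwards [eventually_ge_atTop 0] with v hv ω
    simp only [hξA, lt_max_iff, or_iff_left_iff_imp]
    intro h; linarith)
  have hξAm : ∀ᵐ ω ∂μ, ξA 0 ω ≤ max (m 0 ω) 0 := by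
    filter_upwards [hξm0] with ω h
    exact max_le h ((neg_nonpos.2 hA0).trans (le_max_right _ _))
  obtain ⟨V, hVa, hV0, hV1, hVe, hVs⟩ := exists_superharmonic hf (ξ := ξA 0) (m := m 0) (A := A)
    (α := αA) (κ := κ) (p := p) ((hξm 0).max measurable_const) (hmm 0) hA0
    (fun ω => le_max_right _ _) hξAm hξAi (by rw [hαA, neg_neg]) hαA0 hp.le hξAt hmt hpκ
  have hVm : Measurable V := hVa.measurable
  have hstep : ∀ n y, ∫⁻ ω, (if y < m n ω then 1 else ENNReal.ofReal (V (y - ξA n ω))) ∂μ ≤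
      ENNReal.ofReal (V y) := by
    intro n y
    refine le_of_eq_of_le ?_ (hVs y)
    refine ((hid n).comp (u := fun q : ℝ × ℝ => if y < q.2 then (1 : ℝ≥0∞) else
      ENNReal.ofReal (V (y - max q.1 (-A)))) ?_).lintegral_eq
    refine Measurable.ite (measurableSet_lt (by fun_prop) (by fun_prop)) measurable_const ?_
    exact (hVm.comp (by fun_prop)).ennreal_ofReal
  -- truncation from above
  obtain ⟨b, hb1, hb0⟩ := (((tendsto_integral_min hξAi).eventually (lt_mem_nhds
    (show -((1 + e) * α) < ∫ ω, ξA 0 ω ∂μ by nlinarith))).and (eventually_ge_atTop 0)).exists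
  -- With the sign reversed this is a bounded walk whose positive drift `β` is at most `(1 + e) α`,
  -- ready for `window_replacement`.
  set ζ : ℕ → Ω → ℝ := fun n ω => -min (ξA n ω) b with hζ
  set β := ∫ ω, ζ 0 ω ∂μ with hβ
  have hβ1 : β ≤ (1 + e) * α := by rw [hβ]; simp only [hζ, integral_neg]; linarith
  have hβ0 : 0 < β := by
    have : ∫ ω, min (ξA 0 ω) b ∂μ ≤ ∫ ω, ξA 0 ω ∂μ :=
      integral_mono (hξAi.inf (integrable_const _)) hξAi fun ω => min_le_left _ _
    rw [hβ]; simp only [hζ, integral_neg]; linarith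
  have hζu : Measurable fun q : ℝ × ℝ => -min (max q.1 (-A)) b := by fun_prop
  have hζid : ∀ n, IdentDistrib (ζ n) (ζ 0) μ μ := fun n => (hid n).comp hζu
  have hζm : ∀ n, Measurable (ζ n) := fun n => hζu.comp ((hξm n).prodMk (hmm n))
  have hζb : ∀ n ω, |ζ n ω| ≤ max A b := by
    intro n ω
    simp only [hζ, abs_neg, abs_le]
    exact ⟨le_min ((neg_le_neg (le_max_left A b)).trans (le_max_right _ _))
      (by linarith [le_max_right A b]), (min_le_right _ _).trans (le_max_right _ _)⟩
  have hζe : integrableExpSet (ζ 0) μ ∈ 𝓝 0 := integrableExpSet_of_bdd (hζm 0) (hζb 0)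
  have hζi : ∀ n, Integrable (ζ n) μ := fun n =>
    Integrable.of_bound (hζm n).aestronglyMeasurable (max A b) (Eventually.of_forall (hζb n))
  obtain ⟨θ, hθ, hlow⟩ := exists_lower_bound hf hζid hζe hβ0 hκ0.le he3
  have hrep := window_replacement hf hζid hζe hβ0 hβ.symm he3
  obtain ⟨R, hR⟩ := eventually_atTop.1 hVe
  have hV0' : ∀ᶠ x in atTop, V (x / 2) ≤ e := by
    have h1 := (hf.tailInt_tendsto.const_mul κ).comp (tendsto_id.atTop_div_const (two_pos (α := ℝ)))
    rw [mul_zero] at h1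
    filter_upwards [h1.eventually (gt_mem_nhds he3),
      (tendsto_id.atTop_div_const (two_pos (α := ℝ))).eventually (eventually_ge_atTop R)] with x h2 h3
    exact (hR _ h3).trans_le h2.le
  filter_upwards [hlow, hrep, hV0', (tendsto_id.atTop_div_const (two_pos (α := ℝ))).eventually
    (eventually_ge_atTop R), eventually_ge_atTop 0] with x hx1 hx2 hx3 hx4 hx0 P Q σ h hξQ hmQ
  obtain ⟨c, hc0, hc1, hc2⟩ := hx1
  obtain ⟨L, hL⟩ := h.bdd
  have hζQ : ∀ n, Measurable[Q n] (ζ n) := fun n => hζu.comp ((hξQ n).prodMk (hmQ n))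
  have hξAQ : ∀ n, Measurable[Q n] (ξA n) := fun n => (hξQ n).max measurable_const
  have hsum := hc2 P Q h.toIndepSteps hζQ (L + 1)
  have hmain := exceed_le_of_superharmonic hf (ξ := ξA) (m := m) (ζ := ζ) h hL hξAQ hmQ hζQ
    (fun n ω => by simp [hζ]) hVa hV0 hV1 hκ0.le he3.le hc0 hstep hx0
    (fun y hy => hR y (le_trans hx4 hy)) hx3 hc1 hsum.1
    (integrable_windowInt_partialSum hf (fun n => (h.measurable_partialSum hζQ n).mono (h.le n) le_rfl)
      hζi h.measurable hL x)
  have hrep' := (abs_le.1 (hx2 P Q σ h hζQ)).2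
  have hσm : Measurable fun ω => (σ ω : ℝ) := measurable_from_nat.comp h.measurable
  have hwi : ∀ s : ℝ, 0 < s → Integrable (fun ω => windowInt f x (s * σ ω)) μ := fun s hs =>
    integrable_windowInt hf (hσm.const_mul s) (L := s * L) (fun ω => by
      rw [abs_of_nonneg (by positivity)]
      exact mul_le_mul_of_nonneg_left (by exact_mod_cast hL ω) hs.le) x
  have hββ : ∫ ω, windowInt f x (β * σ ω) ∂μ ≤ (1 + e) * ∫ ω, windowInt f x (α * σ ω) ∂μ := by
    rw [← integral_const_mul]
    refine integral_mono (hwi β hβ0) ((hwi α hα).const_mul _) fun ω => ?_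
    refine (hf.windowInt_mono x (mul_le_mul_of_nonneg_right hβ1 (Nat.cast_nonneg _))).trans ?_
    rw [mul_assoc]
    exact hf.windowInt_mul_le x (by linarith)
  have hsub : μ.real (exceed ξ m x σ) ≤ μ.real (exceed ξA m x σ) :=
    measureReal_mono (exceed_mono (fun n ω => le_max_left _ _) (fun _ _ => le_rfl) x σ)
  set I := ∫ ω, windowInt f x (α * σ ω) ∂μ with hI
  have hI0 : 0 ≤ I := integral_nonneg fun ω => hf.windowInt_nonneg x (by positivity)
  have hfx := hf.pos x
  set J := ∫ ω, windowInt f x (β * σ ω) ∂μ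
  have hJ : ∫ ω, windowInt f x (partialSum ζ (σ ω) ω) ∂μ ≤ (1 + e) ^ 2 * I + e * f x := by
    have := mul_le_mul_of_nonneg_left hββ (show 0 ≤ 1 + e by linarith)
    linarith
  have h1e : 0 < 1 - e := by linarith
  -- Two of the four factors `1 + e` come from `κ`, since `αA` may fall below `α`; one comes from
  -- `window_replacement` and one from comparing `β` with `α`.
  have hfin : (1 - e) * μ.real (exceed ξ m x σ) ≤
      (1 + e) ^ 4 * (p / α * I) + ((1 + e) ^ 2 * p / α + 1) * e * f x := by
    calc (1 - e) * μ.real (exceed ξ m x σ) ≤ (1 - e) * μ.real (exceed ξA m x σ) := by gcongr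
      _ ≤ κ * ((1 + e) ^ 2 * I + e * f x) + e * f x := by
        refine hmain.trans (add_le_add (mul_le_mul_of_nonneg_left hJ hκ0.le) hsum.2)
      _ ≤ (1 + e) ^ 2 * p / α * ((1 + e) ^ 2 * I + e * f x) + e * f x := by gcongr
      _ = _ := by ring
  rw [mul_comm, ← le_div_iff₀ h1e] at hfin
  refine hfin.trans ?_
  have h2 := mul_le_mul_of_nonneg_right he1.le (show 0 ≤ p / α * I by positivity)
  have h3 := mul_le_mul_of_nonneg_right he2.le hfx.le
  calc _ = (1 + e) ^ 4 / (1 - e) * (p / α * I) + ((1 + e) ^ 2 * p / α + 1) * e / (1 - e) * f x := by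
        ring
    _ ≤ _ := add_le_add h2 h3

end

end RandomTimeMaxima

/-! ### Lower bound for a random walk on a random time interval -/

namespace RandomTimeMaxima

section

variable {Ω : Type*} [mΩ : MeasurableSpace Ω] {μ : Measure Ω} [IsProbabilityMeasure μ]
  {f : ℝ → ℝ}

/-- The integrated tail is almost subharmonic for the walk with steps truncated from above. -/
lemma exists_subharmonic (hf : StrongTail f) {ξ : Ω → ℝ} {b κ p αb : ℝ} (hξ : Measurable ξ)
    (hξi : Integrable ξ μ) (hmean : ∫ ω, min (ξ ω) b ∂μ = -αb) (hκ : 0 < κ)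
    (hξt : HasTail μ ξ f p) (hlt : κ * αb < p) :
    ∃ R, ∀ y ≥ R, ENNReal.ofReal (κ * tailInt f (max y 0)) ≤
      ∫⁻ ω, (if y < ξ ω then 1 else
        ENNReal.ofReal (κ * tailInt f (max (y - min (ξ ω) b) 0))) ∂μ := by
  -- The last factor is the net gain when crossing is rewarded with 1 instead of the value that the
  -- tangent bound already counts there.
  have h1 : Tendsto (fun y => μ.real {ω | y < ξ ω} / f y * (1 - κ * (tailInt f y + b * f y)))
      atTop (𝓝 p) := by
    have := hξt.mul ((((hf.tailInt_tendsto.add (hf.tendsto_zero.const_mul b)).const_mul κ)).const_sub 1)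
    simpa using this
  obtain ⟨R, hR⟩ := eventually_atTop.1 (((h1.eventually (lt_mem_nhds hlt)).and
    (eventually_ge_atTop 0)).and (eventually_ge_atTop b))
  refine ⟨R, fun y hy => ?_⟩
  obtain ⟨⟨h2, hy0⟩, hyb⟩ := hR y hy
  have hfy := hf.pos y
  rw [div_mul_eq_mul_div, lt_div_iff₀ hfy] at h2
  set d := κ * (tailInt f y + b * f y)
  set E := {ω | y < ξ ω} with hE
  have hEm : MeasurableSet E := measurableSet_lt measurable_const hξ
  have hVm : Measurable fun z : ℝ => κ * tailInt f (max z 0) :=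
    (hf.tailInt_anti.measurable.comp (by fun_prop)).const_mul κ
  classical
  set φ : Ω → ℝ := fun ω => if y < ξ ω then 1 else κ * tailInt f (max (y - min (ξ ω) b) 0) with hφ
  have hφm : Measurable φ := Measurable.ite hEm measurable_const (hVm.comp (by fun_prop))
  have hφ0 : ∀ ω, 0 ≤ φ ω := fun ω => by
    simp only [hφ]; split_ifs
    · exact zero_le_one
    · exact mul_nonneg hκ.le (hf.tailInt_nonneg _)
  have hφi : Integrable φ μ := by
    refine Integrable.of_bound hφm.aestronglyMeasurable (1 + κ * tailInt f 0)
      (Eventually.of_forall fun ω => ?_)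
    have h3 := mul_nonneg hκ.le (hf.tailInt_nonneg 0)
    rw [Real.norm_of_nonneg (hφ0 ω)]
    simp only [hφ]
    split_ifs
    · linarith
    · have := mul_le_mul_of_nonneg_left
        (hf.tailInt_anti (le_max_right (y - min (ξ ω) b) 0)) hκ.le
      linarith
  have hmi : Integrable (fun ω => min (ξ ω) b) μ := hξi.inf (integrable_const b)
  -- A minorant: the integrated tail is convex and lies above its tangent at `y`, and crossings are
  -- completed to the value 1. Its mean exceeds `κ tailInt f y` because the drift loses `κ αb f y`
  -- while crossing gains about `p f y`.
  set ψ : Ω → ℝ := fun ω => κ * (tailInt f y + f y * min (ξ ω) b) + (1 - d) * E.indicator 1 ω with hψ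
  have hIi : Integrable (E.indicator (1 : Ω → ℝ)) μ := (integrable_const (1 : ℝ)).indicator hEm
  have h3i : Integrable (fun ω => κ * (tailInt f y + f y * min (ξ ω) b)) μ :=
    ((integrable_const _).add (hmi.const_mul _)).const_mul κ
  have hψφ : ∀ ω, ψ ω ≤ φ ω := by
    intro ω
    simp only [hψ, hφ]
    by_cases hω : y < ξ ω
    · rw [Set.indicator_of_mem (show ω ∈ E from hω), if_pos hω, min_eq_right (by linarith)]
      simp only [d, Pi.one_apply]
      apply le_of_eq; ring
    · rw [Set.indicator_of_notMem (show ω ∉ E from hω), if_neg hω, mul_zero, add_zero]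
      refine mul_le_mul_of_nonneg_left ?_ hκ.le
      have h4 : min (ξ ω) b ≤ y := (min_le_left _ _).trans (not_lt.1 hω)
      rw [max_eq_left (by linarith)]
      have h5 := hf.windowInt_le y (-min (ξ ω) b)
      rw [hf.windowInt_eq, ← sub_eq_add_neg] at h5
      linarith
  have hint := integral_mono (h3i.add (hIi.const_mul _)) hφi hψφ
  simp only [Pi.add_apply] at hint
  rw [integral_add h3i (hIi.const_mul _), integral_const_mul,
    integral_add (integrable_const _) (hmi.const_mul _), integral_const_mul, integral_const_mul,
    integral_indicator_one hEm, hmean] at hint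
  simp only [integral_const, probReal_univ, one_smul] at hint
  have hgoal : ∫⁻ ω, (if y < ξ ω then 1 else
        ENNReal.ofReal (κ * tailInt f (max (y - min (ξ ω) b) 0))) ∂μ =
        ENNReal.ofReal (∫ ω, φ ω ∂μ) := by
    rw [ofReal_integral_eq_lintegral_ofReal hφi (Eventually.of_forall hφ0)]
    refine lintegral_congr fun ω => ?_
    simp only [hφ]
    split_ifs <;> simp
  rw [hgoal, max_eq_left hy0]
  refine ENNReal.ofReal_le_ofReal ?_
  linarith

/-- The lower comparison of the exceedance probability with the stopped truncated walk. -/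
lemma le_exceed_of_subharmonic (hf : StrongTail f) {ξ m ζ : ℕ → Ω → ℝ} {κ R θ c x : ℝ}
    {P Q : ℕ → MeasurableSpace Ω} {σ : Ω → ℕ} {L : ℕ}
    (h : GridStopping μ P Q σ) (hL : ∀ ω, σ ω ≤ L)
    (hξ : ∀ n, Measurable[Q n] (ξ n)) (hm : ∀ n, Measurable[Q n] (m n))
    (hζ : ∀ n, Measurable[Q n] (ζ n)) (hζξ : ∀ n ω, ξ n ω ≤ -ζ n ω) (hκ : 0 ≤ κ) (hc : 0 ≤ c)
    (hstep : ∀ n y, R ≤ y → ENNReal.ofReal (κ * tailInt f (max y 0)) ≤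
      ∫⁻ ω, (if y < m n ω then 1 else ENNReal.ofReal (κ * tailInt f (max (y - ξ n ω) 0))) ∂μ)
    (hx0 : 0 ≤ x) (hxR : 2 * R ≤ x) (hce : ∀ u < -x / 2, 1 ≤ c * Real.exp (-θ * u))
    (hi : ∀ n, Integrable (fun ω => Real.exp (-θ * partialSum ζ n ω)) μ)
    (hw : Integrable (fun ω => windowInt f x (partialSum ζ (σ ω) ω)) μ) :
    κ * ∫ ω, windowInt f x (partialSum ζ (σ ω) ω) ∂μ ≤ μ.real (exceed ξ m x σ) +
      κ * tailInt f 0 * ∑ n ∈ Finset.range L, ∫ ω, c * Real.exp (-θ * partialSum ζ n ω) ∂μ := by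
  set C := κ * tailInt f 0 with hC
  have hC0 : 0 ≤ C := mul_nonneg hκ (hf.tailInt_nonneg 0)
  -- Freezing the function at negative arguments makes it bounded by `C`, the most that a step can
  -- lose where subharmonicity fails.
  set V : ℝ → ℝ := fun z => κ * tailInt f (max z 0) with hV
  have hVa : Antitone V := fun y z hyz =>
    mul_le_mul_of_nonneg_left (hf.tailInt_anti (max_le_max_right 0 hyz)) hκ
  have hV0 : ∀ y, 0 ≤ V y := fun y => mul_nonneg hκ (hf.tailInt_nonneg _)
  have hVC : ∀ y, V y ≤ C := fun y =>
    mul_le_mul_of_nonneg_left (hf.tailInt_anti (le_max_right _ _)) hκ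
  set E := exceed ξ m x σ with hE
  have hEm : MeasurableSet E := h.measurableSet_exceed hξ hm x
  have hQm : Measurable fun ω => partialSum ζ (σ ω) ω :=
    measurable_eval_nat (fun n => (h.measurable_partialSum hζ n).mono (h.le n) le_rfl) h.measurable
  have hQS : ∀ n ω, partialSum ξ n ω ≤ -partialSum ζ n ω := fun n ω => by
    rw [← partialSum_neg]; exact partialSum_mono hζξ n ω
  have hk := h.le_lintegral_killed hξ hm x hVa.measurable (R := R) (C := C) (fun n y => by
    rcases lt_or_ge y R with hy | hy
    · rw [Set.indicator_of_mem (Set.mem_Iio.2 hy)]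
      exact (ENNReal.ofReal_le_ofReal (hVC y)).trans le_add_self
    · exact (hstep n y hy).trans le_self_add) L
  have hVQi : Integrable (fun ω => V (x + partialSum ζ (σ ω) ω)) μ :=
    Integrable.of_bound (hVa.measurable.comp (measurable_const.add hQm)).aestronglyMeasurable C
      (Eventually.of_forall fun ω => by
        rw [Real.norm_of_nonneg (hV0 _)]; exact hVC _)
  have hkill : ∫⁻ ω, killed ξ m x σ V L ω ∂μ ≤
      ENNReal.ofReal (μ.real E + ∫ ω, V (x + partialSum ζ (σ ω) ω) ∂μ) := by
    rw [ENNReal.ofReal_add measureReal_nonneg (integral_nonneg fun ω => hV0 _),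
      ofReal_measureReal,
      ofReal_integral_eq_lintegral_ofReal hVQi (Eventually.of_forall fun ω => hV0 _),
      ← lintegral_indicator_one hEm,
      ← lintegral_add_left (measurable_one.indicator hEm)]
    refine lintegral_mono fun ω => ?_
    simp only [killed]
    have hσ : (fun ω => min (σ ω) L) = σ := funext fun ω => min_eq_left (hL ω)
    rw [hσ, min_eq_left (hL ω)]
    by_cases hω : ω ∈ E
    · rw [if_pos hω, Set.indicator_of_mem hω]
      exact le_self_add
    · rw [if_neg hω]
      refine le_trans (ENNReal.ofReal_le_ofReal (hVa ?_)) le_add_self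
      linarith [hQS (σ ω) ω]
  -- By `2 R ≤ x` and `ξ ≤ -ζ`, a remaining distance below `R` forces the partial sum of `ζ` below
  -- `-x / 2`.
  have hterm : ∀ n, μ {ω | x - partialSum ξ n ω < R} ≤
      ENNReal.ofReal (∫ ω, c * Real.exp (-θ * partialSum ζ n ω) ∂μ) := by
    intro n
    have hsm : Measurable (partialSum ξ n) := (h.measurable_partialSum hξ n).mono (h.le n) le_rfl
    have hset : MeasurableSet {ω | x - partialSum ξ n ω < R} :=
      measurableSet_lt (measurable_const.sub hsm) measurable_const
    rw [ofReal_integral_eq_lintegral_ofReal ((hi n).const_mul c)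
      (Eventually.of_forall fun ω => by positivity), ← lintegral_indicator_one hset]
    refine lintegral_mono fun ω => ?_
    by_cases hω : ω ∈ {ω | x - partialSum ξ n ω < R}
    · rw [Set.indicator_of_mem hω]
      have hω' : x - partialSum ξ n ω < R := hω
      rw [Pi.one_apply, ← ENNReal.ofReal_one]
      refine ENNReal.ofReal_le_ofReal (hce _ ?_)
      linarith [hQS n ω]
    · rw [Set.indicator_of_notMem hω]; exact zero_le
  set T := ∑ n ∈ Finset.range L, ∫ ω, c * Real.exp (-θ * partialSum ζ n ω) ∂μ with hT
  have ht0 : ∀ n, 0 ≤ ∫ ω, c * Real.exp (-θ * partialSum ζ n ω) ∂μ := fun n =>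
    integral_nonneg fun ω => by positivity
  have hsum : ∑ k ∈ Finset.range L, ENNReal.ofReal C * μ {ω | x - partialSum ξ k ω < R} ≤
      ENNReal.ofReal (C * T) := by
    rw [ENNReal.ofReal_mul hC0, hT, ENNReal.ofReal_sum_of_nonneg fun n _ => ht0 n, Finset.mul_sum]
    exact Finset.sum_le_sum fun n _ => by gcongr; exact hterm n
  have hT0 : 0 ≤ T := Finset.sum_nonneg fun n _ => ht0 n
  have hVi0 : 0 ≤ ∫ ω, V (x + partialSum ζ (σ ω) ω) ∂μ := integral_nonneg fun ω => hV0 _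
  have hall := hk.trans (add_le_add hkill hsum)
  rw [← ENNReal.ofReal_add (add_nonneg measureReal_nonneg hVi0) (mul_nonneg hC0 hT0),
    ENNReal.ofReal_le_ofReal_iff (add_nonneg (add_nonneg measureReal_nonneg hVi0)
      (mul_nonneg hC0 hT0))] at hall
  have hVle : ∫ ω, V (x + partialSum ζ (σ ω) ω) ∂μ ≤
      κ * tailInt f x - κ * ∫ ω, windowInt f x (partialSum ζ (σ ω) ω) ∂μ := by
    have h1 : ∫ ω, (κ * tailInt f x - κ * windowInt f x (partialSum ζ (σ ω) ω)) ∂μ =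
        κ * tailInt f x - κ * ∫ ω, windowInt f x (partialSum ζ (σ ω) ω) ∂μ := by
      rw [integral_sub (integrable_const _) (hw.const_mul κ), integral_const, probReal_univ,
        one_smul, integral_const_mul]
    rw [← h1]
    refine integral_mono hVQi ((integrable_const _).sub (hw.const_mul κ)) fun ω => ?_
    simp only [hV]
    rw [hf.windowInt_eq]
    have := mul_le_mul_of_nonneg_left
      (hf.tailInt_anti (le_max_left (x + partialSum ζ (σ ω) ω) 0)) hκ
    linarith
  have hVx : V x = κ * tailInt f x := by simp only [hV, max_eq_left hx0]
  rw [hVx] at hall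
  linarith

/-- Lower bound for the maximum of a random walk on a random time interval. -/
theorem exceed_lower (hf : StrongTail f) {ξ : ℕ → Ω → ℝ} {α p ε : ℝ}
    (hξm : ∀ n, Measurable (ξ n)) (hid : ∀ n, IdentDistrib (ξ n) (ξ 0) μ μ)
    (hint : Integrable (ξ 0) μ) (hmean : ∫ ω, ξ 0 ω ∂μ = -α) (hα : 0 < α) (hp : 0 < p)
    (hξt : HasTail μ (ξ 0) f p) (hε : 0 < ε) :
    ∀ᶠ x in atTop, ∀ P Q σ, GridStopping μ P Q σ → (∀ n, Measurable[Q n] (ξ n)) →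
      (1 - ε) * (p / α * ∫ ω, windowInt f x (α * σ ω) ∂μ) - ε * f x ≤
        μ.real (exceed ξ ξ x σ) := by
  have ht1 : Tendsto (fun e : ℝ => (1 - e) ^ 3 / (1 + e)) (𝓝 0) (𝓝 1) := by
    have : ContinuousAt (fun e : ℝ => (1 - e) ^ 3 / (1 + e)) 0 :=
      ContinuousAt.div (by fun_prop) (by fun_prop) (by norm_num)
    simpa [ContinuousAt] using this
  have ht2 : Tendsto (fun e : ℝ => (p / α + 1) * e) (𝓝 0) (𝓝 0) := by
    have : ContinuousAt (fun e : ℝ => (p / α + 1) * e) 0 := by fun_prop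
    simpa [ContinuousAt] using this
  obtain ⟨e, ⟨⟨⟨he1, he2⟩, he4⟩, he3⟩⟩ := ((((ht1.eventually (lt_mem_nhds (show 1 - ε < 1 by linarith))).and
    (ht2.eventually (gt_mem_nhds hε))).and (gt_mem_nhds one_pos)).filter_mono
      (nhdsWithin_le_nhds (s := Set.Ioi 0))).and self_mem_nhdsWithin |>.exists
  have he3 : 0 < e := he3
  -- The steps of the walk are cut at `b` with almost no change of the mean, but the overshoot
  -- variable remains the full step: the big jump is seen only through killing.
  obtain ⟨b, hb1, hb0⟩ := (((tendsto_integral_min hint).eventually (lt_mem_nhds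
    (show -((1 + e) * α) < ∫ ω, ξ 0 ω ∂μ by nlinarith))).and (eventually_ge_atTop 0)).exists
  set ξb : ℕ → Ω → ℝ := fun n ω => min (ξ n ω) b with hξb
  have hξbi : Integrable (ξb 0) μ := hint.inf (integrable_const _)
  set αb := -∫ ω, ξb 0 ω ∂μ with hαb
  have hαb1 : αb < (1 + e) * α := by rw [hαb]; linarith
  have hαb2 : α ≤ αb := by
    have : ∫ ω, ξb 0 ω ∂μ ≤ ∫ ω, ξ 0 ω ∂μ := integral_mono hξbi hint fun ω => min_le_left _ _
    linarith
  have hαb0 : 0 < αb := hα.trans_le hαb2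
  have h1e : 0 < 1 - e := by linarith
  set κ := (1 - e) * p / αb with hκ
  have hκ0 : 0 < κ := by positivity
  have hκp : κ * αb < p := by rw [hκ, div_mul_cancel₀ _ hαb0.ne']; nlinarith
  have hκ1 : κ ≤ p / α := by
    rw [hκ]
    exact div_le_div₀ hp.le (by nlinarith) hα hαb2
  have hκ2 : (1 - e) * p / ((1 + e) * α) ≤ κ := by
    rw [hκ]; exact div_le_div_of_nonneg_left (by positivity) hαb0 hαb1.le
  obtain ⟨R, hR⟩ := exists_subharmonic hf (hξm 0) hint (b := b) (αb := αb)
    (by rw [hαb, neg_neg]) hκ0 hξt hκp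
  have hVm : Measurable fun z : ℝ => κ * tailInt f (max z 0) :=
    (hf.tailInt_anti.measurable.comp (by fun_prop)).const_mul κ
  have hstep : ∀ n y, R ≤ y → ENNReal.ofReal (κ * tailInt f (max y 0)) ≤
      ∫⁻ ω, (if y < ξ n ω then 1 else ENNReal.ofReal (κ * tailInt f (max (y - ξb n ω) 0))) ∂μ := by
    intro n y hy
    refine (hR y hy).trans_eq ?_
    refine ((hid n).comp (u := fun q : ℝ => if y < q then (1 : ℝ≥0∞) else
      ENNReal.ofReal (κ * tailInt f (max (y - min q b) 0))) ?_).symm.lintegral_eq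
    refine Measurable.ite (measurableSet_lt (by fun_prop) (by fun_prop)) measurable_const ?_
    exact (hVm.comp (by fun_prop)).ennreal_ofReal
  -- A second truncation, from below, gives a bounded walk for the window. It can only raise the
  -- position, so evaluating the decreasing terminal function along it bounds the true value from
  -- above.
  obtain ⟨A, hA1, hA0⟩ := (((tendsto_integral_max_neg hξbi).eventually (gt_mem_nhds
    (show ∫ ω, ξb 0 ω ∂μ < -((1 - e) * α) by nlinarith))).and (eventually_ge_atTop 0)).exists
  set ζ : ℕ → Ω → ℝ := fun n ω => -max (ξb n ω) (-A) with hζ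
  set β := ∫ ω, ζ 0 ω ∂μ with hβ
  have hβ1 : (1 - e) * α ≤ β := by rw [hβ]; simp only [hζ, integral_neg]; linarith
  have hβ0 : 0 < β := lt_of_lt_of_le (by positivity) hβ1
  have hζu : Measurable fun q : ℝ => -max (min q b) (-A) := by fun_prop
  have hζid : ∀ n, IdentDistrib (ζ n) (ζ 0) μ μ := fun n => (hid n).comp hζu
  have hζm : ∀ n, Measurable (ζ n) := fun n => hζu.comp (hξm n)
  have hζb : ∀ n ω, |ζ n ω| ≤ max A b := by
    intro n ω
    simp only [hζ, abs_neg, abs_le]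
    exact ⟨(neg_le_neg (le_max_left A b)).trans (le_max_right _ _),
      max_le ((min_le_right _ _).trans (le_max_right _ _)) (by linarith [le_max_left A b])⟩
  have hζe : integrableExpSet (ζ 0) μ ∈ 𝓝 0 := integrableExpSet_of_bdd (hζm 0) (hζb 0)
  have hζi : ∀ n, Integrable (ζ n) μ := fun n =>
    Integrable.of_bound (hζm n).aestronglyMeasurable (max A b) (Eventually.of_forall (hζb n))
  set C := κ * tailInt f 0 with hC
  have hC0 : 0 ≤ C := mul_nonneg hκ0.le (hf.tailInt_nonneg 0)
  obtain ⟨θ, hθ, hlow⟩ := exists_lower_bound hf hζid hζe hβ0 le_rfl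
    (show 0 < e / (C + 1) by positivity)
  have hrep := window_replacement hf hζid hζe hβ0 hβ.symm he3
  filter_upwards [hlow, hrep, eventually_ge_atTop (2 * R), eventually_ge_atTop 0]
    with x hx1 hx2 hx3 hx0 P Q σ h hξQ
  obtain ⟨c, hc0, hc1, hc2⟩ := hx1
  obtain ⟨L, hL⟩ := h.bdd
  have hζQ : ∀ n, Measurable[Q n] (ζ n) := fun n => hζu.comp (hξQ n)
  have hξbQ : ∀ n, Measurable[Q n] (ξb n) := fun n => (hξQ n).min measurable_const
  have hsum := hc2 P Q h.toIndepSteps hζQ L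
  have hmain := le_exceed_of_subharmonic hf (ξ := ξb) (m := ξ) (ζ := ζ) h hL hξbQ hξQ hζQ
    (fun n ω => by simp [hζ]) hκ0.le hc0 hstep hx0 hx3
    (fun u hu => by simpa using hc1 u hu) hsum.1
    (integrable_windowInt_partialSum hf (fun n => (h.measurable_partialSum hζQ n).mono (h.le n) le_rfl)
      hζi h.measurable hL x)
  have hrep' := (abs_le.1 (hx2 P Q σ h hζQ)).1
  have hσm : Measurable fun ω => (σ ω : ℝ) := measurable_from_nat.comp h.measurable
  have hwi : ∀ s : ℝ, 0 < s → Integrable (fun ω => windowInt f x (s * σ ω)) μ := fun s hs =>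
    integrable_windowInt hf (hσm.const_mul s) (L := s * L) (fun ω => by
      rw [abs_of_nonneg (by positivity)]
      exact mul_le_mul_of_nonneg_left (by exact_mod_cast hL ω) hs.le) x
  have hββ : (1 - e) * ∫ ω, windowInt f x (α * σ ω) ∂μ ≤ ∫ ω, windowInt f x (β * σ ω) ∂μ := by
    rw [← integral_const_mul]
    refine integral_mono ((hwi α hα).const_mul _) (hwi β hβ0) fun ω => ?_
    refine (hf.windowInt_mul_ge x h1e.le (by linarith)).trans ?_
    rw [← mul_assoc]
    exact hf.windowInt_mono x (mul_le_mul_of_nonneg_right hβ1 (Nat.cast_nonneg _))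
  have hsub : μ.real (exceed ξb ξ x σ) ≤ μ.real (exceed ξ ξ x σ) :=
    measureReal_mono (exceed_mono (fun n ω => min_le_left _ _) (fun _ _ => le_rfl) x σ)
  set I := ∫ ω, windowInt f x (α * σ ω) ∂μ with hI
  have hI0 : 0 ≤ I := integral_nonneg fun ω => hf.windowInt_nonneg x (by positivity)
  have hfx := hf.pos x
  set J := ∫ ω, windowInt f x (β * σ ω) ∂μ
  have hJ : (1 - e) ^ 2 * I - e * f x ≤ ∫ ω, windowInt f x (partialSum ζ (σ ω) ω) ∂μ := by
    have := mul_le_mul_of_nonneg_left hββ h1e.le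
    linarith
  have hS : C * ∑ n ∈ Finset.range L, ∫ ω, c * Real.exp (-θ * partialSum ζ n ω) ∂μ ≤ e * f x := by
    calc _ ≤ C * (e / (C + 1) * f x) := mul_le_mul_of_nonneg_left hsum.2 hC0
      _ = C / (C + 1) * (e * f x) := by ring
      _ ≤ 1 * (e * f x) := by
        gcongr
        rw [div_le_one (by positivity)]; linarith
      _ = _ := one_mul _
  have h3 : (1 - e) ^ 3 / (1 + e) * (p / α * I) - (p / α + 1) * e * f x ≤
      μ.real (exceed ξ ξ x σ) := by
    have h4 := mul_le_mul_of_nonneg_left hJ hκ0.le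
    have h5 : (1 - e) * p / ((1 + e) * α) * ((1 - e) ^ 2 * I) ≤ κ * ((1 - e) ^ 2 * I) := by gcongr
    have h6 : κ * (e * f x) ≤ p / α * (e * f x) := by gcongr
    have h7 : (1 - e) * p / ((1 + e) * α) * ((1 - e) ^ 2 * I) =
        (1 - e) ^ 3 / (1 + e) * (p / α * I) := by field_simp
    linarith
  refine le_trans ?_ h3
  have h4 := mul_le_mul_of_nonneg_right he1.le (show 0 ≤ p / α * I by positivity)
  have h5 := mul_le_mul_of_nonneg_right he2.le hfx.le
  linarith

end

end RandomTimeMaxima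

/-! ### Tails of sums and of random sums of independent variables -/

namespace RandomTimeMaxima

section

variable {Ω : Type*} [mΩ : MeasurableSpace Ω] {μ : Measure Ω} [IsProbabilityMeasure μ]
  {f : ℝ → ℝ}

/-- Conditioning on `W` in the event `U + W > v`. -/
lemma measure_add_gt_inter_le {U W : Ω → ℝ} (hU : Measurable U) (hW : Measurable W)
    (hind : IndepFun U W μ) {a : ℝ} (ha : 0 ≤ a) (hb : ∀ v, μ.real {ω | v < U ω} ≤ a * f v) (v : ℝ)
    {B : Set ℝ} (hB : MeasurableSet B) :
    μ {ω | v < U ω + W ω ∧ W ω ∈ B} ≤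
      ENNReal.ofReal a * ∫⁻ ω in {ω | W ω ∈ B}, ENNReal.ofReal (f (v - W ω)) ∂μ := by
  have hUB : MeasurableSet {q : ℝ × ℝ | v < q.2 + q.1} :=
    measurableSet_lt measurable_const (by fun_prop)
  have hg : Measurable fun q : ℝ × ℝ => ({q : ℝ × ℝ | v < q.2 + q.1}.indicator (1 : ℝ × ℝ → ℝ≥0∞) q) :=
    measurable_one.indicator hUB
  have hWB : MeasurableSet {ω | W ω ∈ B} := hW hB
  have h1 := setLIntegral_indep (μ := μ) (m₁ := MeasurableSpace.comap W inferInstance)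
    (m₂ := MeasurableSpace.comap U inferInstance) hind.symm hW.comap_le hU.comap_le
    (comap_measurable W) (comap_measurable U) (B := {ω | W ω ∈ B}) ⟨B, hB, rfl⟩ hg
  have h2 : μ {ω | v < U ω + W ω ∧ W ω ∈ B} = ∫⁻ ω in {ω | W ω ∈ B},
      ({q : ℝ × ℝ | v < q.2 + q.1}.indicator (1 : ℝ × ℝ → ℝ≥0∞) (W ω, U ω)) ∂μ := by
    have hm : MeasurableSet {ω | v < U ω + W ω} := measurableSet_lt measurable_const (hU.add hW)
    have : ∀ ω, ({q : ℝ × ℝ | v < q.2 + q.1}.indicator (1 : ℝ × ℝ → ℝ≥0∞) (W ω, U ω)) =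
        {ω | v < U ω + W ω}.indicator 1 ω := fun ω => by simp [Set.indicator]
    simp_rw [this]
    rw [lintegral_indicator_one hm, Measure.restrict_apply hm]
    rfl
  rw [h2, h1, ← lintegral_const_mul' _ _ ENNReal.ofReal_ne_top]
  refine lintegral_mono fun ω => ?_
  have hm : MeasurableSet {ω' | v - W ω < U ω'} := measurableSet_lt measurable_const hU
  have : ∀ ω', ({q : ℝ × ℝ | v < q.2 + q.1}.indicator (1 : ℝ × ℝ → ℝ≥0∞) (W ω, U ω')) =
      {ω' | v - W ω < U ω'}.indicator 1 ω' := fun ω' => by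
    simp [Set.indicator, sub_lt_iff_lt_add]
  simp_rw [this]
  rw [lintegral_indicator_one hm, ← ofReal_measureReal, ← ENNReal.ofReal_mul ha]
  exact ENNReal.ofReal_le_ofReal (hb _)

namespace HasTail

/-- The tail of a sum of independent variables is bounded by the common tail, with a constant that
depends linearly on the constant of one summand. -/
lemma exists_add_bound (hf : StrongTail f) {W₀ : Ω → ℝ} {p : ℝ} (hW₀ : Measurable W₀)
    (hWt : HasTail μ W₀ f p) : ∃ D ≥ 1, ∀ U W : Ω → ℝ, Measurable U → Measurable W →
      IdentDistrib W W₀ μ μ → IndepFun U W μ → ∀ a ≥ 0, (∀ v, μ.real {ω | v < U ω} ≤ a * f v) →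
      ∀ v, μ.real {ω | v < U ω + W ω} ≤ D * (1 + a) * f v := by
  obtain ⟨C, hC0, hC₀⟩ := hWt.bound hf
  obtain ⟨B, hB0, hB⟩ := hWt.mid_jump' hf hW₀ one_pos
  obtain ⟨E, hE1, hE⟩ := hf.exp_bound one_pos
  obtain ⟨R, hR⟩ := eventually_atTop.1 (hB B le_rfl)
  set D₁ := E * Real.exp (1 * B) with hD₁
  have hD₁0 : 0 < D₁ := by positivity
  have hfR := hf.pos R
  refine ⟨1 + C + D₁ + (f R)⁻¹, by have := inv_pos.2 hfR; linarith,
    fun U W hU hW hid hind a ha hb v => ?_⟩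
  have hC : ∀ v, μ.real {ω | v < W ω} ≤ C * f v := fun v => by
    refine le_of_eq_of_le ?_ (hC₀ v)
    exact congrArg ENNReal.toReal (hid.measure_mem_eq (s := Set.Ioi v) measurableSet_Ioi)
  have hRW : ∀ y ≥ R, ∫⁻ ω in {ω | B < W ω ∧ W ω ≤ y}, ENNReal.ofReal (f (y - W ω)) ∂μ ≤
      ENNReal.ofReal (1 * f y) := fun y hy => by
    have hg : Measurable fun z : ℝ => ENNReal.ofReal (f (y - z)) :=
      (hf.measurable.comp (measurable_const.sub measurable_id)).ennreal_ofReal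
    have e1 := setLIntegral_map (μ := μ) (measurableSet_Ioc (a := B) (b := y)) hg hW
    have e2 := setLIntegral_map (μ := μ) (measurableSet_Ioc (a := B) (b := y)) hg hW₀
    rw [hid.map_eq, e2] at e1
    exact le_of_eq_of_le e1.symm (hR y hy)
  have hfv := hf.pos v
  have hinv := inv_pos.2 hfR
  rcases lt_or_ge v R with hv | hv
  · have h1 : 1 ≤ (f R)⁻¹ * f v := by
      rw [inv_mul_eq_div, one_le_div hfR]; exact hf.anti hv.le
    refine measureReal_le_one.trans (h1.trans ?_)
    gcongr
    nlinarith [mul_nonneg hC0 ha, mul_nonneg hD₁0.le ha, mul_nonneg hinv.le ha]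
  -- Conditioning on `W ≤ v`: for `W ≤ B` the tail of `U` is shifted by a bounded amount, and for
  -- larger `W` the intermediate-jump estimate applies. The event `W > v` is added afterwards.
  · have hi : ∫⁻ ω in {ω | W ω ∈ Set.Iic v}, ENNReal.ofReal (f (v - W ω)) ∂μ ≤
        ENNReal.ofReal ((D₁ + 1) * f v) := by
      have hsub : {ω | W ω ∈ Set.Iic v} ⊆ {ω | W ω ≤ B} ∪ {ω | B < W ω ∧ W ω ≤ v} := by
        intro ω hω
        rcases le_or_gt (W ω) B with h | h
        · exact Or.inl h
        · exact Or.inr ⟨h, hω⟩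
      refine (lintegral_mono_set hsub).trans ((lintegral_union_le _ _ _).trans ?_)
      rw [add_mul, ENNReal.ofReal_add (by positivity) (by positivity)]
      refine add_le_add ?_ (hRW v hv)
      calc ∫⁻ ω in {ω | W ω ≤ B}, ENNReal.ofReal (f (v - W ω)) ∂μ
          ≤ ∫⁻ ω in {ω | W ω ≤ B}, ENNReal.ofReal (D₁ * f v) ∂μ := by
            refine setLIntegral_mono' (measurableSet_le hW measurable_const) fun ω hω => ?_
            exact ENNReal.ofReal_le_ofReal ((hf.anti (by linarith [hω.out])).trans (hE v B hB0.le))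
        _ ≤ _ := by
            rw [setLIntegral_const]
            exact mul_le_of_le_one_right' prob_le_one
    have h1 := measure_add_gt_inter_le hU hW hind ha hb v (B := Set.Iic v) measurableSet_Iic
    have h2 : μ.real {ω | v < U ω + W ω ∧ W ω ∈ Set.Iic v} ≤ a * ((D₁ + 1) * f v) := by
      refine ENNReal.toReal_le_of_le_ofReal (by positivity) (h1.trans ?_)
      rw [ENNReal.ofReal_mul ha]
      gcongr
    have h3 : μ.real {ω | v < U ω + W ω} ≤
        μ.real {ω | v < U ω + W ω ∧ W ω ∈ Set.Iic v} + μ.real {ω | v < W ω} := by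
      refine (measureReal_mono fun ω hω => ?_).trans (measureReal_union_le _ _)
      rcases le_or_gt (W ω) v with h | h
      · exact Or.inl ⟨hω, h⟩
      · exact Or.inr h
    have h4 := hC v
    have h5 : 0 ≤ f v * (a * (C + (f R)⁻¹) + (1 + D₁ + (f R)⁻¹)) := by positivity
    nlinarith

/-- If the sum exceeds `v`, then `U` or `W` alone exceeds `v - B`, or `W` makes an intermediate
jump, or `W > v` together with `U > B`. The first two give `u + w`; the others are small for large
`B`. -/
lemma limsup_add_le (hf : StrongTail f) {U W : Ω → ℝ} {u w : ℝ} (hU : Measurable U)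
    (hW : Measurable W) (hind : IndepFun U W μ) (hUt : HasTail μ U f u) (hWt : HasTail μ W f w)
    {ε : ℝ} (hε : 0 < ε) : ∀ᶠ v in atTop, μ.real {ω | v < U ω + W ω} / f v ≤ u + w + ε := by
  obtain ⟨C, hC0, hC⟩ := hUt.bound hf
  obtain ⟨B₀, hB₀, hB⟩ := hWt.mid_jump' hf hW (ε := ε / (4 * (C + 1))) (by positivity)
  have hw0 : 0 ≤ w := ge_of_tendsto hWt (Eventually.of_forall fun v => by
    have := hf.pos v; positivity)
  -- choose the level `B`
  have hlim : Tendsto (fun B => C * f B) atTop (𝓝 0) := by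
    simpa using hf.tendsto_zero.const_mul C
  obtain ⟨B, hB1, hB2⟩ := ((hlim.eventually (gt_mem_nhds
    (show (0:ℝ) < ε / (4 * (w + 1)) by positivity))).and (eventually_ge_atTop B₀)).exists
  have hUB : μ.real {ω | B < U ω} ≤ ε / (4 * (w + 1)) := (hC B).trans hB1.le
  have h1 := (hUt.shift hf (-B)).eventually (gt_mem_nhds (show u < u + ε / 4 by linarith))
  have h2 := (hWt.shift hf (-B)).eventually (gt_mem_nhds (show w < w + ε / 4 by linarith))
  have h3 := Tendsto.eventually hWt (gt_mem_nhds (lt_add_one w))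
  filter_upwards [h1, h2, h3, hB B hB2] with v e1 e2 e3 e4
  have hfv := hf.pos v
  rw [div_le_iff₀ hfv]
  rw [div_lt_iff₀ hfv] at e1 e2 e3
  have hsub : {ω | v < U ω + W ω} ⊆ ({ω | v + -B < U ω} ∪ {ω | v + -B < W ω}) ∪
      ({ω | v < U ω + W ω ∧ W ω ∈ Set.Ioc B v} ∪ ({ω | B < U ω} ∩ {ω | v < W ω})) := by
    intro ω hω
    have hω' : v < U ω + W ω := hω
    rcases le_or_gt (W ω) B with h | h
    · exact Or.inl (Or.inl (show v + -B < U ω by linarith))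
    rcases le_or_gt (U ω) B with h' | h'
    · exact Or.inl (Or.inr (show v + -B < W ω by linarith))
    rcases le_or_gt (W ω) v with h'' | h''
    · exact Or.inr (Or.inl ⟨hω, h, h''⟩)
    · exact Or.inr (Or.inr ⟨h', h''⟩)
  have e5 : μ.real {ω | v < U ω + W ω ∧ W ω ∈ Set.Ioc B v} ≤ C * (ε / (4 * (C + 1)) * f v) := by
    have := measure_add_gt_inter_le hU hW hind hC0 hC v (B := Set.Ioc B v) measurableSet_Ioc
    refine ENNReal.toReal_le_of_le_ofReal (by positivity) (this.trans ?_)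
    rw [ENNReal.ofReal_mul hC0]
    gcongr
    exact e4
  have e6 : μ.real ({ω | B < U ω} ∩ {ω | v < W ω}) ≤ ε / (4 * (w + 1)) * ((w + 1) * f v) := by
    rw [show μ.real ({ω | B < U ω} ∩ {ω | v < W ω}) =
      μ.real {ω | B < U ω} * μ.real {ω | v < W ω} by
        simp only [measureReal_def]
        rw [← ENNReal.toReal_mul]
        congr 1
        exact hind.measure_inter_preimage_eq_mul (Set.Ioi B) (Set.Ioi v) measurableSet_Ioi
          measurableSet_Ioi]
    gcongr
  have e7 : C * (ε / (4 * (C + 1)) * f v) ≤ ε / 4 * f v := by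
    have : C / (C + 1) ≤ 1 := by rw [div_le_one (by positivity)]; linarith
    calc _ = C / (C + 1) * (ε / 4 * f v) := by field_simp
      _ ≤ 1 * (ε / 4 * f v) := by gcongr
      _ = _ := one_mul _
  have e8 : ε / (4 * (w + 1)) * ((w + 1) * f v) = ε / 4 * f v := by field_simp
  have := (measureReal_mono (μ := μ) hsub).trans ((measureReal_union_le _ _).trans (add_le_add
    (measureReal_union_le _ _) (measureReal_union_le _ _)))
  linarith

lemma tendsto_abs_le (U : Ω → ℝ) :
    Tendsto (fun B : ℝ => μ.real {ω | |U ω| ≤ B}) atTop (𝓝 1) := by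
  have h1 : Tendsto (fun B : ℝ => μ {ω | |U ω| ≤ B}) atTop (𝓝 (μ (⋃ B : ℝ, {ω | |U ω| ≤ B}))) :=
    tendsto_measure_iUnion_atTop fun a b hab ω hω => le_trans hω.out hab
  have h2 : (⋃ B : ℝ, {ω | |U ω| ≤ B}) = Set.univ :=
    Set.eq_univ_of_forall fun ω => Set.mem_iUnion.2 ⟨|U ω|, le_refl |U ω|⟩
  rw [h2, measure_univ] at h1
  exact (ENNReal.tendsto_toReal ENNReal.one_ne_top).comp h1

/-- One variable is large while the other stays in `[-B, B]`. The two such events are disjoint for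
`v ≥ 0`, independence factorizes each, and for large `B` the second factor is close to 1. -/
lemma le_liminf_add (hf : StrongTail f) {U W : Ω → ℝ} {u w : ℝ} (hU : Measurable U)
    (hW : Measurable W) (hind : IndepFun U W μ) (hUt : HasTail μ U f u) (hWt : HasTail μ W f w)
    {ε : ℝ} (hε : 0 < ε) : ∀ᶠ v in atTop, u + w - ε ≤ μ.real {ω | v < U ω + W ω} / f v := by
  have hlim : Tendsto (fun B : ℝ => u * μ.real {ω | |W ω| ≤ B} + w * μ.real {ω | |U ω| ≤ B}) atTop
      (𝓝 (u + w)) := by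
    simpa using ((tendsto_abs_le W).const_mul u).add ((tendsto_abs_le U).const_mul w)
  obtain ⟨B, hB⟩ := (hlim.eventually (lt_mem_nhds (show u + w - ε < u + w by linarith))).exists
  have h1 := ((hUt.shift hf B).mul_const (μ.real {ω | |W ω| ≤ B})).add
    ((hWt.shift hf B).mul_const (μ.real {ω | |U ω| ≤ B}))
  filter_upwards [h1.eventually (lt_mem_nhds hB), eventually_ge_atTop 0] with v hv hv0
  have hfv := hf.pos v
  refine hv.le.trans ?_
  rw [div_mul_eq_mul_div, div_mul_eq_mul_div, ← add_div]
  gcongr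
  have hp : ∀ (U W : Ω → ℝ), IndepFun U W μ → μ.real {ω | v + B < U ω} * μ.real {ω | |W ω| ≤ B} =
      μ.real ({ω | v + B < U ω} ∩ {ω | |W ω| ≤ B}) := by
    intro U W hind
    simp only [measureReal_def]
    rw [← ENNReal.toReal_mul]
    congr 1
    exact (hind.measure_inter_preimage_eq_mul (Set.Ioi (v + B)) {y | |y| ≤ B} measurableSet_Ioi
      (measurableSet_le (by fun_prop) measurable_const)).symm
  rw [hp U W hind, hp W U hind.symm, ← measureReal_union]
  · refine measureReal_mono ?_
    rintro ω (⟨ha, hb⟩ | ⟨ha, hb⟩)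
    · have := (abs_le.1 hb.out).1
      have ha : v + B < U ω := ha
      show v < U ω + W ω
      linarith
    · have := (abs_le.1 hb.out).1
      have ha : v + B < W ω := ha
      show v < U ω + W ω
      linarith
  · rw [Set.disjoint_left]
    rintro ω ⟨ha, -⟩ ⟨-, hb⟩
    have ha : v + B < U ω := ha
    linarith [(abs_le.1 hb.out).2]
  · exact (measurableSet_lt measurable_const hW).inter (measurableSet_le hU.abs measurable_const)

/-- The tails of independent variables add up. -/
theorem add (hf : StrongTail f) {U W : Ω → ℝ} {u w : ℝ} (hU : Measurable U)
    (hW : Measurable W) (hind : IndepFun U W μ) (hUt : HasTail μ U f u) (hWt : HasTail μ W f w) :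
    HasTail μ (fun ω => U ω + W ω) f (u + w) := by
  rw [HasTail, Metric.tendsto_nhds]
  intro ε hε
  filter_upwards [limsup_add_le hf hU hW hind hUt hWt (half_pos hε),
    le_liminf_add hf hU hW hind hUt hWt (half_pos hε)] with v h1 h2
  rw [Real.dist_eq, abs_lt]
  constructor <;> linarith

omit [IsProbabilityMeasure μ] in
lemma const_add (hf : StrongTail f) {U : Ω → ℝ} {u : ℝ} (h : HasTail μ U f u) (s : ℝ) :
    HasTail μ (fun ω => U ω + s) f u := by
  refine (h.shift hf (-s)).congr fun v => ?_
  simp only [← sub_eq_add_neg, sub_lt_iff_lt_add]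

end HasTail

variable {Y : ℕ → Ω → ℝ}

lemma hasTail_partialSum (hf : StrongTail f) (hY : ∀ n, Measurable (Y n))
    (hid : ∀ n, IdentDistrib (Y n) (Y 0) μ μ) (hind : iIndepFun Y μ) (ht : HasTail μ (Y 0) f 1)
    (k : ℕ) : HasTail μ (partialSum Y k) f k := by
  induction k with
  | zero =>
    refine tendsto_const_nhds.congr' ?_
    filter_upwards [eventually_ge_atTop 0] with v hv
    simp [not_lt.2 hv]
  | succ k ih =>
    have h1 : HasTail μ (Y k) f 1 := by
      refine ht.congr fun v => ?_
      congr 1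
      exact congrArg ENNReal.toReal ((hid k).measure_mem_eq (s := Set.Ioi v) measurableSet_Ioi).symm
    have h2 : IndepFun (partialSum Y k) (Y k) μ := by
      have := hind.indepFun_finsetSum_of_notMem hY (s := Finset.range k) (i := k) (by simp)
      convert this using 1
      ext ω; simp [partialSum]
    have h3 : Measurable (partialSum Y k) := Finset.measurable_fun_sum _ fun i _ => hY i
    have := HasTail.add hf h3 (hY k) h2 ih h1
    push_cast
    refine this.congr fun v => ?_
    simp only [partialSum_succ]

/-- A uniform bound for the tails of the partial sums. -/
lemma exists_partialSum_bound (hf : StrongTail f) (hY : ∀ n, Measurable (Y n))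
    (hid : ∀ n, IdentDistrib (Y n) (Y 0) μ μ) (hind : iIndepFun Y μ) (ht : HasTail μ (Y 0) f 1) :
    ∃ K ≥ 1, ∀ (k : ℕ) (v : ℝ), μ.real {ω | v < partialSum Y k ω} ≤ K ^ (k + 1) * f v := by
  obtain ⟨D, hD1, hD⟩ := ht.exists_add_bound hf (hY 0)
  have hf0 := inv_pos.2 (hf.pos 0)
  set K := 2 * D + (f 0)⁻¹ with hK
  have hK1 : 1 ≤ K := by linarith
  refine ⟨K, hK1, fun k => ?_⟩
  induction k with
  | zero =>
    intro v
    rcases le_or_gt 0 v with hv | hv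
    · have : 0 ≤ K ^ (0 + 1) * f v := mul_nonneg (by positivity) (hf.nonneg v)
      simpa [not_lt.2 hv] using this
    · refine measureReal_le_one.trans ?_
      have h1 : 1 ≤ (f 0)⁻¹ * f v := by
        rw [inv_mul_eq_div, one_le_div (hf.pos 0)]; exact hf.anti hv.le
      refine h1.trans (mul_le_mul_of_nonneg_right ?_ (hf.nonneg v))
      rw [zero_add, pow_one]; linarith
  | succ k ih =>
    intro v
    have h2 : IndepFun (partialSum Y k) (Y k) μ := by
      have := hind.indepFun_finsetSum_of_notMem hY (s := Finset.range k) (i := k) (by simp)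
      convert this using 1
      ext ω; simp [partialSum]
    have h3 : Measurable (partialSum Y k) := Finset.measurable_fun_sum _ fun i _ => hY i
    have := hD _ _ h3 (hY k) (hid k) h2 (K ^ (k + 1)) (by positivity) ih v
    simp only [partialSum_succ]
    refine this.trans (mul_le_mul_of_nonneg_right ?_ (hf.nonneg v))
    -- Each summand maps the constant `a` to `D (1 + a)`; for `a ≥ 1` and `K ≥ 2 D` this is at most
    -- `K a`.
    have h4 : 1 ≤ K ^ (k + 1) := one_le_pow₀ hK1
    rw [pow_succ _ (k + 1)]
    nlinarith

/-- Decomposition of the tail of a randomly stopped sequence. -/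
lemma hasSum_random {Z : ℕ → Ω → ℝ} {N : Ω → ℕ} (hN : Measurable N) (hZ : ∀ k, Measurable (Z k))
    (hind : ∀ k, IndepFun N (Z k) μ) (v : ℝ) :
    HasSum (fun k => μ.real {ω | N ω = k} * μ.real {ω | v < Z k ω})
      (μ.real {ω | v < Z (N ω) ω}) := by
  have hms : ∀ k, MeasurableSet {ω | N ω = k} := fun k => hN (measurableSet_singleton k)
  have hU : {ω | v < Z (N ω) ω} = ⋃ k, ({ω | N ω = k} ∩ {ω | v < Z k ω}) := by
    ext ω
    simp only [Set.mem_iUnion, Set.mem_inter_iff, Set.mem_ofPred_eq]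
    exact ⟨fun h => ⟨N ω, rfl, h⟩, fun ⟨k, h1, h2⟩ => h1 ▸ h2⟩
  have h1 : ∀ k, μ ({ω | N ω = k} ∩ {ω | v < Z k ω}) = μ {ω | N ω = k} * μ {ω | v < Z k ω} :=
    fun k => (hind k).measure_inter_preimage_eq_mul {k} (Set.Ioi v) (measurableSet_singleton k)
      measurableSet_Ioi
  have h2 : μ {ω | v < Z (N ω) ω} = ∑' k, μ {ω | N ω = k} * μ {ω | v < Z k ω} := by
    rw [hU, measure_iUnion]
    · simp_rw [h1]
    · intro i j hij
      refine Set.disjoint_left.2 ?_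
      rintro ω ⟨ha, -⟩ ⟨hb, -⟩
      exact hij (ha.out.symm.trans hb.out)
    · exact fun k => (hms k).inter (measurableSet_lt measurable_const (hZ k))
  have h3 : (∑' k, μ {ω | N ω = k} * μ {ω | v < Z k ω}) ≠ ∞ := h2 ▸ measure_ne_top _ _
  have h4 := ENNReal.hasSum_toReal h3
  rw [← ENNReal.tsum_toReal_eq (ENNReal.ne_top_of_tsum_ne_top h3), ← h2] at h4
  simpa only [ENNReal.toReal_mul, measureReal_def] using h4

/-- The expectation of a variable with values in `ℕ`. -/
lemma integrable_nat_of_summable {N : Ω → ℕ} (hN : Measurable N) {φ : ℕ → ℝ} (hφ : ∀ k, 0 ≤ φ k)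
    (hs : Summable fun k => μ.real {ω | N ω = k} * φ k) :
    Integrable (fun ω => φ (N ω)) μ ∧
      ∫ ω, φ (N ω) ∂μ = ∑' k, μ.real {ω | N ω = k} * φ k := by
  have hms : ∀ k, MeasurableSet {ω | N ω = k} := fun k => hN (measurableSet_singleton k)
  have hmap : ∀ k, (μ.map N).real {k} = μ.real {ω | N ω = k} := fun k => by
    rw [map_measureReal_apply hN (measurableSet_singleton k)]; rfl
  have hi : Integrable φ (μ.map N) := by
    rw [← lintegral_ofReal_ne_top_iff_integrable (Measurable.of_discrete).aestronglyMeasurable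
      (Eventually.of_forall hφ), lintegral_countable']
    have : ∀ k, ENNReal.ofReal (φ k) * (μ.map N) {k} =
        ENNReal.ofReal (μ.real {ω | N ω = k} * φ k) := fun k => by
      rw [Measure.map_apply hN (measurableSet_singleton k), mul_comm,
        ENNReal.ofReal_mul measureReal_nonneg, ofReal_measureReal]; rfl
    simp_rw [this]
    exact hs.tsum_ofReal_ne_top
  refine ⟨hi.comp_measurable hN, ?_⟩
  rw [← integral_map hN.aemeasurable hi.1, integral_countable hi]
  simp [hmap]

/-- The tail of a random sum with light-tailed number of summands. -/
theorem hasTail_random (hf : StrongTail f) {Z : ℕ → Ω → ℝ} {N : Ω → ℕ} (hN : Measurable N)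
    (hZ : ∀ k, Measurable (Z k)) (hind : ∀ k, IndepFun N (Z k) μ)
    (ht : ∀ k : ℕ, HasTail μ (Z k) f k)
    {K : ℝ} (hK : 2 ≤ K) (hb : ∀ k v, μ.real {ω | v < Z k ω} ≤ K ^ (k + 1) * f v)
    (hs : Summable fun k => μ.real {ω | N ω = k} * K ^ (k + 1)) :
    HasTail μ (fun ω => Z (N ω) ω) f (∫ ω, (N ω : ℝ) ∂μ) := by
  have hs' : Summable fun k : ℕ => μ.real {ω | N ω = k} * (k : ℝ) := by
    refine Summable.of_nonneg_of_le (fun k => by positivity) (fun k => ?_) hs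
    gcongr
    have h1 : (k : ℝ) ≤ 2 ^ k := by exact_mod_cast Nat.lt_two_pow_self.le
    calc (k : ℝ) ≤ 2 ^ k := h1
      _ ≤ K ^ k := by gcongr
      _ ≤ K ^ (k + 1) := pow_le_pow_right₀ (by linarith) (Nat.le_succ k)
  rw [(integrable_nat_of_summable hN (φ := fun k => (k : ℝ)) (fun k => by positivity) hs').2]
  -- Each term of the series over the value of `N` converges after division by `f v`, and the
  -- geometric bound is summable against the law of `N`.
  have := tendsto_tsum_of_dominated_convergence (𝓕 := atTop)
    (f := fun v k => μ.real {ω | N ω = k} * (μ.real {ω | v < Z k ω} / f v)) hs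
    (fun k => (ht k).const_mul _) (Eventually.of_forall fun v k => by
      have hfv := hf.pos v
      rw [Real.norm_of_nonneg (by positivity)]
      gcongr
      rw [div_le_iff₀ hfv]
      exact hb k v)
  refine this.congr fun v => ?_
  simp_rw [← mul_div_assoc]
  rw [tsum_div_const, (hasSum_random hN hZ hind v).tsum_eq]

end

end RandomTimeMaxima

/-! ### Deterministic properties of the paths -/

namespace RandomTimeMaxima

section

/-- The space of the inter-arrival times and jump sizes. -/
abbrev Marks : Type := (ℕ → ℝ) × (ℕ → ℝ)

/-- The inter-arrival times as coordinates. -/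
def gapAt (i : ℕ) (z : Marks) : ℝ := z.1 i

/-- The jump sizes as coordinates. -/
def jumpAt (i : ℕ) (z : Marks) : ℝ := z.2 i

/-- The marks of a path with finitely many genuine jumps on bounded intervals. -/
structure GoodMarks (z : Marks) : Prop where
  gap_pos : ∀ i, 0 < z.1 i
  jump_ne : ∀ i, z.2 i ≠ 0
  tendsto : Tendsto (fun n => epoch gapAt n z) atTop atTop

/-- The number of jumps in `[0, t]`. -/
noncomputable def pathCount (z : Marks) (t : ℝ≥0) : ℕ := (count gapAt t z).toNat

/-- The path of the compound process. -/
noncomputable def pathX (c : ℝ) (z : Marks) (t : ℝ≥0) : ℝ := compound gapAt jumpAt c t z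

lemma epoch_succ {Ω : Type*} (gap : ℕ → Ω → ℝ) (n : ℕ) (ω : Ω) :
    epoch gap (n + 1) ω = epoch gap n ω + gap n ω := Finset.sum_range_succ _ _

lemma epoch_zero {Ω : Type*} (gap : ℕ → Ω → ℝ) (ω : Ω) : epoch gap 0 ω = 0 := by simp [epoch]

lemma pathX_eq (c : ℝ) (z : Marks) (t : ℝ≥0) :
    pathX c z t = (∑ i ∈ Finset.range (pathCount z t), z.2 i) + c * t := rfl

namespace GoodMarks

variable {z : Marks} (hz : GoodMarks z)
include hz

lemma strictMono : StrictMono fun n => epoch gapAt n z :=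
  strictMono_nat_of_lt_succ fun n => by
    rw [epoch_succ]; exact lt_add_of_pos_right _ (hz.gap_pos n)

/-- The count is the least index whose following epoch exceeds `t`; such an index exists because the
epochs tend to infinity. -/
lemma count_eq (t : ℝ≥0) : ∃ m : ℕ, count gapAt t z = m ∧
    ∀ k : ℕ, k < m ↔ epoch gapAt (k + 1) z ≤ t := by
  classical
  have hex : ∃ n, (t : ℝ) < epoch gapAt (n + 1) z :=
    (((tendsto_add_atTop_iff_nat 1).2 hz.tendsto).eventually (eventually_gt_atTop (t : ℝ))).exists
  have hiff : ∀ k : ℕ, k < Nat.find hex ↔ epoch gapAt (k + 1) z ≤ t := fun k => by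
    constructor
    · exact fun h => not_lt.1 (Nat.find_min hex h)
    · intro h
      by_contra h'
      have h1 := Nat.find_spec hex
      have h2 := hz.strictMono.monotone (show Nat.find hex + 1 ≤ k + 1 by omega)
      linarith
  refine ⟨Nat.find hex, ?_, hiff⟩
  have hset : {n : ℕ | ENNReal.ofReal (epoch gapAt (n + 1) z) ≤ (t : ℝ≥0∞)} =
      (Finset.range (Nat.find hex) : Set ℕ) := by
    ext k
    rw [Finset.coe_range, Set.mem_Iio, hiff, Set.mem_ofPred_eq,
      ← ENNReal.ofReal_coe_nnreal, ENNReal.ofReal_le_ofReal_iff t.coe_nonneg]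
  unfold count
  rw [hset, Set.encard_coe_eq_coe_finsetCard, Finset.card_range]

lemma coe_pathCount (t : ℝ≥0) : (pathCount z t : ℕ∞) = count gapAt t z := by
  obtain ⟨m, hm, -⟩ := hz.count_eq t
  simp [pathCount, hm]

lemma lt_pathCount (t : ℝ≥0) (k : ℕ) : k < pathCount z t ↔ epoch gapAt (k + 1) z ≤ t := by
  obtain ⟨m, hm, h⟩ := hz.count_eq t
  rw [pathCount, hm, ENat.toNat_natCast, h]

lemma pathCount_eq_iff (t : ℝ≥0) (k : ℕ) :
    pathCount z t = k ↔ epoch gapAt k z ≤ t ∧ (t : ℝ) < epoch gapAt (k + 1) z := by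
  have h1 : pathCount z t = k ↔ k ≤ pathCount z t ∧ ¬ k < pathCount z t := by omega
  rw [h1, hz.lt_pathCount, not_le, and_congr_left_iff]
  intro _
  cases k with
  | zero => simp [epoch_zero]
  | succ k => exact hz.lt_pathCount t k

lemma pathCount_mono : Monotone (pathCount z) := fun s t hst => by
  by_contra h
  have h1 := (hz.lt_pathCount s (pathCount z t)).1 (not_le.1 h)
  have h2 := (hz.lt_pathCount t (pathCount z t)).2 (h1.trans hst)
  omega

lemma pathCount_zero : pathCount z 0 = 0 := by
  rw [hz.pathCount_eq_iff]
  simp only [epoch_zero, NNReal.coe_zero, le_refl, true_and, epoch_succ, zero_add]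
  exact hz.gap_pos 0

lemma pathX_zero (c : ℝ) : pathX c z 0 = 0 := by
  simp [pathX_eq, hz.pathCount_zero]

omit hz in
lemma count_top : count gapAt ⊤ z = ⊤ := by
  have : {n : ℕ | ENNReal.ofReal (epoch gapAt (n + 1) z) ≤ ⊤} = Set.univ := by ext; simp
  rw [count, this, Set.encard_univ]; simp

/-- Paths are constant up to the drift for a short time. -/
lemma exists_pathCount_eq (t : ℝ≥0) : ∃ t' > t, ∀ s, t ≤ s → s < t' → pathCount z s = pathCount z t := by
  have h := (hz.pathCount_eq_iff t _).1 rfl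
  have h0 : 0 ≤ epoch gapAt (pathCount z t + 1) z := t.2.trans h.2.le
  refine ⟨⟨epoch gapAt (pathCount z t + 1) z, h0⟩, h.2, fun s hs hs' => ?_⟩
  rw [hz.pathCount_eq_iff]
  exact ⟨h.1.trans hs, hs'⟩

end GoodMarks

/-- The marks seen from time `t` on. -/
noncomputable def shiftMarks (t : ℝ≥0) (z : Marks) : Marks :=
  (fun i => if i = 0 then epoch gapAt (pathCount z t + 1) z - t else z.1 (pathCount z t + i),
    fun i => z.2 (pathCount z t + i))

/-- The first gap of the shifted marks is the residual time until the next jump, and all later gaps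
are the old ones. -/
lemma epoch_shiftMarks (t : ℝ≥0) (z : Marks) (j : ℕ) :
    epoch gapAt (j + 1) (shiftMarks t z) = epoch gapAt (pathCount z t + j + 1) z - t := by
  induction j with
  | zero => simp [epoch_succ, epoch_zero, gapAt, shiftMarks]
  | succ j ih =>
    rw [epoch_succ, ih, show pathCount z t + (j + 1) + 1 = (pathCount z t + j + 1) + 1 by ring,
      epoch_succ gapAt (pathCount z t + j + 1)]
    simp only [gapAt, shiftMarks, Nat.succ_ne_zero, if_false]
    rw [show pathCount z t + (j + 1) = pathCount z t + j + 1 by ring]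
    ring

namespace GoodMarks

variable {z : Marks} (hz : GoodMarks z)
include hz

lemma shift (t : ℝ≥0) : GoodMarks (shiftMarks t z) where
  gap_pos i := by
    simp only [shiftMarks]
    split_ifs with h
    · exact sub_pos.2 ((hz.pathCount_eq_iff t _).1 rfl).2
    · exact hz.gap_pos _
  jump_ne i := hz.jump_ne _
  tendsto := by
    rw [← tendsto_add_atTop_iff_nat 1]
    simp only [epoch_shiftMarks]
    refine tendsto_atTop_add_const_right _ _ (hz.tendsto.comp ?_)
    exact tendsto_atTop_mono (fun n => show n ≤ pathCount z t + n + 1 by omega) tendsto_id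

lemma pathCount_add (t s : ℝ≥0) :
    pathCount z (t + s) = pathCount z t + pathCount (shiftMarks t z) s := by
  have h1 := ((hz.shift t).pathCount_eq_iff s _).1 rfl
  have h2 := (hz.pathCount_eq_iff t _).1 rfl
  rw [hz.pathCount_eq_iff, NNReal.coe_add]
  refine ⟨?_, ?_⟩
  · rcases Nat.eq_zero_or_pos (pathCount (shiftMarks t z) s) with h | h
    · rw [h, add_zero]; linarith [h2.1, s.2]
    · obtain ⟨j, hj⟩ := Nat.exists_eq_succ_of_ne_zero h.ne'
      rw [hj] at h1 ⊢
      have := h1.1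
      rw [Nat.succ_eq_add_one, epoch_shiftMarks] at this
      rw [Nat.succ_eq_add_one, ← add_assoc]
      linarith
  · have := h1.2
    rw [epoch_shiftMarks] at this
    linarith

/-- Turns every question about increments after `t` into one about the law of the shifted marks. -/
lemma pathX_add (c : ℝ) (t s : ℝ≥0) :
    pathX c z (t + s) - pathX c z t = pathX c (shiftMarks t z) s := by
  simp only [pathX_eq, hz.pathCount_add, Finset.sum_range_add, NNReal.coe_add, shiftMarks]
  ring

/-- A bound for the path by the positive parts of the jumps. -/
lemma pathX_le (c : ℝ) {t h : ℝ≥0} (hth : t ≤ h) :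
    pathX c z t ≤ (∑ i ∈ Finset.range (pathCount z h), max (z.2 i) 0) + max c 0 * h := by
  rw [pathX_eq]
  refine add_le_add ?_ ?_
  · refine (Finset.sum_le_sum fun i _ => le_max_left (z.2 i) 0).trans ?_
    exact Finset.sum_le_sum_of_subset_of_nonneg
      (Finset.range_subset_range.2 (hz.pathCount_mono hth)) fun i _ _ => le_max_right _ _
  · exact (mul_le_mul_of_nonneg_right (le_max_left c 0) t.2).trans
      (mul_le_mul_of_nonneg_left hth (le_max_right _ _))

/-- Paths are right-continuous. -/
lemma exists_lt_pathX (c : ℝ) {t : ℝ≥0} {x : ℝ} (hx : x < pathX c z t) :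
    ∃ t' > t, ∀ s, t ≤ s → s < t' → x < pathX c z s := by
  obtain ⟨t₁, h1, h2⟩ := hz.exists_pathCount_eq t
  -- During a time `d` the drift moves the path by less than the margin above `x`; the `+ 1` covers
  -- `c = 0`.
  set d := (pathX c z t - x) / (|c| + 1) with hd
  have hd0 : 0 < d := div_pos (by linarith) (by positivity)
  refine ⟨min t₁ (t + ⟨d, hd0.le⟩), lt_min h1 (lt_add_of_pos_right t hd0), fun s hs hs' => ?_⟩
  have h3 := h2 s hs (hs'.trans_le (min_le_left _ _))
  have h4 : (s : ℝ) < t + d := by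
    have := hs'.trans_le (min_le_right _ _)
    exact_mod_cast this
  have h5 : (t : ℝ) ≤ s := hs
  rw [pathX_eq, h3]
  rw [pathX_eq] at hx hd
  have h6 : |c| * (s - t) < pathX c z t - x := by
    have h7 : d * (|c| + 1) = pathX c z t - x := by
      rw [hd, ← pathX_eq, div_mul_cancel₀ _ (by positivity)]
    nlinarith [abs_nonneg c]
  rw [pathX_eq] at h6
  nlinarith [neg_abs_le c, abs_nonneg c]

end GoodMarks

end

end RandomTimeMaxima

/-! ### Memorylessness and stationarity of the marks -/

namespace RandomTimeMaxima

section

/-- Memorylessness of the exponential law, by translating its density by `s`. The point zero is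
discarded because the strict inequality excludes it on one side only. -/
lemma expMeasure_Ioi_inter {r s : ℝ} (hs : 0 ≤ s) {B : Set ℝ}
    (hB : MeasurableSet B) :
    expMeasure r {g | s < g ∧ g - s ∈ B} = ENNReal.ofReal (Real.exp (-r * s)) * expMeasure r B := by
  have hm : MeasurableSet {g : ℝ | s < g ∧ g - s ∈ B} :=
    measurableSet_Ioi.inter ((measurable_id.sub_const s) hB)
  have hpm : Measurable (exponentialPDF r) := (measurable_exponentialPDFReal r).ennreal_ofReal
  have e : expMeasure r = volume.withDensity (exponentialPDF r) := rfl
  rw [e, withDensity_apply _ hm, withDensity_apply _ hB, ← lintegral_indicator hm,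
    ← lintegral_indicator hB,
    ← lintegral_add_right_eq_self (fun g => {g | s < g ∧ g - s ∈ B}.indicator (exponentialPDF r) g) s,
    ← lintegral_const_mul _ (hpm.indicator hB)]
  refine lintegral_congr_ae ?_
  filter_upwards [compl_mem_ae_iff.2 (measure_singleton (μ := volume) (0:ℝ))] with g hg
  have hg0 : g ≠ 0 := hg
  rcases lt_or_gt_of_ne hg0 with h | h
  · rw [Set.indicator_of_notMem (by simp [h.le])]
    by_cases hgB : g ∈ B
    · rw [Set.indicator_of_mem hgB, exponentialPDF_of_neg h, mul_zero]
    · rw [Set.indicator_of_notMem hgB, mul_zero]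
  · by_cases hgB : g ∈ B
    · rw [Set.indicator_of_mem hgB, Set.indicator_of_mem (by simp [h, hgB]),
        exponentialPDF_of_nonneg h.le, exponentialPDF_of_nonneg (by linarith),
        ← ENNReal.ofReal_mul (Real.exp_pos _).le]
      congr 1
      rw [show -(r * (g + s)) = -r * s + -(r * g) by ring, Real.exp_add]
      ring
    · rw [Set.indicator_of_notMem hgB, mul_zero, Set.indicator_of_notMem (by simp [hgB])]

/-- The law of the inter-arrival times. -/
noncomputable def gapLaw (r : ℝ) : Measure (ℕ → ℝ) := Measure.infinitePi fun _ => expMeasure r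

/-- Ageing of the first inter-arrival time. -/
def ageFirst (s : ℝ) (g : ℕ → ℝ) (i : ℕ) : ℝ := if i = 0 then g 0 - s else g i

lemma measurable_ageFirst : Measurable fun q : ℝ × (ℕ → ℝ) => ageFirst q.1 q.2 := by
  refine measurable_pi_lambda _ fun i => ?_
  unfold ageFirst
  split_ifs <;> fun_prop

/-- The memoryless property of the sequence of inter-arrival times. -/
lemma gapLaw_ageFirst {r : ℝ} (hr : 0 < r) {s : ℝ} (hs : 0 ≤ s) {A : Set (ℕ → ℝ)}
    (hA : MeasurableSet A) :
    gapLaw r {g | s < g 0 ∧ ageFirst s g ∈ A} =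
      ENNReal.ofReal (Real.exp (-r * s)) * gapLaw r A := by
  have := isProbabilityMeasure_expMeasure hr
  have hφ : Measurable (ageFirst s) := measurable_ageFirst.comp measurable_prodMk_left
  have hS : MeasurableSet {g : ℕ → ℝ | s < g 0} :=
    measurableSet_lt measurable_const (measurable_pi_apply 0)
  set κ := ENNReal.ofReal (Real.exp (-r * s)) with hκ
  have hκ0 : κ ≠ 0 := by simp [hκ, Real.exp_pos]
  have hκt : κ ≠ ∞ := ENNReal.ofReal_ne_top
  -- The law of the sequence conditioned on a first gap above `s` and then aged by `s`. It is
  -- identified on finite-dimensional boxes, which determine an infinite product.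
  set ν : Measure (ℕ → ℝ) := κ⁻¹ • ((gapLaw r).restrict {g | s < g 0}).map (ageFirst s) with hν
  have hνA : ∀ A, MeasurableSet A → ν A = κ⁻¹ * gapLaw r {g | s < g 0 ∧ ageFirst s g ∈ A} := by
    intro A hA
    rw [hν, Measure.smul_apply, smul_eq_mul, Measure.map_apply hφ hA,
      Measure.restrict_apply (hφ hA), Set.inter_comm]
    rfl
  have key : ν = gapLaw r := by
    refine Measure.eq_infinitePi _ fun t B hB => ?_
    have hpi : MeasurableSet (Set.pi (t : Set ℕ) B) :=
      MeasurableSet.pi t.countable_toSet fun i _ => hB i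
    rw [hνA _ hpi]
    -- The conditioning constrains coordinate 0 even when the box does not; in that case the box is
    -- given the whole line there.
    set B₀ : Set ℝ := if 0 ∈ t then B 0 else Set.univ with hB₀
    have hB₀m : MeasurableSet B₀ := by
      rw [hB₀]; split_ifs
      · exact hB 0
      · exact MeasurableSet.univ
    set B' : ℕ → Set ℝ := fun i => if i = 0 then {g | s < g ∧ g - s ∈ B₀} else B i with hB'
    have hset : {g : ℕ → ℝ | s < g 0 ∧ ageFirst s g ∈ Set.pi (t : Set ℕ) B} =
        Set.pi ((insert 0 (t.erase 0) : Finset ℕ) : Set ℕ) B' := by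
      ext g
      simp only [Set.mem_ofPred_eq, Set.mem_pi, Finset.mem_coe, Finset.mem_insert, Finset.mem_erase,
        hB', hB₀, ageFirst]
      constructor
      · rintro ⟨h1, h2⟩ i hi
        by_cases hi0 : i = 0
        · subst hi0
          rw [if_pos rfl]
          refine ⟨h1, ?_⟩
          split_ifs with h0
          · simpa using h2 0 h0
          · trivial
        · have := h2 i (by tauto)
          simpa [hi0] using this
      · intro h
        have h0 := h 0 (Or.inl rfl)
        rw [if_pos rfl] at h0
        refine ⟨h0.1, fun i hi => ?_⟩
        by_cases hi0 : i = 0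
        · subst hi0
          have := h0.2
          rw [if_pos hi] at this
          simpa using this
        · have := h i (Or.inr ⟨hi0, hi⟩)
          simpa [hi0] using this
    have hB'm : ∀ i ∈ insert 0 (t.erase 0), MeasurableSet (B' i) := fun i _ => by
      simp only [hB']
      split_ifs
      · exact measurableSet_Ioi.inter ((measurable_id.sub_const s) hB₀m)
      · exact hB i
    rw [hset, gapLaw, Measure.infinitePi_pi _ hB'm, Finset.prod_insert (by simp)]
    have h1 : ∏ i ∈ t.erase 0, expMeasure r (B' i) = ∏ i ∈ t.erase 0, expMeasure r (B i) :=
      Finset.prod_congr rfl fun i hi => by simp [hB', Finset.ne_of_mem_erase hi]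
    have h2 : expMeasure r (B' 0) = κ * expMeasure r B₀ := by
      simp only [hB', if_true]
      exact expMeasure_Ioi_inter hs hB₀m
    rw [h1, h2, mul_assoc, ← mul_assoc κ⁻¹, ENNReal.inv_mul_cancel hκ0 hκt, one_mul, hB₀]
    split_ifs with h0
    · exact Finset.mul_prod_erase t (fun i => expMeasure r (B i)) h0
    · rw [measure_univ, one_mul, Finset.erase_eq_of_notMem h0]
  rw [← key, hνA _ hA, ← mul_assoc, ENNReal.mul_inv_cancel hκ0 hκt, one_mul, key]

namespace IsCompoundPoissonData

variable {Ω : Type*} [mΩ : MeasurableSpace Ω] {μ : Measure Ω} {r : ℝ}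
  {gap Y : ℕ → Ω → ℝ} (h : IsCompoundPoissonData μ r gap Y)

/-- The marks as a random variable. -/
def marks (gap Y : ℕ → Ω → ℝ) (ω : Ω) : Marks := (fun i => gap i ω, fun i => Y i ω)

include h

lemma measurable_marks : Measurable (marks gap Y) :=
  (measurable_pi_lambda _ h.measurable_gap).prodMk (measurable_pi_lambda _ h.measurable_jump)

lemma map_gap (k : ℕ) : μ.map (fun ω i => gap (k + i) ω) = gapLaw r := by
  have := (h.indep_gap.precomp (g := fun i => k + i) (add_right_injective k)).map_fun_eq_infinitePi_map
    fun i => h.measurable_gap _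
  rw [this, gapLaw]
  congr 1
  ext1 i
  exact h.law_gap _

lemma map_jump (k : ℕ) : μ.map (fun ω i => Y (k + i) ω) =
    Measure.infinitePi fun _ => μ.map (Y 0) := by
  have := (h.indep_jump.precomp (g := fun i => k + i) (add_right_injective k)).map_fun_eq_infinitePi_map
    fun i => h.measurable_jump _
  rw [this]
  congr 1
  ext1 i
  exact (h.identDistrib_jump _).map_eq

lemma measurable_epoch (k : ℕ) : Measurable (epoch gap k) :=
  Finset.measurable_fun_sum _ fun i _ => h.measurable_gap i

lemma indepFun_epoch (k : ℕ) : IndepFun (epoch gap k) (fun ω i => gap (k + i) ω) μ := by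
  have h1 := indep_iSup_of_disjoint (fun i => (h.measurable_gap i).comap_le)
    ((iIndepFun_iff_iIndep _ _ _).1 h.indep_gap) (S := Set.Iio k) (T := Set.Ici k)
    (Set.disjoint_left.2 fun i h1 h2 => absurd (Set.mem_Ici.1 h2) (not_le.2 h1))
  refine indep_of_indep_of_le_left (indep_of_indep_of_le_right h1 ?_) ?_
  · refine Measurable.comap_le ?_
    refine @measurable_pi_lambda _ _ _ (_) _ _ fun i => ?_
    refine (comap_measurable (gap (k + i))).mono ?_ le_rfl
    exact le_iSup₂_of_le (f := fun i (_ : i ∈ Set.Ici k) =>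
      MeasurableSpace.comap (gap i) inferInstance) (k + i) (Nat.le_add_right k i) le_rfl
  · refine Measurable.comap_le ?_
    refine Finset.measurable_fun_sum _ fun i hi => ?_
    refine (comap_measurable (gap i)).mono ?_ le_rfl
    exact le_iSup₂_of_le (f := fun i (_ : i ∈ Set.Iio k) =>
      MeasurableSpace.comap (gap i) inferInstance) i (Finset.mem_range.1 hi) le_rfl

/-- Dropping `exp (-r g)` leaves `r / θ` times the exponential density of rate `θ`. The crude value
suffices since `θ` stays free. -/
lemma mgf_gap_le {θ : ℝ} (hθ : 0 < θ) (i : ℕ) :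
    Integrable (fun ω => Real.exp (-θ * gap i ω)) μ ∧ mgf (gap i) μ (-θ) ≤ r / θ := by
  have hr := h.rate_pos
  have hm : Measurable fun g : ℝ => Real.exp (-θ * g) := by fun_prop
  have hpm : Measurable (exponentialPDF r) := (measurable_exponentialPDFReal r).ennreal_ofReal
  have hpθ : Measurable (exponentialPDF θ) := (measurable_exponentialPDFReal θ).ennreal_ofReal
  have e : expMeasure r = volume.withDensity (exponentialPDF r) := rfl
  have hl : ∫⁻ ω, ENNReal.ofReal (Real.exp (-θ * gap i ω)) ∂μ ≤ ENNReal.ofReal (r / θ) := by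
    rw [← lintegral_map (f := fun g => ENNReal.ofReal (Real.exp (-θ * g))) hm.ennreal_ofReal
      (h.measurable_gap i), h.law_gap, e, lintegral_withDensity_eq_lintegral_mul _ hpm
      hm.ennreal_ofReal]
    calc _ ≤ ∫⁻ g, ENNReal.ofReal (r / θ) * exponentialPDF θ g := by
          refine lintegral_mono fun g => ?_
          rw [Pi.mul_apply]
          rcases lt_or_ge g 0 with hg | hg
          · simp [exponentialPDF_of_neg hg]
          · rw [exponentialPDF_of_nonneg hg, exponentialPDF_of_nonneg hg,
              ← ENNReal.ofReal_mul (by positivity), ← ENNReal.ofReal_mul (by positivity)]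
            refine ENNReal.ofReal_le_ofReal ?_
            have h1 : Real.exp (-(r * g)) ≤ 1 := Real.exp_le_one_iff.2 (by nlinarith)
            have h2 : r / θ * (θ * Real.exp (-(θ * g))) = r * Real.exp (-θ * g) := by
              rw [show -θ * g = -(θ * g) by ring]; field_simp
            rw [h2, mul_assoc]
            exact mul_le_mul_of_nonneg_left (mul_le_of_le_one_left (Real.exp_pos _).le h1) hr.le
      _ = _ := by
          rw [lintegral_const_mul _ hpθ, lintegral_exponentialPDF_eq_one hθ, mul_one]
  have hi : Integrable (fun ω => Real.exp (-θ * gap i ω)) μ := by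
    have hmg : Measurable fun ω => Real.exp (-θ * gap i ω) := hm.comp (h.measurable_gap i)
    rw [← lintegral_ofReal_ne_top_iff_integrable hmg.aestronglyMeasurable
      (Eventually.of_forall fun ω => (Real.exp_pos _).le)]
    exact ne_top_of_le_ne_top ENNReal.ofReal_ne_top hl
  refine ⟨hi, ?_⟩
  rw [mgf, integral_eq_lintegral_of_nonneg_ae (Eventually.of_forall fun ω => (Real.exp_pos _).le)
    hi.1]
  exact ENNReal.toReal_le_of_le_ofReal (by positivity) hl

/-- Exponential bound for the epochs. -/
lemma measureReal_epoch_le (k : ℕ) {θ : ℝ} (hθ : 0 < θ) (t : ℝ) :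
    μ.real {ω | epoch gap k ω ≤ t} ≤ Real.exp (θ * t) * (r / θ) ^ k := by
  have := h.indep_gap.isProbabilityMeasure
  have hs : epoch gap k = ∑ i ∈ Finset.range k, gap i := by ext ω; simp [epoch]
  have h1 := measure_le_le_exp_mul_mgf (μ := μ) (X := epoch gap k) (t := -θ) t (by linarith) (by
    rw [hs]
    exact h.indep_gap.integrable_exp_mul_sum h.measurable_gap fun i _ => (h.mgf_gap_le hθ i).1)
  refine h1.trans ?_
  rw [neg_neg, hs, h.indep_gap.mgf_sum h.measurable_gap]
  refine mul_le_mul_of_nonneg_left ?_ (Real.exp_pos _).le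
  calc ∏ i ∈ Finset.range k, mgf (gap i) μ (-θ) ≤ ∏ i ∈ Finset.range k, r / θ :=
        Finset.prod_le_prod (fun i _ => mgf_nonneg) fun i _ => (h.mgf_gap_le hθ i).2
    _ = _ := by rw [Finset.prod_const, Finset.card_range]

lemma ae_gap_pos : ∀ᵐ ω ∂μ, ∀ i, 0 < gap i ω := by
  rw [ae_all_iff]
  intro i
  have hp := isProbabilityMeasure_expMeasure h.rate_pos
  have h0 : (expMeasure r) (Set.Iic 0) = 0 := by
    have := cdf_expMeasure_eq h.rate_pos 0
    rw [cdf_eq_real] at this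
    simpa [measureReal_def, ENNReal.toReal_eq_zero_iff] using this
  rw [← h.law_gap i, Measure.map_apply (h.measurable_gap i) measurableSet_Iic] at h0
  rw [ae_iff]
  convert h0 using 2
  ext ω; simp

lemma ae_goodMarks : ∀ᵐ ω ∂μ, GoodMarks (marks gap Y ω) := by
  have := h.indep_gap.isProbabilityMeasure
  have hr := h.rate_pos
  have h1 : ∀ᵐ ω ∂μ, ∀ i, Y i ω ≠ 0 := by
    rw [ae_all_iff]
    intro i
    exact (h.identDistrib_jump i).symm.ae_snd (p := fun y => y ≠ 0)
      (measurableSet_singleton (0:ℝ)).compl h.jump_ne_zero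
  -- With `θ = 2 r` the bound for the epochs decays like `2⁻ᵏ`, so almost surely no `m` bounds them
  -- all.
  have h2 : ∀ᵐ ω ∂μ, ∀ m : ℕ, ∃ k, (m : ℝ) < epoch gap k ω := by
    rw [ae_all_iff]
    intro m
    rw [ae_iff]
    have hle : ∀ k, μ.real {ω | ¬∃ k, (m : ℝ) < epoch gap k ω} ≤
        Real.exp (2 * r * m) * (r / (2 * r)) ^ k := fun k =>
      (measureReal_mono (show {ω | ¬∃ k, (m : ℝ) < epoch gap k ω} ⊆ {ω | epoch gap k ω ≤ m} from
        fun ω hω => not_lt.1 (not_exists.1 hω k))).trans (h.measureReal_epoch_le k (by positivity) m)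
    have hlim : Tendsto (fun k : ℕ => Real.exp (2 * r * m) * (r / (2 * r)) ^ k) atTop (𝓝 0) := by
      have : Tendsto (fun k : ℕ => (r / (2 * r)) ^ k) atTop (𝓝 0) :=
        tendsto_pow_atTop_nhds_zero_of_lt_one (by positivity) (by
          rw [div_lt_one (by positivity)]; linarith)
      simpa using this.const_mul (Real.exp (2 * r * m))
    have := ge_of_tendsto' hlim hle
    exact (measureReal_eq_zero_iff).1 (le_antisymm this measureReal_nonneg)
  filter_upwards [h.ae_gap_pos, h1, h2] with ω hω1 hω2 hω3
  refine ⟨hω1, hω2, tendsto_atTop_atTop_of_monotone ?_ fun b => ?_⟩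
  · refine monotone_nat_of_le_succ fun n => ?_
    rw [epoch_succ]
    exact le_add_of_nonneg_right (hω1 n).le
  · obtain ⟨m, hm⟩ := exists_nat_ge b
    obtain ⟨k, hk⟩ := hω3 m
    exact ⟨k, hm.trans hk.le⟩

end IsCompoundPoissonData

lemma measurable_count {Ω : Type*} [MeasurableSpace Ω] {gap : ℕ → Ω → ℝ}
    (hgap : ∀ i, Measurable (gap i)) {τ : Ω → ℝ≥0∞} (hτ : Measurable τ) :
    Measurable fun ω => count gap (τ ω) ω := by
  refine measurable_encard.comp (measurable_set_iff.2 fun n => measurableSet_setOfPred.1 ?_)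
  exact measurableSet_le (Finset.measurable_fun_sum _ fun i _ => hgap i).ennreal_ofReal hτ

lemma measurable_gapAt (i : ℕ) : Measurable (gapAt i) :=
  (measurable_pi_apply i).comp measurable_fst

lemma measurable_jumpAt (i : ℕ) : Measurable (jumpAt i) :=
  (measurable_pi_apply i).comp measurable_snd

lemma measurable_pathCount (t : ℝ≥0) : Measurable fun z : Marks => pathCount z t :=
  (measurable_of_countable ENat.toNat).comp
    (measurable_count measurable_gapAt (τ := fun _ => (t : ℝ≥0∞)) measurable_const)

lemma measurable_pathX (c : ℝ) (t : ℝ≥0) : Measurable fun z : Marks => pathX c z t := by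
  refine Measurable.add ?_ measurable_const
  exact measurable_eval_nat (g := fun n z => ∑ i ∈ Finset.range n, jumpAt i z)
    (fun n => Finset.measurable_fun_sum _ fun i _ => measurable_jumpAt i) (measurable_pathCount t)

lemma measurable_shiftMarks (t : ℝ≥0) : Measurable (shiftMarks t) := by
  refine Measurable.prodMk (measurable_pi_lambda _ fun i => ?_) (measurable_pi_lambda _ fun i => ?_)
  · by_cases hi : i = 0
    · simp only [hi, if_true]
      refine Measurable.sub_const ?_ _
      exact measurable_eval_nat (g := fun n z => epoch gapAt (n + 1) z)
        (fun n => Finset.measurable_fun_sum _ fun i _ => measurable_gapAt i) (measurable_pathCount t)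
    · simp only [hi, if_false]
      exact measurable_eval_nat (g := fun n z => gapAt (n + i) z) (fun n => measurable_gapAt _)
        (measurable_pathCount t)
  · exact measurable_eval_nat (g := fun n z => jumpAt (n + i) z) (fun n => measurable_jumpAt _)
      (measurable_pathCount t)

namespace IsCompoundPoissonData

variable {Ω : Type*} [mΩ : MeasurableSpace Ω] {μ : Measure Ω} {r : ℝ}
  {gap Y : ℕ → Ω → ℝ} (h : IsCompoundPoissonData μ r gap Y)
include h

lemma map_marks : μ.map (marks gap Y) =
    (gapLaw r).prod (Measure.infinitePi fun _ => μ.map (Y 0)) := by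
  have := h.indep_gap.isProbabilityMeasure
  have h1 := (indepFun_iff_map_prod_eq_prod_map_map
    (measurable_pi_lambda _ h.measurable_gap).aemeasurable
    (measurable_pi_lambda _ h.measurable_jump).aemeasurable).1 h.indep_gap_jump
  have h2 := h.map_gap 0
  have h3 := h.map_jump 0
  simp only [zero_add] at h2 h3
  rw [h2, h3] at h1
  exact h1

/-- The gaps from index `k` on are independent of the epoch `T_k`, and by memorylessness ageing the
next gap leaves a fresh sequence, whose law factors out. -/
lemma measure_age (k : ℕ) (t : ℝ≥0) {A : Set (ℕ → ℝ)} (hA : MeasurableSet A) :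
    μ {ω | epoch gap k ω ≤ t ∧ t - epoch gap k ω < gap k ω ∧
      ageFirst (t - epoch gap k ω) (fun i => gap (k + i) ω) ∈ A} =
      (∫⁻ ω in {ω | epoch gap k ω ≤ t}, ENNReal.ofReal (Real.exp (-r * (t - epoch gap k ω))) ∂μ) *
        gapLaw r A := by
  have := h.indep_gap.isProbabilityMeasure
  have hr := h.rate_pos
  set W : Ω → ℕ → ℝ := fun ω i => gap (k + i) ω with hW
  have hWm : Measurable W := measurable_pi_lambda _ fun i => h.measurable_gap _
  have hUm := h.measurable_epoch k
  set S : Set (ℝ × (ℕ → ℝ)) := {q | t - q.1 < q.2 0 ∧ ageFirst (t - q.1) q.2 ∈ A} with hS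
  have hSm : MeasurableSet S := by
    refine MeasurableSet.inter (measurableSet_lt (measurable_const.sub measurable_fst)
      ((measurable_pi_apply 0).comp measurable_snd)) ?_
    exact (measurable_ageFirst.comp
      ((measurable_const.sub measurable_fst).prodMk measurable_snd)) hA
  have hB : MeasurableSet {ω | epoch gap k ω ≤ t} := measurableSet_le hUm measurable_const
  have h1 := setLIntegral_indep (μ := μ) (m₁ := MeasurableSpace.comap (epoch gap k) inferInstance)
    (m₂ := MeasurableSpace.comap W inferInstance) (h.indepFun_epoch k) hUm.comap_le hWm.comap_le
    (comap_measurable _) (comap_measurable W) (B := {ω | epoch gap k ω ≤ t})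
    ⟨Set.Iic t, measurableSet_Iic, rfl⟩ (g := S.indicator 1) (measurable_one.indicator hSm)
  have h2 : ∫⁻ ω in {ω | epoch gap k ω ≤ t}, S.indicator 1 (epoch gap k ω, W ω) ∂μ =
      μ {ω | epoch gap k ω ≤ t ∧ (epoch gap k ω, W ω) ∈ S} := by
    have hm : MeasurableSet {ω | (epoch gap k ω, W ω) ∈ S} := (hUm.prodMk hWm) hSm
    have : ∀ ω, S.indicator (1 : ℝ × (ℕ → ℝ) → ℝ≥0∞) (epoch gap k ω, W ω) =
        {ω | (epoch gap k ω, W ω) ∈ S}.indicator 1 ω := fun ω => by simp [Set.indicator]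
    simp_rw [this]
    rw [lintegral_indicator_one hm, Measure.restrict_apply hm, Set.inter_comm]
    rfl
  rw [h2] at h1
  refine (Eq.trans ?_ h1).trans ?_
  · rfl
  rw [← lintegral_mul_const]
  · refine setLIntegral_congr_fun hB fun ω hω => ?_
    have hm : MeasurableSet {g | (epoch gap k ω, g) ∈ S} := measurable_prodMk_left hSm
    have : ∀ ω', S.indicator (1 : ℝ × (ℕ → ℝ) → ℝ≥0∞) (epoch gap k ω, W ω') =
        {g | (epoch gap k ω, g) ∈ S}.indicator 1 (W ω') := fun ω' => by simp [Set.indicator]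
    simp only [this]
    rw [← lintegral_map (measurable_one.indicator hm) hWm, h.map_gap, lintegral_indicator_one hm]
    exact gapLaw_ageFirst hr (sub_nonneg.2 hω) hA
  · exact (Real.measurable_exp.comp ((measurable_const.sub hUm).const_mul _)).ennreal_ofReal

/-- Stationarity: the marks seen from time `t` on have the same law. -/
theorem map_shiftMarks (t : ℝ≥0) : μ.map (fun ω => shiftMarks t (marks gap Y ω)) =
    μ.map (marks gap Y) := by
  have := h.indep_gap.isProbabilityMeasure
  have := isProbabilityMeasure_expMeasure h.rate_pos
  have : IsProbabilityMeasure (μ.map (Y 0)) :=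
    Measure.isProbabilityMeasure_map (h.measurable_jump 0).aemeasurable
  have : IsProbabilityMeasure (gapLaw r) := by unfold gapLaw; infer_instance
  have hSm : Measurable fun ω => shiftMarks t (marks gap Y ω) :=
    (measurable_shiftMarks t).comp h.measurable_marks
  have hNm : Measurable fun ω => pathCount (marks gap Y ω) t :=
    (measurable_pathCount t).comp h.measurable_marks
  rw [h.map_marks]
  refine (Measure.prod_eq fun A B hA hB => ?_).symm
  rw [Measure.map_apply hSm (hA.prod hB)]
  -- The probability of exactly `k` jumps up to `t`; its Poisson value is never needed.
  set w : ℕ → ℝ≥0∞ := fun k => ∫⁻ ω in {ω | epoch gap k ω ≤ t},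
    ENNReal.ofReal (Real.exp (-r * (t - epoch gap k ω))) ∂μ with hw
  set D : Set (ℕ → ℝ) → ℕ → Set Ω := fun A k => {ω | epoch gap k ω ≤ t ∧
    t - epoch gap k ω < gap k ω ∧ ageFirst (t - epoch gap k ω) (fun i => gap (k + i) ω) ∈ A} with hD
  have hdecomp : ∀ E : Set Ω, MeasurableSet E →
      μ E = ∑' k, μ (E ∩ {ω | pathCount (marks gap Y ω) t = k}) := by
    intro E hE
    rw [← measure_iUnion]
    · congr 1; ext ω; simp
    · intro i j hij
      refine Set.disjoint_left.2 ?_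
      rintro ω ⟨-, ha⟩ ⟨-, hb⟩
      exact hij (ha.out.symm.trans hb.out)
    · exact fun k => hE.inter (hNm (measurableSet_singleton k))
  have hae : ∀ A B k, (((fun ω => shiftMarks t (marks gap Y ω)) ⁻¹' A ×ˢ B) ∩
      {ω | pathCount (marks gap Y ω) t = k} : Set Ω) =ᵐ[μ]
      (D A k ∩ {ω | (fun i => Y (k + i) ω) ∈ B} : Set Ω) := by
    intro A B k
    filter_upwards [h.ae_goodMarks] with ω hω
    refine propext ?_
    change (shiftMarks t (marks gap Y ω) ∈ A ×ˢ B ∧ pathCount (marks gap Y ω) t = k) ↔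
      (epoch gap k ω ≤ t ∧ t - epoch gap k ω < gap k ω ∧
        ageFirst (t - epoch gap k ω) (fun i => gap (k + i) ω) ∈ A) ∧ (fun i => Y (k + i) ω) ∈ B
    have e1 : pathCount (marks gap Y ω) t = k ↔
        epoch gap k ω ≤ t ∧ t - epoch gap k ω < gap k ω := by
      rw [hω.pathCount_eq_iff, sub_lt_iff_lt_add', ← epoch_succ]; rfl
    have e2 : pathCount (marks gap Y ω) t = k → shiftMarks t (marks gap Y ω) =
        (ageFirst (t - epoch gap k ω) (fun i => gap (k + i) ω), fun i => Y (k + i) ω) := by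
      intro hk
      simp only [shiftMarks, hk]
      refine Prod.ext (funext fun i => ?_) rfl
      simp only [ageFirst, epoch_succ]
      split_ifs
      · simp only [marks, gapAt, add_zero]
        rw [sub_sub_eq_add_sub, add_comm (gap k ω)]
        rfl
      · rfl
    constructor
    · rintro ⟨h1, h2⟩
      rw [e2 h2] at h1
      exact ⟨⟨(e1.1 h2).1, (e1.1 h2).2, h1.1⟩, h1.2⟩
    · rintro ⟨⟨h1, h2, h3⟩, h4⟩
      have h5 := e1.2 ⟨h1, h2⟩
      rw [e2 h5]
      exact ⟨⟨h3, h4⟩, h5⟩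
  have hDY : ∀ A B k, MeasurableSet A → MeasurableSet B →
      μ (D A k ∩ {ω | (fun i => Y (k + i) ω) ∈ B}) =
        w k * gapLaw r A * (Measure.infinitePi fun _ => μ.map (Y 0)) B := by
    intro A B k hA hB
    have hYm : Measurable fun (y : ℕ → ℝ) i => y (k + i) :=
      measurable_pi_lambda _ fun i => measurable_pi_apply _
    have hDm : MeasurableSet {g : ℕ → ℝ | (∑ i ∈ Finset.range k, g i) ≤ t ∧
        t - (∑ i ∈ Finset.range k, g i) < g k ∧
        ageFirst (t - ∑ i ∈ Finset.range k, g i) (fun i => g (k + i)) ∈ A} := by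
      have hs : Measurable fun g : ℕ → ℝ => ∑ i ∈ Finset.range k, g i :=
        Finset.measurable_fun_sum _ fun i _ => measurable_pi_apply i
      refine (measurableSet_le hs measurable_const).inter
        ((measurableSet_lt (measurable_const.sub hs) (measurable_pi_apply k)).inter ?_)
      exact (measurable_ageFirst.comp ((measurable_const.sub hs).prodMk hYm)) hA
    have h1 := h.indep_gap_jump.measure_inter_preimage_eq_mul _ _ hDm (hYm hB)
    refine h1.trans ?_
    congr 1
    · exact h.measure_age k t hA
    · rw [← h.map_jump k, Measure.map_apply (measurable_pi_lambda _ fun i => h.measurable_jump _) hB]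
      rfl
  have hsum : ∀ A B, MeasurableSet A → MeasurableSet B →
      μ ((fun ω => shiftMarks t (marks gap Y ω)) ⁻¹' A ×ˢ B) =
        (∑' k, w k) * (gapLaw r A * (Measure.infinitePi fun _ => μ.map (Y 0)) B) := by
    intro A B hA hB
    rw [hdecomp _ (hSm (hA.prod hB)), ← ENNReal.tsum_mul_right]
    refine tsum_congr fun k => ?_
    rw [measure_congr (hae A B k), hDY A B k hA hB, mul_assoc]
  -- The total mass comes from applying the factorization to the whole space.
  have hw1 : ∑' k, w k = 1 := by
    have := hsum Set.univ Set.univ MeasurableSet.univ MeasurableSet.univ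
    simpa using this.symm
  rw [hsum A B hA hB, hw1, one_mul]

end IsCompoundPoissonData

end

end RandomTimeMaxima

/-! ### Moments of the number of jumps and of compound sums -/

namespace RandomTimeMaxima

section

namespace IsCompoundPoissonData

variable {Ω : Type*} [mΩ : MeasurableSpace Ω] {μ : Measure Ω} {r : ℝ}
  {gap Y : ℕ → Ω → ℝ} (h : IsCompoundPoissonData μ r gap Y)

/-- The number of jumps in `[0, t]`, as a natural number. -/
noncomputable def jumps (gap Y : ℕ → Ω → ℝ) (t : ℝ≥0) (ω : Ω) : ℕ := pathCount (marks gap Y ω) t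

include h

lemma measurable_jumps (t : ℝ≥0) : Measurable (jumps gap Y t) :=
  (measurable_pathCount t).comp h.measurable_marks

lemma measureReal_le_jumps (t : ℝ≥0) (k : ℕ) {θ : ℝ} (hθ : 0 < θ) :
    μ.real {ω | k ≤ jumps gap Y t ω} ≤ Real.exp (θ * t) * (r / θ) ^ k := by
  have := h.indep_gap.isProbabilityMeasure
  refine le_trans (ENNReal.toReal_mono (measure_ne_top _ _) (measure_mono_ae ?_))
    (h.measureReal_epoch_le k hθ t)
  filter_upwards [h.ae_goodMarks] with ω hω hk
  cases k with
  | zero =>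
    change epoch gap 0 ω ≤ t
    simp [epoch_zero]
  | succ k => exact (hω.lt_pathCount t k).1 hk

lemma summable_jumps (t : ℝ≥0) {K : ℝ} (hK : 1 ≤ K) :
    Summable fun k => μ.real {ω | jumps gap Y t ω = k} * K ^ (k + 1) := by
  have := h.indep_gap.isProbabilityMeasure
  have hr := h.rate_pos
  have hs : Summable fun k : ℕ => Real.exp (2 * r * K * t) * K * (1 / 2 : ℝ) ^ k :=
    (summable_geometric_of_lt_one (by norm_num) (by norm_num)).mul_left _
  refine Summable.of_nonneg_of_le (fun k => by positivity) (fun k => ?_) hs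
  -- Taking `θ = 2 r K` makes the ratio of the series, including the weight `K ^ k`, equal to `1 /
  -- 2`.
  have h1 : μ.real {ω | jumps gap Y t ω = k} ≤ Real.exp (2 * r * K * t) * (r / (2 * r * K)) ^ k :=
    (measureReal_mono fun ω (hω : jumps gap Y t ω = k) => hω.ge).trans
      (h.measureReal_le_jumps t k (by positivity))
  calc _ ≤ Real.exp (2 * r * K * t) * (r / (2 * r * K)) ^ k * K ^ (k + 1) := by gcongr
    _ = Real.exp (2 * r * K * t) * K * (r / (2 * r * K) * K) ^ k := by rw [mul_pow]; ring
    _ = _ := by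
      rw [show r / (2 * r * K) * K = 1 / 2 by field_simp]

lemma integrableExpSet_jumps (t : ℝ≥0) (a : ℝ) :
    integrableExpSet (fun ω => a * (jumps gap Y t ω : ℝ)) μ ∈ 𝓝 0 := by
  have := h.indep_gap.isProbabilityMeasure
  refine Filter.mem_of_superset univ_mem fun θ _ => ?_
  set K := Real.exp |θ * a| with hK
  have hK1 : 1 ≤ K := Real.one_le_exp (abs_nonneg _)
  have h1 := (integrable_nat_of_summable (h.measurable_jumps t) (fun k => by positivity)
    (h.summable_jumps t hK1)).1
  have hm : Measurable fun ω => Real.exp (θ * (a * (jumps gap Y t ω : ℝ))) :=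
    (measurable_from_nat (f := fun n : ℕ => Real.exp (θ * (a * (n : ℝ))))).comp
      (h.measurable_jumps t)
  refine h1.mono' hm.aestronglyMeasurable (Eventually.of_forall fun ω => ?_)
  rw [Real.norm_of_nonneg (Real.exp_pos _).le]
  refine le_trans ?_ (pow_le_pow_right₀ hK1 (Nat.le_succ _))
  rw [hK, ← Real.exp_nat_mul, Real.exp_le_exp, ← mul_assoc, mul_comm (jumps gap Y t ω : ℝ)]
  exact mul_le_mul_of_nonneg_right (le_abs_self _) (Nat.cast_nonneg _)

lemma integrable_jumps (t : ℝ≥0) : Integrable (fun ω => (jumps gap Y t ω : ℝ)) μ := by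
  have := h.indep_gap.isProbabilityMeasure
  have := integrable_of_integrableExpSet (h.integrableExpSet_jumps t 1)
  simpa using this

/-- The number of jumps depends on the gaps alone, which becomes visible when the jump sizes are
replaced by zero. -/
lemma indepFun_jumps (t : ℝ≥0) {β : Type*} [MeasurableSpace β] {G : (ℕ → ℝ) → β}
    (hG : Measurable G) : IndepFun (jumps gap Y t) (fun ω => G fun i => Y i ω) μ := by
  have hm : Measurable fun g : ℕ → ℝ => pathCount (g, 0) t :=
    (measurable_pathCount t).comp measurable_prodMk_right
  exact h.indep_gap_jump.comp hm hG

lemma summable_lt_jumps (t : ℝ≥0) : Summable fun k => μ.real {ω | k < jumps gap Y t ω} := by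
  have := h.indep_gap.isProbabilityMeasure
  have hr := h.rate_pos
  have hs : Summable fun k : ℕ => Real.exp (2 * r * t) * (1 / 2 : ℝ) ^ k :=
    (summable_geometric_of_lt_one (by norm_num) (by norm_num)).mul_left _
  refine Summable.of_nonneg_of_le (fun k => by positivity) (fun k => ?_) hs
  have h1 := (measureReal_mono (μ := μ)
    (show {ω | k < jumps gap Y t ω} ⊆ {ω | k ≤ jumps gap Y t ω} from
    fun ω (hω : k < jumps gap Y t ω) => hω.le)).trans
    (h.measureReal_le_jumps t k (show 0 < 2 * r by positivity))
  rwa [show r / (2 * r) = 1 / 2 by field_simp] at h1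

/-- The number of jumps and independent rewards. -/
lemma integral_rewards (t : ℝ≥0) {φ : ℝ → ℝ} (hφ : Measurable φ)
    (hi : Integrable (fun ω => φ (Y 0 ω)) μ) :
    Integrable (fun ω => ∑ i ∈ Finset.range (jumps gap Y t ω), φ (Y i ω)) μ ∧
      ∫ ω, ∑ i ∈ Finset.range (jumps gap Y t ω), φ (Y i ω) ∂μ =
        (∑' k, μ.real {ω | k < jumps gap Y t ω}) * ∫ ω, φ (Y 0 ω) ∂μ := by
  have := h.indep_gap.isProbabilityMeasure
  have hr := h.rate_pos
  have hms : ∀ k, MeasurableSet {ω | k < jumps gap Y t ω} := fun k =>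
    measurableSet_lt measurable_const (h.measurable_jumps t)
  have hid : ∀ (ψ : ℝ → ℝ), Measurable ψ → ∀ k,
      IdentDistrib (fun ω => ψ (Y k ω)) (fun ω => ψ (Y 0 ω)) μ μ :=
    fun ψ hψ k => (h.identDistrib_jump k).comp hψ
  have hFi : ∀ (ψ : ℝ → ℝ), Measurable ψ → ∀ k,
      ∫ ω, {ω | k < jumps gap Y t ω}.indicator (fun ω => ψ (Y k ω)) ω ∂μ =
        μ.real {ω | k < jumps gap Y t ω} * ∫ ω, ψ (Y 0 ω) ∂μ := by
    intro ψ hψ k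
    have h1 : IndepFun ({ω | k < jumps gap Y t ω}.indicator (1 : Ω → ℝ)) (fun ω => ψ (Y k ω)) μ := by
      have := (h.indepFun_jumps t (G := fun y => ψ (y k)) (hψ.comp (measurable_pi_apply k))).comp
        (φ := (Set.Ioi k).indicator (1 : ℕ → ℝ)) (ψ := id) (measurable_of_countable _) measurable_id
      exact this
    have h2 : ∀ ω, {ω | k < jumps gap Y t ω}.indicator (fun ω => ψ (Y k ω)) ω =
        {ω | k < jumps gap Y t ω}.indicator (1 : Ω → ℝ) ω * ψ (Y k ω) := fun ω => by
      by_cases hω : k < jumps gap Y t ω <;> simp [hω]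
    simp_rw [h2]
    rw [h1.integral_fun_mul_eq_mul_integral
      (measurable_one.indicator (hms k)).aestronglyMeasurable
      (hψ.comp (h.measurable_jump k)).aestronglyMeasurable,
      integral_indicator_one (hms k), (hid ψ hψ k).integral_eq]
  set F : ℕ → Ω → ℝ := fun k => {ω | k < jumps gap Y t ω}.indicator fun ω => φ (Y k ω) with hF
  have hFint : ∀ k, Integrable (F k) μ := fun k =>
    ((hid φ hφ k).integrable_iff.2 hi).indicator (hms k)
  have hnorm : ∀ k, ∫ ω, ‖F k ω‖ ∂μ = μ.real {ω | k < jumps gap Y t ω} * ∫ ω, |φ (Y 0 ω)| ∂μ := by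
    intro k
    rw [← hFi (fun y => |φ y|) hφ.abs k]
    refine integral_congr_ae (Eventually.of_forall fun ω => ?_)
    simp only [hF, norm_indicator_eq_indicator_norm, Real.norm_eq_abs]
  have hs0 := h.summable_lt_jumps t
  have hs : Summable fun k => ∫ ω, ‖F k ω‖ ∂μ := by
    simp_rw [hnorm]; exact hs0.mul_right _
  have htsum : ∀ ω, ∑' k, F k ω = ∑ i ∈ Finset.range (jumps gap Y t ω), φ (Y i ω) := by
    intro ω
    rw [tsum_eq_sum (s := Finset.range (jumps gap Y t ω))]
    · refine Finset.sum_congr rfl fun i hi => ?_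
      simp only [hF]
      rw [Set.indicator_of_mem]
      exact Finset.mem_range.1 hi
    · intro i hi
      simp only [hF]
      rw [Set.indicator_of_notMem]
      exact fun h' => hi (Finset.mem_range.2 h')
  have h1 := hasSum_integral_of_summable_integral_norm hFint hs
  simp_rw [htsum] at h1
  refine ⟨⟨?_, ?_⟩, ?_⟩
  · exact (measurable_eval_nat (g := fun n ω => ∑ i ∈ Finset.range n, φ (Y i ω))
      (fun n => Finset.measurable_fun_sum _ fun i _ => hφ.comp (h.measurable_jump i))
      (h.measurable_jumps t)).aestronglyMeasurable
  · have h2 : ∀ k, ∫⁻ ω, ‖F k ω‖ₑ ∂μ = ENNReal.ofReal (∫ ω, ‖F k ω‖ ∂μ) := fun k =>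
      (ofReal_integral_norm_eq_lintegral_enorm (hFint k)).symm
    calc ∫⁻ ω, ‖∑ i ∈ Finset.range (jumps gap Y t ω), φ (Y i ω)‖ₑ ∂μ
        ≤ ∫⁻ ω, ∑' k, ‖F k ω‖ₑ ∂μ := by
          refine lintegral_mono fun ω => ?_
          refine le_trans ?_ (ENNReal.sum_le_tsum (Finset.range (jumps gap Y t ω)))
          refine (enorm_sum_le _ _).trans (Finset.sum_le_sum fun i hi => ?_)
          simp only [hF]
          rw [Set.indicator_of_mem (show ω ∈ {ω | i < jumps gap Y t ω} from Finset.mem_range.1 hi)]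
      _ = ∑' k, ENNReal.ofReal (∫ ω, ‖F k ω‖ ∂μ) := by
          rw [lintegral_tsum fun k => (hFint k).1.enorm]; simp_rw [h2]
      _ < ∞ := hs.tsum_ofReal_ne_top.lt_top
  · rw [← h1.tsum_eq]
    simp only [hF]
    simp_rw [hFi φ hφ]
    rw [tsum_mul_right]

lemma integral_jumps_eq_tsum (t : ℝ≥0) :
    ∫ ω, (jumps gap Y t ω : ℝ) ∂μ = ∑' k, μ.real {ω | k < jumps gap Y t ω} := by
  have := h.indep_gap.isProbabilityMeasure
  have := (h.integral_rewards t (φ := fun _ => 1) measurable_const (integrable_const 1)).2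
  simpa using this

lemma jumps_add (t s : ℝ≥0) : ∀ᵐ ω ∂μ, jumps gap Y (t + s) ω =
    jumps gap Y t ω + pathCount (shiftMarks t (marks gap Y ω)) s := by
  filter_upwards [h.ae_goodMarks] with ω hω using hω.pathCount_add t s

lemma identDistrib_shift (t : ℝ≥0) {β : Type*} [MeasurableSpace β] {G : Marks → β}
    (hG : Measurable G) : IdentDistrib (fun ω => G (shiftMarks t (marks gap Y ω)))
      (fun ω => G (marks gap Y ω)) μ μ := by
  have h1 : Measurable fun ω => shiftMarks t (marks gap Y ω) :=
    (measurable_shiftMarks t).comp h.measurable_marks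
  have : IdentDistrib (fun ω => shiftMarks t (marks gap Y ω)) (marks gap Y) μ μ :=
    ⟨h1.aemeasurable, h.measurable_marks.aemeasurable, h.map_shiftMarks t⟩
  exact this.comp hG

/-- Stationarity: the jumps after `t` are counted by the shifted marks, which have the original law.
-/
lemma integral_jumps_add (t s : ℝ≥0) : ∫ ω, (jumps gap Y (t + s) ω : ℝ) ∂μ =
    ∫ ω, (jumps gap Y t ω : ℝ) ∂μ + ∫ ω, (jumps gap Y s ω : ℝ) ∂μ := by
  have hm : Measurable fun z : Marks => (pathCount z s : ℝ) :=
    measurable_from_nat.comp (measurable_pathCount s)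
  have hid := h.identDistrib_shift t hm
  have h1 : ∫ ω, (jumps gap Y (t + s) ω : ℝ) ∂μ =
      ∫ ω, ((jumps gap Y t ω : ℝ) + (pathCount (shiftMarks t (marks gap Y ω)) s : ℝ)) ∂μ := by
    refine integral_congr_ae ?_
    filter_upwards [h.jumps_add t s] with ω hω
    rw [hω]; push_cast; rfl
  rw [h1, integral_add (h.integrable_jumps t) (hid.integrable_iff.2 (h.integrable_jumps s)),
    hid.integral_eq]
  rfl

/-- The mean is a sum of tail probabilities. With `u = r t`, the first is `1 - exp (-u)`, and the
others form a geometric series of order `u ^ 2`, by the epoch bound with `θ = 1 / t`. -/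
lemma abs_integral_jumps_sub_le (t : ℝ≥0) (ht : r * t ≤ 1 / 2) :
    |∫ ω, (jumps gap Y t ω : ℝ) ∂μ - r * t| ≤ 7 * (r * t) ^ 2 := by
  have := h.indep_gap.isProbabilityMeasure
  have hr := h.rate_pos
  rcases eq_or_ne t 0 with rfl | ht0
  · have : ∀ᵐ ω ∂μ, (jumps gap Y 0 ω : ℝ) = 0 := by
      filter_upwards [h.ae_goodMarks] with ω hω
      exact_mod_cast hω.pathCount_zero
    rw [integral_congr_ae this]; simp
  have ht0 : (0:ℝ) < t := NNReal.coe_pos.2 (pos_iff_ne_zero.2 ht0)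
  set u := r * t with hu
  have hu0 : 0 < u := by positivity
  have hp0 : μ.real {ω | 0 < jumps gap Y t ω} = 1 - Real.exp (-u) := by
    have h1 : μ.real {ω | 0 < jumps gap Y t ω} = (μ.map (gap 0)).real (Set.Iic (t:ℝ)) := by
      rw [map_measureReal_apply (h.measurable_gap 0) measurableSet_Iic]
      refine congrArg ENNReal.toReal (measure_congr ?_)
      filter_upwards [h.ae_goodMarks] with ω hω
      refine propext ((hω.lt_pathCount t 0).trans ?_)
      rw [epoch_succ, epoch_zero, zero_add]; rfl
    have := isProbabilityMeasure_expMeasure hr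
    rw [h1, h.law_gap, ← cdf_eq_real, cdf_expMeasure_eq hr, if_pos t.coe_nonneg]
  have hpk : ∀ k, μ.real {ω | k + 1 < jumps gap Y t ω} ≤ Real.exp 1 * u ^ 2 * u ^ k := by
    intro k
    have h1 := (measureReal_mono (μ := μ)
      (show {ω | k + 1 < jumps gap Y t ω} ⊆ {ω | k + 2 ≤ jumps gap Y t ω} from
      fun ω (hω : k + 1 < jumps gap Y t ω) => hω)).trans
      (h.measureReal_le_jumps t (k + 2) (show 0 < (t:ℝ)⁻¹ by positivity))
    rw [inv_mul_cancel₀ ht0.ne', div_inv_eq_mul, ← hu] at h1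
    rw [mul_assoc, ← pow_add, add_comm 2 k]
    exact h1
  have hs := h.summable_lt_jumps t
  rw [h.integral_jumps_eq_tsum, hs.tsum_eq_zero_add, hp0]
  have hu1 : u < 1 := by linarith
  have hT : ∑' k, μ.real {ω | k + 1 < jumps gap Y t ω} ≤ Real.exp 1 * u ^ 2 * (1 - u)⁻¹ := by
    rw [← tsum_geometric_of_lt_one hu0.le hu1, ← tsum_mul_left]
    have hs1 : Summable fun k => μ.real {ω | k + 1 < jumps gap Y t ω} :=
      (summable_nat_add_iff (f := fun k => μ.real {ω | k < jumps gap Y t ω}) 1).2 hs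
    exact Summable.tsum_le_tsum hpk hs1
      ((summable_geometric_of_lt_one hu0.le hu1).mul_left _)
  have hT0 : 0 ≤ ∑' k, μ.real {ω | k + 1 < jumps gap Y t ω} := tsum_nonneg fun k => measureReal_nonneg
  have h2 : (1 - u)⁻¹ ≤ 2 := by
    rw [inv_le_comm₀ (by linarith) two_pos]; linarith
  have h3 : Real.exp 1 * u ^ 2 * (1 - u)⁻¹ ≤ 6 * u ^ 2 := by
    have := Real.exp_one_lt_d9
    calc _ ≤ 3 * u ^ 2 * 2 := by
          gcongr
          linarith
      _ = _ := by ring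
  have h4 := Real.abs_exp_sub_one_sub_id_le (x := -u) (by rw [abs_neg, abs_of_pos hu0]; linarith)
  rw [abs_le] at h4 ⊢
  constructor <;> nlinarith [h4.1, h4.2]

/-- The expected number of jumps. -/
theorem integral_jumps (t : ℝ≥0) : ∫ ω, (jumps gap Y t ω : ℝ) ∂μ = r * t := by
  have hr := h.rate_pos
  set g : ℝ≥0 → ℝ := fun t => ∫ ω, (jumps gap Y t ω : ℝ) ∂μ with hg
  -- Additivity over `n + 1` equal pieces multiplies the quadratic error of one piece by `n + 1`,
  -- leaving an error of order `1 / n`.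
  have hn : ∀ (n : ℕ) (s : ℝ≥0), g ((n + 1) * s) = (n + 1) * g s := by
    intro n s
    induction n with
    | zero => simp
    | succ n ih =>
      have : ((n + 1 : ℕ) + 1 : ℝ≥0) * s = (n + 1) * s + s := by push_cast; ring
      rw [this]
      have h2 := h.integral_jumps_add ((n + 1) * s) s
      change g _ = g _ + g _ at h2
      rw [h2, ih]; push_cast; ring
  have hb : ∀ n : ℕ, 2 * (r * t) ≤ n + 1 → |g t - r * t| ≤ 7 * (r * t) ^ 2 * (1 / (n + 1 : ℝ)) := by
    intro n hn'
    have hn0 : (0:ℝ) < n + 1 := by positivity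
    set s : ℝ≥0 := t / (n + 1) with hs
    have hsr : (s : ℝ) = t / (n + 1) := by rw [hs]; push_cast; rfl
    have hst : (n + 1) * s = t := by
      rw [hs]; field_simp
    have h1 := h.abs_integral_jumps_sub_le s (by
      rw [hsr, ← mul_div_assoc, div_le_iff₀ hn0]; linarith)
    have h2 := hn n s
    rw [hst] at h2
    change |g s - r * s| ≤ _ at h1
    have h3 : g t - r * t = (n + 1) * (g s - r * s) := by
      rw [h2, hsr]; field_simp
    rw [h3, abs_mul, abs_of_pos hn0]
    calc _ ≤ (n + 1) * (7 * (r * s) ^ 2) := by gcongr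
      _ = _ := by rw [hsr]; field_simp
  have hlim : Tendsto (fun n : ℕ => 7 * (r * t) ^ 2 * (1 / (n + 1 : ℝ))) atTop (𝓝 0) := by
    rw [← mul_zero (7 * (r * (t:ℝ)) ^ 2)]
    exact tendsto_one_div_add_atTop_nhds_zero_nat.const_mul (7 * (r * (t:ℝ)) ^ 2)
  have h0 : |g t - r * t| ≤ 0 := by
    refine ge_of_tendsto hlim ?_
    obtain ⟨m, hm⟩ := exists_nat_ge (2 * (r * t))
    filter_upwards [eventually_ge_atTop m] with n hn'
    refine hb n (hm.trans ?_)
    have : (m : ℝ) ≤ n := by exact_mod_cast hn'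
    linarith
  exact sub_eq_zero.1 (abs_eq_zero.1 (le_antisymm h0 (abs_nonneg _)))

/-- The mean of the compound process. -/
theorem integral_compound (c : ℝ) (hY : Integrable (Y 0) μ) (t : ℝ≥0) :
    Integrable (compound gap Y c t) μ ∧
      ∫ ω, compound gap Y c t ω ∂μ = r * t * ∫ ω, (c / r + Y 0 ω) ∂μ := by
  have := h.indep_gap.isProbabilityMeasure
  have hr := h.rate_pos
  obtain ⟨h1, h2⟩ := h.integral_rewards t measurable_id hY
  have e : compound gap Y c t =
      fun ω => (∑ i ∈ Finset.range (jumps gap Y t ω), id (Y i ω)) + c * t := rfl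
  refine ⟨e ▸ h1.add (integrable_const _), ?_⟩
  rw [e, integral_add h1 (integrable_const _), h2, ← h.integral_jumps_eq_tsum, h.integral_jumps,
    integral_add (integrable_const _) hY]
  simp only [id, integral_const, probReal_univ, one_smul]
  field_simp
  ring

end IsCompoundPoissonData

end

end RandomTimeMaxima

/-! ### Maxima over a cell and tails of increments -/

namespace RandomTimeMaxima

section

/-- The maximum of the path over the rational multiples of `h` in `[0, h]`. -/
noncomputable def pathMax (c : ℝ) (h : ℝ≥0) (z : Marks) : ℝ :=
  ⨆ q : {q : ℚ≥0 // q ≤ 1}, pathX c z ((q : ℚ≥0) * h)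

lemma measurable_pathMax (c : ℝ) (h : ℝ≥0) : Measurable (pathMax c h) :=
  Measurable.iSup fun _ => measurable_pathX c _

namespace GoodMarks

variable {z : Marks} (hz : GoodMarks z)
include hz

lemma bddAbove_pathX (c : ℝ) (h : ℝ≥0) :
    BddAbove (Set.range fun q : {q : ℚ≥0 // q ≤ 1} => pathX c z ((q : ℚ≥0) * h)) := by
  refine ⟨(∑ i ∈ Finset.range (pathCount z h), max (z.2 i) 0) + max c 0 * h, ?_⟩
  rintro _ ⟨q, rfl⟩
  refine hz.pathX_le c (h := h) (mul_le_of_le_one_left' ?_)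
  exact_mod_cast q.2

lemma pathMax_le (c : ℝ) (h : ℝ≥0) :
    pathMax c h z ≤ (∑ i ∈ Finset.range (pathCount z h), max (z.2 i) 0) + max c 0 * h := by
  have : Nonempty {q : ℚ≥0 // q ≤ 1} := ⟨⟨1, le_rfl⟩⟩
  refine ciSup_le fun q => hz.pathX_le c (mul_le_of_le_one_left' ?_)
  exact_mod_cast q.2

/-- Right-continuity lets a rational point just to the right of `u` replace `u`; the endpoint `u =
h` has no room to its right and is the case `q = 1`. -/
lemma pathX_le_pathMax (c : ℝ) {u h : ℝ≥0} (hu : u ≤ h) (h0 : 0 < h) :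
    pathX c z u ≤ pathMax c h z := by
  rcases hu.eq_or_lt with rfl | hu
  · have := le_ciSup (hz.bddAbove_pathX c u) ⟨1, le_rfl⟩
    rw [pathMax]
    simpa using this
  · refine le_of_forall_lt fun x hx => ?_
    obtain ⟨t', ht', h1⟩ := hz.exists_lt_pathX c hx
    obtain ⟨q, hq1, hq2⟩ := exists_rat_btwn
      (show ((u / h : ℝ≥0) : ℝ) < ((min t' h / h : ℝ≥0) : ℝ) from
        NNReal.coe_lt_coe.2 (div_lt_div_of_pos_right (lt_min ht' hu) h0))
    have hq0 : 0 ≤ q := by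
      have : (0:ℝ) < q := lt_of_le_of_lt (NNReal.coe_nonneg _) hq1
      exact_mod_cast this.le
    lift q to ℚ≥0 using hq0
    have e1 : u / h < (q : ℝ≥0) := by
      rw [← NNReal.coe_lt_coe]; exact hq1.trans_eq (by norm_cast)
    have e2 : (q : ℝ≥0) < min t' h / h := by
      rw [← NNReal.coe_lt_coe]; exact lt_of_eq_of_lt (by norm_cast) hq2
    rw [div_lt_iff₀ h0] at e1
    rw [lt_div_iff₀ h0] at e2
    have hq1' : q ≤ 1 := by
      have : (q : ℝ≥0) * h < 1 * h := by rw [one_mul]; exact e2.trans_le (min_le_right _ _)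
      exact_mod_cast (lt_of_mul_lt_mul_right this h0.le).le
    exact (h1 _ e1.le (e2.trans_le (min_le_left _ _))).trans_le
      (le_ciSup (hz.bddAbove_pathX c h) ⟨q, hq1'⟩)

end GoodMarks

namespace IsCompoundPoissonData

variable {Ω : Type*} [mΩ : MeasurableSpace Ω] {μ : Measure Ω} {r : ℝ}
  {gap Y : ℕ → Ω → ℝ} (h : IsCompoundPoissonData μ r gap Y) {f : ℝ → ℝ}

/-- The sum of the positive parts of the jumps in `[0, t]`. -/
noncomputable def upSum (gap Y : ℕ → Ω → ℝ) (t : ℝ≥0) (ω : Ω) : ℝ :=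
  ∑ i ∈ Finset.range (jumps gap Y t ω), max (Y i ω) 0

include h

/-- The tail of a compound sum. -/
lemma hasTail_rewards (hf : StrongTail f) {φ : ℝ → ℝ} (hφ : Measurable φ)
    (ht : HasTail μ (fun ω => φ (Y 0 ω)) f 1) (t : ℝ≥0) :
    HasTail μ (fun ω => ∑ i ∈ Finset.range (jumps gap Y t ω), φ (Y i ω)) f (r * t) := by
  have := h.indep_gap.isProbabilityMeasure
  set V : ℕ → Ω → ℝ := fun n ω => φ (Y n ω) with hV
  have hVm : ∀ n, Measurable (V n) := fun n => hφ.comp (h.measurable_jump n)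
  have hVid : ∀ n, IdentDistrib (V n) (V 0) μ μ := fun n => (h.identDistrib_jump n).comp hφ
  have hVi : iIndepFun V μ := h.indep_jump.comp (fun _ => φ) fun _ => hφ
  obtain ⟨K, hK1, hK⟩ := exists_partialSum_bound hf hVm hVid hVi ht
  rw [← h.integral_jumps t]
  refine hasTail_random (N := jumps gap Y t) (Z := fun k => partialSum V k) (K := max K 2) hf
    (h.measurable_jumps t)
    (fun k => Finset.measurable_fun_sum _ fun i _ => hVm i) (fun k => ?_)
    (hasTail_partialSum hf hVm hVid hVi ht) (le_max_right K 2) (fun k v => ?_)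
    (h.summable_jumps t (hK1.trans (le_max_left _ _)))
  · exact h.indepFun_jumps t (G := fun y => ∑ i ∈ Finset.range k, φ (y i))
      (Finset.measurable_fun_sum _ fun i _ => hφ.comp (measurable_pi_apply i))
  · refine (hK k v).trans (mul_le_mul_of_nonneg_right ?_ (hf.nonneg v))
    exact pow_le_pow_left₀ (by linarith) (le_max_left _ _) _

omit h in
lemma hasTail_max (ht : HasTail μ (Y 0) f 1) : HasTail μ (fun ω => max (Y 0 ω) 0) f 1 :=
  ht.congr_right (by
    filter_upwards [eventually_ge_atTop 0] with v hv ω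
    simp [not_lt.2 hv])

lemma hasTail_upSum (hf : StrongTail f) (ht : HasTail μ (Y 0) f 1) (t : ℝ≥0) :
    HasTail μ (upSum gap Y t) f (r * t) :=
  h.hasTail_rewards hf (φ := fun y => max y 0) (by fun_prop) (hasTail_max ht) t

theorem hasTail_compound (hf : StrongTail f) (ht : HasTail μ (Y 0) f 1) (c : ℝ) (t : ℝ≥0) :
    HasTail μ (compound gap Y c t) f (r * t) :=
  HasTail.const_add hf (h.hasTail_rewards hf measurable_id ht t) (c * t)

/-- Squeezed between the value at the endpoint and the sum of the positive jumps plus a constant,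
which have the same tail constant. -/
theorem hasTail_pathMax (hf : StrongTail f) (ht : HasTail μ (Y 0) f 1) (c : ℝ) {t : ℝ≥0}
    (h0 : 0 < t) : HasTail μ (fun ω => pathMax c t (marks gap Y ω)) f (r * t) := by
  have := h.indep_gap.isProbabilityMeasure
  refine tendsto_of_tendsto_of_tendsto_of_le_of_le (h.hasTail_compound hf ht c t)
    (HasTail.const_add hf (h.hasTail_upSum hf ht t) (max c 0 * t)) (fun v => ?_) fun v => ?_
  · refine div_le_div_of_nonneg_right ?_ (hf.nonneg v)
    refine ENNReal.toReal_mono (measure_ne_top _ _) (measure_mono_ae ?_)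
    filter_upwards [h.ae_goodMarks] with ω hω hv
    exact lt_of_lt_of_le hv (hω.pathX_le_pathMax c le_rfl h0)
  · refine div_le_div_of_nonneg_right ?_ (hf.nonneg v)
    refine ENNReal.toReal_mono (measure_ne_top _ _) (measure_mono_ae ?_)
    filter_upwards [h.ae_goodMarks] with ω hω hv
    exact lt_of_lt_of_le hv (hω.pathMax_le c t)

/-- In short time intervals large jumps are unlikely, uniformly in the level. -/
lemma exists_upSum_le (hf : StrongTail f) (ht : HasTail μ (Y 0) f 1) {δ : ℝ} (hδ : 0 < δ) :
    ∃ h₀ : ℝ≥0, 0 < h₀ ∧ ∀ t ≤ h₀, ∀ v ≥ 0, μ.real {ω | v < upSum gap Y t ω} ≤ δ * f v := by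
  have := h.indep_gap.isProbabilityMeasure
  have hr := h.rate_pos
  set V : ℕ → Ω → ℝ := fun n ω => max (Y n ω) 0 with hV
  have hφ : Measurable fun y : ℝ => max y 0 := by fun_prop
  have hVm : ∀ n, Measurable (V n) := fun n => hφ.comp (h.measurable_jump n)
  have hVid : ∀ n, IdentDistrib (V n) (V 0) μ μ := fun n => (h.identDistrib_jump n).comp hφ
  have hVi : iIndepFun V μ := h.indep_jump.comp (fun _ y => max y 0) fun _ => hφ
  obtain ⟨K, hK1, hK⟩ := exists_partialSum_bound hf hVm hVid hVi (hasTail_max ht)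
  have hK0 : 0 < K := by linarith
  have hlim : Tendsto (fun u : ℝ => Real.exp 1 * K * (r * u * K) * (1 - r * u * K)⁻¹) (𝓝 0)
      (𝓝 0) := by
    have : ContinuousAt (fun u : ℝ => Real.exp 1 * K * (r * u * K) * (1 - r * u * K)⁻¹) 0 :=
      ContinuousAt.mul (by fun_prop) (ContinuousAt.inv₀ (by fun_prop) (by simp))
    simpa [ContinuousAt] using this
  have hlim2 : Tendsto (fun u : ℝ => r * u * K) (𝓝 0) (𝓝 0) := by
    have : ContinuousAt (fun u : ℝ => r * u * K) 0 := by fun_prop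
    simpa [ContinuousAt] using this
  obtain ⟨u, ⟨hu1, hu2⟩, hu0⟩ := (((hlim.eventually (gt_mem_nhds hδ)).and
    (hlim2.eventually (gt_mem_nhds one_pos))).filter_mono
      (nhdsWithin_le_nhds (s := Set.Ioi 0))).and self_mem_nhdsWithin |>.exists
  have hu0 : 0 < u := hu0
  refine ⟨⟨u, hu0.le⟩, hu0, fun t htu v hv => ?_⟩
  have hsum := hasSum_random (h.measurable_jumps t)
    (fun k => Finset.measurable_fun_sum (Finset.range k) fun i _ => hVm i) (fun k =>
      h.indepFun_jumps t (G := fun y => ∑ i ∈ Finset.range k, max (y i) 0)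
      (Finset.measurable_fun_sum _ fun i _ => hφ.comp (measurable_pi_apply i))) v
  have hρ : 0 ≤ r * u * K := by positivity
  have hgeo : HasSum (fun k : ℕ => Real.exp 1 * K * (r * u * K) * (r * u * K) ^ k * f v)
      (Real.exp 1 * K * (r * u * K) * (1 - r * u * K)⁻¹ * f v) :=
    ((hasSum_geometric_of_lt_one hρ hu2).mul_left _).mul_right _
  -- Without jumps the sum is zero and cannot exceed `v ≥ 0`; every remaining term carries the small
  -- factor `r u K`.
  have h0 : μ.real {ω | jumps gap Y t ω = 0} * μ.real {ω | v < ∑ i ∈ Finset.range 0, V i ω} = 0 := by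
    simp [not_lt.2 hv]
  have hsum1 := (hasSum_nat_add_iff' 1).2 hsum
  rw [Finset.sum_range_one, h0, sub_zero] at hsum1
  refine (hasSum_le (fun k => ?_) hsum1 hgeo).trans
    (mul_le_mul_of_nonneg_right hu1.le (hf.nonneg v))
  have h1 : μ.real {ω | jumps gap Y t ω = k + 1} ≤ Real.exp 1 * (r * u) ^ (k + 1) := by
    have h2 := (measureReal_mono (μ := μ)
      (show {ω | jumps gap Y t ω = k + 1} ⊆ {ω | k + 1 ≤ jumps gap Y t ω} from
      fun ω (hω : jumps gap Y t ω = k + 1) => hω.ge)).trans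
      (h.measureReal_le_jumps t (k + 1) (show 0 < u⁻¹ by positivity))
    rw [div_inv_eq_mul] at h2
    refine h2.trans (mul_le_mul_of_nonneg_right (Real.exp_le_exp.2 ?_) (by positivity))
    rw [inv_mul_le_one₀ hu0]
    exact htu
  calc _ ≤ Real.exp 1 * (r * u) ^ (k + 1) * (K ^ (k + 1 + 1) * f v) :=
        mul_le_mul h1 (hK (k + 1) v) measureReal_nonneg (by positivity)
    _ = _ := by rw [mul_pow (r * u) K]; ring

end IsCompoundPoissonData

end

end RandomTimeMaxima

/-! ### Recovering the number of jumps from the path -/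

namespace RandomTimeMaxima

section

open scoped Classical in
/-- The number of jumps in `[0, s]` of a path with drift `c`, read off from the increments of the
path over fine partitions. -/
noncomputable def jumpCount (c : ℝ) (s : ℝ≥0) (g : ℝ≥0 → ℝ) : ℝ :=
  (limsup (fun n : ℕ => ∑ i ∈ Finset.range (n + 1),
    if g ((i + 1 : ℕ) * (s / (n + 1))) - g (i * (s / (n + 1))) = c * (s / (n + 1) : ℝ≥0)
      then (0 : ℝ≥0∞) else 1) atTop).toReal

/-- Random times are assumed independent only of increments of the path, so a jump count may serve
as a step only if the increments determine it measurably. -/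
lemma measurable_jumpCount {Ω : Type*} {m : MeasurableSpace Ω} (c : ℝ) {s : ℝ≥0}
    {Z : ℝ≥0 → Ω → ℝ} (hZ : ∀ u ≤ s, Measurable (Z u)) :
    Measurable fun ω => jumpCount c s fun u => Z u ω := by
  refine ENNReal.measurable_toReal.comp (Measurable.limsup fun n => ?_)
  refine Finset.measurable_fun_sum _ fun i hi => ?_
  have hle : ∀ k : ℕ, k ≤ n + 1 → (k : ℝ≥0) * (s / (n + 1)) ≤ s := fun k hk => by
    rw [← mul_div_assoc, div_le_iff₀ (by positivity), mul_comm]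
    gcongr
    exact_mod_cast hk
  have hi := Finset.mem_range.1 hi
  refine Measurable.ite ?_ measurable_const measurable_const
  exact measurableSet_eq_fun ((hZ _ (hle _ hi)).sub (hZ _ (hle _ hi.le))) measurable_const

namespace GoodMarks

variable {z : Marks} (hz : GoodMarks z)
include hz

/-- Two jumps between `t` and `t'` would be separated by a gap not exceeding `δ`. -/
lemma pathCount_le_add_one {s t t' : ℝ≥0} (hs : t' ≤ s) {δ : ℝ}
    (hδ : ∀ i < pathCount z s, δ < z.1 i) (ht : (t' : ℝ) - t ≤ δ) :
    pathCount z t' ≤ pathCount z t + 1 := by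
  by_contra! hlt
  have h1 := (hz.lt_pathCount _ _).1 hlt
  have h2 := ((hz.pathCount_eq_iff t _).1 rfl).2
  have h3 := hδ _ (hlt.trans_le (hz.pathCount_mono hs))
  rw [epoch_succ] at h1
  simp only [gapAt] at h1 h2
  linarith

/-- The number of jumps is a function of the path. -/
theorem jumpCount_eq (c : ℝ) (s : ℝ≥0) : jumpCount c s (pathX c z) = pathCount z s := by
  have hlim : Tendsto (fun n : ℕ => (s : ℝ) / (n + 1)) atTop (𝓝 0) := by
    simpa [div_eq_mul_inv] using tendsto_one_div_add_atTop_nhds_zero_nat.const_mul (s : ℝ)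
  -- Once the mesh is below all gaps before `s`, a cell holds at most one jump; as jumps are
  -- nonzero, an increment equal to the drift alone means no jump. The sum is then exact, not only
  -- in the limit.
  have hev : ∀ᶠ n : ℕ in atTop, ∀ i ∈ Finset.range (pathCount z s), (s : ℝ) / (n + 1) < z.1 i :=
    (Filter.eventually_all_finset _).2 fun i _ => hlim.eventually (gt_mem_nhds (hz.gap_pos i))
  rw [jumpCount, Filter.limsup_congr (v := fun _ => (pathCount z s : ℝ≥0∞)), limsup_const,
    ENNReal.toReal_natCast]
  filter_upwards [hev] with n hn
  set δ : ℝ≥0 := s / (n + 1) with hδ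
  have hδr : (δ : ℝ) = s / (n + 1) := by rw [hδ]; push_cast; rfl
  have hmul : ((n + 1 : ℕ) : ℝ≥0) * δ = s := by rw [hδ]; push_cast; field_simp
  have hmono : Monotone fun i : ℕ => pathCount z (i * δ) := fun i j hij =>
    hz.pathCount_mono (by gcongr)
  have hterm : ∀ i ∈ Finset.range (n + 1),
      (if pathX c z ((i + 1 : ℕ) * δ) - pathX c z (i * δ) = c * δ then (0 : ℝ≥0∞) else 1) =
        ((pathCount z ((i + 1 : ℕ) * δ) - pathCount z (i * δ) : ℕ) : ℝ≥0∞) := by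
    intro i hi
    have hi := Finset.mem_range.1 hi
    have hle : ((i + 1 : ℕ) : ℝ≥0) * δ ≤ s := by
      rw [← hmul]; gcongr; omega
    have h1 := hz.pathCount_le_add_one hle (t := i * δ) (δ := δ)
      (fun j hj => by rw [hδr]; exact hn j (Finset.mem_range.2 hj))
      (by push_cast; linarith)
    have h2 : pathCount z (i * δ) ≤ pathCount z ((i + 1 : ℕ) * δ) := hmono (Nat.le_succ i)
    rcases h2.eq_or_lt with h3 | h3
    · rw [if_pos, ← h3]
      · simp
      · rw [pathX_eq, pathX_eq, ← h3]; push_cast; ring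
    · have h4 : pathCount z ((i + 1 : ℕ) * δ) = pathCount z (i * δ) + 1 := by omega
      rw [if_neg, h4]
      · simp
      · rw [pathX_eq, pathX_eq, h4, Finset.sum_range_succ]
        intro h5
        refine hz.jump_ne (pathCount z (i * δ)) ?_
        push_cast at h5
        linarith
  rw [Finset.sum_congr rfl hterm, ← Nat.cast_sum,
    Finset.sum_range_tsub (f := fun i : ℕ => pathCount z (i * δ)) hmono, hmul]
  simp [hz.pathCount_zero]

end GoodMarks

end

end RandomTimeMaxima

/-! ### Random times independent of the future as optional times of a filtration -/

namespace RandomTimeMaxima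

section

variable {Ω : Type*} [mΩ : MeasurableSpace Ω] {μ : Measure Ω} [IsProbabilityMeasure μ]

/-- On the generating π-system of intersections `a ∩ b`, first `a` splits off by independence from
`I ⊔ G`, and then `b` separates from `g`. -/
lemma indep_sup_left {A I G : MeasurableSpace Ω} (hA : A ≤ mΩ) (hI : I ≤ mΩ) (hG : G ≤ mΩ)
    (h1 : Indep A (I ⊔ G) μ) (h2 : Indep I G μ) : Indep (A ⊔ I) G μ := by
  set S : Set (Set Ω) := {s | ∃ a b, MeasurableSet[A] a ∧ MeasurableSet[I] b ∧ s = a ∩ b} with hS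
  have hgen : A ⊔ I = MeasurableSpace.generateFrom S := by
    refine le_antisymm (sup_le ?_ ?_) (MeasurableSpace.generateFrom_le ?_)
    · exact fun a ha => MeasurableSpace.measurableSet_generateFrom
        ⟨a, Set.univ, ha, MeasurableSet.univ, (Set.inter_univ a).symm⟩
    · exact fun b hb => MeasurableSpace.measurableSet_generateFrom
        ⟨Set.univ, b, MeasurableSet.univ, hb, (Set.univ_inter b).symm⟩
    · rintro _ ⟨a, b, ha, hb, rfl⟩
      exact MeasurableSet.inter ((le_sup_left : A ≤ A ⊔ I) a ha) ((le_sup_right : I ≤ A ⊔ I) b hb)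
  refine IndepSets.indep (p1 := S) (p2 := {s | MeasurableSet[G] s}) (sup_le hA hI) hG ?_
    (@MeasurableSpace.isPiSystem_measurableSet Ω G) hgen
    (@MeasurableSpace.generateFrom_measurableSet Ω G).symm ?_
  · rintro _ ⟨a, b, ha, hb, rfl⟩ _ ⟨a', b', ha', hb', rfl⟩ _
    exact ⟨a ∩ a', b ∩ b', ha.inter ha', hb.inter hb', Set.inter_inter_inter_comm a b a' b'⟩
  · rw [IndepSets_iff]
    rintro _ g ⟨a, b, ha, hb, rfl⟩ hg
    rw [Indep_iff] at h1 h2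
    have hbI : MeasurableSet[I ⊔ G] b := (le_sup_left : I ≤ I ⊔ G) b hb
    have hgI : MeasurableSet[I ⊔ G] g := (le_sup_right : G ≤ I ⊔ G) g hg
    rw [Set.inter_assoc, h1 a (b ∩ g) ha (hbI.inter hgI), h2 b g hb hg, h1 a b ha hbI, mul_assoc]

/-- The σ-algebra generated by the path until time `t`. -/
abbrev pastAlg (X : ℝ≥0 → Ω → ℝ) (t : ℝ≥0) : MeasurableSpace Ω :=
  ⨆ (s : ℝ≥0) (_ : s ≤ t), MeasurableSpace.comap (X s) inferInstance

/-- The σ-algebra generated by the increments after time `t`. -/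
abbrev futureAlg (X : ℝ≥0 → Ω → ℝ) (t : ℝ≥0) : MeasurableSpace Ω :=
  ⨆ (s : ℝ≥0) (_ : t < s), MeasurableSpace.comap (fun ω => X s ω - X t ω) inferInstance

/-- The σ-algebra generated by the increments between `t` and `t'`. -/
abbrev incrAlg (X : ℝ≥0 → Ω → ℝ) (t t' : ℝ≥0) : MeasurableSpace Ω :=
  ⨆ (s : ℝ≥0) (_ : t < s ∧ s ≤ t'), MeasurableSpace.comap (fun ω => X s ω - X t ω) inferInstance

/-- A filtration to which `X` is adapted and that does not depend on the future increments. -/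
structure FutureIndep (μ : Measure Ω) (X : ℝ≥0 → Ω → ℝ) (𝒜 : ℝ≥0 → MeasurableSpace Ω) : Prop where
  le : ∀ t, 𝒜 t ≤ mΩ
  mono : Monotone 𝒜
  adapted : ∀ t, Measurable[𝒜 t] (X t)
  indep : ∀ t, 0 < t → Indep (𝒜 t) (futureAlg X t) μ

/-- A bounded optional time. -/
structure OptionalTime (𝒜 : ℝ≥0 → MeasurableSpace Ω) (T : Ω → ℝ≥0) : Prop where
  lt : ∀ s, MeasurableSet[𝒜 s] {ω | T ω < s}
  bdd : ∃ L : ℝ≥0, ∀ ω, T ω ≤ L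

/-- The filtration generated by `X` and the events `{τ ≤ t}`. -/
abbrev stopAlg (X : ℝ≥0 → Ω → ℝ) (τ : Ω → ℝ≥0∞) (t : ℝ≥0) : MeasurableSpace Ω :=
  MeasurableSpace.generateFrom {A | ∃ C, MeasurableSet[pastAlg X t] C ∧
    (A = C ∨ ∃ s, 0 < s ∧ s ≤ t ∧ A = C ∩ {ω | τ ω ≤ (s : ℝ≥0∞)})}

section Alg

variable {X : ℝ≥0 → Ω → ℝ}

omit mΩ in
lemma measurable_pastAlg {s t : ℝ≥0} (h : s ≤ t) : Measurable[pastAlg X t] (X s) :=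
  measurable_iff_comap_le.2 (le_iSup₂_of_le s h le_rfl)

omit mΩ in
lemma measurable_futureAlg {s t : ℝ≥0} (h : t ≤ s) :
    Measurable[futureAlg X t] fun ω => X s ω - X t ω := by
  rcases h.eq_or_lt with rfl | h
  · simp_rw [sub_self]; exact @measurable_const ℝ Ω _ (futureAlg X t) 0
  · exact measurable_iff_comap_le.2 (le_iSup₂_of_le s h le_rfl)

omit mΩ in
lemma measurable_incrAlg {s t t' : ℝ≥0} (h : t ≤ s) (h' : s ≤ t') :
    Measurable[incrAlg X t t'] fun ω => X s ω - X t ω := by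
  rcases h.eq_or_lt with rfl | h
  · simp_rw [sub_self]; exact @measurable_const ℝ Ω _ (incrAlg X t t') 0
  · exact measurable_iff_comap_le.2 (le_iSup₂_of_le s ⟨h, h'⟩ le_rfl)

omit mΩ in
lemma pastAlg_mono : Monotone (pastAlg X) := fun _ _ h =>
  iSup₂_le fun _ hu => (measurable_pastAlg (hu.trans h)).comap_le

lemma pastAlg_le (hX : ∀ t, Measurable (X t)) (t : ℝ≥0) : pastAlg X t ≤ mΩ :=
  iSup₂_le fun u _ => (hX u).comap_le

lemma futureAlg_le (hX : ∀ t, Measurable (X t)) (t : ℝ≥0) : futureAlg X t ≤ mΩ :=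
  iSup₂_le fun u _ => ((hX u).sub (hX t)).comap_le

lemma incrAlg_le (hX : ∀ t, Measurable (X t)) (t t' : ℝ≥0) : incrAlg X t t' ≤ mΩ :=
  iSup₂_le fun u _ => ((hX u).sub (hX t)).comap_le

omit mΩ in
lemma incrAlg_le_futureAlg (t t' : ℝ≥0) : incrAlg X t t' ≤ futureAlg X t :=
  iSup₂_le fun _ hu => (measurable_futureAlg hu.1.le).comap_le

omit mΩ in
lemma incrAlg_le_pastAlg {t t' : ℝ≥0} (h : t ≤ t') : incrAlg X t t' ≤ pastAlg X t' :=
  iSup₂_le fun _ hu =>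
    ((measurable_pastAlg hu.2).sub (measurable_pastAlg h)).comap_le

omit mΩ in
lemma futureAlg_anti {s t : ℝ≥0} (h : s ≤ t) : futureAlg X t ≤ futureAlg X s :=
  iSup₂_le fun u hu => by
    have h1 : Measurable[futureAlg X s] fun ω => (X u ω - X s ω) - (X t ω - X s ω) :=
      (measurable_futureAlg (h.trans hu.le)).sub (measurable_futureAlg h)
    simp_rw [sub_sub_sub_cancel_right] at h1
    exact h1.comap_le

omit mΩ in
lemma pastAlg_le_sup (s t : ℝ≥0) : pastAlg X t ≤ pastAlg X s ⊔ incrAlg X s t :=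
  iSup₂_le fun u hu => by
    rcases le_total u s with hus | hus
    · exact ((measurable_pastAlg hus).mono le_sup_left le_rfl).comap_le
    · have h1 : Measurable[pastAlg X s ⊔ incrAlg X s t] fun ω => X s ω + (X u ω - X s ω) :=
        ((measurable_pastAlg le_rfl).mono le_sup_left le_rfl).add
          ((measurable_incrAlg hus hu).mono le_sup_right le_rfl)
      simp_rw [add_sub_cancel] at h1
      exact h1.comap_le

omit mΩ in
lemma measurableSet_stopAlg {τ : Ω → ℝ≥0∞} {t : ℝ≥0} {C : Set Ω} (h : MeasurableSet[pastAlg X t] C) :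
    MeasurableSet[stopAlg X τ t] C :=
  MeasurableSpace.measurableSet_generateFrom ⟨C, h, Or.inl rfl⟩

omit mΩ in
lemma measurableSet_stopAlg_le {τ : Ω → ℝ≥0∞} {s t : ℝ≥0} (h0 : 0 < s) (h : s ≤ t) :
    MeasurableSet[stopAlg X τ t] {ω | τ ω ≤ (s : ℝ≥0∞)} :=
  MeasurableSpace.measurableSet_generateFrom ⟨Set.univ, MeasurableSet.univ,
    Or.inr ⟨s, h0, h, (Set.univ_inter _).symm⟩⟩

/-- A random time that does not depend on the future increments can be added to the past. -/
theorem NotDependOnFuture.futureIndep {τ : Ω → ℝ≥0∞} (hX : ∀ t, Measurable (X t))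
    (hτ : Measurable τ) (h : NotDependOnFuture μ X τ) : FutureIndep μ X (stopAlg X τ) where
  le t := by
    refine MeasurableSpace.generateFrom_le ?_
    rintro _ ⟨C, hC, rfl | ⟨s, -, -, rfl⟩⟩
    · exact pastAlg_le hX t _ hC
    · exact (pastAlg_le hX t _ hC).inter (measurableSet_le hτ measurable_const)
  mono s t hst := by
    refine MeasurableSpace.generateFrom_le ?_
    rintro _ ⟨C, hC, rfl | ⟨u, hu0, hu, rfl⟩⟩
    · exact measurableSet_stopAlg (pastAlg_mono hst _ hC)
    · exact (measurableSet_stopAlg (pastAlg_mono hst _ hC)).inter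
        (measurableSet_stopAlg_le hu0 (hu.trans hst))
  adapted t := fun B hB => measurableSet_stopAlg (measurable_pastAlg le_rfl hB)
  indep t ht := by
    have hle : ∀ s : ℝ≥0, MeasurableSpace.generateFrom {{ω | τ ω ≤ (s : ℝ≥0∞)}} ≤ mΩ := fun s =>
      MeasurableSpace.generateFrom_le fun A hA => by
        rw [Set.mem_singleton_iff.1 hA]; exact measurableSet_le hτ measurable_const
    have hpf : Indep (pastAlg X t) (futureAlg X t) μ :=
      indep_of_indep_of_le_left (h t ht) le_sup_left
    -- At an earlier time `s` the hypothesis gives independence from all increments after `s`. Those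
    -- up to `t` are moved to the side of the past, being independent of the future of `t` by the
    -- hypothesis at `t`.
    have key : ∀ s : ℝ≥0, 0 < s → s ≤ t → Indep
        (pastAlg X s ⊔ MeasurableSpace.generateFrom {{ω | τ ω ≤ (s : ℝ≥0∞)}} ⊔ incrAlg X s t)
        (futureAlg X t) μ := fun s hs0 hs =>
      indep_sup_left (sup_le (pastAlg_le hX s) (hle s)) (incrAlg_le hX s t) (futureAlg_le hX t)
        (indep_of_indep_of_le_right (h s hs0)
          (sup_le (incrAlg_le_futureAlg s t) (futureAlg_anti hs)))
        (indep_of_indep_of_le_left hpf (incrAlg_le_pastAlg hs))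
    refine IndepSets.indep (p2 := {s | MeasurableSet[futureAlg X t] s}) ?_ (futureAlg_le hX t) ?_
      (@MeasurableSpace.isPiSystem_measurableSet Ω (futureAlg X t)) rfl
      (@MeasurableSpace.generateFrom_measurableSet Ω (futureAlg X t)).symm ?_
    · refine MeasurableSpace.generateFrom_le ?_
      rintro _ ⟨C, hC, rfl | ⟨s, -, -, rfl⟩⟩
      · exact pastAlg_le hX t _ hC
      · exact (pastAlg_le hX t _ hC).inter (measurableSet_le hτ measurable_const)
    · rintro _ ⟨C, hC, rfl | ⟨s, hs0, hs, rfl⟩⟩ _ ⟨C', hC', rfl | ⟨s', hs0', hs', rfl⟩⟩ _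
      · exact ⟨_, hC.inter hC', Or.inl rfl⟩
      · exact ⟨_, hC.inter hC', Or.inr ⟨s', hs0', hs', (Set.inter_assoc _ _ _).symm⟩⟩
      · exact ⟨_, hC.inter hC', Or.inr ⟨s, hs0, hs, Set.inter_right_comm _ _ _⟩⟩
      -- The events `τ ≤ s` are nested, so intersections stay in the generating class.
      · refine ⟨_, hC.inter hC', Or.inr ⟨min s s', lt_min hs0 hs0', (min_le_left _ _).trans hs, ?_⟩⟩
        rw [Set.inter_inter_inter_comm]
        congr 1
        ext ω
        simp [ENNReal.coe_min]
    · rw [IndepSets_iff]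
      rintro _ G ⟨C, hC, rfl | ⟨s, hs0, hs, rfl⟩⟩ hG
      · exact (Indep_iff _ _ μ).1 hpf _ _ hC hG
      · refine (Indep_iff _ _ μ).1 (key s hs0 hs) _ _ (MeasurableSet.inter ?_ ?_) hG
        · refine (sup_le_sup_right le_sup_left _ : pastAlg X s ⊔ incrAlg X s t ≤ _) _
            (pastAlg_le_sup s t _ hC)
        · refine (le_sup_right.trans le_sup_left :
            MeasurableSpace.generateFrom {{ω | τ ω ≤ (s : ℝ≥0∞)}} ≤ _) _
            (MeasurableSpace.measurableSet_generateFrom rfl)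

omit mΩ in
/-- Truncated random times. -/
lemma optionalTime_stopAlg (τ : Ω → ℝ≥0∞) (L : ℝ≥0) :
    OptionalTime (stopAlg X τ) fun ω => (min (τ ω) L).toNNReal where
  lt s := by
    have hcoe : ∀ ω, ((min (τ ω) L).toNNReal : ℝ≥0∞) = min (τ ω) L := fun ω =>
      ENNReal.coe_toNNReal (min_lt_of_right_lt ENNReal.coe_lt_top).ne
    by_cases hL : L < s
    · have : {ω | (min (τ ω) L).toNNReal < s} = Set.univ := by
        refine Set.eq_univ_of_forall fun ω => lt_of_le_of_lt ?_ hL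
        rw [← ENNReal.coe_le_coe, hcoe]
        exact min_le_right _ _
      rw [this]; exact MeasurableSet.univ
    -- The strict inequality is a countable union of events `τ ≤ q`; `q` must be positive because
    -- the filtration provides such events for positive times only.
    · have : {ω | (min (τ ω) L).toNNReal < s} =
          ⋃ q : {q : ℚ≥0 // 0 < q ∧ (q : ℝ≥0) < s}, {ω | τ ω ≤ ((q : ℚ≥0) : ℝ≥0)} := by
        ext ω
        simp only [Set.mem_ofPred_eq, Set.mem_iUnion, Subtype.exists, exists_prop]
        constructor
        · intro hω
          obtain ⟨q, hq1, hq2⟩ := exists_rat_btwn (NNReal.coe_lt_coe.2 hω)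
          have hq0 : 0 < q := by
            have : (0:ℝ) < q := lt_of_le_of_lt (NNReal.coe_nonneg _) hq1
            exact_mod_cast this
          lift q to ℚ≥0 using hq0.le
          have e1 : (min (τ ω) L).toNNReal < (q : ℝ≥0) := by
            rw [← NNReal.coe_lt_coe]; exact hq1.trans_eq (by norm_cast)
          have e2 : (q : ℝ≥0) < s := by
            rw [← NNReal.coe_lt_coe]; exact lt_of_eq_of_lt (by norm_cast) hq2
          refine ⟨q, ⟨by exact_mod_cast hq0, e2⟩, ?_⟩
          rw [← ENNReal.coe_lt_coe, hcoe] at e1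
          rcases min_lt_iff.1 e1 with h2 | h2
          · exact h2.le
          · exact absurd ((ENNReal.coe_lt_coe.1 h2).trans e2) hL
        · rintro ⟨q, ⟨-, hq⟩, hω⟩
          refine lt_of_le_of_lt ?_ hq
          rw [← ENNReal.coe_le_coe, hcoe]
          exact (min_le_left _ _).trans hω
      rw [this]
      refine MeasurableSet.iUnion fun q => measurableSet_stopAlg_le ?_ q.2.2.le
      exact_mod_cast q.2.1
  bdd := ⟨L, fun ω => by
    rw [← ENNReal.coe_le_coe,
      ENNReal.coe_toNNReal (min_lt_of_right_lt ENNReal.coe_lt_top).ne]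
    exact min_le_right _ _⟩

omit [IsProbabilityMeasure μ] in
/-- Delayed optional times. -/
lemma OptionalTime.add_const {𝒜 : ℝ≥0 → MeasurableSpace Ω} {T : Ω → ℝ≥0} (hT : OptionalTime 𝒜 T)
    (h : FutureIndep μ X 𝒜) (d : ℝ≥0) : OptionalTime 𝒜 fun ω => T ω + d where
  lt s := by
    have : {ω | T ω + d < s} = {ω | T ω < s - d} := by
      ext ω; simp only [Set.mem_ofPred_eq, lt_tsub_iff_right]
    rw [this]
    exact h.mono (tsub_le_self (a := s)) _ (hT.lt _)
  bdd := by
    obtain ⟨L, hL⟩ := hT.bdd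
    exact ⟨L + d, fun ω => add_le_add_left (hL ω) d⟩

end Alg

end

end RandomTimeMaxima

/-! ### Discretization on a grid and the upper bound for the process -/

namespace RandomTimeMaxima

section

section Grid

variable {Ω : Type*} {η : ℝ≥0} {T : Ω → ℝ≥0} {ω : Ω}

/-- The index of the first point of the grid of mesh `η` after the time `T`. -/
noncomputable def gridIndex (η : ℝ≥0) (T : Ω → ℝ≥0) (ω : Ω) : ℕ := ⌊T ω / η⌋₊ + 1

lemma gridIndex_le_iff (hη : 0 < η) {n : ℕ} : gridIndex η T ω ≤ n ↔ T ω < n * η := by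
  rw [gridIndex, Nat.succ_le_iff, Nat.floor_lt (by positivity), div_lt_iff₀ hη]

lemma lt_gridIndex_iff (hη : 0 < η) {n : ℕ} : n < gridIndex η T ω ↔ n * η ≤ T ω := by
  rw [← not_le, gridIndex_le_iff hη, not_lt]

lemma lt_gridIndex_mul (hη : 0 < η) : T ω < gridIndex η T ω * η := (gridIndex_le_iff hη).1 le_rfl

lemma gridIndex_mul_le (hη : 0 < η) : gridIndex η T ω * η ≤ T ω + η := by
  have h1 : ((gridIndex η T ω - 1 : ℕ) : ℝ≥0) * η ≤ T ω :=
    (lt_gridIndex_iff hη).1 (Nat.sub_lt (Nat.succ_pos _) one_pos)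
  calc (gridIndex η T ω : ℝ≥0) * η = ((gridIndex η T ω - 1 : ℕ) : ℝ≥0) * η + η := by
        simp [gridIndex, add_mul]
    _ ≤ _ := add_le_add_left h1 η

/-- The information available at the points of the grid. -/
abbrev gridPast (𝒜 : ℝ≥0 → MeasurableSpace Ω) (η : ℝ≥0) (n : ℕ) : MeasurableSpace Ω :=
  if n = 0 then ⊥ else 𝒜 (n * η)

/-- The information of the increments between two points of the grid. -/
abbrev gridStep (X : ℝ≥0 → Ω → ℝ) (η : ℝ≥0) (n : ℕ) : MeasurableSpace Ω :=
  incrAlg X (n * η) ((n + 1 : ℕ) * η)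

/-- The increments over a grid. -/
noncomputable def gridIncr (X : ℝ≥0 → Ω → ℝ) (η : ℝ≥0) (n : ℕ) (ω : Ω) : ℝ :=
  X ((n + 1 : ℕ) * η) ω - X (n * η) ω

/-- The maxima of the increments over a grid. -/
noncomputable def gridMax (X : ℝ≥0 → Ω → ℝ) (η : ℝ≥0) (n : ℕ) (ω : Ω) : ℝ :=
  ⨆ q : {q : ℚ≥0 // q ≤ 1}, (X (n * η + (q : ℚ≥0) * η) ω - X (n * η) ω)

variable {X : ℝ≥0 → Ω → ℝ}

lemma partialSum_gridIncr (k : ℕ) : partialSum (gridIncr X η) k ω = X (k * η) ω - X 0 ω := by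
  have := Finset.sum_range_sub (fun i : ℕ => X (i * η) ω) k
  simpa [partialSum, gridIncr] using this

lemma measurable_gridIncr (n : ℕ) : Measurable[gridStep X η n] (gridIncr X η n) :=
  measurable_incrAlg (by gcongr; omega) le_rfl

lemma measurable_gridMax (n : ℕ) : Measurable[gridStep X η n] (gridMax X η n) := by
  refine Measurable.iSup fun q => measurable_incrAlg le_self_add ?_
  rw [Nat.cast_succ, add_mul, one_mul]
  gcongr
  exact mul_le_of_le_one_left' (by exact_mod_cast q.2)

variable [mΩ : MeasurableSpace Ω] {μ : Measure Ω} [IsProbabilityMeasure μ]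
  {𝒜 : ℝ≥0 → MeasurableSpace Ω}

omit [IsProbabilityMeasure μ] in
lemma FutureIndep.measurable (h : FutureIndep μ X 𝒜) (t : ℝ≥0) : Measurable (X t) :=
  (h.adapted t).mono (h.le t) le_rfl

omit [IsProbabilityMeasure μ] in
lemma FutureIndep.measurable_time (h : FutureIndep μ X 𝒜) (hT : OptionalTime 𝒜 T) :
    Measurable T := measurable_of_Iio fun s => h.le s _ (hT.lt s)

/-- Rounding to a grid point strictly after `T` makes the event that the index is at most `n` equal
to `T < n η`, which is known at that grid point. -/
theorem FutureIndep.gridStopping (h : FutureIndep μ X 𝒜) (hT : OptionalTime 𝒜 T) (hη : 0 < η) :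
    GridStopping μ (gridPast 𝒜 η) (gridStep X η) (gridIndex η T) where
  le n := by
    unfold gridPast
    split_ifs
    · exact bot_le
    · exact h.le _
  mono m n hmn := by
    unfold gridPast
    split_ifs with h1 h2 h2
    · exact le_rfl
    · exact bot_le
    · omega
    · exact h.mono (by gcongr)
  step_le n := by
    rw [gridPast, if_neg (Nat.succ_ne_zero n)]
    refine iSup₂_le fun u hu => Measurable.comap_le ?_
    exact ((h.adapted u).mono (h.mono hu.2) le_rfl).sub
      ((h.adapted _).mono (h.mono (hu.1.le.trans hu.2)) le_rfl)
  -- Independence of the future is available at positive times only; at the grid point zero the past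
  -- is taken trivial.
  indep n := by
    unfold gridPast
    split_ifs with h1
    · exact indep_bot_left _
    · exact indep_of_indep_of_le_right (h.indep _ (by positivity)) (incrAlg_le_futureAlg _ _)
  stopped n := by
    simp_rw [gridIndex_le_iff hη]
    by_cases h1 : n = 0
    · subst h1; simp
    · have := hT.lt (n * η)
      rwa [gridPast, if_neg h1]
  bdd := by
    obtain ⟨L, hL⟩ := hT.bdd
    refine ⟨⌊L / η⌋₊ + 1, fun ω => ?_⟩
    unfold gridIndex
    gcongr
    exact hL ω

end Grid

section Window

variable {Ω : Type*} [mΩ : MeasurableSpace Ω] {μ : Measure Ω} [IsProbabilityMeasure μ] {f : ℝ → ℝ}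

/-- By the tangent inequality, lengthening a window by `d` costs at most `d f x`. -/
lemma integral_windowInt_le (hf : StrongTail f) {W W' : Ω → ℝ} {L L' d : ℝ} (hW : Measurable W)
    (hW' : Measurable W') (hL : ∀ ω, |W ω| ≤ L) (hL' : ∀ ω, |W' ω| ≤ L') (h0 : ∀ ω, 0 ≤ W' ω)
    (hd : 0 ≤ d) (hle : ∀ ω, W ω ≤ W' ω + d) (x : ℝ) :
    ∫ ω, windowInt f x (W ω) ∂μ ≤ ∫ ω, windowInt f x (W' ω) ∂μ + d * f x := by
  have hi := integrable_windowInt (μ := μ) hf hW hL x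
  have hi' := integrable_windowInt (μ := μ) hf hW' hL' x
  have h1 : ∫ ω, windowInt f x (W' ω) ∂μ + d * f x = ∫ ω, (windowInt f x (W' ω) + d * f x) ∂μ := by
    rw [integral_add hi' (integrable_const _)]; simp
  rw [h1]
  refine integral_mono hi (hi'.add (integrable_const _)) fun ω => ?_
  calc windowInt f x (W ω) ≤ windowInt f x (W' ω + d) := hf.windowInt_mono x (hle ω)
    _ ≤ windowInt f x (W' ω) + (W' ω + d - W' ω) * f (x + W' ω) := hf.windowInt_tangent x _ _
    _ ≤ windowInt f x (W' ω) + d * f x := by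
      rw [add_sub_cancel_left]
      have := hf.anti (show x ≤ x + W' ω by linarith [h0 ω])
      gcongr

variable {T : Ω → ℝ≥0} {η : ℝ≥0}

lemma measurable_gridIndex (hT : Measurable T) : Measurable (gridIndex η T) :=
  (Nat.measurable_floor.comp (hT.div_const η)).add_const 1

omit mΩ in
lemma coe_gridIndex_mul_le (hη : 0 < η) (ω : Ω) : (gridIndex η T ω : ℝ) * η ≤ T ω + η := by
  exact_mod_cast gridIndex_mul_le (T := T) (ω := ω) hη

omit mΩ in
lemma coe_lt_gridIndex_mul (hη : 0 < η) (ω : Ω) : (T ω : ℝ) < gridIndex η T ω * η := by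
  exact_mod_cast lt_gridIndex_mul (T := T) (ω := ω) hη

/-- The mean window of a random time and of its grid approximation. -/
lemma integral_windowInt_grid (hf : StrongTail f) (hT : Measurable T) {L : ℝ≥0}
    (hL : ∀ ω, T ω ≤ L) (hη : 0 < η) {b : ℝ} (hb : 0 ≤ b) (x : ℝ) :
    ∫ ω, windowInt f x (b * η * gridIndex η T ω) ∂μ ≤
        ∫ ω, windowInt f x (b * T ω) ∂μ + b * η * f x ∧
      ∫ ω, windowInt f x (b * T ω) ∂μ ≤ ∫ ω, windowInt f x (b * η * gridIndex η T ω) ∂μ := by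
  have hL0 : ∀ ω, (T ω : ℝ) ≤ L := hL
  have hTm : Measurable fun ω => b * (T ω : ℝ) := hT.coe_nnreal_real.const_mul b
  have hgm : Measurable fun ω => b * η * (gridIndex η T ω : ℝ) :=
    (measurable_from_nat.comp (measurable_gridIndex hT)).const_mul _
  have hb1 : ∀ ω, |b * (T ω : ℝ)| ≤ b * L := fun ω => by
    rw [abs_of_nonneg (by positivity)]
    exact mul_le_mul_of_nonneg_left (hL0 ω) hb
  have hb2 : ∀ ω, b * η * (gridIndex η T ω : ℝ) ≤ b * T ω + b * η := fun ω => by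
    rw [mul_assoc, mul_comm (η : ℝ), ← mul_add]
    exact mul_le_mul_of_nonneg_left (coe_gridIndex_mul_le hη ω) hb
  have hb3 : ∀ ω, |b * η * (gridIndex η T ω : ℝ)| ≤ b * L + b * η := fun ω => by
    rw [abs_of_nonneg (by positivity)]
    exact (hb2 ω).trans (add_le_add_left ((le_abs_self _).trans (hb1 ω)) _)
  refine ⟨integral_windowInt_le hf hgm hTm hb3 hb1 (fun ω => by positivity) (by positivity) hb2 x,
    ?_⟩
  refine (integral_windowInt_le (d := 0) hf hTm hgm hb1 hb3 (fun ω => by positivity) le_rfl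
    (fun ω => ?_) x).trans_eq (by simp)
  rw [add_zero, mul_assoc, mul_comm (η : ℝ)]
  exact mul_le_mul_of_nonneg_left (coe_lt_gridIndex_mul hη ω).le hb

end Window

lemma HasTail.congr_identDistrib {Ω : Type*} [MeasurableSpace Ω] {μ : Measure Ω} {ξ ξ' : Ω → ℝ}
    {f : ℝ → ℝ} {p : ℝ} (h : HasTail μ ξ f p) (hid : IdentDistrib ξ' ξ μ μ) :
    HasTail μ ξ' f p := by
  refine Tendsto.congr (fun v => ?_) h
  rw [measureReal_def, measureReal_def]
  exact congrArg (fun u => ENNReal.toReal u / f v) (hid.measure_mem_eq measurableSet_Ioi).symm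

namespace IsCompoundPoissonData

variable {Ω : Type*} [mΩ : MeasurableSpace Ω] {μ : Measure Ω} {r : ℝ}
  {gap Y : ℕ → Ω → ℝ} (h : IsCompoundPoissonData μ r gap Y) {f : ℝ → ℝ}
include h

lemma gridIncr_ae (c : ℝ) (η : ℝ≥0) (n : ℕ) : ∀ᵐ ω ∂μ, gridIncr (compound gap Y c) η n ω =
    pathX c (shiftMarks (n * η) (marks gap Y ω)) η := by
  filter_upwards [h.ae_goodMarks] with ω hω
  rw [← hω.pathX_add, gridIncr, Nat.cast_succ, add_mul, one_mul]
  rfl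

lemma gridMax_ae (c : ℝ) (η : ℝ≥0) (n : ℕ) : ∀ᵐ ω ∂μ, gridMax (compound gap Y c) η n ω =
    pathMax c η (shiftMarks (n * η) (marks gap Y ω)) := by
  filter_upwards [h.ae_goodMarks] with ω hω
  simp_rw [pathMax, ← hω.pathX_add]
  rfl

lemma identDistrib_grid (c : ℝ) (η : ℝ≥0) (n : ℕ) :
    IdentDistrib (fun ω => (gridIncr (compound gap Y c) η n ω, gridMax (compound gap Y c) η n ω))
      (fun ω => (pathX c (marks gap Y ω) η, pathMax c η (marks gap Y ω))) μ μ := by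
  have h1 := h.identDistrib_shift (n * η) (G := fun z => (pathX c z η, pathMax c η z))
    ((measurable_pathX c η).prodMk (measurable_pathMax c η))
  refine IdentDistrib.trans (IdentDistrib.symm ?_) h1
  refine IdentDistrib.of_ae_eq h1.aemeasurable_fst ?_
  filter_upwards [h.gridIncr_ae c η n, h.gridMax_ae c η n] with ω h2 h3
  rw [h2, h3]

lemma identDistrib_gridIncr (c : ℝ) (η : ℝ≥0) (n : ℕ) :
    IdentDistrib (gridIncr (compound gap Y c) η n) (compound gap Y c η) μ μ :=
  (h.identDistrib_grid c η n).comp measurable_fst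

lemma identDistrib_gridMax (c : ℝ) (η : ℝ≥0) (n : ℕ) :
    IdentDistrib (gridMax (compound gap Y c) η n) (fun ω => pathMax c η (marks gap Y ω)) μ μ :=
  (h.identDistrib_grid c η n).comp measurable_snd

omit h mΩ in
lemma compound_eq (c : ℝ) (t : ℝ≥0) :
    compound gap Y c t = fun ω => pathX c (marks gap Y ω) t := rfl

lemma measurable_compound (c : ℝ) (t : ℝ≥0) : Measurable (compound gap Y c t) := by
  rw [compound_eq]
  exact (measurable_pathX c t).comp h.measurable_marks

lemma compound_zero (c : ℝ) : ∀ᵐ ω ∂μ, compound gap Y c 0 ω = 0 := by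
  filter_upwards [h.ae_goodMarks] with ω hω using hω.pathX_zero c

lemma gridIncr_le_gridMax (c : ℝ) {η : ℝ≥0} (hη : 0 < η) : ∀ᵐ ω ∂μ,
    gridIncr (compound gap Y c) η 0 ω ≤ max (gridMax (compound gap Y c) η 0 ω) 0 := by
  filter_upwards [h.ae_goodMarks, h.gridIncr_ae c η 0, h.gridMax_ae c η 0] with ω hω h1 h2
  rw [h1, h2]
  exact le_max_of_le_left ((hω.shift _).pathX_le_pathMax c le_rfl hη)

/-- A crossing at time `u` shows in the maximum over the cell containing `u`, and this cell starts
no later than `T`. -/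
lemma max_le_exceed (c : ℝ) {η : ℝ≥0} (hη : 0 < η) (x : ℝ) (T : Ω → ℝ≥0) :
    μ.real {ω | ∃ u ≤ T ω, x < compound gap Y c u ω} ≤
      μ.real (exceed (gridIncr (compound gap Y c) η) (gridMax (compound gap Y c) η) x
        (gridIndex η T)) := by
  have := h.indep_gap.isProbabilityMeasure
  refine ENNReal.toReal_mono (measure_ne_top _ _) (measure_mono_ae ?_)
  have h3 := ae_all_iff.2 (h.gridMax_ae c η)
  filter_upwards [h.ae_goodMarks, h.compound_zero c, h3] with ω hω h0 h3
  rintro ⟨u, hu, hxu⟩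
  set k := ⌊u / η⌋₊ with hk
  have hk1 : k * η ≤ u := by
    have := Nat.floor_le (show 0 ≤ u / η by positivity)
    rwa [le_div_iff₀ hη] at this
  have hk2 : u < k * η + η := by
    have := Nat.lt_floor_add_one (u / η)
    rwa [div_lt_iff₀ hη, add_mul, one_mul] at this
  refine ⟨k, (lt_gridIndex_iff hη).2 (hk1.trans hu), ?_⟩
  rw [partialSum_gridIncr, h0, h3 k, sub_zero]
  obtain ⟨s, hs⟩ := exists_add_of_le hk1
  rw [hs] at hxu hk2
  have h4 := (hω.shift (k * η)).pathX_le_pathMax c (u := s) (h := η)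
    (lt_of_add_lt_add_left hk2).le hη
  rw [← hω.pathX_add] at h4
  change x < pathX c (marks gap Y ω) (k * η + s) at hxu
  change x < pathX c (marks gap Y ω) (k * η) + _
  linarith

/-- The upper bound for the maximum until a bounded time. -/
theorem max_upper (hf : StrongTail f) (ht : HasTail μ (Y 0) f 1) (hY : Integrable (Y 0) μ)
    {c a ε : ℝ} (hmean : ∫ ω, (c / r + Y 0 ω) ∂μ = -a) (ha : 0 < a) (hε : 0 < ε) :
    ∀ᶠ x in atTop, ∀ 𝒜 T, FutureIndep μ (compound gap Y c) 𝒜 → OptionalTime 𝒜 T →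
      μ.real {ω | ∃ u ≤ T ω, x < compound gap Y c u ω} ≤
        (1 + ε) * (1 / a * ∫ ω, windowInt f x (a * r * T ω) ∂μ) + ε * f x := by
  have := h.indep_gap.isProbabilityMeasure
  have hr := h.rate_pos
  -- With `(1 + ε) r η = ε / 2`, rounding `T` up to the grid uses at most half of the allowed error
  -- `ε f x`.
  set η : ℝ≥0 := ⟨ε / (2 * (1 + ε) * r), by positivity⟩ with hη
  have hηr : (η : ℝ) = ε / (2 * (1 + ε) * r) := rfl
  have hη0 : 0 < η := by rw [← NNReal.coe_pos, hηr]; positivity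
  have hη0' : (0 : ℝ) < η := hη0
  obtain ⟨hXi, hXm⟩ := h.integral_compound c hY η
  have hm := h.identDistrib_gridIncr c η 0
  have hle := h.gridIncr_le_gridMax c hη0
  have key := exceed_upper (μ := μ) hf (ξ := gridIncr (compound gap Y c) η)
    (m := gridMax (compound gap Y c) η) (α := a * r * η) (p := r * η) (ε := ε / 2)
    (fun n => (measurable_gridIncr n).mono (incrAlg_le (h.measurable_compound c) _ _) le_rfl)
    (fun n => (measurable_gridMax n).mono (incrAlg_le (h.measurable_compound c) _ _) le_rfl)
    (fun n => (h.identDistrib_grid c η n).trans (h.identDistrib_grid c η 0).symm) hle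
    (hm.integrable_iff.2 hXi) (by rw [hm.integral_eq, hXm, hmean]; ring) (by positivity)
    (by positivity) ((h.hasTail_compound hf ht c η).congr_identDistrib hm)
    ((h.hasTail_pathMax hf ht c hη0).congr_identDistrib (h.identDistrib_gridMax c η 0))
    (by positivity)
  filter_upwards [key] with x hx 𝒜 T hA hT
  have hg := hA.gridStopping hT hη0
  have h1 := hx _ _ _ hg measurable_gridIncr measurable_gridMax
  obtain ⟨L, hL⟩ := hT.bdd
  have h2 := h.max_le_exceed c hη0 x T
  have h5 := (integral_windowInt_grid (μ := μ) hf (hA.measurable_time hT) hL hη0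
    (show 0 ≤ a * r by positivity) x).1
  have h6 : 0 ≤ ∫ ω, windowInt f x (a * r * T ω) ∂μ :=
    integral_nonneg fun ω => hf.windowInt_nonneg x (by positivity)
  have hfx := hf.nonneg x
  have hpa : r * η / (a * r * η) = 1 / a := by field_simp
  rw [hpa] at h1
  refine h2.trans (h1.trans ?_)
  calc _ ≤ (1 + ε / 2) * (1 / a * (∫ ω, windowInt f x (a * r * T ω) ∂μ + a * r * η * f x)) +
        ε / 2 * f x := by gcongr
    _ = (1 + ε / 2) * (1 / a * ∫ ω, windowInt f x (a * r * T ω) ∂μ) +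
        ((1 + ε / 2) * (r * η) + ε / 2) * f x := by field_simp; ring
    _ ≤ _ := by
      have e1 : (1 + ε) * (r * η) = ε / 2 := by rw [hηr]; field_simp
      have e2 : 0 ≤ r * η := by positivity
      have e3 : (1 + ε / 2) * (r * η) + ε / 2 ≤ ε := by nlinarith
      have e4 : 0 ≤ 1 / a * ∫ ω, windowInt f x (a * r * T ω) ∂μ := by positivity
      gcongr
      linarith

end IsCompoundPoissonData

end

end RandomTimeMaxima

/-! ### Overshoot after a random time and the lower bound for the process -/

namespace RandomTimeMaxima

section

/-- Long-tailedness under the integral: beyond a threshold each value of `f` changes by a factor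
close to 1, whatever the length. -/
lemma StrongTail.windowInt_shift_ge {f : ℝ → ℝ} (hf : StrongTail f) {d e : ℝ} (he : 0 < e) :
    ∀ᶠ x in atTop, ∀ t, 0 ≤ t → (1 - e) * windowInt f x t ≤ windowInt f (x + d) t := by
  obtain ⟨x₀, hx₀⟩ := eventually_atTop.1 (hf.eventually_shift' d he)
  filter_upwards [eventually_ge_atTop x₀] with x hx t ht
  have h1 : windowInt f (x + d) t = ∫ v in x..x + t, f (v + d) := by
    rw [windowInt, intervalIntegral.integral_comp_add_right (fun v => f v)]
    congr 1; ring
  rw [h1, windowInt, ← intervalIntegral.integral_const_mul]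
  refine intervalIntegral.integral_mono_on (by linarith) ((hf.intervalIntegrable _ _).const_mul _)
    ?_ fun v hv => hx₀ v (hx.trans hv.1)
  have : Antitone fun v => f (v + d) := fun u v huv => hf.anti (by linarith)
  exact (this.antitoneOn _).intervalIntegrable

/-- Restricting the measure to `A` avoids any measurability of `A`. -/
lemma measure_eq_tsum_inter {Ω : Type*} [MeasurableSpace Ω] (μ : Measure Ω) {σ : Ω → ℕ}
    (hσ : Measurable σ) (A : Set Ω) : μ A = ∑' k, μ ({ω | σ ω = k} ∩ A) := by
  have h1 := measure_iUnion (μ := μ.restrict A) (f := fun k => {ω | σ ω = k})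
    (fun i j hij => Set.disjoint_left.2 fun ω hi hj => hij (hi.symm.trans hj))
    fun k => hσ (measurableSet_singleton k)
  have h2 : ⋃ k, {ω | σ ω = k} = Set.univ := Set.eq_univ_of_forall fun ω => Set.mem_iUnion.2 ⟨_, rfl⟩
  rw [h2, Measure.restrict_apply_univ] at h1
  rw [h1]
  exact tsum_congr fun k => Measure.restrict_apply (hσ (measurableSet_singleton k))

/-- Fatou's lemma for sets, with no measurability: in `overshoot` the set `B` involves an
uncountable union over times. -/
lemma measureReal_le_of_liminf {Ω : Type*} [MeasurableSpace Ω] {μ : Measure Ω}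
    [IsProbabilityMeasure μ] {B : Set Ω} {E : ℕ → Set Ω} {K : ℝ} (hK : ∀ m, μ.real (E m) ≤ K)
    (hB : ∀ᵐ ω ∂μ, ω ∈ B → ∀ᶠ m in atTop, ω ∈ E m) : μ.real B ≤ K := by
  have h1 : μ B ≤ μ (⋃ N, ⋂ m ≥ N, E m) := by
    refine measure_mono_ae ?_
    filter_upwards [hB] with ω hω hωB
    obtain ⟨N, hN⟩ := eventually_atTop.1 (hω hωB)
    exact Set.mem_iUnion.2 ⟨N, Set.mem_iInter₂.2 hN⟩
  have hmono : Monotone fun N => ⋂ m ≥ N, E m := fun N N' h =>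
    Set.biInter_subset_biInter_left fun m (hm : N' ≤ m) => h.trans hm
  rw [hmono.measure_iUnion] at h1
  refine ENNReal.toReal_le_of_le_ofReal (measureReal_nonneg.trans (hK 0)) (h1.trans ?_)
  refine iSup_le fun N => (measure_mono (Set.biInter_subset_of_mem (le_refl N))).trans ?_
  exact (ENNReal.le_ofReal_iff_toReal_le (measure_ne_top _ _)
    (measureReal_nonneg.trans (hK 0))).2 (hK N)

lemma setLIntegral_indicator_comp {Ω α : Type*} [MeasurableSpace Ω] [MeasurableSpace α]
    (μ : Measure Ω) {g : Ω → α} (hg : Measurable g) {S : Set α} (hS : MeasurableSet S) (B : Set Ω) :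
    ∫⁻ ω in B, S.indicator (1 : α → ℝ≥0∞) (g ω) ∂μ = μ (B ∩ {ω | g ω ∈ S}) := by
  have h1 : (fun ω => S.indicator (1 : α → ℝ≥0∞) (g ω)) = (g ⁻¹' S).indicator 1 := by
    rfl
  rw [h1, lintegral_indicator_one (hg hS), Measure.restrict_apply (hg hS), Set.inter_comm]
  rfl

/-- The maximum of the increments of a process over a time interval of length `η`. -/
noncomputable def incrMax {Ω : Type*} (X : ℝ≥0 → Ω → ℝ) (η t : ℝ≥0) (ω : Ω) : ℝ :=
  ⨆ q : {q : ℚ≥0 // q ≤ 1}, (X (t + (q : ℚ≥0) * η) ω - X t ω)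

namespace GoodMarks

variable {z : Marks} (hz : GoodMarks z)
include hz

lemma exists_pathX_lt (c : ℝ) {t : ℝ≥0} {x : ℝ} (hx : pathX c z t < x) :
    ∃ t' > t, ∀ s, t ≤ s → s < t' → pathX c z s < x := by
  obtain ⟨t₁, h1, h2⟩ := hz.exists_pathCount_eq t
  have hcont : ContinuousAt (fun s : ℝ≥0 => pathX c z t + c * ((s : ℝ) - t)) t := by fun_prop
  have hev : ∀ᶠ s : ℝ≥0 in 𝓝[≥] t, pathX c z t + c * ((s : ℝ) - t) < x :=
    (hcont.eventually (gt_mem_nhds (by simpa using hx))).filter_mono nhdsWithin_le_nhds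
  obtain ⟨t₂, h3, h4⟩ := (mem_nhdsGE_iff_exists_Ico_subset' h1).1 hev
  refine ⟨min t₁ t₂, lt_min h1 h3, fun s hs hs' => ?_⟩
  have h5 : pathX c z t + c * ((s : ℝ) - t) < x := h4 ⟨hs, hs'.trans_le (min_le_right _ _)⟩
  refine lt_of_eq_of_lt ?_ h5
  rw [pathX_eq, pathX_eq, h2 s hs (hs'.trans_le (min_le_left _ _))]
  ring

end GoodMarks

namespace IsCompoundPoissonData

variable {Ω : Type*} [mΩ : MeasurableSpace Ω] {μ : Measure Ω} {r : ℝ}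
  {gap Y : ℕ → Ω → ℝ} (h : IsCompoundPoissonData μ r gap Y) {f : ℝ → ℝ}
include h

/-- For large `v` this is the tail asymptotics over unit time; below the threshold `f` is at most 1
and the probability is bounded away from zero. -/
lemma exists_tail_le (hf : StrongTail f) (ht : HasTail μ (Y 0) f 1) (c : ℝ) :
    ∃ C > 0, ∀ v, f v ≤ C * μ.real {ω | v < compound gap Y c 1 ω} := by
  have := h.indep_gap.isProbabilityMeasure
  have hr := h.rate_pos
  have h1 := h.hasTail_compound hf ht c 1
  rw [NNReal.coe_one, mul_one] at h1
  obtain ⟨x₀, hx₀⟩ := eventually_atTop.1 (h1.eventually (lt_mem_nhds (show r / 2 < r by linarith)))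
  have hP : ∀ v ≥ x₀, r / 2 * f v ≤ μ.real {ω | v < compound gap Y c 1 ω} := fun v hv =>
    ((lt_div_iff₀ (hf.pos v)).1 (hx₀ v hv)).le
  have hP0 : 0 < μ.real {ω | x₀ < compound gap Y c 1 ω} :=
    lt_of_lt_of_le (mul_pos (by linarith) (hf.pos x₀)) (hP x₀ le_rfl)
  set p := μ.real {ω | x₀ < compound gap Y c 1 ω} with hp
  refine ⟨2 / r + p⁻¹, by positivity, fun v => ?_⟩
  rcases le_total x₀ v with hv | hv
  · calc f v = 2 / r * (r / 2 * f v) := by field_simp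
      _ ≤ 2 / r * μ.real {ω | v < compound gap Y c 1 ω} := by gcongr; exact hP v hv
      _ ≤ _ := by
        have : 0 ≤ p⁻¹ := by positivity
        gcongr
        linarith
  · calc f v ≤ 1 := hf.le_one v
      _ = p⁻¹ * p := (inv_mul_cancel₀ hP0.ne').symm
      _ ≤ p⁻¹ * μ.real {ω | v < compound gap Y c 1 ω} := by
        gcongr
        exact measureReal_mono fun ω hω => lt_of_le_of_lt hv hω
      _ ≤ _ := by
        have : 0 < 2 / r := by positivity
        gcongr
        linarith

/-- After a shift to time zero the drift contributes at most `max c 0 * η`, and the sum of the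
positive jumps bounds the rest. -/
lemma measure_lt_incrMax_le {δ : ℝ} {η : ℝ≥0} (c : ℝ)
    (hδ : ∀ v ≥ 0, μ.real {ω | v < upSum gap Y η ω} ≤ δ * f v) (t : ℝ≥0) {v : ℝ} (hv : 0 ≤ v) :
    μ {ω | max c 0 * η + v < incrMax (compound gap Y c) η t ω} ≤ ENNReal.ofReal (δ * f v) := by
  have := h.indep_gap.isProbabilityMeasure
  have h1 := (h.identDistrib_shift t (measurable_pathMax c η)).measure_mem_eq
    (measurableSet_Ioi (a := max c 0 * η + v))
  have h2 : μ {ω | max c 0 * η + v < incrMax (compound gap Y c) η t ω} =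
      μ ((fun ω => pathMax c η (shiftMarks t (marks gap Y ω))) ⁻¹' Set.Ioi (max c 0 * η + v)) := by
    refine measure_congr ?_
    filter_upwards [h.ae_goodMarks] with ω hω
    have h3 : incrMax (compound gap Y c) η t ω = pathMax c η (shiftMarks t (marks gap Y ω)) := by
      simp_rw [pathMax, ← hω.pathX_add]
      rfl
    exact congrArg (fun u => max c 0 * η + v < u) h3
  rw [h2, h1]
  refine le_trans (measure_mono_ae ?_) ((ENNReal.le_ofReal_iff_toReal_le (measure_ne_top _ _)
    (measureReal_nonneg.trans (hδ v hv))).2 (hδ v hv))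
  filter_upwards [h.ae_goodMarks] with ω hω
  intro (h4 : max c 0 * η + v < pathMax c η (marks gap Y ω))
  have h5 := h4.trans_le (hω.pathMax_le c η)
  change v < upSum gap Y η ω
  have h6 : upSum gap Y η ω = ∑ i ∈ Finset.range (pathCount (marks gap Y ω) η),
    max ((marks gap Y ω).2 i) 0 := rfl
  linarith

lemma measure_lt_incr (c : ℝ) (t s : ℝ≥0) (v : ℝ) :
    μ {ω | v < compound gap Y c (t + s) ω - compound gap Y c t ω} =
      μ {ω | v < compound gap Y c s ω} := by
  have h1 := (h.identDistrib_shift t (measurable_pathX c s)).measure_mem_eq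
    (measurableSet_Ioi (a := v))
  refine Eq.trans (measure_congr ?_) h1
  filter_upwards [h.ae_goodMarks] with ω hω
  exact congrArg (fun u => v < u) (hω.pathX_add c t s)

/-- A large increment shortly after a random time on a fine grid. -/
lemma overshoot_grid {c δ C : ℝ} {η θ : ℝ≥0} (hθ : 0 < θ)
    (hδ0 : 0 < δ) (hδ : ∀ v ≥ 0, μ.real {ω | v < upSum gap Y η ω} ≤ δ * f v) (hC : 0 < C)
    (hCf : ∀ v, f v ≤ C * μ.real {ω | v < compound gap Y c 1 ω})
    {𝒜 : ℝ≥0 → MeasurableSpace Ω} {T : Ω → ℝ≥0} (hA : FutureIndep μ (compound gap Y c) 𝒜)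
    (hT : OptionalTime 𝒜 T) (x : ℝ) :
    μ {ω | compound gap Y c (gridIndex θ T ω * θ) ω < x + 1 ∧ x + (max c 0 * η + 1) <
        compound gap Y c (gridIndex θ T ω * θ) ω +
          incrMax (compound gap Y c) η (gridIndex θ T ω * θ) ω} ≤
      ENNReal.ofReal (δ * C) * μ {ω | x + 1 < compound gap Y c (gridIndex θ T ω * θ + 1) ω} := by
  have := h.indep_gap.isProbabilityMeasure
  have hσm := measurable_gridIndex (η := θ) (hA.measurable_time hT)
  rw [measure_eq_tsum_inter μ hσm, measure_eq_tsum_inter μ hσm {ω | _ < _}, ← ENNReal.tsum_mul_left]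
  refine ENNReal.tsum_le_tsum fun k => ?_
  rcases Nat.eq_zero_or_pos k with rfl | hk
  · simp [gridIndex]
  set t : ℝ≥0 := k * θ with ht
  have ht0 : 0 < t := by positivity
  set X := compound gap Y c with hX
  -- At the grid point `t` it is known whether the rounded time equals `t`; on this event the state
  -- at `t` can be frozen against the later increments.
  have hB : MeasurableSet[𝒜 t] {ω | gridIndex θ T ω = k} := by
    have : {ω | gridIndex θ T ω = k} = {ω | T ω < t} \ {ω | T ω < (k - 1 : ℕ) * θ} := by
      ext ω
      simp only [Set.mem_ofPred_eq, Set.mem_sdiff, ht]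
      rw [← gridIndex_le_iff hθ, ← gridIndex_le_iff hθ]
      omega
    rw [this]
    exact (hT.lt t).diff (hA.mono (by rw [ht]; gcongr; omega) _ (hT.lt _))
  have hfut := futureAlg_le hA.measurable t
  have hW : Measurable[futureAlg X t] (incrMax X η t) :=
    Measurable.iSup fun q => measurable_futureAlg le_self_add
  have hW' : Measurable[futureAlg X t] fun ω => X (t + 1) ω - X t ω :=
    measurable_futureAlg le_self_add
  have hms : MeasurableSet {q : ℝ × ℝ | q.1 < x + 1 ∧ x + (max c 0 * η + 1) < q.1 + q.2} :=
    (measurableSet_lt measurable_fst measurable_const).inter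
      (measurableSet_lt measurable_const (measurable_fst.add measurable_snd))
  have hms' : MeasurableSet {q : ℝ × ℝ | x + 1 < q.1 + q.2} :=
    measurableSet_lt measurable_const (measurable_fst.add measurable_snd)
  have hI := setLIntegral_indep (hA.indep t ht0) (hA.le t) hfut (hA.adapted t) hW hB
    (measurable_one.indicator hms)
  have hI' := setLIntegral_indep (hA.indep t ht0) (hA.le t) hfut (hA.adapted t) hW' hB
    (measurable_one.indicator hms')
  have hBm := hA.le t _ hB
  have hXm := hA.measurable
  have e1 : μ ({ω | gridIndex θ T ω = k} ∩ {ω | X (gridIndex θ T ω * θ) ω < x + 1 ∧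
      x + (max c 0 * η + 1) < X (gridIndex θ T ω * θ) ω + incrMax X η (gridIndex θ T ω * θ) ω}) =
      ∫⁻ ω in {ω | gridIndex θ T ω = k}, {q : ℝ × ℝ | q.1 < x + 1 ∧
        x + (max c 0 * η + 1) < q.1 + q.2}.indicator 1 (X t ω, incrMax X η t ω) ∂μ := by
    rw [setLIntegral_indicator_comp μ ((hXm t).prodMk (hW.mono hfut le_rfl)) hms]
    congr 1
    ext ω
    refine and_congr_right fun (hω : gridIndex θ T ω = k) => ?_
    simp only [Set.mem_ofPred_eq, hω, ht]
  have e2 : μ ({ω | gridIndex θ T ω = k} ∩ {ω | x + 1 < X (gridIndex θ T ω * θ + 1) ω}) =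
      ∫⁻ ω in {ω | gridIndex θ T ω = k},
        {q : ℝ × ℝ | x + 1 < q.1 + q.2}.indicator 1 (X t ω, X (t + 1) ω - X t ω) ∂μ := by
    rw [setLIntegral_indicator_comp μ ((hXm t).prodMk (hW'.mono hfut le_rfl)) hms']
    congr 1
    ext ω
    refine and_congr_right fun (hω : gridIndex θ T ω = k) => ?_
    simp only [Set.mem_ofPred_eq, hω, ht, add_sub_cancel]
  rw [e1, e2, hI, hI', ← lintegral_const_mul' _ _ ENNReal.ofReal_ne_top]
  refine lintegral_mono fun ω => ?_
  have e3 := setLIntegral_indicator_comp μ ((measurable_const (a := X t ω)).prodMk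
    (hW.mono hfut le_rfl)) hms Set.univ
  have e4 := setLIntegral_indicator_comp μ ((measurable_const (a := X t ω)).prodMk
    (hW'.mono hfut le_rfl)) hms' Set.univ
  rw [setLIntegral_univ, Set.univ_inter] at e3 e4
  rw [e3, e4]
  simp only [Set.mem_ofPred_eq]
  -- From a state below `x + 1` the increment must exceed a positive level `v`. Within time `η` this
  -- has probability at most `δ f v`, hence at most `δ C` times that of exceeding `v` in unit time.
  by_cases hU : X t ω < x + 1
  swap
  · simp [hU]
  have e5 : {ω' | x + 1 < X t ω + (X (t + 1) ω' - X t ω')} =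
      {ω' | x + 1 - X t ω < X (t + 1) ω' - X t ω'} := by
    ext ω'; simp only [Set.mem_ofPred_eq, sub_lt_iff_lt_add']
  have e6 : {ω' | X t ω < x + 1 ∧ x + (max c 0 * η + 1) < X t ω + incrMax X η t ω'} ⊆
      {ω' | max c 0 * η + (x + 1 - X t ω) < incrMax X η t ω'} := by
    rintro ω' ⟨-, h2⟩
    simp only [Set.mem_ofPred_eq]
    linarith
  rw [e5, h.measure_lt_incr]
  refine (measure_mono e6).trans ((h.measure_lt_incrMax_le c hδ t (by linarith)).trans ?_)
  rw [← ofReal_measureReal, ← ENNReal.ofReal_mul (by positivity), mul_assoc]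
  exact ENNReal.ofReal_le_ofReal (mul_le_mul_of_nonneg_left (hCf _) hδ0.le)

/-- A large increment shortly after a random time. -/
lemma overshoot {c δ C : ℝ} {η : ℝ≥0} (hη : 0 < η)
    (hδ0 : 0 < δ) (hδ : ∀ v ≥ 0, μ.real {ω | v < upSum gap Y η ω} ≤ δ * f v) (hC : 0 < C)
    (hCf : ∀ v, f v ≤ C * μ.real {ω | v < compound gap Y c 1 ω})
    {𝒜 : ℝ≥0 → MeasurableSpace Ω} {T : Ω → ℝ≥0} (hA : FutureIndep μ (compound gap Y c) 𝒜)
    (hT : OptionalTime 𝒜 T) (x : ℝ) :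
    μ.real {ω | compound gap Y c (T ω) ω ≤ x ∧ ∃ s ≤ η, x + (max c 0 * η + 1) <
        compound gap Y c (T ω + s) ω} ≤
      δ * C * μ.real {ω | ∃ u ≤ T ω + 2, x < compound gap Y c u ω} := by
  have := h.indep_gap.isProbabilityMeasure
  -- A second mesh, tending to zero, lets the rounded time approach `T` from the right. There the
  -- process stays below `x + 1` by right-continuity, which is why the level was raised by 1.
  set θ : ℕ → ℝ≥0 := fun m => 1 / (m + 1) with hθ
  have hθ0 : ∀ m, 0 < θ m := fun m => by simp only [hθ]; positivity
  have hθ1 : ∀ m, θ m ≤ 1 := fun m => by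
    simp only [hθ]
    exact div_le_one_of_le₀ (by simp) (by positivity)
  have hθlim : Tendsto θ atTop (𝓝 0) := tendsto_one_div_add_atTop_nhds_zero_nat
  refine measureReal_le_of_liminf (fun m => ENNReal.toReal_le_of_le_ofReal (by positivity)
    ((h.overshoot_grid (hθ0 m) hδ0 hδ hC hCf hA hT x).trans ?_)) ?_
  · rw [ENNReal.ofReal_mul (p := δ * C) (by positivity), ofReal_measureReal]
    gcongr with ω
    intro hω
    refine ⟨_, ?_, (lt_add_one x).trans hω⟩
    calc gridIndex (θ m) T ω * θ m + 1 ≤ T ω + θ m + 1 := by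
          gcongr; exact gridIndex_mul_le (hθ0 m)
      _ ≤ T ω + 1 + 1 := by gcongr; exact hθ1 m
      _ = T ω + 2 := by ring
  · filter_upwards [h.ae_goodMarks] with ω hω
    rintro ⟨h1, s, hs, h2⟩
    set z := marks gap Y ω with hz
    change pathX c z (T ω) ≤ x at h1
    change _ < pathX c z (T ω + s) at h2
    have hs0 : 0 < s := by
      refine pos_iff_ne_zero.2 ?_
      rintro rfl
      rw [add_zero] at h2
      have : 0 ≤ max c 0 * η := by positivity
      linarith
    obtain ⟨t₁, ht₁, h3⟩ := hω.exists_pathX_lt c (lt_of_le_of_lt h1 (lt_add_one x))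
    have hd : 0 < min (t₁ - T ω) s := lt_min (tsub_pos_of_lt ht₁) hs0
    filter_upwards [hθlim.eventually (gt_mem_nhds hd)] with m hm
    set t := gridIndex (θ m) T ω * θ m with ht
    have ht1 : T ω < t := lt_gridIndex_mul (hθ0 m)
    have ht2 : t ≤ T ω + θ m := gridIndex_mul_le (hθ0 m)
    have ht3 : t < t₁ := ht2.trans_lt (by
      have := lt_tsub_iff_left.1 (hm.trans_le (min_le_left _ _))
      exact this)
    have ht4 : t ≤ T ω + s := ht2.trans (by gcongr; exact (hm.trans_le (min_le_right _ _)).le)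
    obtain ⟨s', hs'⟩ := exists_add_of_le ht4
    have hs'η : s' ≤ η := by
      have : T ω + s' ≤ T ω + s := by rw [hs']; gcongr
      exact (le_of_add_le_add_left this).trans hs
    refine ⟨h3 t ht1.le ht3, ?_⟩
    have h5 := (hω.shift t).pathX_le_pathMax c hs'η hη
    have h6 : incrMax (compound gap Y c) η t ω = pathMax c η (shiftMarks t z) := by
      simp_rw [pathMax, ← hω.pathX_add]
      rfl
    rw [← hω.pathX_add, ← h6, ← hs'] at h5
    change _ < pathX c z t + _
    linarith

/-- The lower bound for the maximum until a bounded time. -/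
theorem max_lower (hf : StrongTail f) (ht : HasTail μ (Y 0) f 1) (hY : Integrable (Y 0) μ)
    {c a ε : ℝ} (hmean : ∫ ω, (c / r + Y 0 ω) ∂μ = -a) (ha : 0 < a) (hε : 0 < ε) :
    ∀ᶠ x in atTop, ∀ 𝒜 T, FutureIndep μ (compound gap Y c) 𝒜 → OptionalTime 𝒜 T →
      (1 - ε) * (1 / a * ∫ ω, windowInt f x (a * r * T ω) ∂μ) - ε * f x ≤
        μ.real {ω | ∃ u ≤ T ω, x < compound gap Y c u ω} := by
  have := h.indep_gap.isProbabilityMeasure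
  have hr := h.rate_pos
  obtain ⟨C, hC, hCf⟩ := h.exists_tail_le hf ht c
  set e := min (ε / 3) (1 / 2) with he
  have he0 : 0 < e := by positivity
  have he1 : e ≤ 1 / 2 := min_le_right _ _
  have he2 : 3 * e ≤ ε := by have := min_le_left (ε / 3) (1 / 2); linarith
  -- Makes `δ C` times the upper bound for the maximum up to `T + 2` at most `e` times the main term
  -- plus `e f x`.
  set δ := e / (C * (4 * r + 2)) with hδ
  have hδ0 : 0 < δ := by positivity
  obtain ⟨η, hη0, hη⟩ := h.exists_upSum_le hf ht hδ0
  have hη0' : (0 : ℝ) < η := hη0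
  obtain ⟨hXi, hXm⟩ := h.integral_compound c hY η
  have hm := h.identDistrib_gridIncr c η 0
  have key := exceed_lower (μ := μ) hf (ξ := gridIncr (compound gap Y c) η) (α := a * r * η)
    (p := r * η) (ε := e)
    (fun n => (measurable_gridIncr n).mono (incrAlg_le (h.measurable_compound c) _ _) le_rfl)
    (fun n => (h.identDistrib_gridIncr c η n).trans (h.identDistrib_gridIncr c η 0).symm)
    (hm.integrable_iff.2 hXi) (by rw [hm.integral_eq, hXm, hmean]; ring) (by positivity)
    (by positivity) ((h.hasTail_compound hf ht c η).congr_identDistrib hm) he0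
  set d := max c 0 * η + 1 with hd
  have hd0 : 0 ≤ d := by positivity
  filter_upwards [(tendsto_atTop_add_const_right atTop d tendsto_id).eventually key,
    hf.windowInt_shift_ge (d := d) he0, h.max_upper hf ht hY hmean ha one_pos]
    with x hx hshift hup 𝒜 T hA hT
  have hg := hA.gridStopping hT hη0
  have hTm := hA.measurable_time hT
  obtain ⟨L, hL⟩ := hT.bdd
  have hL0 : ∀ ω, (T ω : ℝ) ≤ L := hL
  have hpa : r * η / (a * r * η) = 1 / a := by field_simp
  have h1 := hx _ _ _ hg measurable_gridIncr
  rw [hpa, id] at h1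
  have hfx := hf.nonneg x
  have har : 0 ≤ a * r := by positivity
  set Φ := ∫ ω, windowInt f x (a * r * T ω) ∂μ with hΦ
  have hΦ0 : 0 ≤ Φ := integral_nonneg fun ω => hf.windowInt_nonneg x (by positivity)
  have hW1 : ∀ ω, |a * r * (T ω : ℝ)| ≤ a * r * L := fun ω => by
    rw [abs_of_nonneg (by positivity)]
    exact mul_le_mul_of_nonneg_left (hL0 ω) har
  have hTm' : Measurable fun ω => a * r * (T ω : ℝ) := hTm.coe_nnreal_real.const_mul _
  have h2 : (1 - e) * Φ ≤ ∫ ω, windowInt f (x + d) (a * r * η * gridIndex η T ω) ∂μ := by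
    refine le_trans ?_ (integral_windowInt_grid (μ := μ) hf hTm hL hη0 har (x + d)).2
    rw [hΦ, ← integral_const_mul]
    exact integral_mono ((integrable_windowInt hf hTm' hW1 x).const_mul _)
      (integrable_windowInt hf hTm' hW1 _) fun ω => hshift _ (by positivity)
  have h3 := hup 𝒜 (fun ω => T ω + 2) hA (hT.add_const hA 2)
  have h4 : ∫ ω, windowInt f x (a * r * (T ω + 2 : ℝ≥0)) ∂μ ≤ Φ + 2 * (a * r) * f x := by
    have hb : ∀ ω, a * r * ((T ω + 2 : ℝ≥0) : ℝ) = a * r * T ω + 2 * (a * r) := fun ω => by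
      push_cast; ring
    simp_rw [hb]
    refine integral_windowInt_le (L := a * r * L + 2 * (a * r)) hf (hTm'.add_const _) hTm'
      (fun ω => ?_) hW1 (fun ω => by positivity) (by positivity) (fun ω => le_rfl) x
    rw [abs_of_nonneg (by positivity)]
    exact add_le_add_left ((le_abs_self _).trans (hW1 ω)) _
  have h5 := h.overshoot hη0 hδ0 (hη η le_rfl) hC hCf hA hT x
  -- If the grid walk crosses `x + d`, either the process has passed `x` by time `T`, or it is at
  -- most `x` at `T` and the crossing takes place within `η` after `T`.
  have h6 : μ.real (exceed (gridIncr (compound gap Y c) η) (gridIncr (compound gap Y c) η) (x + d)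
      (gridIndex η T)) ≤ μ.real {ω | ∃ u ≤ T ω, x < compound gap Y c u ω} +
        μ.real {ω | compound gap Y c (T ω) ω ≤ x ∧ ∃ s ≤ η, x + d <
          compound gap Y c (T ω + s) ω} := by
    refine le_trans (ENNReal.toReal_mono (measure_ne_top _ _) (measure_mono_ae ?_))
      (measureReal_union_le _ _)
    filter_upwards [h.compound_zero c] with ω h0
    rintro ⟨k, hk, hxk⟩
    rw [partialSum_gridIncr, h0, sub_zero, gridIncr, add_sub_cancel] at hxk
    rcases le_or_gt (((k + 1 : ℕ) : ℝ≥0) * η) (T ω) with hkT | hkT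
    · exact Or.inl ⟨_, hkT, by linarith⟩
    · by_cases hmax : ∃ u ≤ T ω, x < compound gap Y c u ω
      · exact Or.inl hmax
      · push Not at hmax
        obtain ⟨s, hs⟩ := exists_add_of_le hkT.le
        refine Or.inr ⟨hmax _ le_rfl, s, ?_, by rwa [← hs]⟩
        have hk1 : (k : ℝ≥0) * η ≤ T ω := (lt_gridIndex_iff hη0).1 hk
        rw [Nat.cast_succ, add_mul, one_mul] at hs
        have : T ω + s ≤ T ω + η := by rw [← hs]; gcongr
        exact le_of_add_le_add_left this
  have h7 : f (x + d) ≤ f x := hf.anti (by linarith)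
  have hδC : δ * C * (4 * r + 2) = e := by rw [hδ]; field_simp
  have h8 : δ * C * μ.real {ω | ∃ u ≤ T ω + 2, x < compound gap Y c u ω} ≤
      e * (1 / a * Φ) + e * f x := by
    have hδC0 : 0 ≤ δ * C := by positivity
    have hΦa : 0 ≤ 1 / a * Φ := by positivity
    calc _ ≤ δ * C * ((1 + 1) * (1 / a * (Φ + 2 * (a * r) * f x)) + 1 * f x) := by
          refine mul_le_mul_of_nonneg_left (h3.trans ?_) hδC0
          gcongr
      _ = δ * C * (2 * (1 / a * Φ)) + δ * C * ((4 * r + 1) * f x) := by field_simp; ring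
      _ ≤ δ * C * ((4 * r + 2) * (1 / a * Φ)) + δ * C * ((4 * r + 2) * f x) := by
          gcongr <;> linarith
      _ = _ := by rw [← mul_assoc, ← mul_assoc (δ * C) _ (f x), hδC]
  have h9 : (1 - e) * (1 / a * ((1 - e) * Φ)) - e * f x ≤
      (1 - e) * (1 / a * ∫ ω, windowInt f (x + d) (a * r * η * gridIndex η T ω) ∂μ) -
        e * f (x + d) := by
    have : 0 ≤ 1 - e := by linarith
    gcongr
  have hΦa : 0 ≤ 1 / a * Φ := by positivity
  have h10 : (1 - ε) * (1 / a * Φ) ≤ (1 - 3 * e) * (1 / a * Φ) := by gcongr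
  have h11 : (1 - e) * (1 / a * ((1 - e) * Φ)) = (1 - 2 * e) * (1 / a * Φ) + e ^ 2 * (1 / a * Φ) := by
    ring
  have h12 : 0 ≤ e ^ 2 * (1 / a * Φ) := by positivity
  have h13 : 2 * e * f x ≤ ε * f x := mul_le_mul_of_nonneg_right (by linarith) hfx
  linarith

end IsCompoundPoissonData

end

end RandomTimeMaxima

/-! ### The number of jumps up to a random time -/

namespace RandomTimeMaxima

section

/-- Wald's identity. -/
lemma GridStopping.integral_partialSum {Ω : Type*} [MeasurableSpace Ω] {μ : Measure Ω}
    [IsProbabilityMeasure μ] {P Q : ℕ → MeasurableSpace Ω} {X : ℕ → Ω → ℝ} {σ : Ω → ℕ} {m : ℝ}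
    (h : GridStopping μ P Q σ) (hX : ∀ n, Measurable[Q n] (X n)) (hi : ∀ n, Integrable (X n) μ)
    (hm : ∀ n, ∫ ω, X n ω ∂μ = m) :
    ∫ ω, partialSum X (σ ω) ω ∂μ = m * ∫ ω, (σ ω : ℝ) ∂μ := by
  obtain ⟨L, hL⟩ := h.bdd
  have h1 := h.integral_partialSum_min hX hi L
  have h2 := h.integral_partialSum_min (X := fun _ _ => m)
    (fun n => @measurable_const ℝ Ω _ (Q n) m) (fun n => integrable_const m) L
  simp only [min_eq_left (hL _)] at h1 h2
  rw [h1, ← integral_const_mul]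
  simp only [partialSum, Finset.sum_const, Finset.card_range, nsmul_eq_mul, integral_const,
    probReal_univ, one_smul] at h2
  simp_rw [hm, mul_comm m]
  exact h2.symm

/-- The number of jumps over a grid step, as a function of the increments. -/
noncomputable def gridJumps {Ω : Type*} (c : ℝ) (X : ℝ≥0 → Ω → ℝ) (η : ℝ≥0) (n : ℕ) (ω : Ω) : ℝ :=
  jumpCount c η fun u => X (n * η + u) ω - X (n * η) ω

lemma measurable_gridJumps {Ω : Type*} (c : ℝ) (X : ℝ≥0 → Ω → ℝ) (η : ℝ≥0) (n : ℕ) :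
    Measurable[gridStep X η n] (gridJumps c X η n) := by
  refine measurable_jumpCount (m := gridStep X η n) (Z := fun u ω => X (n * η + u) ω - X (n * η) ω)
    c fun u hu => measurable_incrAlg le_self_add ?_
  rw [Nat.cast_succ, add_mul, one_mul]
  gcongr

namespace IsCompoundPoissonData

variable {Ω : Type*} [mΩ : MeasurableSpace Ω] {μ : Measure Ω} {r : ℝ}
  {gap Y : ℕ → Ω → ℝ} (h : IsCompoundPoissonData μ r gap Y) {f : ℝ → ℝ}
include h

lemma gridJumps_ae (c : ℝ) (η : ℝ≥0) (n : ℕ) : ∀ᵐ ω ∂μ, gridJumps c (compound gap Y c) η n ω =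
    pathCount (shiftMarks (n * η) (marks gap Y ω)) η := by
  filter_upwards [h.ae_goodMarks] with ω hω
  rw [← (hω.shift _).jumpCount_eq c η]
  exact congrArg (jumpCount c η) (funext fun u => hω.pathX_add c _ u)

lemma identDistrib_gridJumps (c : ℝ) (η : ℝ≥0) (n : ℕ) :
    IdentDistrib (gridJumps c (compound gap Y c) η n) (fun ω => (jumps gap Y η ω : ℝ)) μ μ := by
  have h1 := h.identDistrib_shift (n * η) (G := fun z => (pathCount z η : ℝ))
    (measurable_from_nat.comp (measurable_pathCount η))
  refine IdentDistrib.trans (IdentDistrib.symm (IdentDistrib.of_ae_eq h1.aemeasurable_fst ?_)) h1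
  filter_upwards [h.gridJumps_ae c η n] with ω h2
  rw [h2]

lemma partialSum_gridJumps (c : ℝ) (η : ℝ≥0) : ∀ᵐ ω ∂μ, ∀ k,
    partialSum (gridJumps c (compound gap Y c) η) k ω = jumps gap Y (k * η) ω := by
  filter_upwards [h.ae_goodMarks, ae_all_iff.2 (h.gridJumps_ae c η)] with ω hω h1 k
  induction k with
  | zero => simp [jumps, hω.pathCount_zero]
  | succ k ih =>
    rw [partialSum_succ, ih, h1, Nat.cast_succ, add_mul, one_mul, jumps, jumps, hω.pathCount_add]
    push_cast
    rfl

lemma measurable_jumps_time {T : Ω → ℝ≥0} (hT : Measurable T) :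
    Measurable fun ω => jumps gap Y (T ω) ω :=
  (measurable_of_countable ENat.toNat).comp (measurable_count h.measurable_gap
    (τ := fun ω => (T ω : ℝ≥0∞)) hT.coe_nnreal_ennreal)

lemma integrable_jumps_time {T : Ω → ℝ≥0} (hT : Measurable T) {L : ℝ≥0} (hL : ∀ ω, T ω ≤ L) :
    Integrable (fun ω => (jumps gap Y (T ω) ω : ℝ)) μ := by
  refine (h.integrable_jumps L).mono'
    (measurable_from_nat.comp (h.measurable_jumps_time hT)).aestronglyMeasurable ?_
  filter_upwards [h.ae_goodMarks] with ω hω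
  rw [Real.norm_of_nonneg (Nat.cast_nonneg _)]
  exact_mod_cast hω.pathCount_mono (hL ω)

/-- Wald's identity on the grid, with the jump counts of the cells as steps. -/
lemma integral_jumps_gridIndex {c : ℝ} {η : ℝ≥0} (hη : 0 < η) {𝒜 : ℝ≥0 → MeasurableSpace Ω}
    {T : Ω → ℝ≥0} (hA : FutureIndep μ (compound gap Y c) 𝒜) (hT : OptionalTime 𝒜 T) :
    ∫ ω, (jumps gap Y (gridIndex η T ω * η) ω : ℝ) ∂μ =
      r * ∫ ω, (gridIndex η T ω : ℝ) * η ∂μ := by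
  have := h.indep_gap.isProbabilityMeasure
  have h1 := (hA.gridStopping hT hη).integral_partialSum (m := r * η)
    (measurable_gridJumps c (compound gap Y c) η)
    (fun n => (h.identDistrib_gridJumps c η n).integrable_iff.2 (h.integrable_jumps η))
    fun n => by rw [(h.identDistrib_gridJumps c η n).integral_eq, h.integral_jumps]
  rw [integral_mul_const, mul_left_comm, mul_comm (∫ ω, _ ∂μ), ← h1]
  refine integral_congr_ae ?_
  filter_upwards [h.partialSum_gridJumps c η] with ω hω
  rw [hω]

/-- The mean number of jumps until a random time. -/
theorem integral_jumps_time {c : ℝ} {𝒜 : ℝ≥0 → MeasurableSpace Ω}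
    {T : Ω → ℝ≥0} (hA : FutureIndep μ (compound gap Y c) 𝒜) (hT : OptionalTime 𝒜 T) :
    ∫ ω, (jumps gap Y (T ω) ω : ℝ) ∂μ = r * ∫ ω, (T ω : ℝ) ∂μ := by
  have := h.indep_gap.isProbabilityMeasure
  set θ : ℕ → ℝ≥0 := fun m => 1 / (m + 1) with hθ
  have hθ0 : ∀ m, 0 < θ m := fun m => by simp only [hθ]; positivity
  have hθ1 : ∀ m, θ m ≤ 1 := fun m => by
    simp only [hθ]
    exact div_le_one_of_le₀ (by simp) (by positivity)
  have hθlim : Tendsto θ atTop (𝓝 0) := tendsto_one_div_add_atTop_nhds_zero_nat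
  have hTm := hA.measurable_time hT
  obtain ⟨L, hL⟩ := hT.bdd
  have hgT : ∀ m ω, gridIndex (θ m) T ω * θ m ≤ L + 1 := fun m ω =>
    (gridIndex_mul_le (hθ0 m)).trans (add_le_add (hL ω) (hθ1 m))
  have hgm : ∀ m, Measurable fun ω => (gridIndex (θ m) T ω : ℝ≥0) * θ m := fun m =>
    (measurable_from_nat.comp (measurable_gridIndex hTm)).mul_const _
  have hsq : ∀ ω, Tendsto (fun m => (gridIndex (θ m) T ω : ℝ≥0) * θ m) atTop (𝓝 (T ω)) := fun ω =>
    tendsto_of_tendsto_of_tendsto_of_le_of_le tendsto_const_nhds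
      (by simpa using hθlim.const_add (T ω)) (fun m => (lt_gridIndex_mul (hθ0 m)).le)
      fun m => gridIndex_mul_le (hθ0 m)
  -- The rounded times approach `T` from the right, where the count is constant for a short while.
  have l1 : Tendsto (fun m => ∫ ω, (jumps gap Y (gridIndex (θ m) T ω * θ m) ω : ℝ) ∂μ) atTop
      (𝓝 (∫ ω, (jumps gap Y (T ω) ω : ℝ) ∂μ)) := by
    refine tendsto_integral_of_dominated_convergence (fun ω => (jumps gap Y (L + 1) ω : ℝ))
      (fun m => (measurable_from_nat.comp
        (h.measurable_jumps_time (hgm m))).aestronglyMeasurable) (h.integrable_jumps _)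
      (fun m => ?_) ?_
    · filter_upwards [h.ae_goodMarks] with ω hω
      rw [Real.norm_of_nonneg (Nat.cast_nonneg _)]
      exact_mod_cast hω.pathCount_mono (hgT m ω)
    · filter_upwards [h.ae_goodMarks] with ω hω
      obtain ⟨t', ht', h2⟩ := hω.exists_pathCount_eq (T ω)
      refine tendsto_const_nhds.congr' ?_
      filter_upwards [(hsq ω).eventually (gt_mem_nhds ht')] with m hm
      exact congrArg _ (h2 _ (lt_gridIndex_mul (hθ0 m)).le hm).symm
  have l2 : Tendsto (fun m => r * ∫ ω, (gridIndex (θ m) T ω : ℝ) * θ m ∂μ) atTop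
      (𝓝 (r * ∫ ω, (T ω : ℝ) ∂μ)) := by
    refine Tendsto.const_mul r ?_
    refine tendsto_integral_of_dominated_convergence (fun _ => ((L + 1 : ℝ≥0) : ℝ))
      (fun m => ?_) (integrable_const _) (fun m => Eventually.of_forall fun ω => ?_)
      (Eventually.of_forall fun ω => ?_)
    · exact ((hgm m).coe_nnreal_real).aestronglyMeasurable
    · rw [Real.norm_of_nonneg (by positivity)]
      exact_mod_cast hgT m ω
    · exact_mod_cast hsq ω
  refine tendsto_nhds_unique l1 (l2.congr fun m => ?_)
  exact (h.integral_jumps_gridIndex (hθ0 m) hA hT).symm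

/-- In the mean window the number of jumps until a random time can be replaced by its mean. -/
theorem jumps_window (hf : StrongTail f) {c a ε : ℝ} (ha : 0 < a) (hε : 0 < ε) :
    ∀ᶠ x in atTop, ∀ 𝒜 T, FutureIndep μ (compound gap Y c) 𝒜 → OptionalTime 𝒜 T →
      |∫ ω, windowInt f x (a * jumps gap Y (T ω) ω) ∂μ - ∫ ω, windowInt f x (a * r * T ω) ∂μ| ≤
        ε * (∫ ω, windowInt f x (a * r * T ω) ∂μ + f x) := by
  have := h.indep_gap.isProbabilityMeasure
  have hr := h.rate_pos
  -- Makes `a r η = min 1 (ε / 4)`, the price in units of `f x` of rounding `T` up to the grid.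
  set η : ℝ≥0 := ⟨min 1 (ε / 4) / (a * r), by positivity⟩ with hη
  have hηr : a * r * (η : ℝ) = min 1 (ε / 4) := by
    change a * r * (min 1 (ε / 4) / (a * r)) = _
    field_simp
  have hη0 : 0 < η := by
    rw [← NNReal.coe_pos]; change 0 < min 1 (ε / 4) / (a * r); positivity
  have hid := h.identDistrib_gridJumps c η
  have hmul : ∀ n, IdentDistrib (fun ω => a * gridJumps c (compound gap Y c) η n ω)
      (fun ω => a * (jumps gap Y η ω : ℝ)) μ μ := fun n => (hid n).comp (measurable_const_mul a)
  have key := window_replacement (μ := μ) hf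
    (ζ := fun n ω => a * gridJumps c (compound gap Y c) η n ω) (β := a * r * η) (ε := ε / 4)
    (fun n => (hmul n).trans (hmul 0).symm)
    (by rw [show integrableExpSet (fun ω => a * gridJumps c (compound gap Y c) η 0 ω) μ =
          integrableExpSet (fun ω => a * (jumps gap Y η ω : ℝ)) μ from Set.ext fun t =>
            ((hmul 0).comp (u := fun y => Real.exp (t * y)) (by fun_prop)).integrable_iff]
        exact h.integrableExpSet_jumps η a)
    (by positivity) (by rw [(hmul 0).integral_eq, integral_const_mul, h.integral_jumps]; ring)
    (by positivity)
  filter_upwards [key] with x hx 𝒜 T hA hT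
  have hg := hA.gridStopping hT hη0
  have hTm := hA.measurable_time hT
  obtain ⟨L, hL⟩ := hT.bdd
  have hfx := hf.nonneg x
  have h1 := hx _ _ _ hg fun n => (measurable_gridJumps c (compound gap Y c) η n).const_mul a
  obtain ⟨h2, h3⟩ := integral_windowInt_grid (μ := μ) hf hTm hL hη0 (show 0 ≤ a * r by positivity) x
  have h4 : ∫ ω, windowInt f x (partialSum
      (fun n ω => a * gridJumps c (compound gap Y c) η n ω) (gridIndex η T ω) ω) ∂μ =
      ∫ ω, windowInt f x (a * jumps gap Y (gridIndex η T ω * η) ω) ∂μ := by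
    refine integral_congr_ae ?_
    filter_upwards [h.partialSum_gridJumps c η] with ω hω
    rw [← hω, partialSum, partialSum, Finset.mul_sum]
  rw [h4] at h1
  have hgm : Measurable fun ω => (gridIndex η T ω : ℝ≥0) * η :=
    (measurable_from_nat.comp (measurable_gridIndex hTm)).mul_const _
  have hgL : ∀ ω, gridIndex η T ω * η ≤ L + η := fun ω =>
    (gridIndex_mul_le hη0).trans (add_le_add_left (hL ω) η)
  have hj1 := h.integrable_jumps_time hTm hL
  have hj2 := h.integrable_jumps_time hgm hgL
  have hW : ∀ {S : Ω → ℝ≥0}, Measurable S → Integrable (fun ω => (jumps gap Y (S ω) ω : ℝ)) μ →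
      Integrable (fun ω => windowInt f x (a * jumps gap Y (S ω) ω)) μ := by
    intro S hS hi
    refine (hi.const_mul a).mono' ((hf.continuous_windowInt x).measurable.comp
      ((measurable_from_nat.comp (h.measurable_jumps_time hS)).const_mul a)).aestronglyMeasurable
      (Eventually.of_forall fun ω => ?_)
    exact (hf.abs_windowInt_le x _).trans_eq (abs_of_nonneg (by positivity))
  have hmono : ∀ᵐ ω ∂μ, jumps gap Y (T ω) ω ≤ jumps gap Y (gridIndex η T ω * η) ω := by
    filter_upwards [h.ae_goodMarks] with ω hω
    exact hω.pathCount_mono (lt_gridIndex_mul hη0).le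
  have h5 : ∫ ω, windowInt f x (a * jumps gap Y (T ω) ω) ∂μ ≤
      ∫ ω, windowInt f x (a * jumps gap Y (gridIndex η T ω * η) ω) ∂μ := by
    refine integral_mono_ae (hW hTm hj1) (hW hgm hj2) ?_
    filter_upwards [hmono] with ω hω
    refine hf.windowInt_mono x ?_
    gcongr
  -- By the tangent inequality each extra jump after `T` in the last cell costs at most `a f x`, and
  -- their mean number is at most `r η`.
  have h6 : ∫ ω, windowInt f x (a * jumps gap Y (gridIndex η T ω * η) ω) ∂μ ≤
      ∫ ω, windowInt f x (a * jumps gap Y (T ω) ω) ∂μ + a * r * η * f x := by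
    have e1 : ∫ ω, ((jumps gap Y (gridIndex η T ω * η) ω : ℝ) - jumps gap Y (T ω) ω) ∂μ ≤
        r * η := by
      rw [integral_sub hj2 hj1, h.integral_jumps_time hA hT, h.integral_jumps_gridIndex hη0 hA hT,
        ← mul_sub]
      refine mul_le_mul_of_nonneg_left ?_ hr.le
      have hi1 : Integrable (fun ω => (T ω : ℝ)) μ :=
        Integrable.of_bound (C := L) hTm.coe_nnreal_real.aestronglyMeasurable
          (Eventually.of_forall fun ω => by rw [Real.norm_of_nonneg (by positivity)]; exact hL ω)
      have hi2 : Integrable (fun ω => (gridIndex η T ω : ℝ) * η) μ :=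
        Integrable.of_bound (C := (L + η : ℝ≥0)) hgm.coe_nnreal_real.aestronglyMeasurable
          (Eventually.of_forall fun ω => by
            rw [Real.norm_of_nonneg (by positivity)]; exact_mod_cast hgL ω)
      rw [sub_le_iff_le_add']
      have : ∫ ω, (T ω : ℝ) ∂μ + η = ∫ ω, ((T ω : ℝ) + η) ∂μ := by
        rw [integral_add hi1 (integrable_const _)]; simp
      rw [this]
      exact integral_mono hi2 (hi1.add (integrable_const _)) fun ω => coe_gridIndex_mul_le hη0 ω
    have hj3 : Integrable (fun ω => (jumps gap Y (gridIndex η T ω * η) ω : ℝ) -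
        jumps gap Y (T ω) ω) μ := hj2.sub hj1
    have e2 : ∫ ω, windowInt f x (a * jumps gap Y (gridIndex η T ω * η) ω) ∂μ ≤
        ∫ ω, (windowInt f x (a * jumps gap Y (T ω) ω) +
          a * f x * ((jumps gap Y (gridIndex η T ω * η) ω : ℝ) - jumps gap Y (T ω) ω)) ∂μ := by
      refine integral_mono_ae (hW hgm hj2) ((hW hTm hj1).add (hj3.const_mul _)) ?_
      filter_upwards [hmono] with ω hω
      have hω' : (jumps gap Y (T ω) ω : ℝ) ≤ jumps gap Y (gridIndex η T ω * η) ω := by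
        exact_mod_cast hω
      refine (hf.windowInt_tangent x (a * jumps gap Y (T ω) ω) _).trans ?_
      rw [← mul_sub, mul_right_comm]
      have : f (x + a * jumps gap Y (T ω) ω) ≤ f x := hf.anti (by
        have : 0 ≤ a * (jumps gap Y (T ω) ω : ℝ) := by positivity
        linarith)
      have h0 : 0 ≤ a * ((jumps gap Y (gridIndex η T ω * η) ω : ℝ) - jumps gap Y (T ω) ω) :=
        mul_nonneg ha.le (sub_nonneg.2 hω')
      gcongr
    rw [integral_add (hW hTm hj1) (hj3.const_mul _), integral_const_mul] at e2
    refine e2.trans ?_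
    have : a * f x * ∫ ω, ((jumps gap Y (gridIndex η T ω * η) ω : ℝ) - jumps gap Y (T ω) ω) ∂μ ≤
        a * f x * (r * η) := mul_le_mul_of_nonneg_left e1 (by positivity)
    linarith
  rw [hηr] at h1 h2 h6
  have hm1 : min 1 (ε / 4) ≤ 1 := min_le_left _ _
  have hm2 : min 1 (ε / 4) * f x ≤ ε / 4 * f x :=
    mul_le_mul_of_nonneg_right (min_le_right _ _) hfx
  have hm3 : min 1 (ε / 4) * f x ≤ 1 * f x := mul_le_mul_of_nonneg_right hm1 hfx
  set Φ := ∫ ω, windowInt f x (a * r * T ω) ∂μ with hΦ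
  have hΦ0 : 0 ≤ Φ := integral_nonneg fun ω => hf.windowInt_nonneg x (by positivity)
  have h7 : ε / 4 * (∫ ω, windowInt f x (min 1 (ε / 4) * gridIndex η T ω) ∂μ + f x) ≤
      ε / 4 * (Φ + 2 * f x) := by
    refine mul_le_mul_of_nonneg_left ?_ (by positivity)
    linarith
  rw [hηr] at h3
  have h8 := h1.trans h7
  have h9 : 0 ≤ ε * Φ := by positivity
  have h10 : 0 ≤ ε * f x := by positivity
  rw [abs_le] at h8 ⊢
  constructor <;> nlinarith [h8.1, h8.2]

end IsCompoundPoissonData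

end

end RandomTimeMaxima

/-! ### Uniform asymptotics and window integrals of extended length -/

namespace RandomTimeMaxima

section

/-- The normalized error `(f - g) / (g + h)` serves as both error functions. -/
lemma uniformAsymp_of_abs_le {ι : Type*} {S : Set ι} {f g : ι → ℝ → ℝ} {h : ℝ → ℝ}
    (hg : ∀ i x, 0 ≤ g i x) (hh : ∀ x, 0 < h x)
    (H : ∀ ε > 0, ∀ᶠ x in atTop, ∀ i ∈ S, |f i x - g i x| ≤ ε * (g i x + h x)) :
    UniformAsymp S f g h := by
  have hpos : ∀ i x, 0 < g i x + h x := fun i x => add_pos_of_nonneg_of_pos (hg i x) (hh x)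
  have hU : TendstoUniformlyOn (fun x i => (f i x - g i x) / (g i x + h x)) (fun _ => 0) atTop S := by
    rw [Metric.tendstoUniformlyOn_iff]
    intro ε hε
    filter_upwards [H (ε / 2) (by positivity)] with x hx i hi
    rw [dist_comm, Real.dist_0_eq_abs, abs_div, abs_of_pos (hpos i x), div_lt_iff₀ (hpos i x)]
    refine (hx i hi).trans_lt ?_
    have := hpos i x
    nlinarith
  refine ⟨fun i x => (f i x - g i x) / (g i x + h x), fun i x => (f i x - g i x) / (g i x + h x),
    hU, hU, Eventually.of_forall fun x i _ => ?_⟩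
  have := (hpos i x).ne'
  field_simp
  ring

/-- Transitivity of uniform asymptotic equivalence. -/
lemma abs_sub_le_of_abs_sub_le {P A B f ε : ℝ} (hA : 0 ≤ A) (hf : 0 ≤ f)
    (hε1 : ε ≤ 1 / 2) (h1 : |P - A| ≤ ε * (A + f)) (h2 : |B - A| ≤ ε * (A + f)) :
    |P - B| ≤ 4 * ε * (B + f) := by
  have h0 : 0 ≤ A + f := by positivity
  have hε : 0 ≤ ε * (A + f) := (abs_nonneg _).trans h1
  have h3 : ε * (A + f) ≤ 1 / 2 * (A + f) := mul_le_mul_of_nonneg_right hε1 h0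
  rw [abs_le] at h1 h2 ⊢
  have h4 : A + f ≤ 2 * (B + f) := by linarith
  rcases h0.eq_or_lt with h5 | h5
  · rw [← h5] at h1 h2 h3
    have hA0 : A = 0 := by linarith
    have hf0 : f = 0 := by linarith
    have hB : B = 0 := by linarith [h2.1, h2.2]
    constructor <;> nlinarith [h1.1, h1.2]
  · have hε0 : 0 ≤ ε := nonneg_of_mul_nonneg_left hε h5
    have h6 : ε * (A + f) ≤ ε * (2 * (B + f)) := mul_le_mul_of_nonneg_left h4 hε0
    constructor <;> linarith

section TailIntegral

variable {G : Measure ℝ}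

lemma tailIntegral_mono (G : Measure ℝ) (x : ℝ) : Monotone (tailIntegral G x) := fun _ _ h =>
  lintegral_mono_set fun _ hv => ⟨hv.1, hv.2.trans h⟩

lemma measurableSet_window (x : ℝ) (ℓ : ℝ≥0∞) :
    MeasurableSet {v : ℝ | x < v ∧ ENNReal.ofReal (v - x) ≤ ℓ} :=
  (measurableSet_lt measurable_const measurable_id).inter
    (measurableSet_le ((measurable_id.sub_const x).ennreal_ofReal) measurable_const)

lemma measurable_tail_measure (G : Measure ℝ) : Measurable fun v => G (Set.Ioi v) :=
  Antitone.measurable fun _ _ h => measure_mono (Set.Ioi_subset_Ioi h)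

lemma tendsto_tailIntegral {x : ℝ} (hfin : tailIntegral G x ⊤ ≠ ⊤) {ℓ : ℕ → ℝ≥0∞}
    (hℓ : Tendsto ℓ atTop (𝓝 ⊤)) :
    Tendsto (fun n => tailIntegral G x (ℓ n)) atTop (𝓝 (tailIntegral G x ⊤)) := by
  simp only [tailIntegral] at hfin ⊢
  simp_rw [← lintegral_indicator (measurableSet_window x _)] at hfin ⊢
  refine tendsto_lintegral_of_dominated_convergence _
    (fun n => (measurable_tail_measure G).indicator (measurableSet_window x _))
    (fun n => Eventually.of_forall fun v => ?_) hfin (Eventually.of_forall fun v => ?_)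
  · refine Set.indicator_le_indicator_of_subset ?_ (fun _ => bot_le) v
    exact fun v hv => ⟨hv.1, le_top⟩
  · refine tendsto_const_nhds.congr' ?_
    filter_upwards [hℓ.eventually (lt_mem_nhds (ENNReal.ofReal_lt_top (r := v - x)))] with n hn
    simp [Set.indicator, hn.le]

variable {Ω : Type*} [MeasurableSpace Ω] {μ : Measure Ω} [IsProbabilityMeasure μ]

lemma lintegral_tailIntegral_ne_top {x : ℝ} (hfin : tailIntegral G x ⊤ ≠ ⊤) (L : Ω → ℝ≥0∞) :
    ∫⁻ ω, tailIntegral G x (L ω) ∂μ ≠ ⊤ := by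
  refine ne_top_of_le_ne_top hfin ?_
  calc _ ≤ ∫⁻ _, tailIntegral G x ⊤ ∂μ := lintegral_mono fun ω => tailIntegral_mono G x le_top
    _ = _ := by simp

/-- Truncating a time at `n` changes nothing for large `n` where the time is finite; where it is
infinite the windows fill the whole tail. The full integrated tail dominates throughout. -/
lemma tendsto_meanTailIntegral {x : ℝ} (hfin : tailIntegral G x ⊤ ≠ ⊤) {L : ℕ → Ω → ℝ≥0∞}
    {L' : Ω → ℝ≥0∞} (hL : ∀ n, Measurable (L n))
    (hlim : ∀ᵐ ω ∂μ, (∀ᶠ n in atTop, L n ω = L' ω) ∨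
      (L' ω = ⊤ ∧ Tendsto (fun n => L n ω) atTop (𝓝 ⊤))) :
    Tendsto (fun n => meanTailIntegral μ G x (L n)) atTop (𝓝 (meanTailIntegral μ G x L')) := by
  refine (ENNReal.tendsto_toReal (lintegral_tailIntegral_ne_top hfin L')).comp ?_
  refine tendsto_lintegral_of_dominated_convergence (fun _ => tailIntegral G x ⊤)
    (fun n => (tailIntegral_mono G x).measurable.comp (hL n))
    (fun n => Eventually.of_forall fun ω => tailIntegral_mono G x le_top) (by simpa using hfin) ?_
  filter_upwards [hlim] with ω hω
  rcases hω with hω | ⟨h1, h2⟩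
  · refine tendsto_const_nhds.congr' ?_
    filter_upwards [hω] with n hn
    rw [hn]
  · rw [h1]
    exact tendsto_tailIntegral hfin h2

omit [IsProbabilityMeasure μ] in
lemma meanTailIntegral_nonneg (x : ℝ) (L : Ω → ℝ≥0∞) : 0 ≤ meanTailIntegral μ G x L :=
  ENNReal.toReal_nonneg

/-- Comparison of mean windows for comparable tails. -/
lemma meanTailIntegral_le_mul {G' : Measure ℝ} {x C : ℝ} (hC : 0 ≤ C)
    (hfin : tailIntegral G x ⊤ ≠ ⊤)
    (hGG : ∀ v, x < v → G' (Set.Ioi v) ≤ ENNReal.ofReal C * G (Set.Ioi v)) (L : Ω → ℝ≥0∞) :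
    meanTailIntegral μ G' x L ≤ C * meanTailIntegral μ G x L := by
  have h1 : ∀ ℓ, tailIntegral G' x ℓ ≤ ENNReal.ofReal C * tailIntegral G x ℓ := fun ℓ => by
    unfold tailIntegral
    rw [← lintegral_const_mul' _ _ ENNReal.ofReal_ne_top]
    exact setLIntegral_mono' (measurableSet_window x ℓ) fun v hv => hGG v hv.1
  have h2 : C * meanTailIntegral μ G x L =
      (∫⁻ ω, ENNReal.ofReal C * tailIntegral G x (L ω) ∂μ).toReal := by
    rw [lintegral_const_mul' _ _ ENNReal.ofReal_ne_top, ENNReal.toReal_mul,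
      ENNReal.toReal_ofReal hC, meanTailIntegral]
  rw [h2, meanTailIntegral]
  refine ENNReal.toReal_mono ?_ (lintegral_mono fun ω => h1 _)
  rw [lintegral_const_mul' _ _ ENNReal.ofReal_ne_top]
  exact ENNReal.mul_ne_top ENNReal.ofReal_ne_top (lintegral_tailIntegral_ne_top hfin L)

variable [IsProbabilityMeasure G] (hf : StrongTail (tail G))
include hf

lemma tailIntegral_ofReal (x : ℝ) {t : ℝ} (ht : 0 ≤ t) :
    tailIntegral G x (ENNReal.ofReal t) = ENNReal.ofReal (windowInt (tail G) x t) := by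
  have h1 : {v : ℝ | x < v ∧ ENNReal.ofReal (v - x) ≤ ENNReal.ofReal t} = Set.Ioc x (x + t) := by
    ext v
    simp only [Set.mem_ofPred_eq, Set.mem_Ioc, ENNReal.ofReal_le_ofReal_iff ht,
      sub_le_iff_le_add']
  rw [tailIntegral, h1, windowInt, intervalIntegral.integral_of_le (by linarith),
    ofReal_integral_eq_lintegral_ofReal
      ((intervalIntegrable_iff_integrableOn_Ioc_of_le (by linarith)).1 (hf.intervalIntegrable _ _))
      (Eventually.of_forall fun v => hf.nonneg v)]
  exact lintegral_congr fun v => (ofReal_measureReal).symm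

lemma tailIntegral_top_ne_top (x : ℝ) : tailIntegral G x ⊤ ≠ ⊤ := by
  have h1 : {v : ℝ | x < v ∧ ENNReal.ofReal (v - x) ≤ ⊤} = Set.Ioi x := by ext v; simp
  rw [tailIntegral, h1, lintegral_congr fun v => (ofReal_measureReal (μ := G)).symm]
  exact ((hf.integrableOn_Ioi x).lintegral_lt_top).ne

omit [IsProbabilityMeasure μ] in
lemma meanTailIntegral_ofReal (x : ℝ) {W : Ω → ℝ} (hW : Measurable W) (h0 : ∀ ω, 0 ≤ W ω) :
    meanTailIntegral μ G x (fun ω => ENNReal.ofReal (W ω)) =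
      ∫ ω, windowInt (tail G) x (W ω) ∂μ := by
  rw [integral_eq_lintegral_of_nonneg_ae
    (Eventually.of_forall fun ω => hf.windowInt_nonneg x (h0 ω))
    ((hf.continuous_windowInt x).measurable.comp hW).aestronglyMeasurable, meanTailIntegral]
  simp_rw [tailIntegral_ofReal hf x (h0 _)]

end TailIntegral

/-- The tail of a strong subexponential distribution. -/
lemma StrongSubexponential.strongTail {F : Measure ℝ} (hF : StrongSubexponential F) :
    StrongTail (tail F) := by
  obtain ⟨hp, hi, hs⟩ := hF
  have hanti : Antitone (tail F) := fun x y h => measureReal_mono (Set.Ioi_subset_Ioi h)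
  refine ⟨hanti, fun x => ?_, fun x => measureReal_le_one, ?_, hs⟩
  -- If the tail vanished at `x` it would vanish beyond, and the quotient in the definition would
  -- eventually be `0` by the convention for division by zero instead of tending to 1.
  · by_contra h0
    have h0 : tail F x = 0 := le_antisymm (not_lt.1 h0) measureReal_nonneg
    have h1 : Tendsto (fun _ : ℝ => (0 : ℝ)) atTop (𝓝 1) := by
      refine hs.congr' ?_
      filter_upwards [eventually_ge_atTop x] with y hy
      have : tail F y = 0 := le_antisymm ((hanti hy).trans_eq h0) measureReal_nonneg
      rw [this, mul_zero, div_zero]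
    exact zero_ne_one (tendsto_nhds_unique tendsto_const_nhds h1)
  · refine ⟨hanti.measurable.aestronglyMeasurable, ?_⟩
    -- Layer-cake formula for the positive part: the tail is integrable because the mean is finite.
    have h1 := lintegral_eq_lintegral_meas_lt F (f := fun y : ℝ => max y 0)
      (Eventually.of_forall fun y => le_max_right y 0) (by fun_prop)
    have h2 : ∫⁻ y, ENNReal.ofReal (max y 0) ∂F < ⊤ := hi.pos_part.lintegral_lt_top
    rw [h1] at h2
    refine lt_of_eq_of_lt (setLIntegral_congr_fun measurableSet_Ioi fun v (hv : 0 < v) => ?_) h2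
    have h3 : {y : ℝ | v < max y 0} = Set.Ioi v := by
      ext y; simp [not_lt.2 hv.le]
    simp only [h3]
    rw [tail, Real.enorm_of_nonneg measureReal_nonneg, ofReal_measureReal]

end

end RandomTimeMaxima

/-! ### Passage to unbounded random times and the three asymptotic formulas -/

namespace RandomTimeMaxima

section

lemma coe_min_toNNReal (t : ℝ≥0∞) (L : ℝ≥0) : (((min t L).toNNReal : ℝ≥0) : ℝ≥0∞) = min t L :=
  ENNReal.coe_toNNReal (min_lt_of_right_lt ENNReal.coe_lt_top).ne

lemma lt_runningMax_iff {Ω : Type*} {X : ℝ≥0 → Ω → ℝ} {s : ℝ≥0∞} {ω : Ω} {x : ℝ} :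
    (x : EReal) < runningMax X s ω ↔ ∃ u : ℝ≥0, (u : ℝ≥0∞) ≤ s ∧ x < X u ω := by
  simp [runningMax, lt_iSup_iff]

/-- The maximum until a random time is approximated by the maxima until the truncated times. -/
lemma tendsto_measure_max {Ω : Type*} [MeasurableSpace Ω] (μ : Measure Ω) [IsProbabilityMeasure μ]
    (X : ℝ≥0 → Ω → ℝ) (τ : Ω → ℝ≥0∞) (x : ℝ) :
    Tendsto (fun n : ℕ => μ.real {ω | ∃ u ≤ (min (τ ω) (n : ℝ≥0)).toNNReal, x < X u ω}) atTop
      (𝓝 (μ.real {ω | (x : EReal) < runningMax X (τ ω) ω})) := by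
  have hiff : ∀ (n : ℕ) ω (u : ℝ≥0), u ≤ (min (τ ω) (n : ℝ≥0)).toNNReal ↔
      (u : ℝ≥0∞) ≤ τ ω ∧ u ≤ (n : ℝ≥0) := fun n ω u => by
    rw [← ENNReal.coe_le_coe, coe_min_toNNReal, le_min_iff, ENNReal.coe_le_coe]
  have hmono : Monotone fun n : ℕ => {ω | ∃ u ≤ (min (τ ω) (n : ℝ≥0)).toNNReal, x < X u ω} := by
    rintro m n hmn ω ⟨u, hu, hx⟩
    rw [hiff] at hu
    exact ⟨u, (hiff n ω u).2 ⟨hu.1, hu.2.trans (by exact_mod_cast hmn)⟩, hx⟩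
  have hU : ⋃ n : ℕ, {ω | ∃ u ≤ (min (τ ω) (n : ℝ≥0)).toNNReal, x < X u ω} =
      {ω | (x : EReal) < runningMax X (τ ω) ω} := by
    ext ω
    simp only [Set.mem_iUnion, Set.mem_ofPred_eq, lt_runningMax_iff]
    constructor
    · rintro ⟨n, u, hu, hx⟩
      exact ⟨u, ((hiff n ω u).1 hu).1, hx⟩
    · rintro ⟨u, hu, hx⟩
      obtain ⟨n, hn⟩ := exists_nat_ge u
      exact ⟨n, u, (hiff n ω u).2 ⟨hu, hn⟩, hx⟩
  rw [← hU]
  exact (ENNReal.tendsto_toReal (measure_ne_top _ _)).comp (tendsto_measure_iUnion_atTop hmono)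

lemma tendsto_min_mul (t : ℝ≥0∞) {b : ℝ} (hb : 0 < b) :
    (∀ᶠ n : ℕ in atTop, ENNReal.ofReal b * min t (n : ℝ≥0) = ENNReal.ofReal b * t) ∨
      (ENNReal.ofReal b * t = ⊤ ∧
        Tendsto (fun n : ℕ => ENNReal.ofReal b * min t (n : ℝ≥0)) atTop (𝓝 ⊤)) := by
  have hb0 : ENNReal.ofReal b ≠ 0 := (ENNReal.ofReal_pos.2 hb).ne'
  rcases eq_or_ne t ⊤ with rfl | ht
  · refine Or.inr ⟨ENNReal.mul_top hb0, ?_⟩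
    have h1 : Tendsto (fun n : ℕ => ENNReal.ofReal b * (n : ℝ≥0∞)) atTop
        (𝓝 (ENNReal.ofReal b * ⊤)) :=
      ENNReal.Tendsto.const_mul ENNReal.tendsto_nat_nhds_top (Or.inl ENNReal.top_ne_zero)
    rw [ENNReal.mul_top hb0] at h1
    simpa using h1
  · refine Or.inl ?_
    obtain ⟨m, hm⟩ := ENNReal.exists_nat_gt ht
    filter_upwards [eventually_ge_atTop m] with n hn
    rw [min_eq_left]
    refine hm.le.trans ?_
    simp only [ENNReal.coe_natCast]
    exact_mod_cast hn

lemma tendsto_window_time {Ω : Type*} [MeasurableSpace Ω] {μ : Measure Ω} [IsProbabilityMeasure μ]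
    {F : Measure ℝ} [IsProbabilityMeasure F] (hf : StrongTail (tail F)) {τ : Ω → ℝ≥0∞}
    (hτ : Measurable τ) {b : ℝ} (hb : 0 < b) (x : ℝ) :
    Tendsto (fun n : ℕ =>
      ∫ ω, windowInt (tail F) x (b * ((min (τ ω) (n : ℝ≥0)).toNNReal : ℝ≥0)) ∂μ) atTop
      (𝓝 (meanTailIntegral μ F x fun ω => ENNReal.ofReal b * τ ω)) := by
  refine (tendsto_meanTailIntegral (μ := μ) (tailIntegral_top_ne_top hf x)
    (L := fun n ω => ENNReal.ofReal b * min (τ ω) (n : ℝ≥0))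
    (fun n => (hτ.min measurable_const).const_mul _)
    (Eventually.of_forall fun ω => tendsto_min_mul (τ ω) hb)).congr fun n => ?_
  rw [← meanTailIntegral_ofReal hf x
    ((hτ.min measurable_const).ennreal_toNNReal.coe_nnreal_real.const_mul b)
      fun ω => by positivity]
  congr 1
  funext ω
  rw [ENNReal.ofReal_mul hb.le, ENNReal.ofReal_coe_nnreal, coe_min_toNNReal]

namespace GoodMarks

variable {z : Marks} (hz : GoodMarks z)
include hz

lemma tendsto_pathCount : Tendsto (fun n : ℕ => pathCount z (n : ℝ≥0)) atTop atTop := by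
  refine tendsto_atTop.2 fun k => ?_
  obtain ⟨m, hm⟩ := exists_nat_ge (epoch gapAt (k + 1) z)
  filter_upwards [eventually_ge_atTop m] with n hn
  refine ((hz.lt_pathCount _ _).2 ?_).le
  have : (m : ℝ) ≤ n := by exact_mod_cast hn
  rw [NNReal.coe_natCast]
  linarith

lemma tendsto_count_min (t : ℝ≥0∞) {b : ℝ} (hb : 0 < b) :
    (∀ᶠ n : ℕ in atTop, ENNReal.ofReal b * (count gapAt (min t (n : ℝ≥0)) z : ℝ≥0∞) =
        ENNReal.ofReal b * (count gapAt t z : ℝ≥0∞)) ∨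
      (ENNReal.ofReal b * (count gapAt t z : ℝ≥0∞) = ⊤ ∧
        Tendsto (fun n : ℕ => ENNReal.ofReal b * (count gapAt (min t (n : ℝ≥0)) z : ℝ≥0∞)) atTop
          (𝓝 ⊤)) := by
  have hb0 : ENNReal.ofReal b ≠ 0 := (ENNReal.ofReal_pos.2 hb).ne'
  rcases eq_or_ne t ⊤ with rfl | ht
  · refine Or.inr ⟨by rw [count_top]; exact ENNReal.mul_top hb0, ?_⟩
    have h1 : Tendsto (fun n : ℕ => ENNReal.ofReal b * ((pathCount z (n : ℝ≥0) : ℕ) : ℝ≥0∞)) atTop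
        (𝓝 (ENNReal.ofReal b * ⊤)) :=
      ENNReal.Tendsto.const_mul (ENNReal.tendsto_nat_nhds_top.comp hz.tendsto_pathCount)
        (Or.inl ENNReal.top_ne_zero)
    rw [ENNReal.mul_top hb0] at h1
    refine h1.congr fun n => ?_
    rw [min_eq_right le_top, ← hz.coe_pathCount]
    simp
  · refine Or.inl ?_
    obtain ⟨m, hm⟩ := ENNReal.exists_nat_gt ht
    filter_upwards [eventually_ge_atTop m] with n hn
    rw [min_eq_left]
    refine hm.le.trans ?_
    simp only [ENNReal.coe_natCast]
    exact_mod_cast hn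

end GoodMarks

namespace IsCompoundPoissonData

variable {Ω : Type*} [mΩ : MeasurableSpace Ω] {μ : Measure Ω} {r : ℝ}
  {gap Y : ℕ → Ω → ℝ} (h : IsCompoundPoissonData μ r gap Y)
include h

lemma hasTail_jump (hf : StrongTail (tail (μ.map fun ω => max (Y 0 ω) 0))) :
    HasTail μ (Y 0) (tail (μ.map fun ω => max (Y 0 ω) 0)) 1 := by
  refine tendsto_const_nhds.congr' ?_
  filter_upwards [eventually_ge_atTop 0] with v hv
  have hm : Measurable fun ω => max (Y 0 ω) 0 := (h.measurable_jump 0).max measurable_const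
  have h1 : tail (μ.map fun ω => max (Y 0 ω) 0) v = μ.real {ω | v < Y 0 ω} := by
    rw [tail, map_measureReal_apply hm measurableSet_Ioi]
    congr 1
    ext ω; simp [not_lt.2 hv]
  rw [← h1, div_self (hf.pos v).ne']

variable {F : Measure ℝ} [IsProbabilityMeasure F]

/-- Two-sided bounds for the maximum until an arbitrary random time. -/
theorem max_bounds (hf : StrongTail (tail F)) (ht : HasTail μ (Y 0) (tail F) 1)
    (hY : Integrable (Y 0) μ) {c a ε : ℝ} (hmean : ∫ ω, (c / r + Y 0 ω) ∂μ = -a) (ha : 0 < a)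
    (hε : 0 < ε) : ∀ᶠ x : ℝ in atTop, ∀ τ ∈ randomTimes μ (compound gap Y c),
      |μ.real {ω | (x : EReal) < runningMax (compound gap Y c) (τ ω) ω} - 1 / a *
          meanTailIntegral μ F x (fun ω => ENNReal.ofReal (a * r) * τ ω)| ≤
        ε * (1 / a * meanTailIntegral μ F x (fun ω => ENNReal.ofReal (a * r) * τ ω) + tail F x) := by
  have := h.indep_gap.isProbabilityMeasure
  have hr := h.rate_pos
  have har : 0 < a * r := by positivity
  filter_upwards [h.max_upper hf ht hY hmean ha hε, h.max_lower hf ht hY hmean ha hε]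
    with x hup hlow τ hτ
  have hA := hτ.2.futureIndep (h.measurable_compound c) hτ.1
  have hT := fun n : ℕ => optionalTime_stopAlg (X := compound gap Y c) τ (n : ℝ≥0)
  -- The bounds hold for all truncations `min τ n` at the same `x`, so they pass to the limit in
  -- `n`.
  have l1 := tendsto_measure_max μ (compound gap Y c) τ x
  have l2 := tendsto_window_time (μ := μ) hf hτ.1 har x
  have b1 := le_of_tendsto_of_tendsto' l1
    (((l2.const_mul (1 / a)).const_mul (1 + ε)).add_const (ε * tail F x))
    fun n => hup _ _ hA (hT n)
  have b2 := le_of_tendsto_of_tendsto'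
    (((l2.const_mul (1 / a)).const_mul (1 - ε)).sub_const (ε * tail F x)) l1
    fun n => hlow _ _ hA (hT n)
  rw [abs_le]
  constructor <;> linarith

/-- The number of jumps until an arbitrary random time. -/
theorem count_bounds (hf : StrongTail (tail F)) {c a ε : ℝ} (ha : 0 < a)
    (hε : 0 < ε) : ∀ᶠ x : ℝ in atTop, ∀ τ ∈ randomTimes μ (compound gap Y c),
      |meanTailIntegral μ F x (fun ω => ENNReal.ofReal a * (count gap (τ ω) ω : ℝ≥0∞)) -
          meanTailIntegral μ F x (fun ω => ENNReal.ofReal (a * r) * τ ω)| ≤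
        ε * (meanTailIntegral μ F x (fun ω => ENNReal.ofReal (a * r) * τ ω) + tail F x) := by
  have := h.indep_gap.isProbabilityMeasure
  have hr := h.rate_pos
  have har : 0 < a * r := by positivity
  filter_upwards [h.jumps_window hf (c := c) ha hε] with x hx τ hτ
  have hA := hτ.2.futureIndep (h.measurable_compound c) hτ.1
  have hT := fun n : ℕ => optionalTime_stopAlg (X := compound gap Y c) τ (n : ℝ≥0)
  have l2 := tendsto_window_time (μ := μ) hf hτ.1 har x
  have l3 : Tendsto (fun n : ℕ =>
      ∫ ω, windowInt (tail F) x (a * jumps gap Y (min (τ ω) (n : ℝ≥0)).toNNReal ω) ∂μ) atTop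
      (𝓝 (meanTailIntegral μ F x fun ω => ENNReal.ofReal a * (count gap (τ ω) ω : ℝ≥0∞))) := by
    have hm : ∀ n : ℕ, Measurable fun ω => count gap (min (τ ω) (n : ℝ≥0)) ω := fun n =>
      measurable_count h.measurable_gap (hτ.1.min measurable_const)
    refine (tendsto_meanTailIntegral (μ := μ) (tailIntegral_top_ne_top hf x)
      (L := fun n ω => ENNReal.ofReal a * (count gap (min (τ ω) (n : ℝ≥0)) ω : ℝ≥0∞))
      (fun n => ((measurable_of_countable ENat.toENNReal).comp (hm n)).const_mul _) ?_).congr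
      fun n => ?_
    · filter_upwards [h.ae_goodMarks] with ω hω
      exact hω.tendsto_count_min (τ ω) ha
    · have h0 := meanTailIntegral_ofReal (μ := μ) hf x
        (W := fun ω => a * (jumps gap Y (min (τ ω) (n : ℝ≥0)).toNNReal ω : ℝ))
        ((measurable_from_nat.comp
          (h.measurable_jumps_time (hA.measurable_time (hT n)))).const_mul a)
        fun ω => by positivity
      rw [← h0]
      unfold meanTailIntegral
      congr 1
      refine lintegral_congr_ae ?_
      filter_upwards [h.ae_goodMarks] with ω hω
      congr 1
      rw [ENNReal.ofReal_mul ha.le, ENNReal.ofReal_natCast]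
      congr 1
      have h1 := hω.coe_pathCount (min (τ ω) (n : ℝ≥0)).toNNReal
      rw [coe_min_toNNReal] at h1
      exact (congrArg ENat.toENNReal h1).symm.trans (by simp [jumps])
  exact le_of_tendsto_of_tendsto' (l3.sub l2).abs ((l2.add_const (tail F x)).const_mul ε)
    fun n => hx _ _ hA (hT n)

/-- Comparison of mean windows for the tails of the jumps and of `X₁`. -/
theorem mean_compound_bounds (hf : StrongTail (tail F)) (ht : HasTail μ (Y 0) (tail F) 1) (c : ℝ)
    {ε : ℝ} (hε : 0 < ε) (hε1 : ε < 1) : ∀ᶠ x in atTop, ∀ L : Ω → ℝ≥0∞,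
      |meanTailIntegral μ (μ.map (compound gap Y c 1)) x L - r * meanTailIntegral μ F x L| ≤
        ε * (r * meanTailIntegral μ F x L) := by
  have := h.indep_gap.isProbabilityMeasure
  have hr := h.rate_pos
  have h1 := h.hasTail_compound hf ht c 1
  rw [NNReal.coe_one, mul_one] at h1
  have hm := h.measurable_compound c 1
  have := Measure.isProbabilityMeasure_map (μ := μ) hm.aemeasurable
  -- Beyond `x₀` the two tails are comparable pointwise with constants `(1 ± ε) r`; the comparison
  -- passes to windows of every length and is therefore uniform in `L`.
  obtain ⟨x₀, hx₀⟩ := eventually_atTop.1 ((h1.eventually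
    (lt_mem_nhds (show (1 - ε) * r < r by nlinarith))).and (h1.eventually
    (gt_mem_nhds (show r < (1 + ε) * r by nlinarith))))
  have hP : ∀ v ≥ x₀, (1 - ε) * r * tail F v ≤ (μ.map (compound gap Y c 1)).real (Set.Ioi v) ∧
      (μ.map (compound gap Y c 1)).real (Set.Ioi v) ≤ (1 + ε) * r * tail F v := fun v hv => by
    rw [map_measureReal_apply hm measurableSet_Ioi]
    exact ⟨((lt_div_iff₀ (hf.pos v)).1 (hx₀ v hv).1).le, ((div_lt_iff₀ (hf.pos v)).1 (hx₀ v hv).2).le⟩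
  filter_upwards [eventually_ge_atTop x₀] with x hx L
  have hup : ∀ v, x < v → (μ.map (compound gap Y c 1)) (Set.Ioi v) ≤
      ENNReal.ofReal ((1 + ε) * r) * F (Set.Ioi v) := fun v hv => by
    rw [← ofReal_measureReal, ← ofReal_measureReal (μ := F), ← ENNReal.ofReal_mul (by positivity)]
    exact ENNReal.ofReal_le_ofReal (hP v (hx.trans hv.le)).2
  have hlow : ∀ v, x < v → F (Set.Ioi v) ≤
      ENNReal.ofReal ((1 - ε) * r)⁻¹ * (μ.map (compound gap Y c 1)) (Set.Ioi v) := fun v hv => by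
    have h0 : 0 < (1 - ε) * r := mul_pos (by linarith) hr
    rw [← ofReal_measureReal, ← ofReal_measureReal (μ := μ.map _),
      ← ENNReal.ofReal_mul (by positivity)]
    refine ENNReal.ofReal_le_ofReal ?_
    rw [le_inv_mul_iff₀ h0]
    exact (hP v (hx.trans hv.le)).1
  have hfin := tailIntegral_top_ne_top hf x
  have hfin' : tailIntegral (μ.map (compound gap Y c 1)) x ⊤ ≠ ⊤ := by
    refine ne_top_of_le_ne_top (ENNReal.mul_ne_top (ENNReal.ofReal_ne_top (r := (1 + ε) * r)) hfin) ?_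
    unfold tailIntegral
    rw [← lintegral_const_mul' _ _ ENNReal.ofReal_ne_top]
    exact setLIntegral_mono' (measurableSet_window x ⊤) fun v hv => hup v hv.1
  have b1 := meanTailIntegral_le_mul (μ := μ) (by positivity) hfin hup L
  have h0 : 0 < (1 - ε) * r := mul_pos (by linarith) hr
  have b2 := meanTailIntegral_le_mul (μ := μ) (by positivity) hfin' hlow L
  rw [le_inv_mul_iff₀ h0] at b2
  rw [abs_le]
  constructor <;> linarith

end IsCompoundPoissonData

end

end RandomTimeMaxima

theorem mainTheorem3 {Ω : Type*} [MeasurableSpace Ω] (μ : Measure Ω) [IsProbabilityMeasure μ]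
    (rate c a : ℝ) (gap Y : ℕ → Ω → ℝ)
    (hXY : RandomTimeMaxima.IsCompoundPoissonData μ rate gap Y)
    (X : ℝ≥0 → Ω → ℝ) (hX : X = RandomTimeMaxima.compound gap Y c)
    (hY : Integrable (Y 0) μ)
    (ha : ∫ ω, (c / rate + Y 0 ω) ∂μ = -a) (ha_pos : 0 < a)
    (F : Measure ℝ) (hF : F = μ.map (fun ω => max (Y 0 ω) 0))
    (hF_strong : RandomTimeMaxima.StrongSubexponential F) :
    RandomTimeMaxima.UniformAsymp (RandomTimeMaxima.randomTimes μ X)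
      (fun τ x => μ.real {ω | (x : EReal) < RandomTimeMaxima.runningMax X (τ ω) ω})
      (fun τ x => 1 / a * RandomTimeMaxima.meanTailIntegral μ F x
        (fun ω => ENNReal.ofReal a * (RandomTimeMaxima.count gap (τ ω) ω : ℝ≥0∞)))
      (RandomTimeMaxima.tail F) ∧
    RandomTimeMaxima.UniformAsymp (RandomTimeMaxima.randomTimes μ X)
      (fun τ x => μ.real {ω | (x : EReal) < RandomTimeMaxima.runningMax X (τ ω) ω})
      (fun τ x => 1 / a * RandomTimeMaxima.meanTailIntegral μ F x
        (fun ω => ENNReal.ofReal (a * rate) * τ ω))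
      (RandomTimeMaxima.tail F) ∧
    RandomTimeMaxima.UniformAsymp (RandomTimeMaxima.randomTimes μ X)
      (fun τ x => μ.real {ω | (x : EReal) < RandomTimeMaxima.runningMax X (τ ω) ω})
      (fun τ x => 1 / |∫ ω, X 1 ω ∂μ| * RandomTimeMaxima.meanTailIntegral μ (μ.map (X 1)) x
        (fun ω => ENNReal.ofReal |∫ ω', X 1 ω' ∂μ| * τ ω))
      (RandomTimeMaxima.tail F) := by
  open RandomTimeMaxima in
  have hr := hXY.rate_pos
  have har : 0 < a * rate := mul_pos ha_pos hr
  have : IsProbabilityMeasure F := hF_strong.1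
  have hf : StrongTail (tail F) := hF_strong.strongTail
  have ht : HasTail μ (Y 0) (tail F) 1 := by
    subst hF
    exact hXY.hasTail_jump hf
  -- The process loses `a * rate` per unit time on average, so the windows in the second and third
  -- formulas have the same length.
  have hmean : |∫ ω, X 1 ω ∂μ| = a * rate := by
    rw [hX, (hXY.integral_compound c hY 1).2, ha, NNReal.coe_one, mul_one, mul_neg, abs_neg,
      abs_of_pos (mul_pos hr ha_pos), mul_comm]
  rw [hmean]
  subst hX
  have hmain := fun {ε : ℝ} (hε : 0 < ε) => hXY.max_bounds hf ht hY (c := c) ha ha_pos hε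
  have hA0 : ∀ (τ : Ω → ℝ≥0∞) (x : ℝ), 0 ≤ 1 / a * meanTailIntegral μ F x (fun ω => ENNReal.ofReal (a * rate) * τ ω) :=
    fun τ x => mul_nonneg (by positivity) (meanTailIntegral_nonneg x _)
  have hε' : ∀ ε : ℝ, 0 < ε → ∃ e, 0 < e ∧ e ≤ 1 / 2 ∧ 4 * e ≤ ε := fun ε hε =>
    ⟨min (ε / 4) (1 / 2), by positivity, min_le_right _ _,
      by linarith [min_le_left (ε / 4) (1 / 2)]⟩
  -- The second formula is `max_bounds`; the other two hold because their main terms are uniformly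
  -- equivalent to the one in it.
  refine ⟨uniformAsymp_of_abs_le
      (fun τ x => mul_nonneg (by positivity) (meanTailIntegral_nonneg x _)) hf.pos fun ε hε => ?_,
    uniformAsymp_of_abs_le hA0 hf.pos fun ε hε => hmain hε, uniformAsymp_of_abs_le
      (fun τ x => mul_nonneg (by positivity) (meanTailIntegral_nonneg x _)) hf.pos fun ε hε => ?_⟩
  · obtain ⟨e, he0, he1, he⟩ := hε' ε hε
    -- The comparison of windows is divided by `a` below, which would inflate the error term in
    -- `tail F`; the entry `e * a` compensates.
    have hmin : 0 < min e (e * a) := by positivity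
    filter_upwards [hmain he0, hXY.count_bounds hf (c := c) ha_pos hmin] with x h1 h2 τ hτ
    have hfx := hf.nonneg x
    have h3 := h2 τ hτ
    set A := meanTailIntegral μ F x (fun ω => ENNReal.ofReal (a * rate) * τ ω) with hA
    set B := meanTailIntegral μ F x
      (fun ω => ENNReal.ofReal a * (count gap (τ ω) ω : ℝ≥0∞)) with hB
    have hA0' : 0 ≤ A := meanTailIntegral_nonneg x _
    have h4 : |1 / a * B - 1 / a * A| ≤ e * (1 / a * A + tail F x) := by
      rw [← mul_sub, abs_mul, abs_of_pos (by positivity)]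
      calc 1 / a * |B - A| ≤ 1 / a * (min e (e * a) * (A + tail F x)) := by gcongr
        _ = min e (e * a) * (1 / a * A) + min e (e * a) * (1 / a * tail F x) := by ring
        _ ≤ e * (1 / a * A) + e * a * (1 / a * tail F x) := by
          gcongr
          · exact min_le_left _ _
          · exact min_le_right _ _
        _ = _ := by field_simp
    have hB0 : 0 ≤ 1 / a * B := mul_nonneg (by positivity) (meanTailIntegral_nonneg x _)
    refine (abs_sub_le_of_abs_sub_le (hA0 τ x) hfx he1 (h1 τ hτ) h4).trans ?_
    gcongr
  · obtain ⟨e, he0, he1, he⟩ := hε' ε hε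
    filter_upwards [hmain he0, hXY.mean_compound_bounds hf ht c he0 (by linarith)] with x h1 h2 τ hτ
    have hfx := hf.nonneg x
    have h3 := h2 fun ω => ENNReal.ofReal (a * rate) * τ ω
    set A := meanTailIntegral μ F x (fun ω => ENNReal.ofReal (a * rate) * τ ω) with hA
    set B := meanTailIntegral μ (μ.map (compound gap Y c 1)) x
      (fun ω => ENNReal.ofReal (a * rate) * τ ω) with hB
    have hA0' : 0 ≤ A := meanTailIntegral_nonneg x _
    have h4 : |1 / (a * rate) * B - 1 / a * A| ≤ e * (1 / a * A + tail F x) := by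
      have e1 : 1 / (a * rate) * B - 1 / a * A = 1 / (a * rate) * (B - rate * A) := by
        field_simp
      rw [e1, abs_mul, abs_of_pos (by positivity)]
      calc 1 / (a * rate) * |B - rate * A| ≤ 1 / (a * rate) * (e * (rate * A)) := by gcongr
        _ = e * (1 / a * A) := by field_simp
        _ ≤ _ := by
          gcongr
          linarith
    have hB0 : 0 ≤ 1 / (a * rate) * B := mul_nonneg (by positivity) (meanTailIntegral_nonneg x _)
    refine (abs_sub_le_of_abs_sub_le (hA0 τ x) hfx he1 (h1 τ hτ) h4).trans ?_
    gcongr
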